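/- **Setting.** Let $M$ be a smooth (Hausdorff) manifold of dimension $d$ with a smooth affine connection $\nabla$ with torsion $T(X,Y)=\nabla_XY-\nabla_YX-[X,Y]$ and curvature $R(X,Y)=[\nabla_X,\nabla_Y]-\nabla_{[X,Y]}$. Let $o\in M$, let $[0,T]$ be a time interval with $T>0$, and let $u_t$, $t\in[0,T]$, be a time-dependent vector field on $M$, smooth in $(t,x)$. Write $/\!/_t$ for $\nabla$-parallel transport along a curve from time $0$ to time $t$. Let $\mathfrak e\subseteq T_oM$ be a subspace with an inner product $\langle\cdot,\cdot\rangle$, and let $\Sigma_t$, $t\in[0,T]$, be a smooth family of symmetric positive semidefinite endomorphisms of $\mathfrak e$. Assume - (A) $\operatorname{image}\Sigma_t=\mathfrak e$ for every $t$ (so $\Sigma_t$ is invertible on $\mathfrak e$); - (B) every element of the holonomy group of $\nabla$ at $o$ maps $\mathfrak e$ into itself and preserves $\langle\cdot,\cdot\rangle$. By (B), parallel transport of $\mathfrak e$ and of its inner product gives (over the connected component of $o$) a subbundle $E$ of $TM$ with a metric $g$, i.e. a sub-Riemannian structure $(E,g)$ compatible with $\nabla$. Consider the process $dx_t=/\!/_t\Sigma_t^{1/2}\circ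 dB_t+u_t(x_t)\,dt$, $x_0=o$, with $B$ a Brownian motion in $\mathfrak e$. Let $\mathbb H$ be the Cameron–Martin space of absolutely continuous curves $\omega:[0,T]\to\mathfrak e$ with $\omega_0=0$ and $\dot\omega\in L^2$. For $\omega\in\mathbb H$ let $\gamma$ be the absolutely continuous solution, if it exists on all of $[0,T]$, of $$\dot\gamma_t=/\!/_t\Sigma_t^{1/2}\dot\omega_t+u_t(\gamma_t)\ \text{ for almost every } t,\qquad \gamma_0=o, \tag{1}$$ and put $\Pi(\omega)=\gamma_T$; $\Pi$ is a smooth map on an open subset of $\mathbb H$. The curve $\gamma$ is a *most probable path* of $x_t$ (from $o$ to $y=\gamma_T$) if it is the solution of (1) for some $\omega$ that minimizes the Onsager–Machlup functional $\frac12\int_0^T\|\dot\omega_t\|^2\,dt$ of $B$ over $\Pi^{-1}(y)$. It is *singular* if it is the solution of (1) for an $\omega$ at which the differential of $\Pi$ is not surjective. For $\alpha\in T_x^*M$ let $\sharp^g\alpha\in E_x$ be defined by $\alpha(v)=\langle\sharp^g\alpha,v\rangle_g$ for $v\in E_x$. For an orthonormal basis $(f_\alpha)$ of $E_x$, a bivector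 $\chi=\frac12\sum_{\alpha,\beta}\chi^{\alpha\beta}f_\alpha\wedge f_\beta\in\wedge^2E_x$ with $\chi^{\alpha\beta}=-\chi^{\beta\alpha}$, and $w_1,w_2\in T_xM$, put $$K(\chi,w_1)(w_2)=\sum_{\alpha,\beta}\chi^{\alpha\beta}\,\langle R(w_1,w_2)f_\alpha,f_\beta\rangle_g .$$ Let $\Sigma_t$ act on $E_{\gamma_t}$ by $/\!/_t\Sigma_t/\!/_t^{-1}$. **Theorem.** If $\gamma:[0,T]\to M$ is a most probable path of $x_t$ and $\gamma$ is not singular, then $\gamma$ is $C^1$ and there are covectors $\lambda_t\in T^*_{\gamma_t}M$ and bivectors $\chi_t\in\wedge^2E_{\gamma_t}$ along $\gamma$, differentiable in $t$, such that for every $t\in[0,T]$ $$\left\{\begin{aligned} \sharp^g\lambda_t&=\Sigma_t^{-1}\bigl(\dot\gamma_t-u_t(\gamma_t)\bigr),\\ \tfrac{D}{dt}\lambda_t&=-\lambda_t(\nabla_{\cdot}\,u_t)-\lambda_t\bigl(T(\dot\gamma_t,\cdot)\bigr)+K(\chi_t,\dot\gamma_t),\\ \tfrac{D}{dt}\chi_t&=\tfrac12\,\Sigma_t\sharp^g\lambda_t\wedge\sharp^g\lambda_t,\qquad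 \chi_T=0 . \end{aligned}\right.$$ (In particular $\dot\gamma_t-u_t(\gamma_t)\in E_{\gamma_t}$.) -/

import Mathlib

open Set MeasureTheory Bundle
open scoped Manifold ContDiff

noncomputable section

/-! ### Curves, covariant derivatives along curves, parallel transport -/

/-- A curve `c : [0, T] → N` in a manifold is absolutely continuous: it is continuous, and near
every time its expression in the preferred chart at that time is absolutely continuous.
Values outside `[0, T]` are irrelevant. -/
def IsACCurve {F G N : Type*} [NormedAddCommGroup F] [NormedSpace ℝ F] [TopologicalSpace G]
    (J : ModelWithCorners ℝ F G) [TopologicalSpace N] [ChartedSpace G N]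
    (T : ℝ) (c : ℝ → N) : Prop :=
  ContinuousOn c (Icc 0 T) ∧ ∀ t ∈ Icc 0 T, ∃ ε > 0,
    AbsolutelyContinuousOnInterval (fun s => extChartAt J (c t) (c s))
      (max 0 (t - ε)) (min T (t + ε))

section Connection

variable {d : ℕ} {M : Type*} [TopologicalSpace M] [ChartedSpace (EuclideanSpace ℝ (Fin d)) M]
  [IsManifold (𝓡 d) ∞ M]

/-- An affine connection on `M`: `cov Y x w` is `(∇_w Y)(x)`. -/
abbrev AffineConnection (d : ℕ) (M : Type*) [TopologicalSpace M]
    [ChartedSpace (EuclideanSpace ℝ (Fin d)) M] [IsManifold (𝓡 d) ∞ M] :=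
  CovariantDerivative (𝓡 d) (EuclideanSpace ℝ (Fin d)) (TangentSpace (𝓡 d) : M → Type _)

/-- The vector field near `x` which extends `v ∈ T_x M` and has constant components in the
preferred chart at `x`. -/
def constExt {x : M} (v : TangentSpace (𝓡 d) x) : (y : M) → TangentSpace (𝓡 d) y :=
  FiberBundle.extend (EuclideanSpace ℝ (Fin d)) v

/-- The covariant derivative `DV/dt` at time `t` of a vector field `V` along `γ` exists and is `D`.
With `V = ∑ Vⁱ ∂ᵢ` in the chart at `γ t`, it is `∑ (V̇ⁱ(t) ∂ᵢ + Vⁱ(t) ∇_{γ̇(t)} ∂ᵢ)`. -/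
def HasCovDerivAlongAt (cov : AffineConnection d M) (γ : ℝ → M)
    (V : (t : ℝ) → TangentSpace (𝓡 d) (γ t)) (t : ℝ) (D : TangentSpace (𝓡 d) (γ t)) : Prop :=
  ∃ (γ' : TangentSpace (𝓡 d) (γ t)) (a : EuclideanSpace ℝ (Fin d)),
    HasMFDerivAt 𝓘(ℝ, ℝ) (𝓡 d) γ t ((1 : ℝ →L[ℝ] ℝ).smulRight γ') ∧
    HasDerivAt (fun s => (trivializationAt (EuclideanSpace ℝ (Fin d))
      (TangentSpace (𝓡 d) : M → Type _) (γ t) ⟨γ s, V s⟩).2) a t ∧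
    D = (trivializationAt (EuclideanSpace ℝ (Fin d))
      (TangentSpace (𝓡 d) : M → Type _) (γ t)).symm (γ t) a + cov (constExt (V t)) (γ t) γ'

/-- `V` is an (absolutely continuous) parallel vector field along `γ : [0, T] → M`. -/
def IsParallelAlong (cov : AffineConnection d M) (T : ℝ) (γ : ℝ → M)
    (V : (t : ℝ) → TangentSpace (𝓡 d) (γ t)) : Prop :=
  IsACCurve (𝓡 d).tangent T (fun t => (⟨γ t, V t⟩ : TangentBundle (𝓡 d) M)) ∧
    ∀ᵐ t ∂(volume.restrict (Icc 0 T)), HasCovDerivAlongAt cov γ V t 0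

/-- The curve `γ : [0, T] → M` starts at `o` and `P t : T_o M → T_{γ t} M` is parallel transport
along it. The first clause says `γ 0 = o` and `P 0 = id`. -/
def IsParallelTransport (cov : AffineConnection d M) (T : ℝ) (o : M) (γ : ℝ → M)
    (P : (t : ℝ) → TangentSpace (𝓡 d) o →L[ℝ] TangentSpace (𝓡 d) (γ t)) : Prop :=
  ∀ v : TangentSpace (𝓡 d) o,
    (⟨γ 0, P 0 v⟩ : TangentBundle (𝓡 d) M) = ⟨o, v⟩ ∧ IsParallelAlong cov T γ (fun t => P t v)

/-- The holonomy group `Hol_o` as a set of endomorphisms of `T_o M`: all parallel transports along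
loops `c : [0, 1] → M` based at `o` that are smooth on `[0, 1]`. (Since parallel transport does not
depend on the parametrization and a piecewise smooth loop can be reparametrized so as to stop at
its corners, piecewise smooth loops give the same set.) -/
def holonomy (cov : AffineConnection d M) (o : M) :
    Set (TangentSpace (𝓡 d) o →L[ℝ] TangentSpace (𝓡 d) o) :=
  {A | ∃ (c : ℝ → M) (P : (t : ℝ) → TangentSpace (𝓡 d) o →L[ℝ] TangentSpace (𝓡 d) (c t)),
    ContMDiffOn 𝓘(ℝ, ℝ) (𝓡 d) ∞ c (Icc 0 1) ∧ IsParallelTransport cov 1 o c P ∧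
    ∀ v, (⟨c 1, P 1 v⟩ : TangentBundle (𝓡 d) M) = ⟨o, A v⟩}

/-- The curvature `R(v, w) z = ∇_v ∇_w z - ∇_w ∇_v z - ∇_{[v, w]} z` at `x`, computed with the local
extensions `constExt` (it is a tensor, so the choice of extensions is irrelevant). -/
def curvature (cov : AffineConnection d M) {x : M} (v w z : TangentSpace (𝓡 d) x) :
    TangentSpace (𝓡 d) x :=
  cov (fun y => cov (constExt z) y (constExt w y)) x v
    - cov (fun y => cov (constExt z) y (constExt v y)) x w
    - cov (constExt z) x (VectorField.mlieBracket (𝓡 d) (constExt v) (constExt w) x)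

end Connection

/-! ### Inner products, wedge products, square roots -/

section Linear

variable {𝔢 : Type*} [NormedAddCommGroup 𝔢] [InnerProductSpace ℝ 𝔢] [FiniteDimensional ℝ 𝔢]

/-- For an injective linear map `f : 𝔢 → V`, the inner product on `range f` that makes `f` an
isometry. -/
def rangeInner {V : Type*} (f : 𝔢 → V) (x y : V) : ℝ :=
  inner ℝ (Function.invFun f x) (Function.invFun f y)

/-- The wedge product `v ∧ w ∈ ⋀² 𝔢`. -/
def wedge (v w : 𝔢) : ⋀[ℝ]^2 𝔢 := exteriorPower.ιMulti ℝ 2 ![v, w]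

/-- The vector `ℓ ∈ 𝔢` with `⟪ℓ, v⟫ = α v` for all `v`. -/
def rieszVector (α : 𝔢 →L[ℝ] ℝ) : 𝔢 :=
  haveI := FiniteDimensional.complete ℝ 𝔢
  (InnerProductSpace.toDual ℝ 𝔢).symm α

open Classical in
/-- The (unique) positive semidefinite square root of a positive semidefinite symmetric operator. -/
def posSqrt (A : 𝔢 →L[ℝ] 𝔢) : 𝔢 →L[ℝ] 𝔢 :=
  if h : ∃ S : 𝔢 →L[ℝ] 𝔢, S.IsPositive ∧ S ∘L S = A then h.choose else 0

end Linear

/-! ### The developed process and its most probable paths -/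

section Development

/-- The data of the process `dx_t = //_t Σ_t^{1/2} ∘ dB_t + u_t dt`, `x_0 = o`, on `[0, T]`. The
subspace of `T_o M` in which the noise lives, with its inner product, is given as the image of an
inner product space `𝔢` under a linear map `ι` (required to be injective in the theorem); `B` is
the Brownian motion of `𝔢`. -/
structure DevelopedProcess (d : ℕ) (M : Type*) [TopologicalSpace M]
    [ChartedSpace (EuclideanSpace ℝ (Fin d)) M] [IsManifold (𝓡 d) ∞ M]
    (𝔢 : Type*) [NormedAddCommGroup 𝔢] [InnerProductSpace ℝ 𝔢] where
  /-- the connection `∇` -/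
  cov : AffineConnection d M
  /-- the time horizon `T` -/
  T : ℝ
  /-- the starting point `o` -/
  o : M
  /-- the inclusion of `𝔢` into `T_o M` -/
  ι : 𝔢 →L[ℝ] TangentSpace (𝓡 d) o
  /-- the covariance `Σ_t : 𝔢 → 𝔢` -/
  S : ℝ → 𝔢 →L[ℝ] 𝔢
  /-- the drift `u_t`, a time-dependent vector field on `M` -/
  u : ℝ → (x : M) → TangentSpace (𝓡 d) x

/-- The Cameron–Martin space of `𝔢` on `[0, T]`: the absolutely continuous curves `ω` in `𝔢` with
`ω_0 = 0` and square integrable derivative, isometrically represented by the derivative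
`ω̇ ∈ L²([0, T]; 𝔢)`. Below, an element `w` of this type is the derivative `ω̇` of the curve `ω` that
it represents. -/
abbrev CameronMartin (𝔢 : Type*) [NormedAddCommGroup 𝔢] (T : ℝ) : Type _ :=
  Lp 𝔢 2 (volume.restrict (Icc 0 T))

namespace DevelopedProcess

variable {d : ℕ} {M : Type*} [TopologicalSpace M] [ChartedSpace (EuclideanSpace ℝ (Fin d)) M]
  [IsManifold (𝓡 d) ∞ M]
  {𝔢 : Type*} [NormedAddCommGroup 𝔢] [InnerProductSpace ℝ 𝔢] [FiniteDimensional ℝ 𝔢]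
  (X : DevelopedProcess d M 𝔢)

/-- `γ` solves `γ̇_t = //_t Σ_t^{1/2} ω̇_t + u_t(γ_t)`, `γ_0 = o`, on `[0, T]` (in the sense of
absolutely continuous curves), where `//_t` is parallel transport along `γ`. -/
def IsDevelopment (w : CameronMartin 𝔢 X.T) (γ : ℝ → M) : Prop :=
  ∃ P : (t : ℝ) → TangentSpace (𝓡 d) X.o →L[ℝ] TangentSpace (𝓡 d) (γ t),
    IsACCurve (𝓡 d) X.T γ ∧ IsParallelTransport X.cov X.T X.o γ P ∧
    ∀ᵐ t ∂(volume.restrict (Icc 0 X.T)), HasMFDerivAt 𝓘(ℝ, ℝ) (𝓡 d) γ t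
      ((1 : ℝ →L[ℝ] ℝ).smulRight (P t (X.ι (posSqrt (X.S t) (w t))) + X.u t (γ t)))

open Classical in
/-- The end point map `Π(ω) = γ_T`. Where the solution does not exist on all of `[0, T]`, the
value is irrelevant (the domain of existence is open). -/
def endpoint (w : CameronMartin 𝔢 X.T) : M :=
  if h : ∃ γ, X.IsDevelopment w γ then h.choose X.T else X.o

/-- `ℍ(y)`: the curves `ω` whose solution `γ` exists on `[0, T]` and satisfies `γ_T = y`. -/
def fibre (y : M) : Set (CameronMartin 𝔢 X.T) :=
  {w | ∃ γ, X.IsDevelopment w γ ∧ γ X.T = y}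

/-- The Onsager–Machlup functional of the Brownian motion of `𝔢`, `½ ∫₀ᵀ ‖ω̇_t‖² dt`. -/
def OM (w : CameronMartin 𝔢 X.T) : ℝ := (1 / 2) * ∫ t in Icc 0 X.T, ‖w t‖ ^ 2

/-- `γ` is a most probable path (from `o` to `γ_T`): it is the solution driven by an `ω` that
minimizes the Onsager–Machlup functional over `ℍ(γ_T)`. -/
def IsMostProbablePath (γ : ℝ → M) : Prop :=
  ∃ w, X.IsDevelopment w γ ∧ ∀ η ∈ X.fibre (γ X.T), X.OM w ≤ X.OM η

/-- `ω` is a regular point of the end point map. -/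
def IsRegular (w : CameronMartin 𝔢 X.T) : Prop :=
  Function.Surjective (mfderiv 𝓘(ℝ, CameronMartin 𝔢 X.T) (𝓡 d) X.endpoint w)

/-- `γ` is singular: it is the solution driven by a singular (i.e. not regular) `ω`. -/
def IsSingular (γ : ℝ → M) : Prop :=
  ∃ w, X.IsDevelopment w γ ∧ ¬ X.IsRegular w

/-- Assumption (A): the image of `Σ_t` is (the fixed space) `𝔢` for all `t`. -/
def AssumptionA : Prop := ∀ t ∈ Icc 0 X.T, (X.S t).range = ⊤

/-- Assumption (B): every element of the holonomy group maps `𝔢` into itself and preserves its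
inner product. -/
def AssumptionB : Prop :=
  ∀ A ∈ holonomy X.cov X.o, ∃ U : 𝔢 →ₗᵢ[ℝ] 𝔢, ∀ v, A (X.ι v) = X.ι (U v)

/-- `K(χ, w₁)(w₂) = ∑_{α,β} χ^{αβ} ⟨R(w₁, w₂) f_α, f_β⟩_g` at a point `x`. Here
`f : 𝔢 → E_x` is an isometry onto the fibre `E_x` of the sub-Riemannian structure
(`⟨·,·⟩_g = rangeInner f`), `χ ∈ ⋀² 𝔢` stands for its image in `⋀² E_x`, and
`χ = ½ ∑_{α,β} χ^{αβ} f_α ∧ f_β` with `χ^{αβ}` skew, `f_α` being the image of an orthonormal basis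
`b` of `𝔢`; thus `χ^{αβ} = ⟪χ, b_α ∧ b_β⟫`. -/
def tensorK {x : M} (f : 𝔢 →L[ℝ] TangentSpace (𝓡 d) x) (χ : ⋀[ℝ]^2 𝔢)
    (w₁ w₂ : TangentSpace (𝓡 d) x) : ℝ :=
  let b := stdOrthonormalBasis ℝ 𝔢
  ∑ α, ∑ β, inner ℝ χ (wedge (b α) (b β)) *
    rangeInner f (curvature X.cov w₁ w₂ (f (b α))) (f (b β))

/-- The system for `(γ, λ, χ)` on `[0, T]`. `P t = //_t` is parallel transport along `γ`, `γ'` is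
the velocity of `γ`, `lam t` is a covector at `γ t`. The fibre of `E` at `γ t` is `//_t 𝔢`, and
`P t ∘ ι` is an isometry from `𝔢` onto it. Through this isometry, vectors and bivectors of
`E_{γ t}` are represented in `𝔢` and `⋀² 𝔢`, so that `χ t` below is `//_t⁻¹ χ_t`, the covariant
derivative `Dχ/dt` is the ordinary derivative of `χ`, `Σ_t` on `E_{γ t}` is `Σ_t` on `𝔢`, and
`♯^g λ_t` is `sharp t` below. The covariant derivative of `λ` is
characterized by `(Dλ/dt)(V) = d/dt (λ(V))` for the parallel fields `V = //_t v`, `v ∈ T_o M`. -/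
structure IsMPPSolution (γ : ℝ → M)
    (P : (t : ℝ) → TangentSpace (𝓡 d) X.o →L[ℝ] TangentSpace (𝓡 d) (γ t))
    (γ' : (t : ℝ) → TangentSpace (𝓡 d) (γ t))
    (lam : (t : ℝ) → TangentSpace (𝓡 d) (γ t) →L[ℝ] ℝ)
    (χ : ℝ → ⋀[ℝ]^2 𝔢) (sharp : ℝ → 𝔢) : Prop where
  transport : IsParallelTransport X.cov X.T X.o γ P
  velocity : ∀ t ∈ Icc 0 X.T, HasMFDerivWithinAt 𝓘(ℝ, ℝ) (𝓡 d) γ (Icc 0 X.T) t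
    ((1 : ℝ →L[ℝ] ℝ).smulRight (γ' t))
  /-- `sharp t = ♯^g λ_t` -/
  sharp_eq : ∀ t ∈ Icc 0 X.T, sharp t = rieszVector (lam t ∘L P t ∘L X.ι)
  /-- `♯^g λ_t = Σ_t⁻¹ (γ̇_t - u_t(γ_t))`, with the invertible `Σ_t` brought to the other side:
  `γ̇_t - u_t(γ_t) = Σ_t ♯^g λ_t`, which lies in `E` -/
  first_eq : ∀ t ∈ Icc 0 X.T, γ' t - X.u t (γ t) = P t (X.ι (X.S t (sharp t)))
  /-- `Dλ/dt = -λ(∇u) - λ(T(γ̇, ·)) + K(χ, γ̇)` -/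
  second_eq : ∀ t ∈ Icc 0 X.T, ∀ v : TangentSpace (𝓡 d) X.o,
    HasDerivWithinAt (fun s => lam s (P s v))
      (- lam t (X.cov (X.u t) (γ t) (P t v)) - lam t (X.cov.torsion (γ t) (γ' t) (P t v))
        + X.tensorK (P t ∘L X.ι) (χ t) (γ' t) (P t v)) (Icc 0 X.T) t
  /-- `Dχ/dt = ½ Σ ♯^g λ ∧ ♯^g λ` -/
  third_eq : ∀ t ∈ Icc 0 X.T,
    HasDerivWithinAt χ ((1 / 2 : ℝ) • wedge (X.S t (sharp t)) (sharp t)) (Icc 0 X.T) t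
  final : χ X.T = 0

end DevelopedProcess

end Development

end

set_option maxSynthPendingDepth 3
set_option linter.unusedSectionVars false
set_option linter.unusedSimpArgs false

/-! ### Absolutely continuous functions and primitives -/

section Primitives

open Filter Topology

variable {V W Z : Type*} [NormedAddCommGroup V] [NormedSpace ℝ V]
  [NormedAddCommGroup W] [NormedSpace ℝ W] [NormedAddCommGroup Z] [NormedSpace ℝ Z]

/-! In a chart the process becomes a control system for a point and a frame, `x' = p N w + u`, `p' =
-Γ(x)(x') p`, where `N` is `Σ^{1/2}` followed by the inclusion into `T_o M`. A most probable path
minimizes `½‖w‖²` under an end point constraint. The theorem is the system of multiplier equations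
at a regular minimizer, written with torsion and curvature.

Differentiability: a solution is a zero of `y ↦ y - y(a) - ∫ f(y)(1, w)` on the space of continuous
curves. The derivative in `y` is the identity minus a Volterra operator. A weighted norm shows that
it is invertible (`isUnit_one_sub_of_volterra`), so the implicit function theorem gives a strictly
differentiable flow (`exists_strictly_differentiable_flow`). A long curve is treated by crossing one
chart at a time (`IsSolution.hasFlowAt`).

Geometry: a variation `(ξ, π)` of `(x, p)` is replaced by the displacement `p⁻¹ ξ` and the rotation
`p⁻¹ (π + Γ(x)(ξ) p)`. By Cartan's structure equations these satisfy a linear equation with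
coefficients given by torsion, curvature and `∇u` (`isPrimitive_invariantVariation`,
`generatorIn_spec`), hence the same in every chart. If `Θ` solves the adjoint equation, then `Θ_T`
of the final variation in the direction `η` is `∫ Θ_s (N_s η_s, 0) ds`.

Optimality: surjectivity of the differential of `Π` excludes an abnormal multiplier, so `⟪w, η⟫ = ∫
Θ_s (N_s η_s, 0) ds` for a solution `Θ` of the adjoint equation with `Θ_T = 0` on rotations
(`exists_adjoint_of_isMostProbablePath`). Therefore `w = N* Θ(·, 0)` has a continuous representative
and the path is `C¹`. With `λ = Θ(P⁻¹ ·, 0)`, the first equation follows from `Σ^{1/2} Σ^{1/2} = Σ`.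
The second is the displacement part of the adjoint equation; its curvature term is `-Θ_t (0, P⁻¹
R(γ', ·) P)`.

The bivector: that term equals `K(χ, γ')` because the curvature maps `E` to itself by skew
endomorphisms, the easy half of the Ambrose–Singer theorem. Transport along segments of a chart
produces a frame field of `E`. By (B), transports between the same points differ on `𝔢` by
isometries, so the connection form of this frame field is skew; the structure equation expresses the
curvature through it (`exists_skew_curvature`). On endomorphisms that restrict to a skew `B` on `𝔢`,
`Θ` evolves by `-⟪B Σ ♯λ, ♯λ⟫`, which is minus the derivative of the pairing of `χ` with `B`, and
both vanish at `T`. -/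

theorem interval_induction {a b : ℝ} {S : ℝ → Prop} (ha : S a)
    (h : ∀ t₀ ∈ Icc a b, ∃ ε > 0, ∀ s ∈ Icc a b, ∀ t ∈ Icc a b, s ≤ t → |s - t₀| < ε →
      |t - t₀| < ε → S s → S t) : ∀ t ∈ Icc a b, S t := by
  intro t ht
  by_contra hS'
  -- At the supremum of the good times, the local hypothesis carries the property past it, or to `t`
  -- if the supremum is `t` itself.
  let G : Set ℝ := {s | s ∈ Icc a t ∧ S s}
  have haG : a ∈ G := ⟨⟨le_refl _, ht.1⟩, ha⟩
  have hGb : BddAbove G := ⟨t, fun s hs => hs.1.2⟩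
  have hst : sSup G ≤ t := csSup_le ⟨a, haG⟩ fun s hs => hs.1.2
  have hs0 : sSup G ∈ Icc a b := ⟨le_csSup hGb haG, hst.trans ht.2⟩
  obtain ⟨δ, hδ, H⟩ := h _ hs0
  obtain ⟨s, hsG, hs⟩ := exists_lt_of_lt_csSup ⟨a, haG⟩ (show sSup G - δ < sSup G by linarith)
  have hsle : s ≤ sSup G := le_csSup hGb hsG
  have hsI : s ∈ Icc a b := ⟨hsG.1.1, hsG.1.2.trans ht.2⟩
  rcases hst.lt_or_eq with hlt | heq
  · set r := min t (sSup G + δ / 2)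
    have hr1 : sSup G < r := lt_min hlt (by linarith)
    have hr2 : r ≤ t := min_le_left _ _
    have hr3 : r ≤ sSup G + δ / 2 := min_le_right _ _
    have : S r := H s hsI r ⟨by linarith [hs0.1], hr2.trans ht.2⟩ (by linarith)
      (by rw [abs_lt]; constructor <;> linarith) (by rw [abs_lt]; constructor <;> linarith) hsG.2
    have := le_csSup hGb (show r ∈ G from ⟨⟨by linarith [hs0.1], hr2⟩, this⟩)
    linarith
  · exact hS' (H s hsI t ht hsG.1.2 (by rw [abs_lt]; constructor <;> linarith)
      (by rw [heq]; simpa) hsG.2)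

/-- Absolute continuity is the convergence to zero of sums of increments, so it passes to any
function whose increments are dominated. -/
theorem AbsolutelyContinuousOnInterval.of_dist_le {X Y : Type*} [PseudoMetricSpace X]
    [PseudoMetricSpace Y] {f : ℝ → X} {g : ℝ → Y} {a b : ℝ}
    (hf : AbsolutelyContinuousOnInterval f a b) {K : ℝ}
    (h : ∀ s ∈ uIcc a b, ∀ t ∈ uIcc a b, dist (g s) (g t) ≤ K * dist (f s) (f t)) :
    AbsolutelyContinuousOnInterval g a b := by
  have h0 := Tendsto.const_mul K hf
  rw [mul_zero] at h0
  refine squeeze_zero' (Eventually.of_forall fun E => Finset.sum_nonneg fun _ _ => dist_nonneg)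
    ?_ h0
  refine Filter.mem_inf_of_right fun E hE => ?_
  simp only [Finset.mul_sum, Set.mem_ofPred_eq]
  exact Finset.sum_le_sum fun i hi => h _ (hE.1 i hi).1 _ (hE.1 i hi).2

theorem IntervalIntegrable.absolutelyContinuousOnInterval_integral {g : ℝ → V} {a b : ℝ}
    (hg : IntervalIntegrable g volume a b) :
    AbsolutelyContinuousOnInterval (fun t => ∫ s in a..t, g s) a b := by
  refine (hg.norm.absolutelyContinuousOnInterval_intervalIntegral
    (c := a) left_mem_uIcc).of_dist_le (K := 1) ?_
  intro s hs t ht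
  have hs' := hg.mono_set (uIcc_subset_uIcc left_mem_uIcc hs)
  have ht' := hg.mono_set (uIcc_subset_uIcc left_mem_uIcc ht)
  rw [dist_eq_norm, Real.dist_eq, one_mul, intervalIntegral.integral_interval_sub_left hs' ht',
    intervalIntegral.integral_interval_sub_left hs'.norm ht'.norm]
  exact intervalIntegral.norm_integral_le_abs_integral_norm

/-- `f` is a primitive of the integrable function `g` on `[a, b]`. -/
structure IsPrimitive (f g : ℝ → V) (a b : ℝ) : Prop where
  integrable : IntervalIntegrable g volume a b
  eq : ∀ t ∈ Icc a b, f t = f a + ∫ s in a..t, g s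

namespace IsPrimitive

variable {f g : ℝ → V} {a b c : ℝ}

theorem intervalIntegrable_mono (h : IsPrimitive f g a b) {s t : ℝ} (hs : s ∈ Icc a b)
    (ht : t ∈ Icc a b) : IntervalIntegrable g volume s t :=
  h.integrable.mono_set (by
    rw [uIcc_of_le (hs.1.trans hs.2)]
    exact ordConnected_Icc.uIcc_subset hs ht)

theorem sub_eq (h : IsPrimitive f g a b) {s t : ℝ} (hs : s ∈ Icc a b) (ht : t ∈ Icc a b) :
    f t - f s = ∫ r in s..t, g r := by
  have ha : a ∈ Icc a b := ⟨le_refl _, hs.1.trans hs.2⟩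
  rw [h.eq t ht, h.eq s hs, ← intervalIntegral.integral_interval_sub_left
    (h.intervalIntegrable_mono ha ht) (h.intervalIntegrable_mono ha hs)]
  abel

theorem mono (h : IsPrimitive f g a b) {s t : ℝ} (hs : s ∈ Icc a b) (ht : t ∈ Icc a b) :
    IsPrimitive f g s t where
  integrable := h.intervalIntegrable_mono hs ht
  eq r hr := by
    rw [← h.sub_eq hs ⟨hs.1.trans hr.1, hr.2.trans ht.2⟩]; abel

theorem trans (h : IsPrimitive f g a b) (h' : IsPrimitive f g b c) (hab : a ≤ b) (hbc : b ≤ c) :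
    IsPrimitive f g a c where
  integrable := h.integrable.trans h'.integrable
  eq t ht := by
    rcases le_total t b with htb | htb
    · exact h.eq t ⟨ht.1, htb⟩
    · rw [h'.eq t ⟨htb, ht.2⟩, h.eq b ⟨hab, le_refl _⟩, add_assoc,
        intervalIntegral.integral_add_adjacent_intervals h.integrable
        (h'.intervalIntegrable_mono ⟨le_refl _, hbc⟩ ⟨htb, ht.2⟩)]

theorem congr {f' g' : ℝ → V} (h : IsPrimitive f g a b) (hab : a ≤ b)
    (hf : ∀ t ∈ Icc a b, f' t = f t) (hg : ∀ᵐ t, t ∈ Icc a b → g' t = g t) :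
    IsPrimitive f' g' a b where
  integrable := h.integrable.congr_ae (by
    rw [uIoc_of_le hab, Filter.EventuallyEq, ae_restrict_iff' measurableSet_Ioc]
    filter_upwards [hg] with t ht hm
    exact (ht (Ioc_subset_Icc_self hm)).symm)
  eq t ht := by
    rw [hf t ht, hf a ⟨le_refl _, hab⟩, h.eq t ht]
    congr 1
    refine intervalIntegral.integral_congr_ae ?_
    filter_upwards [hg] with s hs hm
    rw [uIoc_of_le ht.1] at hm
    exact (hs ⟨hm.1.le, hm.2.trans ht.2⟩).symm

theorem absolutelyContinuous (h : IsPrimitive f g a b) (hab : a ≤ b) :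
    AbsolutelyContinuousOnInterval f a b := by
  refine h.integrable.absolutelyContinuousOnInterval_integral.of_dist_le (K := 1) ?_
  intro s hs t ht
  rw [uIcc_of_le hab] at hs ht
  rw [h.eq s hs, h.eq t ht, dist_add_left, one_mul]

theorem continuousOn (h : IsPrimitive f g a b) (hab : a ≤ b) : ContinuousOn f (Icc a b) := by
  simpa [uIcc_of_le hab] using (h.absolutelyContinuous hab).continuousOn

theorem ae_hasDerivAt [CompleteSpace V] (h : IsPrimitive f g a b) (hab : a ≤ b) :
    ∀ᵐ t, t ∈ Icc a b → HasDerivAt f (g t) t := by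
  -- The integral formula holds only on `[a, b]`, so a two-sided derivative needs an interior point;
  -- the end points form a null set.
  have h₁ : ∀ᵐ x : ℝ, x ≠ a := by simp [ae_iff, measure_singleton]
  have h₂ : ∀ᵐ x : ℝ, x ≠ b := by simp [ae_iff, measure_singleton]
  filter_upwards [h.integrable.ae_hasDerivAt_integral, h₁, h₂] with t ht hta htb hm
  rw [uIcc_of_le hab] at ht
  have hd := (ht hm a ⟨le_refl _, hab⟩).const_add (f a)
  refine hd.congr_of_eventuallyEq ?_
  filter_upwards [Icc_mem_nhds (lt_of_le_of_ne hm.1 (Ne.symm hta)) (lt_of_le_of_ne hm.2 htb)]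
    with s hs using h.eq s hs

/-- The difference between `f` and the integral of `g` is absolutely continuous with derivative zero
almost everywhere, hence constant. -/
theorem of_absolutelyContinuous [CompleteSpace V] (hab : a ≤ b)
    (hf : AbsolutelyContinuousOnInterval f a b)
    (hg : IntervalIntegrable g volume a b) (hd : ∀ᵐ t, t ∈ Icc a b → HasDerivAt f (g t) t) :
    IsPrimitive f g a b where
  integrable := hg
  eq t ht := by
    obtain ⟨C, hC⟩ := (hf.sub hg.absolutelyContinuousOnInterval_integral).const_of_ae_hasDerivAt_zero
      (by
        filter_upwards [hd, hg.ae_hasDerivAt_integral] with s hs hs' hm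
        have h1 := hs (by rwa [uIcc_of_le hab] at hm)
        have h2 := hs' hm a left_mem_uIcc
        simpa using h1.sub h2)
    rw [uIcc_of_le hab] at hC
    have h1 := hC t ht
    have h2 := hC a ⟨le_refl _, hab⟩
    simp only [Pi.sub_apply, intervalIntegral.integral_same, sub_zero] at h1 h2
    rw [h2, ← h1]; abel

theorem hasDerivWithinAt [CompleteSpace V] (h : IsPrimitive f g a b)
    (hg : ContinuousOn g (Icc a b)) {t : ℝ} (ht : t ∈ Icc a b) :
    HasDerivWithinAt f (g t) (Icc a b) t := by
  have : Fact (t ∈ Icc a b) := ⟨ht⟩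
  have hab := ht.1.trans ht.2
  have := intervalIntegral.integral_hasDerivWithinAt_right (a := a) (b := t) (f := g)
    (s := Icc a b) (t := Icc a b)
    (h.intervalIntegrable_mono ⟨le_refl _, hab⟩ ht)
    (hg.stronglyMeasurableAtFilter_nhdsWithin measurableSet_Icc t) (hg t ht)
  exact (this.const_add (f a)).congr (fun s hs => h.eq s hs) (h.eq t ht)

theorem prodMk [CompleteSpace V] [CompleteSpace W] {f₂ g₂ : ℝ → W} (hab : a ≤ b)
    (h : IsPrimitive f g a b) (h₂ : IsPrimitive f₂ g₂ a b) :
    IsPrimitive (fun t => (f t, f₂ t)) (fun t => (g t, g₂ t)) a b := by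
  refine of_absolutelyContinuous hab ?_ ?_ ?_
  · have h0 := Tendsto.add (h.absolutelyContinuous hab) (h₂.absolutelyContinuous hab)
    rw [add_zero] at h0
    refine squeeze_zero (fun E => Finset.sum_nonneg fun _ _ => dist_nonneg) (fun E => ?_) h0
    rw [← Finset.sum_add_distrib]
    refine Finset.sum_le_sum fun i _ => ?_
    rw [Prod.dist_eq]
    exact max_le_add_of_nonneg dist_nonneg dist_nonneg
  · have h1 := h.integrable
    have h2 := h₂.integrable
    rw [intervalIntegrable_iff] at h1 h2 ⊢
    exact Integrable.prodMk h1 h2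
  · filter_upwards [h.ae_hasDerivAt hab, h₂.ae_hasDerivAt hab] with t h1 h2 ht
    exact (h1 ht).prodMk (h2 ht)

end IsPrimitive

theorem ContinuousOn.intervalIntegrable_clm_apply {A : ℝ → V →L[ℝ] W} {g : ℝ → V} {a b : ℝ}
    (hab : a ≤ b) (hA : ContinuousOn A (Icc a b)) (hg : IntervalIntegrable g volume a b) :
    IntervalIntegrable (fun t => A t (g t)) volume a b := by
  obtain ⟨C, hC⟩ := isCompact_Icc.exists_bound_of_continuousOn hA
  rw [intervalIntegrable_iff_integrableOn_Icc_of_le hab] at hg ⊢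
  refine Integrable.mono' (hg.norm.const_mul C) ?_ ?_
  · exact (ContinuousLinearMap.id ℝ (V →L[ℝ] W)).aestronglyMeasurable_comp₂
      (hA.aestronglyMeasurable_of_isCompact isCompact_Icc measurableSet_Icc) hg.1
  · filter_upwards [ae_restrict_mem measurableSet_Icc] with t ht
    exact ((A t).le_opNorm _).trans (mul_le_mul_of_nonneg_right (hC t ht) (norm_nonneg _))

/-- A `C¹` map is Lipschitz on the compact image of the curve, so the composite is absolutely
continuous, and the chain rule holds at almost every time. Changes of chart for curves with merely
integrable velocity rest on this. -/
theorem IsPrimitive.comp [CompleteSpace V] [CompleteSpace W] {f g : ℝ → V} {a b : ℝ} (hab : a ≤ b)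
    (h : IsPrimitive f g a b) {Φ : V → W} (hΦ : ∀ t ∈ Icc a b, ContDiffAt ℝ 1 Φ (f t)) :
    IsPrimitive (fun t => Φ (f t)) (fun t => fderiv ℝ Φ (f t) (g t)) a b := by
  have hc := h.continuousOn hab
  have hlip : LocallyLipschitzOn (f '' Icc a b) Φ := by
    rintro _ ⟨t, ht, rfl⟩
    obtain ⟨K, s, hs, hK⟩ := (hΦ t ht).exists_lipschitzOnWith
    exact ⟨K, s, mem_nhdsWithin_of_mem_nhds hs, hK⟩
  obtain ⟨K, hK⟩ := hlip.exists_lipschitzOnWith_of_compact (isCompact_Icc.image_of_continuousOn hc)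
  refine .of_absolutelyContinuous hab ?_ ?_ ?_
  · refine (h.absolutelyContinuous hab).of_dist_le (K := K) ?_
    rw [uIcc_of_le hab]
    exact fun s hs t ht => hK.dist_le_mul _ (mem_image_of_mem _ hs) _ (mem_image_of_mem _ ht)
  · refine ContinuousOn.intervalIntegrable_clm_apply hab (A := fun t => fderiv ℝ Φ (f t))
      (fun t ht => ?_) h.integrable
    have : ContinuousAt (fderiv ℝ Φ) (f t) :=
      ((hΦ t ht).fderiv_right (m := 0) (by norm_num)).continuousAt
    exact this.comp_continuousWithinAt (hc t ht)
  · filter_upwards [h.ae_hasDerivAt hab] with t ht hm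
    exact ((hΦ t hm).differentiableAt (by norm_num)).hasFDerivAt.comp_hasDerivAt t (ht hm)

theorem IsPrimitive.clm_comp [CompleteSpace V] [CompleteSpace W] {f g : ℝ → V} {a b : ℝ}
    (hab : a ≤ b) (h : IsPrimitive f g a b) (L : V →L[ℝ] W) :
    IsPrimitive (fun t => L (f t)) (fun t => L (g t)) a b := by
  simpa using h.comp hab (Φ := L) (fun t _ => L.contDiff.contDiffAt)

theorem IsPrimitive.bilin [CompleteSpace V] [CompleteSpace W] [CompleteSpace Z] {f g : ℝ → V}
    {f₂ g₂ : ℝ → W} {a b : ℝ} (hab : a ≤ b) (h : IsPrimitive f g a b) (h₂ : IsPrimitive f₂ g₂ a b)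
    (B : V →L[ℝ] W →L[ℝ] Z) :
    IsPrimitive (fun t => B (f t) (f₂ t)) (fun t => B (g t) (f₂ t) + B (f t) (g₂ t)) a b := by
  have hB : ∀ p : V × W, HasFDerivAt (fun p : V × W => B p.1 p.2) (B.deriv₂ p) p := fun p =>
    B.isBoundedBilinearMap.hasFDerivAt p
  have := (h.prodMk hab h₂).comp hab (Φ := fun p : V × W => B p.1 p.2)
    (fun t _ => B.isBoundedBilinearMap.contDiff.contDiffAt)
  refine this.congr hab (fun t _ => rfl) (Eventually.of_forall fun t _ => ?_)
  rw [(hB _).fderiv]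
  simp [add_comm]

/-! ### Gronwall estimates with integrable coefficients -/

/-- With `M` the primitive of `m`, the integrand is the derivative of `½ e^{2M}`. The exponent 2 is
chosen for the factor ½: in the sup norm weighted by `e^{-2M}`, an integral operator with kernel
bounded by `m` is a contraction. -/
theorem integral_mul_exp_two_primitive_le {m : ℝ → ℝ} {a b : ℝ} (hab : a ≤ b)
    (hm : IntervalIntegrable m volume a b) {t : ℝ} (ht : t ∈ Icc a b) :
    ∫ s in a..t, m s * Real.exp (2 * ∫ r in a..s, m r) ≤
      (1 / 2) * Real.exp (2 * ∫ r in a..t, m r) := by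
  have h : IsPrimitive (fun t => ∫ r in a..t, m r) m a b := ⟨hm, fun t _ => by simp⟩
  have h2 := h.comp hab (Φ := fun x => (1 / 2) * Real.exp (2 * x)) (fun t _ => by fun_prop)
  have h3 : ∀ x : ℝ, HasDerivAt (fun x => (1 / 2) * Real.exp (2 * x)) (Real.exp (2 * x)) x := by
    intro x
    have := (((hasDerivAt_id x).const_mul 2).exp).const_mul (1 / 2)
    exact this.congr_deriv (by simp only [id]; ring)
  have h4 := h2.sub_eq ⟨le_refl _, hab⟩ ht
  have h5 : ∀ s, fderiv ℝ (fun x => (1 / 2) * Real.exp (2 * x)) (∫ r in a..s, m r) (m s)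
      = m s * Real.exp (2 * ∫ r in a..s, m r) := by
    intro s
    rw [(h3 _).hasFDerivAt.fderiv]; simp
  simp only [h5] at h4
  rw [← h4]
  simp

/-- Let `C` be the maximum of `d e^{-2M}`. Inserting `d ≤ C e^{2M}` on the right-hand side at the
point of maximum gives `C ≤ C/2`. -/
theorem eq_zero_of_le_integral_mul {m d : ℝ → ℝ} {a b : ℝ} (hab : a ≤ b)
    (hm : IntervalIntegrable m volume a b) (hm0 : ∀ s, 0 ≤ m s) (hd : ContinuousOn d (Icc a b))
    (hd0 : ∀ t ∈ Icc a b, 0 ≤ d t)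
    (h : ∀ t ∈ Icc a b, d t ≤ ∫ s in a..t, m s * d s) : ∀ t ∈ Icc a b, d t = 0 := by
  set M : ℝ → ℝ := fun t => ∫ s in a..t, m s with hM
  have hMc : ContinuousOn M (Icc a b) :=
    IsPrimitive.continuousOn (g := m) ⟨hm, fun t _ => by simp [hM]⟩ hab
  obtain ⟨t₀, ht₀, hmax⟩ := isCompact_Icc.exists_isMaxOn (nonempty_Icc.2 hab)
    (f := fun t => d t * Real.exp (-(2 * M t))) (by fun_prop)
  set C := d t₀ * Real.exp (-(2 * M t₀)) with hC
  have hC0 : 0 ≤ C := mul_nonneg (hd0 _ ht₀) (Real.exp_pos _).le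
  have hle : ∀ t ∈ Icc a b, d t ≤ C * Real.exp (2 * M t) := by
    intro t ht
    have := mul_le_mul_of_nonneg_right (hmax ht) (Real.exp_pos (2 * M t)).le
    simpa only [← hC, mul_assoc, ← Real.exp_add, neg_add_cancel, Real.exp_zero, mul_one] using this
  have hmt : IntervalIntegrable m volume a t₀ := hm.mono_set (by
    rw [uIcc_of_le hab, uIcc_of_le ht₀.1]; exact Icc_subset_Icc_right ht₀.2)
  have key : d t₀ ≤ C * ((1 / 2) * Real.exp (2 * M t₀)) := by
    refine (h t₀ ht₀).trans ((intervalIntegral.integral_mono_on ht₀.1 ?_ ?_ ?_).trans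
      ((intervalIntegral.integral_const_mul C
        (fun s => m s * Real.exp (2 * M s))).trans_le ?_))
    · refine hmt.mul_continuousOn ?_
      rw [uIcc_of_le ht₀.1]; exact hd.mono (Icc_subset_Icc_right ht₀.2)
    · refine (hmt.mul_continuousOn ?_).const_mul C
      rw [uIcc_of_le ht₀.1]
      have := hMc.mono (Icc_subset_Icc_right ht₀.2 : Icc a t₀ ⊆ Icc a b)
      fun_prop
    · intro s hs
      calc m s * d s ≤ m s * (C * Real.exp (2 * M s)) :=
            mul_le_mul_of_nonneg_left (hle s ⟨hs.1, hs.2.trans ht₀.2⟩) (hm0 s)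
        _ = _ := by ring
    · exact mul_le_mul_of_nonneg_left (integral_mul_exp_two_primitive_le hab hm ht₀) hC0
  have hdC : d t₀ = C * Real.exp (2 * M t₀) := by
    rw [hC, mul_assoc, ← Real.exp_add]; simp
  have hC' : C ≤ 0 := by
    have := Real.exp_pos (2 * M t₀)
    by_contra hcon
    push Not at hcon
    nlinarith [mul_pos hcon this]
  intro t ht
  refine le_antisymm ?_ (hd0 t ht)
  have := hle t ht
  nlinarith [Real.exp_pos (2 * M t)]

/-- Uniqueness for linear equations with integrable coefficients, from any time. -/
theorem IsPrimitive.eq_zero_of_linear [CompleteSpace V] {f g : ℝ → V} {m : ℝ → ℝ} {a b : ℝ}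
    (h : IsPrimitive f g a b) (hm : IntervalIntegrable m volume a b) (hm0 : ∀ s, 0 ≤ m s)
    (hg : ∀ᵐ t, t ∈ Icc a b → ‖g t‖ ≤ m t * ‖f t‖) {t₀ : ℝ} (ht₀ : t₀ ∈ Icc a b)
    (h0 : f t₀ = 0) : ∀ t ∈ Icc a b, f t = 0 := by
  have hab := ht₀.1.trans ht₀.2
  have hc := h.continuousOn hab
  have ha : a ∈ Icc a b := ⟨le_refl _, hab⟩
  have hb : b ∈ Icc a b := ⟨hab, le_refl _⟩
  have hmono : ∀ s ∈ Icc a b, ∀ t ∈ Icc a b, IntervalIntegrable m volume s t := fun s hs t ht =>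
    hm.mono_set (by rw [uIcc_of_le hab]; exact ordConnected_Icc.uIcc_subset hs ht)
  have hint : ∀ s ∈ Icc a b, ∀ t ∈ Icc a b, s ≤ t →
      ‖f t - f s‖ ≤ ∫ r in s..t, m r * ‖f r‖ := by
    intro s hs t ht hst
    rw [h.sub_eq hs ht]
    refine intervalIntegral.norm_integral_le_of_norm_le hst ?_ ?_
    · filter_upwards [hg] with r hr hrm
      exact hr ⟨hs.1.trans hrm.1.le, hrm.2.trans ht.2⟩
    · refine (hmono s hs t ht).mul_continuousOn ?_
      rw [uIcc_of_le hst]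
      exact (hc.mono (Icc_subset_Icc hs.1 ht.2)).norm
  intro t ht
  rcases le_total t₀ t with hle | hle
  · refine norm_eq_zero.1 (eq_zero_of_le_integral_mul (d := fun t => ‖f t‖) ht₀.2
      (hmono _ ht₀ _ hb) hm0 (hc.mono (Icc_subset_Icc_left ht₀.1)).norm (fun _ _ => norm_nonneg _)
      (fun s hs => ?_) t ⟨hle, ht.2⟩)
    simpa [h0] using hint t₀ ht₀ s ⟨ht₀.1.trans hs.1, hs.2⟩ hs.1
  -- Times before `t₀` are reduced to the forward estimate by reflecting time.
  · have hrefl : ∀ s ∈ Icc (-t₀) (-a), -s ∈ Icc a b := fun s hs =>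
      ⟨by linarith [hs.2], by linarith [hs.1, ht₀.2]⟩
    have := eq_zero_of_le_integral_mul (d := fun t => ‖f (-t)‖) (m := fun t => m (-t))
      (a := -t₀) (b := -a) (by linarith [ht₀.1]) ?_ (fun s => hm0 _) ?_ (fun _ _ => norm_nonneg _)
      (fun s hs => ?_) (-t) ⟨by linarith, by linarith [ht.1]⟩
    · simpa using this
    · simpa using (IntervalIntegrable.iff_comp_neg (by simp)).1 (hmono _ ht₀ _ ha)
    · exact (hc.comp continuousOn_neg fun s hs => hrefl s hs).norm
    · have h1 := hint (-s) (hrefl s hs) t₀ ht₀ (by linarith [hs.1])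
      rw [h0, zero_sub, norm_neg] at h1
      refine h1.trans_eq ?_
      rw [intervalIntegral.integral_comp_neg (fun r => m r * ‖f r‖), neg_neg]

end Primitives

/-! ### Volterra operators and superposition operators on spaces of continuous maps -/

section Operators

open Filter Topology

variable {K : Type*} [TopologicalSpace K] [CompactSpace K]
  {V W Z : Type*} [NormedAddCommGroup V] [NormedSpace ℝ V]
  [NormedAddCommGroup W] [NormedSpace ℝ W] [NormedAddCommGroup Z] [NormedSpace ℝ Z]

/-- The pointwise action of a continuous bilinear map on continuous maps. -/
noncomputable def ContinuousMap.bilinLift (K : Type*) [TopologicalSpace K] [CompactSpace K]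
    (B : V →L[ℝ] W →L[ℝ] Z) : C(K, V) →L[ℝ] C(K, W) →L[ℝ] C(K, Z) :=
  LinearMap.mkContinuous₂
    (LinearMap.mk₂ ℝ (fun (f : C(K, V)) (g : C(K, W)) =>
        (⟨fun k => B (f k) (g k), by fun_prop⟩ : C(K, Z)))
      (fun _ _ _ => by ext; simp) (fun _ _ _ => by ext; simp)
      (fun _ _ _ => by ext; simp) (fun _ _ _ => by ext; simp)) ‖B‖ (fun f g => by
    refine (ContinuousMap.norm_le _ (by positivity)).2 fun k => ?_
    refine (B.le_opNorm₂ _ _).trans ?_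
    gcongr
    · exact f.norm_coe_le_norm k
    · exact g.norm_coe_le_norm k)

@[simp] theorem ContinuousMap.bilinLift_apply (B : V →L[ℝ] W →L[ℝ] Z) (f : C(K, V)) (g : C(K, W))
    (k : K) : ContinuousMap.bilinLift K B f g k = B (f k) (g k) := rfl

/-- Conjugation with multiplication by `e^{2M}`, where `M` is the primitive of `m`, brings the norm
of `T` below ½. The Neumann series inverts the conjugated operator, and conjugating back inverts `1
- T`, whatever the norm of `T`. -/
theorem isUnit_one_sub_of_volterra {a b : ℝ} (hab : a ≤ b) [CompleteSpace V]
    (T : C(Icc a b, V) →L[ℝ] C(Icc a b, V)) {m : ℝ → ℝ} (hm : IntervalIntegrable m volume a b)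
    (hm0 : ∀ s, 0 ≤ m s)
    (h : ∀ f t, ‖T f t‖ ≤ ∫ s in a..(t : ℝ), m s * ‖f (projIcc a b hab s)‖) :
    IsUnit (1 - T) := by
  set M : ℝ → ℝ := fun t => ∫ s in a..t, m s with hM
  have hMc : ContinuousOn M (Icc a b) :=
    IsPrimitive.continuousOn (g := m) ⟨hm, fun t _ => by simp [hM]⟩ hab
  let θ : ℝ → C(Icc a b, ℝ) := fun c =>
    ⟨fun t => Real.exp (c * M t), by
      have h : Continuous fun t : Icc a b => M t := hMc.domRestrict
      exact Real.continuous_exp.comp (continuous_const.mul h)⟩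
  let Q : ℝ → C(Icc a b, V) →L[ℝ] C(Icc a b, V) := fun c =>
    ContinuousMap.bilinLift (Icc a b) (ContinuousLinearMap.lsmul ℝ ℝ) (θ c)
  have hQ : ∀ c f t, Q c f t = Real.exp (c * M t) • f t := fun c f t => rfl
  have hQQ : ∀ c, Q c * Q (-c) = 1 := by
    intro c; ext f t
    simp [hQ, smul_smul, ← Real.exp_add]
  have hnorm : ‖Q (-2) * T * Q 2‖ ≤ 1 / 2 := by
    refine ContinuousLinearMap.opNorm_le_bound _ (by norm_num) fun f => ?_
    refine (ContinuousMap.norm_le _ (by positivity)).2 fun t => ?_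
    have h1 : ‖T (Q 2 f) t‖ ≤ ‖f‖ * ((1 / 2) * Real.exp (2 * M t)) := by
      have hmt : IntervalIntegrable m volume a t := hm.mono_set (by
        rw [uIcc_of_le hab, uIcc_of_le t.2.1]; exact Icc_subset_Icc_right t.2.2)
      have hc : Continuous fun s => ‖Q 2 f (projIcc a b hab s)‖ := by fun_prop
      refine (h _ t).trans ((intervalIntegral.integral_mono_on t.2.1 ?_ ?_ ?_).trans
        ((intervalIntegral.integral_const_mul ‖f‖
          (fun s => m s * Real.exp (2 * M s))).trans_le ?_))
      · exact hmt.mul_continuousOn hc.continuousOn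
      · refine (hmt.mul_continuousOn ?_).const_mul _
        rw [uIcc_of_le t.2.1]
        have := hMc.mono (Icc_subset_Icc_right t.2.2 : Icc a (t : ℝ) ⊆ Icc a b)
        fun_prop
      · intro s hs
        rw [hQ, norm_smul, projIcc_of_mem hab ⟨hs.1, hs.2.trans t.2.2⟩, Real.norm_eq_abs,
          abs_of_pos (Real.exp_pos _)]
        calc _ ≤ m s * (Real.exp (2 * M s) * ‖f‖) := by
              have := hm0 s
              gcongr
              exact f.norm_coe_le_norm _
          _ = _ := by ring
      · exact mul_le_mul_of_nonneg_left (integral_mul_exp_two_primitive_le hab hm t.2)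
          (norm_nonneg _)
    change ‖Q (-2) (T (Q 2 f)) t‖ ≤ _
    rw [hQ, norm_smul, Real.norm_eq_abs, abs_of_pos (Real.exp_pos _)]
    calc _ ≤ Real.exp (-2 * M t) * (‖f‖ * ((1 / 2) * Real.exp (2 * M t))) := by gcongr
      _ = (Real.exp (-2 * M t) * Real.exp (2 * M t)) * (1 / 2 * ‖f‖) := by ring
      _ = _ := by rw [← Real.exp_add]; simp
  have hu : IsUnit (1 - Q (-2) * T * Q 2) :=
    isUnit_one_sub_of_norm_lt_one (R := C(Icc a b, V) →L[ℝ] C(Icc a b, V))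
      (x := Q (-2) * T * Q 2) (lt_of_le_of_lt hnorm (by norm_num))
  have h2 : Q 2 * Q (-2) = 1 := hQQ 2
  have h2' : Q (-2) * Q 2 = 1 := by simpa using hQQ (-2)
  have hU : IsUnit (Q 2) := ⟨⟨Q 2, Q (-2), h2, h2'⟩, rfl⟩
  have hU' : IsUnit (Q (-2)) := ⟨⟨Q (-2), Q 2, h2', h2⟩, rfl⟩
  have : 1 - T = Q 2 * (1 - Q (-2) * T * Q 2) * Q (-2) := by
    rw [mul_sub, sub_mul, mul_one, h2]
    congr 1
    calc T = (Q 2 * Q (-2)) * T * (Q 2 * Q (-2)) := by rw [h2, one_mul, mul_one]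
      _ = _ := by noncomm_ring
  rw [this]
  exact (hU.mul hu).mul hU'

/-- The superposition operator `y ↦ f (·, y(·))`. -/
def ContinuousMap.superpose {K V W : Type*} [TopologicalSpace K] [TopologicalSpace V]
    [TopologicalSpace W] (f : C(K × V, W)) (y : C(K, V)) : C(K, W) :=
  ⟨fun k => f (k, y k), by fun_prop⟩

/-- Compactness of `K` makes `f'` uniformly close to its values on the graph of `y`. The mean value
inequality on small balls, with the same radius for every `k`, turns this into a strict derivative
in the sup norm. -/
theorem ContinuousMap.hasStrictFDerivAt_superpose (f : C(K × V, W)) (f' : C(K × V, V →L[ℝ] W))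
    (hf : ∀ k y, HasFDerivAt (fun y => f (k, y)) (f' (k, y)) y) (y : C(K, V)) :
    HasStrictFDerivAt f.superpose
      (ContinuousMap.bilinLift K (ContinuousLinearMap.id ℝ (V →L[ℝ] W)) (f'.superpose y)) y := by
  rw [hasStrictFDerivAt_iff_isLittleO, Asymptotics.isLittleO_iff]
  intro ε hε
  have h1 : ∀ᶠ v in 𝓝 (0 : V), ∀ k : K, ‖f' (k, y k + v) - f' (k, y k)‖ < ε := by
    have : ∀ k ∈ (univ : Set K), ∀ᶠ p : V × K in 𝓝 (0, k),
        ‖f' (p.2, y p.2 + p.1) - f' (p.2, y p.2)‖ < ε := by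
      intro k _
      have hc : Continuous fun p : V × K => ‖f' (p.2, y p.2 + p.1) - f' (p.2, y p.2)‖ := by
        fun_prop
      exact hc.continuousAt.eventually_lt continuousAt_const (by simpa using hε)
    simpa using isCompact_univ.eventually_forall_of_forall_eventually this
  obtain ⟨δ, hδ, H⟩ := Metric.eventually_nhds_iff_ball.1 h1
  filter_upwards [prod_mem_nhds (Metric.ball_mem_nhds y hδ) (Metric.ball_mem_nhds y hδ)]
    with p hp
  refine (ContinuousMap.norm_le _ (by positivity)).2 fun k => ?_
  have hmem : ∀ q : C(K, V), q ∈ Metric.ball y δ → q k ∈ Metric.ball (y k) δ := fun q hq =>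
    lt_of_le_of_lt (ContinuousMap.dist_apply_le_dist k) hq
  have := (convex_ball (y k) δ).norm_image_sub_le_of_norm_hasFDerivWithin_le'
    (f := fun z => f (k, z)) (f' := fun z => f' (k, z)) (φ := f' (k, y k)) (C := ε)
    (fun z _ => (hf k z).hasFDerivWithinAt) (fun z hz => by
      have := H (z - y k) (by simpa [dist_eq_norm] using hz) k
      rw [add_sub_cancel] at this
      exact this.le) (hmem _ hp.2) (hmem _ hp.1)
  refine this.trans ?_
  gcongr
  exact ContinuousMap.norm_coe_le_norm (p.1 - p.2) k

/-- Induction on the order: the derivative of `y ↦ g ∘ y` is a continuous linear function of `g' ∘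
y`, and `g'` has one derivative less. The target is generalized because it becomes `V →L[ℝ] W`. -/
theorem ContinuousMap.contDiff_comp {K V : Type} [TopologicalSpace K] [CompactSpace K]
    [NormedAddCommGroup V] [NormedSpace ℝ V] (n : ℕ) :
    ∀ {W : Type} [NormedAddCommGroup W] [NormedSpace ℝ W] (g : C(V, W)), ContDiff ℝ n g →
      ContDiff ℝ n (fun y : C(K, V) => g.comp y) := by
  induction n with
  | zero =>
    intro W _ _ g _
    exact contDiff_zero.2 (ContinuousMap.continuous_postcomp g)
  | succ n ih =>
    intro W _ _ g hg
    push_cast at hg ⊢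
    have hg' := (contDiff_succ_iff_fderiv.1 hg).2.2
    let g' : C(V, V →L[ℝ] W) := ⟨fderiv ℝ g, hg'.continuous⟩
    have hd : ∀ y : C(K, V), HasFDerivAt (fun y : C(K, V) => g.comp y)
        (ContinuousMap.bilinLift K (ContinuousLinearMap.id ℝ (V →L[ℝ] W)) (g'.comp y)) y := fun y =>
      (ContinuousMap.hasStrictFDerivAt_superpose (g.comp ⟨Prod.snd, continuous_snd⟩)
        (g'.comp ⟨Prod.snd, continuous_snd⟩) (fun k y =>
          ((contDiff_succ_iff_fderiv.1 hg).1 y).hasFDerivAt) y).hasFDerivAt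
    refine contDiff_succ_iff_hasFDerivAt.2 ⟨_, ?_, hd⟩
    exact (ContinuousLinearMap.contDiff _).comp (ih g' hg')

set_option synthInstance.maxHeartbeats 200000 in
/-- Integration of controls: `(g, (c, w)) ↦ ∫ₐᵗ g(s) (c, w(s)) ds`. -/
theorem exists_controlIntegral {𝔢 : Type*} [NormedAddCommGroup 𝔢] [NormedSpace ℝ 𝔢]
    {T a b : ℝ} (ha : 0 ≤ a) (hab : a ≤ b) (hb : b ≤ T) [CompleteSpace V] :
    ∃ J : C(Icc a b, (ℝ × 𝔢) →L[ℝ] V) →L[ℝ] (ℝ × Lp 𝔢 2 (volume.restrict (Icc 0 T))) →L[ℝ]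
        C(Icc a b, V),
      ∀ g w (t : Icc a b), J g w t = ∫ s in a..(t : ℝ), g (projIcc a b hab s) (w.1, w.2 s) := by
  have hsub : Icc a b ⊆ Icc 0 T := Icc_subset_Icc ha hb
  have hw1 : ∀ w : Lp 𝔢 2 (volume.restrict (Icc 0 T)), Integrable w (volume.restrict (Icc 0 T)) :=
    fun w => (Lp.memLp w).integrable (by norm_num)
  have hwI : ∀ w : Lp 𝔢 2 (volume.restrict (Icc 0 T)), IntervalIntegrable w volume a b := fun w => by
    rw [intervalIntegrable_iff_integrableOn_Icc_of_le hab]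
    exact (hw1 w).mono_measure (Measure.restrict_mono hsub le_rfl)
  have hpI : ∀ w : ℝ × Lp 𝔢 2 (volume.restrict (Icc 0 T)),
      IntervalIntegrable (fun s => (w.1, w.2 s)) volume a b := fun w => by
    have h1 : IntervalIntegrable (fun _ : ℝ => w.1) volume a b := intervalIntegrable_const
    have h2 := hwI w.2
    rw [intervalIntegrable_iff] at h1 h2 ⊢
    exact Integrable.prodMk h1 h2
  have hgI : ∀ (g : C(Icc a b, (ℝ × 𝔢) →L[ℝ] V))
      (w : ℝ × Lp 𝔢 2 (volume.restrict (Icc 0 T))), IntervalIntegrable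
      (fun s => g (projIcc a b hab s) (w.1, w.2 s)) volume a b := fun g w =>
    ContinuousOn.intervalIntegrable_clm_apply hab (by fun_prop) (hpI w)
  have hgIt : ∀ (g : C(Icc a b, (ℝ × 𝔢) →L[ℝ] V))
      (w : ℝ × Lp 𝔢 2 (volume.restrict (Icc 0 T))) (t : Icc a b), IntervalIntegrable
      (fun s => g (projIcc a b hab s) (w.1, w.2 s)) volume a t := fun g w t =>
    (hgI g w).mono_set (by
      rw [uIcc_of_le hab, uIcc_of_le t.2.1]; exact Icc_subset_Icc_right t.2.2)
  obtain ⟨P, hP⟩ : ∃ P : C(Icc a b, (ℝ × 𝔢) →L[ℝ] V) →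
      (ℝ × Lp 𝔢 2 (volume.restrict (Icc 0 T))) → C(Icc a b, V),
      ∀ g w (t : Icc a b), P g w t = ∫ s in a..(t : ℝ), g (projIcc a b hab s) (w.1, w.2 s) := by
    refine ⟨fun g w => ⟨fun t => ∫ s in a..(t : ℝ), g (projIcc a b hab s) (w.1, w.2 s), ?_⟩,
      fun g w t => rfl⟩
    exact (IsPrimitive.continuousOn (f := fun t => ∫ s in a..t, g (projIcc a b hab s) (w.1, w.2 s))
      ⟨hgI g w, fun t _ => by simp⟩ hab).domRestrict
  have haddw : ∀ w w' : Lp 𝔢 2 (volume.restrict (Icc 0 T)), ∀ t : Icc a b,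
      ∀ᵐ s, s ∈ uIoc a (t : ℝ) → (w + w' : Lp 𝔢 2 (volume.restrict (Icc 0 T))) s = w s + w' s := by
    intro w w' t
    have := (ae_restrict_iff' measurableSet_Icc).1 (Lp.coeFn_add w w')
    filter_upwards [this] with s hs hm
    rw [uIoc_of_le t.2.1] at hm
    exact hs (hsub ⟨hm.1.le, hm.2.trans t.2.2⟩)
  have hsmulw : ∀ (c : ℝ) (w : Lp 𝔢 2 (volume.restrict (Icc 0 T))), ∀ t : Icc a b,
      ∀ᵐ s, s ∈ uIoc a (t : ℝ) → (c • w : Lp 𝔢 2 (volume.restrict (Icc 0 T))) s = c • w s := by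
    intro c w t
    have := (ae_restrict_iff' measurableSet_Icc).1 (Lp.coeFn_smul c w)
    filter_upwards [this] with s hs hm
    rw [uIoc_of_le t.2.1] at hm
    exact hs (hsub ⟨hm.1.le, hm.2.trans t.2.2⟩)
  -- On a bounded interval the `L²` norm controls the `L¹` norm, by Hölder's inequality.
  obtain ⟨C, hC0, hC⟩ : ∃ C : ℝ, 0 ≤ C ∧ ∀ w : Lp 𝔢 2 (volume.restrict (Icc 0 T)),
      ∫ s in a..b, ‖w s‖ ≤ C * ‖w‖ := by
    refine ⟨((volume.restrict (Icc 0 T)) univ ^ (1 / (1 : ENNReal).toReal - 1 / (2 : ENNReal).toReal)).toReal,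
      by positivity, fun w => ?_⟩
    have h1 := eLpNorm_le_eLpNorm_mul_rpow_measure_univ (p := 1) (q := 2) (by norm_num)
      (Lp.aestronglyMeasurable w)
    rw [Lp.norm_def, mul_comm, ← ENNReal.toReal_mul]
    calc ∫ s in a..b, ‖w s‖ ≤ ∫ s in Icc 0 T, ‖w s‖ := by
          rw [intervalIntegral.integral_of_le hab]
          exact setIntegral_mono_set (hw1 w).norm (ae_of_all _ fun _ => norm_nonneg _)
            ((Ioc_subset_Icc_self.trans hsub).eventuallyLE)
      _ = (eLpNorm w 1 (volume.restrict (Icc 0 T))).toReal := by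
          rw [integral_norm_eq_lintegral_enorm (Lp.aestronglyMeasurable w),
            eLpNorm_one_eq_lintegral_enorm]
      _ ≤ _ := by
          refine ENNReal.toReal_mono (ENNReal.mul_ne_top (Lp.eLpNorm_ne_top w) ?_) h1
          exact ENNReal.rpow_ne_top_of_nonneg (by norm_num) (measure_ne_top _ _)
  refine ⟨LinearMap.mkContinuous₂ (LinearMap.mk₂ ℝ P ?_ ?_ ?_ ?_) ((b - a) + C) ?_,
    fun g w t => hP g w t⟩
  · intro g g' w; ext t
    simp only [hP, ContinuousMap.add_apply, _root_.add_apply]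
    exact intervalIntegral.integral_add (hgIt g w t) (hgIt g' w t)
  · intro c g w; ext t
    simp only [hP, ContinuousMap.smul_apply, _root_.smul_apply]
    exact intervalIntegral.integral_smul _ _
  · intro g w w'; ext t
    simp only [hP, ContinuousMap.add_apply]
    rw [← intervalIntegral.integral_add (hgIt g w t) (hgIt g w' t)]
    refine intervalIntegral.integral_congr_ae ?_
    filter_upwards [haddw w.2 w'.2 t] with s hs hm
    rw [← map_add, Prod.snd_add, hs hm]; rfl
  · intro c g w; ext t
    simp only [hP, ContinuousMap.smul_apply]
    rw [← intervalIntegral.integral_smul]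
    refine intervalIntegral.integral_congr_ae ?_
    filter_upwards [hsmulw c w.2 t] with s hs hm
    rw [← map_smul, Prod.smul_snd, hs hm]; rfl
  · intro g w
    refine (ContinuousMap.norm_le _ (by have := sub_nonneg.2 hab; positivity)).2 fun t => ?_
    have hI2 : IntervalIntegrable (fun s => ‖g‖ * (‖w.1‖ + ‖w.2 s‖)) volume a b :=
      ((intervalIntegrable_const (c := ‖w.1‖)).add (hwI w.2).norm).const_mul _
    calc ‖P g w t‖ ≤ ∫ s in a..(t : ℝ), ‖g‖ * (‖w.1‖ + ‖w.2 s‖) := by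
          rw [hP]
          refine intervalIntegral.norm_integral_le_of_norm_le t.2.1 (ae_of_all _ fun s _ => ?_)
            (hI2.mono_set (by
              rw [uIcc_of_le hab, uIcc_of_le t.2.1]; exact Icc_subset_Icc_right t.2.2))
          refine (ContinuousLinearMap.le_opNorm _ _).trans ?_
          gcongr
          · exact g.norm_coe_le_norm _
          · exact max_le_add_of_nonneg (norm_nonneg _) (norm_nonneg _)
      _ ≤ ∫ s in a..b, ‖g‖ * (‖w.1‖ + ‖w.2 s‖) :=
          intervalIntegral.integral_mono_interval le_rfl t.2.1 t.2.2
            (ae_of_all _ fun s => by positivity) hI2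
      _ = ‖g‖ * ((b - a) * ‖w.1‖ + ∫ s in a..b, ‖w.2 s‖) := by
          rw [intervalIntegral.integral_const_mul, intervalIntegral.integral_add
            intervalIntegrable_const (hwI w.2).norm, intervalIntegral.integral_const, smul_eq_mul]
      _ ≤ ‖g‖ * ((b - a) * ‖w‖ + C * ‖w‖) := by
          have := sub_nonneg.2 hab
          gcongr
          · exact norm_fst_le w
          · exact (hC w.2).trans (by gcongr; exact norm_snd_le w)
      _ = _ := by ring

end Operators

/-! ### Controlled differential equations -/

section Flow

open Filter Topology

variable {V : Type*} [NormedAddCommGroup V] [NormedSpace ℝ V] [CompleteSpace V]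

theorem intervalIntegrable_const_prod_Lp {𝔢 : Type*} [NormedAddCommGroup 𝔢] {T a b : ℝ}
    (ha : 0 ≤ a) (hab : a ≤ b) (hb : b ≤ T) (c : ℝ) (w : Lp 𝔢 2 (volume.restrict (Icc 0 T))) :
    IntervalIntegrable (fun s => (c, w s)) volume a b := by
  have h1 : IntervalIntegrable (fun _ : ℝ => c) volume a b := intervalIntegrable_const
  have h2 : IntervalIntegrable w volume a b := by
    rw [intervalIntegrable_iff_integrableOn_Icc_of_le hab]
    exact ((Lp.memLp w).integrable (by norm_num)).mono_measure
      (Measure.restrict_mono (Icc_subset_Icc ha hb) le_rfl)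
  rw [intervalIntegrable_iff] at h1 h2 ⊢
  exact Integrable.prodMk h1 h2

/-- The map is the residual of the integral equation `y = x + J (N y) w`. Its derivative in `y` is
`h ↦ h - J (M h) c₀`, the form to which the Volterra criterion applies. -/
theorem HasStrictFDerivAt.sub_sub_bilin {X A C W : Type*}
    [NormedAddCommGroup X] [NormedSpace ℝ X] [NormedAddCommGroup A] [NormedSpace ℝ A]
    [NormedAddCommGroup C] [NormedSpace ℝ C] [NormedAddCommGroup W] [NormedSpace ℝ W]
    {N : C → A} {M : C →L[ℝ] A} {y₀ : C} (hN : HasStrictFDerivAt N M y₀)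
    (J : A →L[ℝ] W →L[ℝ] C) (cst : X →L[ℝ] C) (x₀ : X) (c₀ : W) :
    ∃ G' : (X × W) × C →L[ℝ] C,
      HasStrictFDerivAt (fun q : (X × W) × C => q.2 - cst q.1.1 - J (N q.2) q.1.2) G'
        ((x₀, c₀), y₀) ∧
      ∀ q, G' q = q.2 - cst q.1.1 - (J (M q.2) c₀ + J (N y₀) q.1.2) := by
  let u : (X × W) × C := ((x₀, c₀), y₀)
  have h1 : HasStrictFDerivAt (fun q : (X × W) × C => q.2)
      (ContinuousLinearMap.snd ℝ _ _) u := hasStrictFDerivAt_snd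
  let cst' : (X × W) × C →L[ℝ] C :=
    cst.comp ((ContinuousLinearMap.fst ℝ _ _).comp (ContinuousLinearMap.fst ℝ _ _))
  have h2 : HasStrictFDerivAt cst' cst' u := cst'.hasStrictFDerivAt
  let pr : (X × W) × C →L[ℝ] W :=
    (ContinuousLinearMap.snd ℝ _ _).comp (ContinuousLinearMap.fst ℝ _ _)
  have h3 : HasStrictFDerivAt pr pr u := pr.hasStrictFDerivAt
  have h5 : HasStrictFDerivAt (fun q : (X × W) × C => (N q.2, q.1.2))
      ((M.comp (ContinuousLinearMap.snd ℝ _ _)).prod pr) u := (hN.comp u h1).prodMk h3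
  have h4 := HasStrictFDerivAt.comp (f := fun q : (X × W) × C => (N q.2, q.1.2)) u
    (J.isBoundedBilinearMap.hasStrictFDerivAt (N y₀, c₀)) h5
  refine ⟨_, (h1.sub h2).sub h4, fun q => ?_⟩
  change q.2 - _ - (J (N y₀) q.1.2 + J (M q.2) c₀) = _
  rw [add_comm (J (N y₀) q.1.2)]
  rfl

theorem exists_comp_apply {A C W : Type*}
    [NormedAddCommGroup A] [NormedSpace ℝ A]
    [NormedAddCommGroup C] [NormedSpace ℝ C] [NormedAddCommGroup W] [NormedSpace ℝ W]
    (J : A →L[ℝ] W →L[ℝ] C) (M : C →L[ℝ] A) (c₀ : W) :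
    ∃ R : C →L[ℝ] C, ∀ h, R h = J (M h) c₀ :=
  ⟨(J.flip c₀).comp M, fun _ => rfl⟩

set_option synthInstance.maxHeartbeats 200000 in
set_option maxSynthPendingDepth 3 in
set_option maxHeartbeats 1000000 in
-- Implicit function theorem for the residual of the integral equation, with the initial value and
-- the control as parameters. The drift is carried by an additional real control, frozen at 1, so
-- that the right-hand side is linear in the controls. The derivative of the flow is described only
-- through the linearized equation that it solves.
theorem exists_strictly_differentiable_flow {𝔢 : Type*} [NormedAddCommGroup 𝔢] [NormedSpace ℝ 𝔢]
    [CompleteSpace 𝔢] {T a b : ℝ} (ha : 0 ≤ a) (hab : a ≤ b) (hb : b ≤ T)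
    {f : ℝ → V → (ℝ × 𝔢) →L[ℝ] V} {f' : ℝ → V → V →L[ℝ] (ℝ × 𝔢) →L[ℝ] V}
    (hfc : ContinuousOn (fun p : ℝ × V => f p.1 p.2) (Icc a b ×ˢ univ))
    (hfc' : ContinuousOn (fun p : ℝ × V => f' p.1 p.2) (Icc a b ×ˢ univ))
    (hd : ∀ t ∈ Icc a b, ∀ y, HasFDerivAt (f t) (f' t y) y)
    (w : Lp 𝔢 2 (volume.restrict (Icc 0 T))) {y : ℝ → V}
    (hy : IsPrimitive y (fun t => f t (y t) (1, w t)) a b) :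
    ∃ Y : V × Lp 𝔢 2 (volume.restrict (Icc 0 T)) → ℝ → V,
      (∀ t ∈ Icc a b, Y (y a, w) t = y t) ∧
      (∀ᶠ p in 𝓝 (y a, w), Y p a = p.1 ∧
        IsPrimitive (Y p) (fun t => f t (Y p t) (1, p.2 t)) a b) ∧
      (∀ δ > 0, ∀ᶠ p in 𝓝 (y a, w), ∀ t ∈ Icc a b, ‖Y p t - y t‖ < δ) ∧
      ∃ L : V × Lp 𝔢 2 (volume.restrict (Icc 0 T)) →L[ℝ] V,
        HasStrictFDerivAt (fun p => Y p b) L (y a, w) ∧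
        ∀ p, ∃ h : ℝ → V, h a = p.1 ∧ h b = L p ∧ IsPrimitive h
          (fun t => f' t (y t) (h t) (1, w t) + f t (y t) (0, p.2 t)) a b := by
  let μ := volume.restrict (Icc 0 T)
  let K := Icc a b
  let I : ℝ → K := projIcc a b hab
  have hI : ∀ t (ht : t ∈ Icc a b), I t = ⟨t, ht⟩ := fun t ht => projIcc_of_mem hab ht
  obtain ⟨J, hJ⟩ := exists_controlIntegral (𝔢 := 𝔢) (V := V) ha hab hb
  have hmem : ∀ p : K × V, ((p.1 : ℝ), p.2) ∈ Icc a b ×ˢ (univ : Set V) := fun p =>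
    ⟨p.1.2, mem_univ _⟩
  let N : C(K × V, (ℝ × 𝔢) →L[ℝ] V) := ⟨fun p => f p.1 p.2,
    hfc.comp_continuous (f := fun p : K × V => ((p.1 : ℝ), p.2)) (by fun_prop) hmem⟩
  let N' : C(K × V, V →L[ℝ] (ℝ × 𝔢) →L[ℝ] V) := ⟨fun p => f' p.1 p.2,
    hfc'.comp_continuous (f := fun p : K × V => ((p.1 : ℝ), p.2)) (by fun_prop) hmem⟩
  have hN : ∀ k y, HasFDerivAt (fun y => N (k, y)) (N' (k, y)) y := fun k y => hd k k.2 y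
  have hyc := hy.continuousOn hab
  let y₀ : C(K, V) := ⟨fun k => y k, hyc.domRestrict⟩
  let M : C(K, V) →L[ℝ] C(K, (ℝ × 𝔢) →L[ℝ] V) :=
    ContinuousMap.bilinLift (V := V →L[ℝ] (ℝ × 𝔢) →L[ℝ] V) (W := V) (Z := (ℝ × 𝔢) →L[ℝ] V) K
      (ContinuousLinearMap.id ℝ (V →L[ℝ] (ℝ × 𝔢) →L[ℝ] V))
      (N'.superpose y₀)
  have hNs : HasStrictFDerivAt N.superpose M y₀ := N.hasStrictFDerivAt_superpose N' hN y₀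
  let c₀ : ℝ × Lp 𝔢 2 μ := (1, w)
  let u : (V × (ℝ × Lp 𝔢 2 μ)) × C(K, V) := ((y a, c₀), y₀)
  let G : (V × (ℝ × Lp 𝔢 2 μ)) × C(K, V) → C(K, V) := fun q =>
    q.2 - ContinuousLinearMap.const ℝ K q.1.1 - J (N.superpose q.2) q.1.2
  obtain ⟨G', hG', hG'a⟩ := HasStrictFDerivAt.sub_sub_bilin
    (X := V) (A := C(K, (ℝ × 𝔢) →L[ℝ] V)) (C := C(K, V)) (W := ℝ × Lp 𝔢 2 μ) hNs J
    (ContinuousLinearMap.const ℝ K : V →L[ℝ] C(K, V)) (y a) c₀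
  change HasStrictFDerivAt G G' u at hG'
  obtain ⟨R, hR⟩ : ∃ R : C(K, V) →L[ℝ] C(K, V), ∀ h, R h = J (M h) c₀ :=
    exists_comp_apply (A := C(K, (ℝ × 𝔢) →L[ℝ] V)) (C := C(K, V)) (W := ℝ × Lp 𝔢 2 μ) J M c₀
  -- The operator `R` has kernel `f'(y)(·)(1, w)`, dominated by an integrable function of time
  -- because `f'` is bounded along the reference curve.
  have hRu : IsUnit (1 - R) := by
    obtain ⟨B, hB⟩ : ∃ B, ∀ s ∈ Icc a b, ‖f' s (y s)‖ ≤ B := by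
      apply IsCompact.exists_bound_of_continuousOn isCompact_Icc
      exact hfc'.comp (continuousOn_id.prodMk hyc) fun s hs => ⟨hs, mem_univ _⟩
    have hB0 : 0 ≤ B := (norm_nonneg _).trans (hB (I a) (I a).2)
    refine isUnit_one_sub_of_volterra hab R (m := fun s => B * ‖((1 : ℝ), w s)‖)
      ((intervalIntegrable_const_prod_Lp ha hab hb 1 w).norm.const_mul _)
      (fun s => by positivity) fun h t => ?_
    rw [hR, hJ]
    refine intervalIntegral.norm_integral_le_of_norm_le t.2.1 (ae_of_all _ fun s _ => ?_) ?_
    · change ‖f' (I s) (y (I s)) (h (I s)) (1, w s)‖ ≤ _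
      refine (ContinuousLinearMap.le_opNorm₂ _ _ _).trans ?_
      have : ‖f' (I s) (y (I s))‖ ≤ B := hB (I s) (I s).2
      calc _ ≤ B * ‖h (I s)‖ * ‖((1 : ℝ), w s)‖ := by gcongr
        _ = _ := by ring
    · refine (((intervalIntegrable_const_prod_Lp ha t.2.1 (t.2.2.trans hb) 1 w).norm.const_mul
        _)).mul_continuousOn ?_
      have : Continuous fun s => ‖h (I s)‖ := by
        have : Continuous I := continuous_projIcc
        fun_prop
      exact this.continuousOn
  have hinr : G' ∘L .inr ℝ (V × (ℝ × Lp 𝔢 2 μ)) (C(K, V)) = 1 - R := by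
    refine ContinuousLinearMap.ext fun h => ?_
    change G' (0, h) = h - R h
    rw [hG'a, hR]
    simp
  have hinv : (G' ∘L .inr ℝ (V × (ℝ × Lp 𝔢 2 μ)) (C(K, V))).IsInvertible := by
    rw [hinr]
    obtain ⟨U, hU⟩ := hRu
    refine ContinuousLinearMap.IsInvertible.of_inverse (g := (↑U⁻¹ : C(K, V) →L[ℝ] C(K, V))) ?_ ?_
    · rw [← hU]; exact U.mul_inv
    · rw [← hU]; exact U.inv_mul
  set ψ := hG'.implicitFunctionOfProdDomain hinv with hψ
  have hψd := hG'.hasStrictFDerivAt_implicitFunctionOfProdDomain hinv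
  have hψe := hG'.eventually_apply_implicitFunctionOfProdDomain hinv
  have hψ0 : ψ u.1 = y₀ :=
    (hG'.eventually_apply_eq_iff_implicitFunctionOfProdDomain hinv).self_of_nhds.1 rfl
  have hu0 : G u = 0 := by
    ext k
    change y k - y a - J (N.superpose y₀) c₀ k = 0
    rw [hJ, hy.eq k k.2, add_sub_cancel_left, sub_eq_zero]
    refine intervalIntegral.integral_congr fun s hs => ?_
    rw [uIcc_of_le k.2.1] at hs
    have hs' : s ∈ Icc a b := ⟨hs.1, hs.2.trans k.2.2⟩
    change f s (y s) (1, w s) = N.superpose y₀ (I s) (1, w s)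
    rw [hI s hs']; rfl
  -- The derivative of the implicit function; `hD` says that it parametrizes the kernel of `G'`,
  -- that is, the solutions of the linearized integral equation.
  let D := -(G' ∘L .inr ℝ (V × (ℝ × Lp 𝔢 2 μ)) (C(K, V))).inverse ∘L
    (G' ∘L .inl ℝ (V × (ℝ × Lp 𝔢 2 μ)) (C(K, V)))
  have hD : ∀ q, G' (q, D q) = 0 := by
    intro q
    have h1 : (G' ∘L .inr ℝ (V × (ℝ × Lp 𝔢 2 μ)) (C(K, V))) (D q) = - G' (q, 0) := by
      change (G' ∘L .inr ℝ _ _) (-((G' ∘L .inr ℝ _ _).inverse (G' (q, 0)))) = _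
      rw [map_neg, hinv.self_apply_inverse]
    have h2 : (q, D q) = (q, 0) + (0, D q) := by simp
    rw [h2, map_add]
    change _ + (G' ∘L .inr ℝ (V × (ℝ × Lp 𝔢 2 μ)) (C(K, V))) (D q) = 0
    rw [h1, add_neg_cancel]
  -- The real control is set to 1, so its variation is 0. This is why the drift occurs with
  -- coefficient 1 in the equation and 0 in the source term of its linearization.
  let j : V × Lp 𝔢 2 μ → V × (ℝ × Lp 𝔢 2 μ) := fun p => (p.1, (1, p.2))
  let j' : V × Lp 𝔢 2 μ →L[ℝ] V × (ℝ × Lp 𝔢 2 μ) :=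
    (ContinuousLinearMap.fst ℝ _ _).prod
      ((0 : V × Lp 𝔢 2 μ →L[ℝ] ℝ).prod (ContinuousLinearMap.snd ℝ _ _))
  have hj : HasStrictFDerivAt j j' (y a, w) :=
    hasStrictFDerivAt_fst.prodMk ((hasStrictFDerivAt_const _ _).prodMk hasStrictFDerivAt_snd)
  have hψj : HasStrictFDerivAt (ψ ∘ j) (D.comp j') (y a, w) := HasStrictFDerivAt.comp (f := j) (y a, w) hψd hj
  -- from fixed points to primitives
  have hprim : ∀ q : V × (ℝ × Lp 𝔢 2 μ), ∀ z : C(K, V), ∀ g : C(K, (ℝ × 𝔢) →L[ℝ] V),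
      ∀ t ∈ Icc a b, J g q.2 (I t) = ∫ s in a..t, g (I s) (q.2.1, q.2.2 s) := by
    intro q z g t ht
    rw [hJ, hI t ht]
  have hIa : I a = ⟨a, le_refl _, hab⟩ := hI a ⟨le_refl _, hab⟩
  have hgint : ∀ (g : C(K, (ℝ × 𝔢) →L[ℝ] V)) (c : ℝ × Lp 𝔢 2 μ),
      IntervalIntegrable (fun s => g (I s) (c.1, c.2 s)) volume a b := fun g c =>
    ContinuousOn.intervalIntegrable_clm_apply hab (by
      have : Continuous I := continuous_projIcc
      fun_prop) (intervalIntegrable_const_prod_Lp ha hab hb c.1 c.2)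
  refine ⟨fun p t => ψ (j p) (I t), ?_, ?_, ?_, ?_⟩
  · intro t ht
    change ψ u.1 (I t) = _
    rw [hψ0, hI t ht]; rfl
  · have hψe' : ∀ᶠ p in 𝓝 (y a, w), G (j p, ψ (j p)) = 0 := by
      have := hj.continuousAt.eventually hψe
      rw [hu0] at this
      exact this
    filter_upwards [hψe'] with p hp
    have hp' : ∀ k : K, ψ (j p) k = p.1 + J (N.superpose (ψ (j p))) (1, p.2) k := by
      intro k
      have := congrArg (fun z : C(K, V) => z k) hp
      change ψ (j p) k - p.1 - J (N.superpose (ψ (j p))) (1, p.2) k = 0 at this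
      rw [sub_sub, sub_eq_zero] at this
      exact this
    have hpa : ψ (j p) (I a) = p.1 := by
      rw [hp', hJ, hIa]; simp
    have hP : IsPrimitive (fun t => ψ (j p) (I t))
        (fun s => N.superpose (ψ (j p)) (I s) (1, p.2 s)) a b := by
      refine ⟨hgint _ (1, p.2), fun t ht => ?_⟩
      rw [hpa, hp', hprim (p.1, (1, p.2)) (ψ (j p)) _ t ht]
    refine ⟨hpa, hP.congr hab (fun _ _ => rfl) (ae_of_all _ fun t ht => ?_)⟩
    change _ = f (I t) (ψ (j p) (I t)) (1, p.2 t)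
    rw [hI t ht]
  · intro δ hδ
    have hc : ContinuousAt (ψ ∘ j) (y a, w) := hψj.continuousAt
    have := hc.eventually (Metric.ball_mem_nhds _ hδ)
    filter_upwards [this] with p hp t ht
    have h1 : dist (ψ (j p) (I t)) (y₀ (I t)) < δ := by
      refine lt_of_le_of_lt (ContinuousMap.dist_apply_le_dist (I t)) ?_
      rw [← hψ0]; exact hp
    rw [dist_eq_norm] at h1
    rw [hI t ht] at h1 ⊢
    exact h1
  · refine ⟨(ContinuousMap.evalCLM ℝ (I b)).comp (D.comp j'), ?_, fun p => ?_⟩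
    · exact (ContinuousMap.evalCLM ℝ (I b)).hasStrictFDerivAt.comp _ hψj
    · set h : C(K, V) := D (j' p) with hh
      have h0 := hD (j' p)
      rw [hG'a] at h0
      have hp' : ∀ k : K, h k = p.1 + (J (M h) c₀ k + J (N.superpose y₀) (0, p.2) k) := by
        intro k
        have := congrArg (fun z : C(K, V) => z k) h0
        change h k - p.1 - (J (M h) c₀ k + J (N.superpose y₀) (0, p.2) k) = 0 at this
        rw [sub_sub, sub_eq_zero] at this
        exact this
      have hpa : h (I a) = p.1 := by
        rw [hp', hJ, hJ, hIa]; simp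
      have hP : IsPrimitive (fun t => h (I t))
          (fun s => M h (I s) (1, w s) + N.superpose y₀ (I s) (0, p.2 s)) a b := by
        refine ⟨(hgint (M h) (1, w)).add (hgint _ (0, p.2)), fun t ht => ?_⟩
        have ht' : Icc a t ⊆ Icc a b := Icc_subset_Icc_right ht.2
        rw [hpa, hp', hprim (p.1, c₀) h _ t ht, hprim (p.1, (0, p.2)) h _ t ht,
          intervalIntegral.integral_add]
        · exact (hgint (M h) (1, w)).mono_set (by rwa [uIcc_of_le hab, uIcc_of_le ht.1])
        · exact (hgint _ (0, p.2)).mono_set (by rwa [uIcc_of_le hab, uIcc_of_le ht.1])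
      refine ⟨fun t => h (I t), hpa, rfl, hP.congr hab (fun _ _ => rfl)
        (ae_of_all _ fun t ht => ?_)⟩
      change _ = f' (I t) (y (I t)) (h (I t)) (1, w t) + f (I t) (y (I t)) (0, p.2 t)
      rw [hI t ht]
      change f' t (y t) (h (I t)) (1, w t) + _ = f' t (y t) (h ⟨t, ht⟩) (1, w t) + f t (y t) (0, p.2 t)
      rw [hI t ht]

/-- Existence for linear equations with integrable coefficients. -/
theorem exists_isPrimitive_linear {a b : ℝ} (hab : a ≤ b) {A : ℝ → V →L[ℝ] V}
    (hA : IntervalIntegrable A volume a b) (v : V) :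
    ∃ f : ℝ → V, f a = v ∧ IsPrimitive f (fun t => A t (f t)) a b := by
  let K := Icc a b
  let I : ℝ → K := projIcc a b hab
  have hIc : Continuous I := continuous_projIcc
  have hI : ∀ t (ht : t ∈ Icc a b), I t = ⟨t, ht⟩ := fun t ht => projIcc_of_mem hab ht
  have hint : ∀ h : C(K, V), IntervalIntegrable (fun s => A s (h (I s))) volume a b := by
    intro h
    have := ContinuousOn.intervalIntegrable_clm_apply hab
      (A := fun s => ContinuousLinearMap.apply ℝ V (h (I s))) (W := V)
      (by fun_prop) hA
    simpa using this
  have hsub : ∀ t : K, uIcc a (t : ℝ) ⊆ uIcc a b := fun t => by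
    rw [uIcc_of_le hab, uIcc_of_le t.2.1]; exact Icc_subset_Icc_right t.2.2
  have hle : ∀ (h : C(K, V)) (t : K), ‖∫ s in a..(t : ℝ), A s (h (I s))‖ ≤
      ∫ s in a..(t : ℝ), ‖A s‖ * ‖h (I s)‖ := fun h t =>
    intervalIntegral.norm_integral_le_of_norm_le t.2.1
      (ae_of_all _ fun s _ => (A s).le_opNorm _)
      ((hA.mono_set (hsub t)).norm.mul_continuousOn (by fun_prop))
  obtain ⟨R, hR⟩ : ∃ R : C(K, V) →L[ℝ] C(K, V), ∀ h t, R h t = ∫ s in a..(t : ℝ), A s (h (I s)) := by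
    refine ⟨LinearMap.mkContinuous
      { toFun := fun h => ⟨fun t : K => ∫ s in a..(t : ℝ), A s (h (I s)),
          (IsPrimitive.continuousOn (f := fun t => ∫ s in a..t, A s (h (I s)))
            ⟨hint h, fun t _ => by simp⟩ hab).domRestrict⟩
        map_add' := fun h h' => ?_
        map_smul' := fun c h => ?_ } (∫ s in a..b, ‖A s‖) fun h => ?_, fun h t => rfl⟩
    · ext t
      change ∫ s in a..(t : ℝ), A s (h (I s) + h' (I s)) = _ + _
      simp only [map_add]
      exact intervalIntegral.integral_add ((hint h).mono_set (hsub t)) ((hint h').mono_set (hsub t))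
    · ext t
      change ∫ s in a..(t : ℝ), A s (c • h (I s)) = c • _
      simp only [map_smul]
      exact intervalIntegral.integral_smul _ _
    · have h0 : 0 ≤ ∫ s in a..b, ‖A s‖ :=
        intervalIntegral.integral_nonneg hab fun _ _ => norm_nonneg _
      refine (ContinuousMap.norm_le _ (by positivity)).2 fun t => (hle h t).trans ?_
      calc _ ≤ ∫ s in a..(t : ℝ), ‖A s‖ * ‖h‖ := by
            refine intervalIntegral.integral_mono_on t.2.1
              ((hA.mono_set (hsub t)).norm.mul_continuousOn (by fun_prop))
              ((hA.mono_set (hsub t)).norm.mul_const _) fun s _ => ?_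
            exact mul_le_mul_of_nonneg_left (h.norm_coe_le_norm _) (norm_nonneg _)
        _ ≤ ∫ s in a..b, ‖A s‖ * ‖h‖ := intervalIntegral.integral_mono_interval le_rfl t.2.1 t.2.2
            (ae_of_all _ fun _ => by positivity) (hA.norm.mul_const _)
        _ = _ := intervalIntegral.integral_mul_const _ _
  obtain ⟨U, hU⟩ := isUnit_one_sub_of_volterra hab R hA.norm (fun _ => norm_nonneg _)
    fun h t => by rw [hR]; exact hle h t
  set h : C(K, V) := (↑U⁻¹ : C(K, V) →L[ℝ] C(K, V)) (ContinuousLinearMap.const ℝ K v) with hh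
  have h1 : h - R h = ContinuousLinearMap.const ℝ K v := by
    have : (↑U : C(K, V) →L[ℝ] C(K, V)) h = ContinuousLinearMap.const ℝ K v :=
      congrArg (fun T : C(K, V) →L[ℝ] C(K, V) => T (ContinuousLinearMap.const ℝ K v)) U.mul_inv
    rw [hU] at this
    exact this
  have h2 : ∀ k : K, h k = v + ∫ s in a..(k : ℝ), A s (h (I s)) := by
    intro k
    have := congrArg (fun z : C(K, V) => z k) h1
    change h k - R h k = v at this
    rw [hR] at this
    rw [← this]; abel
  have h3 : h (I a) = v := by
    rw [h2, hI a ⟨le_refl _, hab⟩]; simp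
  refine ⟨fun t => h (I t), h3, hint h, fun t ht => ?_⟩
  rw [h3, h2, hI t ht]

omit [CompleteSpace V] in
theorem IsPrimitive.comp_reflect {f g : ℝ → V} {a b : ℝ} (hab : a ≤ b) (h : IsPrimitive f g a b) :
    IsPrimitive (fun t => f (a + b - t)) (fun t => - g (a + b - t)) a b := by
  have hb : b ∈ Icc a b := ⟨hab, le_refl _⟩
  refine ⟨?_, fun t ht => ?_⟩
  · have := (h.integrable.comp_sub_left (a + b)).symm
    rw [add_sub_cancel_left, add_sub_cancel_right] at this
    exact this.neg
  · have ht' : a + b - t ∈ Icc a b := ⟨by linarith [ht.2], by linarith [ht.1]⟩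
    have h1 := h.sub_eq hb ht'
    rw [intervalIntegral.integral_neg, intervalIntegral.integral_comp_sub_left (fun s => g s),
      add_sub_cancel_left, ← intervalIntegral.integral_symm, ← h1]
    abel

/-- The adjoint equation comes with a final value; time reversal reduces it to an initial value
problem. -/
theorem exists_isPrimitive_linear_backward {a b : ℝ} (hab : a ≤ b) {A : ℝ → V →L[ℝ] V}
    (hA : IntervalIntegrable A volume a b) (v : V) :
    ∃ f : ℝ → V, f b = v ∧ IsPrimitive f (fun t => A t (f t)) a b := by
  have hA' : IntervalIntegrable (fun t => - A (a + b - t)) volume a b :=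
    (IsPrimitive.comp_reflect hab
      (f := fun t => ∫ s in a..t, A s) ⟨hA, fun t _ => by simp⟩).integrable
  obtain ⟨f, hf, hf'⟩ := exists_isPrimitive_linear hab hA' v
  refine ⟨fun t => f (a + b - t), by simpa using hf, ?_⟩
  refine (hf'.comp_reflect hab).congr hab (fun _ _ => rfl) (ae_of_all _ fun t _ => ?_)
  simp

end Flow

/-! ### Coordinates on the tangent bundle -/

section Coordinates

open Filter Topology

variable {d : ℕ} {M : Type*} [TopologicalSpace M] [ChartedSpace (EuclideanSpace ℝ (Fin d)) M]
  [IsManifold (𝓡 d) ∞ M]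

/-- The model vector space. -/
abbrev ModelSpace (d : ℕ) := EuclideanSpace ℝ (Fin d)

/-- The components of a tangent vector at `x` in the preferred chart at `q`. -/
noncomputable def toCoord (d : ℕ) {M : Type*} [TopologicalSpace M]
    [ChartedSpace (EuclideanSpace ℝ (Fin d)) M] [IsManifold (𝓡 d) ∞ M] (q x : M) : TangentSpace (𝓡 d) x →L[ℝ] ModelSpace d :=
  tangentCoordChange (𝓡 d) x q x

/-- The tangent vector at `x` with given components in the preferred chart at `q`. -/
noncomputable def ofCoord (d : ℕ) {M : Type*} [TopologicalSpace M]
    [ChartedSpace (EuclideanSpace ℝ (Fin d)) M] [IsManifold (𝓡 d) ∞ M] (q x : M) : ModelSpace d →L[ℝ] TangentSpace (𝓡 d) x :=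
  tangentCoordChange (𝓡 d) q x x

/-- The coordinate map of the preferred chart at `q`. -/
noncomputable abbrev coord (d : ℕ) {M : Type*} [TopologicalSpace M]
    [ChartedSpace (EuclideanSpace ℝ (Fin d)) M] (q : M) : PartialEquiv M (ModelSpace d) := extChartAt (𝓡 d) q

theorem toCoord_self (x : M) (v : TangentSpace (𝓡 d) x) : toCoord d x x v = v :=
  tangentCoordChange_self (I := 𝓡 d) (E := ModelSpace d) (mem_extChartAt_source x)

theorem ofCoord_self (x : M) (v : ModelSpace d) : ofCoord d x x v = v :=
  tangentCoordChange_self (I := 𝓡 d) (E := ModelSpace d) (mem_extChartAt_source x)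

theorem toCoord_ofCoord {q x : M} (hx : x ∈ (coord d q).source) (v : ModelSpace d) :
    toCoord d q x (ofCoord d q x v) = v := by
  refine (tangentCoordChange_comp (I := 𝓡 d) (E := ModelSpace d) ⟨⟨hx, mem_extChartAt_source x⟩, hx⟩).trans ?_
  exact tangentCoordChange_self (I := 𝓡 d) hx

theorem ofCoord_toCoord {q x : M} (hx : x ∈ (coord d q).source) (v : TangentSpace (𝓡 d) x) :
    ofCoord d q x (toCoord d q x v) = v := by
  refine (tangentCoordChange_comp (I := 𝓡 d) (E := ModelSpace d) ⟨⟨mem_extChartAt_source x, hx⟩, mem_extChartAt_source x⟩).trans ?_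
  exact tangentCoordChange_self (I := 𝓡 d) (E := ModelSpace d) (mem_extChartAt_source x)

theorem trivializationAt_symm_eq_ofCoord {q x : M} (hx : x ∈ (coord d q).source) (k : ModelSpace d) :
    (trivializationAt (ModelSpace d) (TangentSpace (𝓡 d) : M → Type _) q).symm x k =
      ofCoord d q x k := by
  have hx' : x ∈ (trivializationAt (ModelSpace d) (TangentSpace (𝓡 d) : M → Type _) q).baseSet := by
    rwa [TangentBundle.trivializationAt_baseSet, ← extChartAt_source (𝓡 d)]
  have h1 := TangentBundle.symmL_trivializationAt_eq_core (I := 𝓡 d) (b₀ := q) (b := x)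
    (by rwa [← extChartAt_source (𝓡 d)])
  have h2 := congrArg (fun A : ModelSpace d →L[ℝ] TangentSpace (𝓡 d) x => A k) h1
  rwa [Trivialization.symmL_apply _ hx'] at h2

theorem hasMFDerivAt_coord {q x : M} (hx : x ∈ (coord d q).source) :
    HasMFDerivAt (𝓡 d) 𝓘(ℝ, ModelSpace d) (coord d q) x (toCoord d q x) := by
  have h1 : MDifferentiableAt (𝓡 d) 𝓘(ℝ, ModelSpace d) (coord d q) x :=
    mdifferentiableAt_extChartAt (by rwa [← extChartAt_source (𝓡 d)])
  have h2 := TangentBundle.continuousLinearMapAt_trivializationAt (I := 𝓡 d) (x₀ := q) (x := x)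
    (by rwa [← extChartAt_source (𝓡 d)])
  have h3 := TangentBundle.continuousLinearMapAt_trivializationAt_eq_core (I := 𝓡 d) (b₀ := q)
    (b := x) (by rwa [← extChartAt_source (𝓡 d)])
  have h4 : toCoord d q x = mfderiv (𝓡 d) 𝓘(ℝ, ModelSpace d) (coord d q) x := h3.symm.trans h2
  rw [h4]
  exact h1.hasMFDerivAt

theorem isOpen_coord_source (q : M) : IsOpen (coord d q).source := isOpen_extChartAt_source q

theorem isOpen_coord_target (q : M) : IsOpen (coord d q).target := isOpen_extChartAt_target q


/-- The transition map from the chart at `q` to the chart at `r`. -/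
noncomputable def transition (d : ℕ) {M : Type*} [TopologicalSpace M]
    [ChartedSpace (EuclideanSpace ℝ (Fin d)) M] (q r : M) : ModelSpace d → ModelSpace d :=
  coord d r ∘ (coord d q).symm

/-- The part of the target of the chart at `q` on which the transition to the chart at `r` is
defined. -/
def transitionSource (d : ℕ) {M : Type*} [TopologicalSpace M]
    [ChartedSpace (EuclideanSpace ℝ (Fin d)) M] (q r : M) : Set (ModelSpace d) :=
  (coord d q).target ∩ (coord d q).symm ⁻¹' (coord d r).source

theorem mem_transitionSource {q r x : M} (hq : x ∈ (coord d q).source)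
    (hr : x ∈ (coord d r).source) : coord d q x ∈ transitionSource d q r := by
  refine ⟨(coord d q).map_source hq, ?_⟩
  rw [mem_preimage, (coord d q).left_inv hq]
  exact hr

theorem isOpen_transitionSource (q r : M) : IsOpen (transitionSource d q r) := by
  exact (continuousOn_extChartAt_symm q).isOpen_inter_preimage (isOpen_coord_target q)
    (isOpen_coord_source r)

theorem contDiffOn_transition (q r : M) :
    ContDiffOn ℝ ∞ (transition d q r) (transitionSource d q r) := by
  have := contDiffOn_ext_coord_change (I := 𝓡 d) (n := ∞) r q
  exact this

theorem transition_coord {q r x : M} (hq : x ∈ (coord d q).source) :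
    transition d q r (coord d q x) = coord d r x := by
  simp only [transition, Function.comp, (coord d q).left_inv hq]

theorem toCoord_eq_fderiv_transition {q r x : M} (hq : x ∈ (coord d q).source)
    (hr : x ∈ (coord d r).source) (v : TangentSpace (𝓡 d) x) :
    toCoord d r x v = fderiv ℝ (transition d q r) (coord d q x) (toCoord d q x v) := by
  have h1 := hasFDerivWithinAt_tangentCoordChange (I := 𝓡 d) (x := q) (y := r) (z := x) ⟨hq, hr⟩
  rw [ModelWithCorners.range_eq_univ, hasFDerivWithinAt_univ] at h1
  have h2 : fderiv ℝ (transition d q r) (coord d q x) = tangentCoordChange (𝓡 d) q r x := h1.fderiv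
  rw [h2]
  exact (tangentCoordChange_comp (I := 𝓡 d) (E := ModelSpace d)
    ⟨⟨mem_extChartAt_source x, hq⟩, hr⟩).symm

/-- The components in the chart at `q` of a vector field, as a function of the coordinates. -/
noncomputable def components (q : M) (V : (x : M) → TangentSpace (𝓡 d) x) :
    ModelSpace d → ModelSpace d :=
  fun y => toCoord d q ((coord d q).symm y) (V ((coord d q).symm y))

theorem components_coord {q x : M} (hx : x ∈ (coord d q).source)
    (V : (x : M) → TangentSpace (𝓡 d) x) : components q V (coord d q x) = toCoord d q x (V x) := by
  simp only [components]
  rw [(coord d q).left_inv hx]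

theorem mdifferentiableAt_iff_coord {q x : M} (hx : x ∈ (coord d q).source)
    {F : Type*} [NormedAddCommGroup F] [NormedSpace ℝ F] {f : M → F} :
    MDifferentiableAt (𝓡 d) 𝓘(ℝ, F) f x ↔
      DifferentiableAt ℝ (f ∘ (coord d q).symm) (coord d q x) := by
  have hy : coord d q x ∈ (coord d q).target := (coord d q).map_source hx
  have h1 : MDifferentiableAt 𝓘(ℝ, ModelSpace d) (𝓡 d) (coord d q).symm (coord d q x) :=
    ((contMDiffOn_extChartAt_symm (n := 1) q).contMDiffAt
      ((isOpen_coord_target q).mem_nhds hy)).mdifferentiableAt one_ne_zero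
  rw [← mdifferentiableAt_iff_differentiableAt]
  constructor
  · intro h
    refine MDifferentiableAt.comp (coord d q x) ?_ h1
    rwa [(coord d q).left_inv hx]
  · intro h
    refine (MDifferentiableAt.comp x h (hasMFDerivAt_coord hx).mdifferentiableAt).congr_of_eventuallyEq
      ?_
    filter_upwards [(isOpen_coord_source q).mem_nhds hx] with z hz
    simp only [Function.comp, (coord d q).left_inv hz]

theorem mdifferentiableAt_section_iff_components {q x : M} (hx : x ∈ (coord d q).source)
    {V : (x : M) → TangentSpace (𝓡 d) x} :
    MDifferentiableAt (𝓡 d) ((𝓡 d).prod 𝓘(ℝ, ModelSpace d))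
      (fun x => TotalSpace.mk' (ModelSpace d) x (V x)) x ↔ DifferentiableAt ℝ (components q V) (coord d q x) := by
  have hx' : x ∈ (trivializationAt (ModelSpace d) (TangentSpace (𝓡 d) : M → Type _) q).baseSet := by
    rwa [TangentBundle.trivializationAt_baseSet, ← extChartAt_source (𝓡 d)]
  rw [Trivialization.mdifferentiableAt_section_iff (IB := 𝓡 d)
    (trivializationAt (ModelSpace d) (TangentSpace (𝓡 d) : M → Type _) q) V hx',
    mdifferentiableAt_iff_coord hx]
  rfl

end Coordinates

/-! ### Christoffel symbols -/

section Christoffel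

open Filter Topology

variable {d : ℕ} {M : Type*} [TopologicalSpace M] [ChartedSpace (EuclideanSpace ℝ (Fin d)) M]
  [IsManifold (𝓡 d) ∞ M] (cov : AffineConnection d M)

/-- Differentiability of a vector field at a point. -/
def VectorFieldDifferentiableAt (V : (x : M) → TangentSpace (𝓡 d) x) (x : M) : Prop :=
  MDifferentiableAt (𝓡 d) ((𝓡 d).prod 𝓘(ℝ, ModelSpace d))
      (fun x => TotalSpace.mk' (ModelSpace d) x (V x)) x

/-- The vector field with constant components `k` in the chart at `q`. -/
noncomputable def constField (d : ℕ) {M : Type*} [TopologicalSpace M]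
    [ChartedSpace (EuclideanSpace ℝ (Fin d)) M] [IsManifold (𝓡 d) ∞ M] (q : M) (k : ModelSpace d)
    (x : M) : TangentSpace (𝓡 d) x :=
  ofCoord d q x k

theorem components_constField {q : M} {y : ModelSpace d} (hy : y ∈ (coord d q).target)
    (k : ModelSpace d) : components q (constField d q k) y = k :=
  toCoord_ofCoord ((coord d q).map_target hy) k

theorem coord_target_mem_nhds {q x : M} (hx : x ∈ (coord d q).source) :
    (coord d q).target ∈ 𝓝 (coord d q x) :=
  (isOpen_coord_target q).mem_nhds ((coord d q).map_source hx)

theorem coord_source_mem_nhds {q x : M} (hx : x ∈ (coord d q).source) :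
    (coord d q).source ∈ 𝓝 x :=
  (isOpen_coord_source q).mem_nhds hx

theorem vectorFieldDifferentiableAt_constField {q x : M} (hx : x ∈ (coord d q).source)
    (k : ModelSpace d) : VectorFieldDifferentiableAt (constField d q k) x := by
  refine (mdifferentiableAt_section_iff_components hx).2 ?_
  refine (differentiableAt_const k).congr_of_eventuallyEq ?_
  filter_upwards [coord_target_mem_nhds hx] with y hy
  exact components_constField hy k

theorem euclideanSpace_eq_sum_single (k : ModelSpace d) :
    k = ∑ i, k i • EuclideanSpace.single i (1 : ℝ) := by
  ext j
  simp [Pi.single_apply]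

theorem AffineConnection.sum {ι : Type*} (s : Finset ι)
    (V : ι → (x : M) → TangentSpace (𝓡 d) x) {x : M}
    (hV : ∀ i ∈ s, VectorFieldDifferentiableAt (V i) x) :
    VectorFieldDifferentiableAt (∑ i ∈ s, V i) x ∧
      cov (∑ i ∈ s, V i) x = ∑ i ∈ s, cov (V i) x := by
  classical
  induction s using Finset.induction_on with
  | empty =>
    simp only [Finset.sum_empty]
    exact ⟨mdifferentiableAt_zeroSection (𝕜 := ℝ) (F := ModelSpace d)
      (E := (TangentSpace (𝓡 d) : M → Type _)), by rw [CovariantDerivative.zero]; rfl⟩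
  | insert a s ha ih =>
    obtain ⟨h1, h2⟩ := ih fun i hi => hV i (Finset.mem_insert_of_mem hi)
    have h3 := hV a (Finset.mem_insert_self a s)
    rw [Finset.sum_insert ha, Finset.sum_insert ha, ← h2]
    exact ⟨mdifferentiableAt_add_section h3 h1,
      cov.isCovariantDerivativeOnUniv.add h3 h1⟩

theorem mvfderiv_apply_eq_fderiv {q x : M} (hx : x ∈ (coord d q).source) {g : M → ℝ}
    (hg : MDifferentiableAt (𝓡 d) 𝓘(ℝ, ℝ) g x) (v : TangentSpace (𝓡 d) x) :
    mvfderiv (𝓡 d) g x v = fderiv ℝ (g ∘ (coord d q).symm) (coord d q x) (toCoord d q x v) := by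
  have h1 := ((mdifferentiableAt_iff_coord hx).1 hg).hasFDerivAt
  have h2 : HasMFDerivAt (𝓡 d) 𝓘(ℝ, ℝ) ((g ∘ (coord d q).symm) ∘ coord d q) x _ :=
    HasMFDerivAt.comp x h1.hasMFDerivAt (hasMFDerivAt_coord hx)
  have h3 : HasMFDerivAt (𝓡 d) 𝓘(ℝ, ℝ) g x _ := h2.congr_of_eventuallyEq (by
    filter_upwards [coord_source_mem_nhds hx] with z hz
    simp only [Function.comp, (coord d q).left_inv hz])
  have h4 := h3.mfderiv
  have h5 : mvfderiv (𝓡 d) g x v = mfderiv (𝓡 d) 𝓘(ℝ, ℝ) g x v := rfl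
  rw [h5, h4]
  rfl

/-- The Christoffel symbols of a connection in the chart at `q`. -/
noncomputable def christoffel (q : M) (y : ModelSpace d) :
    ModelSpace d →L[ℝ] ModelSpace d →L[ℝ] ModelSpace d :=
  ∑ i : Fin d, (ContinuousLinearMap.smulRightL ℝ (ModelSpace d) (ModelSpace d)
    (EuclideanSpace.proj i)).comp
      ((toCoord d q ((coord d q).symm y)).comp ((cov (constField d q (EuclideanSpace.single i 1))
        ((coord d q).symm y)).comp (ofCoord d q ((coord d q).symm y))))

theorem christoffel_coord {q x : M} (hx : x ∈ (coord d q).source) (v : TangentSpace (𝓡 d) x)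
    (k : ModelSpace d) :
    christoffel cov q (coord d q x) (toCoord d q x v) k =
      ∑ i, k i • toCoord d q x (cov (constField d q (EuclideanSpace.single i 1)) x v) := by
  simp only [christoffel]
  rw [(coord d q).left_inv hx, _root_.sum_apply, _root_.sum_apply]
  refine Finset.sum_congr rfl fun i _ => ?_
  change k i • toCoord d q x (cov _ x (ofCoord d q x (toCoord d q x v))) = _
  rw [ofCoord_toCoord hx]

/-- The covariant derivative in coordinates. -/
theorem toCoord_cov {q x : M} (hx : x ∈ (coord d q).source)
    {V : (x : M) → TangentSpace (𝓡 d) x}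
    (hV : DifferentiableAt ℝ (components q V) (coord d q x)) (v : TangentSpace (𝓡 d) x) :
    toCoord d q x (cov V x v) = fderiv ℝ (components q V) (coord d q x) (toCoord d q x v)
      + christoffel cov q (coord d q x) (toCoord d q x v) (toCoord d q x (V x)) := by
  let g : Fin d → M → ℝ := fun i z => toCoord d q z (V z) i
  let W : Fin d → (x : M) → TangentSpace (𝓡 d) x := fun i =>
    g i • constField d q (EuclideanSpace.single i 1)
  have hgc : ∀ i, g i ∘ (coord d q).symm = fun y => components q V y i := fun i => rfl
  have hgd : ∀ i, HasFDerivAt (g i ∘ (coord d q).symm)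
      ((EuclideanSpace.proj i).comp (fderiv ℝ (components q V) (coord d q x))) (coord d q x) := by
    intro i
    rw [hgc]
    exact (EuclideanSpace.proj i : ModelSpace d →L[ℝ] ℝ).hasFDerivAt.comp _ hV.hasFDerivAt
  have hg : ∀ i, MDifferentiableAt (𝓡 d) 𝓘(ℝ, ℝ) (g i) x := fun i =>
    (mdifferentiableAt_iff_coord hx).2 (hgd i).differentiableAt
  have hc := fun i => vectorFieldDifferentiableAt_constField hx
    (EuclideanSpace.single i (1 : ℝ))
  have hW : ∀ i ∈ Finset.univ, VectorFieldDifferentiableAt (W i) x := fun i _ =>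
    (hg i).smul_section (hc i)
  obtain ⟨h1, h2⟩ := AffineConnection.sum cov Finset.univ W hW
  -- Locality allows `V` to be replaced by its expansion in coordinate fields; additivity and the
  -- Leibniz rule then give the formula.
  have hVW : ∀ᶠ z in 𝓝 x, V z = (∑ i, W i) z := by
    filter_upwards [coord_source_mem_nhds hx] with z hz
    have h3 : toCoord d q z (V z) = ∑ i, toCoord d q z (V z) i • EuclideanSpace.single i (1 : ℝ) :=
      euclideanSpace_eq_sum_single _
    have h4 := congrArg (ofCoord d q z) h3
    rw [ofCoord_toCoord hz, map_sum] at h4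
    rw [h4, Finset.sum_apply]
    refine Finset.sum_congr rfl fun i _ => ?_
    rw [map_smul]; rfl
  have hV' : VectorFieldDifferentiableAt V x := (mdifferentiableAt_section_iff_components hx).2 hV
  have h3 : cov V x = ∑ i, cov (W i) x :=
    (cov.isCovariantDerivativeOnUniv.congr_of_eventuallyEq hV' h1 univ_mem hVW).trans h2
  rw [h3, christoffel_coord cov hx, _root_.sum_apply, map_sum]
  have h4 : fderiv ℝ (components q V) (coord d q x) (toCoord d q x v) =
      ∑ i, (fderiv ℝ (components q V) (coord d q x) (toCoord d q x v)) i •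
        EuclideanSpace.single i (1 : ℝ) := euclideanSpace_eq_sum_single _
  rw [h4, ← Finset.sum_add_distrib]
  refine Finset.sum_congr rfl fun i _ => ?_
  have h5 : cov (W i) x = _ := cov.isCovariantDerivativeOnUniv.leibniz (hc i) (hg i)
  rw [h5]
  change toCoord d q x (g i x • cov _ x v + mvfderiv (𝓡 d) (g i) x v • constField d q _ x) = _
  rw [mvfderiv_apply_eq_fderiv hx (hg i), (hgd i).fderiv, map_add, map_smul, map_smul, add_comm]
  congr 2
  exact toCoord_ofCoord hx _

end Christoffel

/-! ### Change of chart and smoothness of the Christoffel symbols. -/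

section Tensors

open Filter Topology

variable {d : ℕ} {M : Type*} [TopologicalSpace M] [ChartedSpace (EuclideanSpace ℝ (Fin d)) M]
  [IsManifold (𝓡 d) ∞ M] (cov : AffineConnection d M)

theorem transitionSource_mem_nhds {q r x : M} (hq : x ∈ (coord d q).source)
    (hr : x ∈ (coord d r).source) : transitionSource d q r ∈ 𝓝 (coord d q x) :=
  (isOpen_transitionSource q r).mem_nhds (mem_transitionSource hq hr)

theorem contDiffAt_transition {q r x : M} (hq : x ∈ (coord d q).source)
    (hr : x ∈ (coord d r).source) : ContDiffAt ℝ ∞ (transition d q r) (coord d q x) :=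
  (contDiffOn_transition q r).contDiffAt (transitionSource_mem_nhds hq hr)

theorem hasFDerivAt_transition {q r x : M} (hq : x ∈ (coord d q).source)
    (hr : x ∈ (coord d r).source) : HasFDerivAt (transition d q r)
      (fderiv ℝ (transition d q r) (coord d q x)) (coord d q x) :=
  ((contDiffAt_transition hq hr).differentiableAt (by simp)).hasFDerivAt

theorem hasFDerivAt_fderiv_transition {q r x : M} (hq : x ∈ (coord d q).source)
    (hr : x ∈ (coord d r).source) : HasFDerivAt (fderiv ℝ (transition d q r))
      (fderiv ℝ (fderiv ℝ (transition d q r)) (coord d q x)) (coord d q x) :=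
  ((ContDiffAt.fderiv_right (m := 1) (contDiffAt_transition hq hr)
    (by norm_cast)).differentiableAt (by simp)).hasFDerivAt

/-- The Christoffel symbols transform by the usual rule. -/
theorem fderiv_transition_christoffel {q r x : M} (hq : x ∈ (coord d q).source)
    (hr : x ∈ (coord d r).source) (v k : ModelSpace d) :
    fderiv ℝ (transition d q r) (coord d q x) (christoffel cov q (coord d q x) v k) =
      fderiv ℝ (fderiv ℝ (transition d q r)) (coord d q x) v k +
      christoffel cov r (coord d r x) (fderiv ℝ (transition d q r) (coord d q x) v)
        (fderiv ℝ (transition d q r) (coord d q x) k) := by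
  -- The covariant derivative of the field with constant components `k` in the chart at `q` is
  -- computed in both charts. In the first only the Christoffel term survives; in the second,
  -- differentiating the components produces the second derivative of the transition map.
  set w := ofCoord d q x v with hw
  have hv : toCoord d q x w = v := toCoord_ofCoord hq v
  have hrw : toCoord d r x w = fderiv ℝ (transition d q r) (coord d q x) v := by
    rw [toCoord_eq_fderiv_transition hq hr, hv]
  have hcomp : components r (constField d q k) =ᶠ[𝓝 (coord d r x)]
      fun y => fderiv ℝ (transition d q r) (transition d r q y) k := by
    filter_upwards [transitionSource_mem_nhds hr hq] with y hy
    have hz := (coord d r).map_target hy.1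
    change toCoord d r _ (ofCoord d q _ k) = _
    rw [toCoord_eq_fderiv_transition hy.2 hz, toCoord_ofCoord hy.2]
    rfl
  have hback : transition d r q (coord d r x) = coord d q x := transition_coord hr
  have h2 := hasFDerivAt_fderiv_transition hq hr
  rw [← hback] at h2
  have hd : HasFDerivAt (components r (constField d q k)) _ (coord d r x) :=
    ((h2.comp _ (hasFDerivAt_transition hr hq)).clm_apply
      (hasFDerivAt_const k (coord d r x))).congr_of_eventuallyEq hcomp
  have h3 := toCoord_cov cov hr hd.differentiableAt w
  have hd' : HasFDerivAt (components q (constField d q k)) (0 : ModelSpace d →L[ℝ] ModelSpace d)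
      (coord d q x) := (hasFDerivAt_const k _).congr_of_eventuallyEq (by
    filter_upwards [coord_target_mem_nhds hq] with y hy
    exact components_constField hy k)
  have h4 := toCoord_cov cov hq hd'.differentiableAt w
  rw [hd'.fderiv, hv] at h4
  rw [hd.fderiv, toCoord_eq_fderiv_transition hq hr, h4] at h3
  have h5 : toCoord d q x (constField d q k x) = k := toCoord_ofCoord hq k
  have h6 : toCoord d r x (constField d q k x) = fderiv ℝ (transition d q r) (coord d q x) k := by
    rw [toCoord_eq_fderiv_transition hq hr, h5]
  have h7 : fderiv ℝ (transition d r q) (coord d r x) (toCoord d r x w) = v := by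
    rw [← toCoord_eq_fderiv_transition hr hq, hv]
  rw [h5, h6] at h3
  simp only [_root_.zero_apply, zero_add, _root_.add_apply, ContinuousLinearMap.comp_apply,
    ContinuousLinearMap.flip_apply, map_zero] at h3
  rw [h7, hback, hrw] at h3
  exact h3

theorem contDiffAt_of_contMDiffAt {q x : M} (hx : x ∈ (coord d q).source) {F : Type*}
    [NormedAddCommGroup F] [NormedSpace ℝ F] {f : M → F} {n : ℕ∞ω} (hn : n ≤ ∞)
    (hf : ContMDiffAt (𝓡 d) 𝓘(ℝ, F) n f x) :
    ContDiffAt ℝ n (f ∘ (coord d q).symm) (coord d q x) := by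
  rw [← contMDiffAt_iff_contDiffAt]
  have h1 : ContMDiffAt 𝓘(ℝ, ModelSpace d) (𝓡 d) n (coord d q).symm (coord d q x) :=
    ((contMDiffOn_extChartAt_symm (n := ∞) q).contMDiffAt (coord_target_mem_nhds hx)).of_le hn
  refine ContMDiffAt.comp (coord d q x) ?_ h1
  rwa [(coord d q).left_inv hx]

/-- The coordinate fields are only smooth on the chart domain, so each is multiplied by a bump
function equal to 1 near the point. The resulting global field is smooth, its covariant derivative
is smooth by hypothesis, and by locality it has the right value near the point. -/
theorem contDiffOn_christoffel [T2Space M]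
    (hcov : CovariantDerivative.ContMDiffCovariantDerivative cov ∞) (q : M) :
    ContDiffOn ℝ ∞ (christoffel cov q) (coord d q).target := by
  intro y hy
  obtain ⟨x, hx, rfl⟩ : ∃ x ∈ (coord d q).source, coord d q x = y :=
    ⟨_, (coord d q).map_target hy, (coord d q).right_inv hy⟩
  refine ContDiffAt.contDiffWithinAt ?_
  let e := trivializationAt (ModelSpace d) (TangentSpace (𝓡 d) : M → Type _) q
  have hxe : ∀ z ∈ (coord d q).source, z ∈ e.baseSet := fun z hz => by
    rwa [TangentBundle.trivializationAt_baseSet, ← extChartAt_source (𝓡 d)]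
  have key : ∀ k : ModelSpace d, ContDiffAt ℝ ∞ (fun y => (toCoord d q ((coord d q).symm y)).comp
      ((cov (constField d q k) ((coord d q).symm y)).comp (ofCoord d q ((coord d q).symm y))))
      (coord d q x) := by
    intro k
    obtain ⟨f, -, hf⟩ := (SmoothBumpFunction.nhds_basis_tsupport (I := 𝓡 d) x).mem_iff.1
      (coord_source_mem_nhds hx)
    have hσ : ContMDiffOn (𝓡 d) ((𝓡 d).prod 𝓘(ℝ, ModelSpace d)) ∞
        (fun z => TotalSpace.mk' (ModelSpace d) z (constField d q k z)) (coord d q).source := by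
      intro z hz
      refine ContMDiffAt.contMDiffWithinAt ?_
      rw [e.contMDiffAt_section_iff (hxe z hz)]
      refine (contMDiffAt_const (c := k)).congr_of_eventuallyEq ?_
      filter_upwards [coord_source_mem_nhds hz] with z' hz'
      exact toCoord_ofCoord hz' k
    have h1 : ContMDiff (𝓡 d) ((𝓡 d).prod 𝓘(ℝ, ModelSpace d)) ∞
        (fun z => TotalSpace.mk' (ModelSpace d) z (((f : M → ℝ) • constField d q k) z)) :=
      ContMDiffOn.smul_section_of_tsupport f.contMDiff.contMDiffOn (isOpen_coord_source q) hf hσ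
    have h2 := hcov.contMDiff.contMDiff (σ := (f : M → ℝ) • constField d q k) h1.contMDiffOn
    have h3 := h2.contMDiffAt univ_mem (x := x)
    have h4 := ((e.continuousLinearMap (RingHom.id ℝ) e).contMDiffAt_section_iff
      (IB := 𝓡 d) (n := ∞) ⟨hxe x hx, hxe x hx⟩).1 h3
    refine (contDiffAt_of_contMDiffAt hx le_rfl h4).congr_of_eventuallyEq ?_
    have h5 : ∀ᶠ y in 𝓝 (coord d q x), f =ᶠ[𝓝 ((coord d q).symm y)] 1 := by
      have h6 := f.eventuallyEq_one.eventuallyEq_nhds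
      have h7 : ContinuousAt (coord d q).symm (coord d q x) :=
        continuousAt_extChartAt_symm' hx
      have h8 : Tendsto (coord d q).symm (𝓝 (coord d q x)) (𝓝 x) := by
        have h9 : Tendsto (coord d q).symm (𝓝 (coord d q x))
          (𝓝 ((coord d q).symm (coord d q x))) := h7
        rwa [(coord d q).left_inv hx] at h9
      exact h8.eventually h6
    filter_upwards [coord_target_mem_nhds hx, h5] with y hy hfy
    have hz := (coord d q).map_target hy
    set z := (coord d q).symm y with hzdef
    have h6 : cov ((f : M → ℝ) • constField d q k) z = cov (constField d q k) z := by
      refine cov.isCovariantDerivativeOnUniv.congr_of_eventuallyEq (h1.mdifferentiable (by simp) z)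
        (vectorFieldDifferentiableAt_constField hz k) univ_mem ?_
      filter_upwards [hfy] with z' hz'
      rw [Pi.smul_apply', hz']
      exact one_smul _ _
    change _ = (e.continuousLinearMapAt ℝ z).comp ((cov ((f : M → ℝ) • constField d q k) z).comp
      (e.symmL ℝ z))
    rw [h6, TangentBundle.continuousLinearMapAt_trivializationAt_eq_core (I := 𝓡 d) (b₀ := q)
      (b := z) (by rwa [← extChartAt_source (𝓡 d)]),
      TangentBundle.symmL_trivializationAt_eq_core (I := 𝓡 d) (b₀ := q)
      (b := z) (by rwa [← extChartAt_source (𝓡 d)])]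
    rfl
  have : christoffel cov q = fun y => ∑ i : Fin d,
      (ContinuousLinearMap.smulRightL ℝ (ModelSpace d) (ModelSpace d)
        (EuclideanSpace.proj i)).comp ((toCoord d q ((coord d q).symm y)).comp
          ((cov (constField d q (EuclideanSpace.single i 1)) ((coord d q).symm y)).comp
            (ofCoord d q ((coord d q).symm y)))) := rfl
  rw [this]
  refine ContDiffAt.sum fun i _ => ?_
  exact contDiffAt_const.clm_comp (key _)

/-! ### Torsion and curvature in coordinates -/

theorem mpullback_coord {q x : M} (hx : x ∈ (coord d q).source)
    (Y : (y : ModelSpace d) → TangentSpace 𝓘(ℝ, ModelSpace d) y) :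
    VectorField.mpullback (𝓡 d) 𝓘(ℝ, ModelSpace d) (coord d q) Y x =
      ofCoord d q x (Y (coord d q x)) := by
  have h : (toCoord d q x).inverse = ofCoord d q x := ContinuousLinearMap.inverse_eq
    (ContinuousLinearMap.ext fun v => toCoord_ofCoord hx v)
    (ContinuousLinearMap.ext fun v => ofCoord_toCoord hx v)
  rw [VectorField.mpullback_apply, (hasMFDerivAt_coord hx).mfderiv]
  exact congrArg (fun A : ModelSpace d →L[ℝ] TangentSpace (𝓡 d) x => A (Y (coord d q x))) h

/-- Near `x` a field is the pullback of its components under the chart, and Lie brackets commute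
with pullback. -/
theorem toCoord_mlieBracket {q x : M} (hx : x ∈ (coord d q).source)
    {V W : (x : M) → TangentSpace (𝓡 d) x}
    (hV : DifferentiableAt ℝ (components q V) (coord d q x))
    (hW : DifferentiableAt ℝ (components q W) (coord d q x)) :
    toCoord d q x (VectorField.mlieBracket (𝓡 d) V W x) =
      fderiv ℝ (components q W) (coord d q x) (toCoord d q x (V x)) -
      fderiv ℝ (components q V) (coord d q x) (toCoord d q x (W x)) := by
  have : IsManifold (𝓡 d) (minSmoothness ℝ 2) M := by
    rw [minSmoothness_of_isRCLikeNormedField]; infer_instance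
  let cmp : ((x : M) → TangentSpace (𝓡 d) x) →
      (y : ModelSpace d) → TangentSpace 𝓘(ℝ, ModelSpace d) y := fun U => components q U
  have hpull : ∀ U : (x : M) → TangentSpace (𝓡 d) x,
      U =ᶠ[𝓝 x] VectorField.mpullback (𝓡 d) 𝓘(ℝ, ModelSpace d) (coord d q) (cmp U) := by
    intro U
    filter_upwards [coord_source_mem_nhds hx] with z hz
    rw [mpullback_coord hz]
    exact ((congrArg (ofCoord d q z) (components_coord hz U)).trans (ofCoord_toCoord hz _)).symm
  have h1 := (hpull V).mlieBracket_vectorField_eq (hpull W)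
  have hdiff : ∀ U, DifferentiableAt ℝ (components q U) (coord d q x) →
      MDifferentiableAt 𝓘(ℝ, ModelSpace d) (𝓘(ℝ, ModelSpace d).prod 𝓘(ℝ, ModelSpace d))
        (fun z => TotalSpace.mk' (ModelSpace d) z (cmp U z)) (coord d q x) := by
    intro U hU
    rw [mdifferentiableAt_section]
    refine (mdifferentiableAt_iff_differentiableAt.2 hU).congr_of_eventuallyEq ?_
    refine Eventually.of_forall fun z => ?_
    exact congrArg Prod.snd (trivializationAt_model_space_apply (I := 𝓘(ℝ, ModelSpace d))
      (⟨z, cmp U z⟩ : TangentBundle 𝓘(ℝ, ModelSpace d) (ModelSpace d)) (coord d q x))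
  have h2 := VectorField.mpullback_mlieBracket (I := 𝓡 d) (I' := 𝓘(ℝ, ModelSpace d))
    (f := coord d q) (x₀ := x) (n := 2) (hdiff _ hV) (hdiff _ hW)
    ((contMDiffAt_extChartAt' (by rwa [← extChartAt_source (𝓡 d)])).of_le (by norm_cast))
    (by simp)
  rw [h1, ← h2, mpullback_coord hx]
  refine (toCoord_ofCoord hx _).trans ?_
  rw [← VectorField.mlieBracketWithin_univ,
    VectorField.mlieBracketWithin_eq_lieBracketWithin, VectorField.lieBracketWithin_univ]
  change fderiv ℝ (components q W) _ (components q V _) -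
    fderiv ℝ (components q V) _ (components q W _) = _
  rw [components_coord hx, components_coord hx]

/-- Evaluated on fields with constant components, whose bracket vanishes, only the antisymmetric
part of the Christoffel symbols is left. -/
theorem toCoord_torsion {q x : M} (hx : x ∈ (coord d q).source) (v w : TangentSpace (𝓡 d) x) :
    toCoord d q x (cov.torsion x v w) =
      christoffel cov q (coord d q x) (toCoord d q x v) (toCoord d q x w) -
      christoffel cov q (coord d q x) (toCoord d q x w) (toCoord d q x v) := by
  have hd : ∀ k, HasFDerivAt (components q (constField d q k))
      (0 : ModelSpace d →L[ℝ] ModelSpace d) (coord d q x) := fun k =>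
    (hasFDerivAt_const k _).congr_of_eventuallyEq (by
      filter_upwards [coord_target_mem_nhds hx] with y hy
      exact components_constField hy k)
  have hc : ∀ u : TangentSpace (𝓡 d) x, constField d q (toCoord d q x u) x = u := fun u =>
    ofCoord_toCoord hx u
  have h1 := cov.torsion_apply
    (vectorFieldDifferentiableAt_constField hx (toCoord d q x v))
    (vectorFieldDifferentiableAt_constField hx (toCoord d q x w))
  rw [hc, hc] at h1
  rw [h1, map_sub, map_sub, toCoord_cov cov hx (hd _).differentiableAt,
    toCoord_cov cov hx (hd _).differentiableAt, toCoord_mlieBracket hx (hd _).differentiableAt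
      (hd _).differentiableAt, (hd _).fderiv, (hd _).fderiv, hc, hc]
  simp

theorem vectorFieldDifferentiableAt_constExt {x : M} (v : TangentSpace (𝓡 d) x) :
    VectorFieldDifferentiableAt (constExt v) x :=
  FiberBundle.mdifferentiableAt_extend (𝓡 d) (ModelSpace d) v

theorem constExt_eventuallyEq {x : M} (v : TangentSpace (𝓡 d) x) :
    ∀ᶠ z in 𝓝 x, constExt v z = constField d x v z := by
  filter_upwards [coord_source_mem_nhds (d := d) (mem_extChartAt_source x)] with z hz
  refine (trivializationAt_symm_eq_ofCoord hz _).trans ?_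
  change ofCoord d x z (toCoord d x x v) = _
  rw [toCoord_self]
  rfl

/-- The curvature tensor expressed through Christoffel symbols. -/
noncomputable def christoffelCurvature {E : Type*} [NormedAddCommGroup E] [NormedSpace ℝ E]
    (Γ : E → E →L[ℝ] E →L[ℝ] E) (y v w : E) : E →L[ℝ] E :=
  fderiv ℝ Γ y v w - fderiv ℝ Γ y w v + Γ y v * Γ y w - Γ y w * Γ y v

/-- The extensions in `curvature` are constant in the chart at `x`, so in the chart at `q` their
components vary. Their second derivatives cancel by symmetry, and their first derivatives cancel
against the bracket term. -/
theorem toCoord_curvature [T2Space M]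
    (hcov : CovariantDerivative.ContMDiffCovariantDerivative cov ∞) {q x : M}
    (hx : x ∈ (coord d q).source) (v w z : TangentSpace (𝓡 d) x) :
    toCoord d q x (curvature cov v w z) =
      christoffelCurvature (christoffel cov q) (coord d q x) (toCoord d q x v) (toCoord d q x w)
        (toCoord d q x z) := by
  have hcomp : ∀ u : TangentSpace (𝓡 d) x, components q (constExt u) =ᶠ[𝓝 (coord d q x)]
      fun y => fderiv ℝ (transition d x q) (transition d q x y) u := by
    intro u
    have h1 : Tendsto (coord d q).symm (𝓝 (coord d q x)) (𝓝 x) := by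
      have h9 : Tendsto (coord d q).symm (𝓝 (coord d q x))
        (𝓝 ((coord d q).symm (coord d q x))) := continuousAt_extChartAt_symm' hx
      rwa [(coord d q).left_inv hx] at h9
    filter_upwards [transitionSource_mem_nhds hx (mem_extChartAt_source x),
      h1.eventually (constExt_eventuallyEq u)] with y hy hyu
    have hz := (coord d q).map_target hy.1
    change toCoord d q _ (constExt u _) = _
    rw [hyu]
    change toCoord d q _ (ofCoord d x _ u) = _
    rw [toCoord_eq_fderiv_transition hy.2 hz]
    exact congrArg _ (toCoord_ofCoord hy.2 u)
  have hsm : ∀ u : TangentSpace (𝓡 d) x, ContDiffAt ℝ 2 (components q (constExt u))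
      (coord d q x) := by
    intro u
    refine ContDiffAt.congr_of_eventuallyEq ?_ (hcomp u)
    have h1 : ContDiffAt ℝ 2 (fderiv ℝ (transition d x q)) (transition d q x (coord d q x)) := by
      rw [transition_coord hx]
      exact ContDiffAt.fderiv_right (contDiffAt_transition (mem_extChartAt_source x) hx)
        (by norm_cast)
    exact (h1.comp _ ((contDiffAt_transition hx (mem_extChartAt_source x)).of_le
      (by norm_cast))).clm_apply contDiffAt_const
  have hΓ : HasFDerivAt (christoffel cov q) (fderiv ℝ (christoffel cov q) (coord d q x))
      (coord d q x) := (((contDiffOn_christoffel cov hcov q).contDiffAt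
        (coord_target_mem_nhds hx)).differentiableAt (by simp)).hasFDerivAt
  have hd : ∀ u : TangentSpace (𝓡 d) x, ∀ᶠ y in 𝓝 (coord d q x),
      DifferentiableAt ℝ (components q (constExt u)) y := fun u => by
    filter_upwards [(hsm u).eventually (by simp)] with y hy
    exact hy.differentiableAt (by simp)
  have hself : ∀ u : TangentSpace (𝓡 d) x, constExt u x = u := fun u =>
    FiberBundle.extend_apply_self _ u
  have hc0 : ∀ u : TangentSpace (𝓡 d) x, components q (constExt u) (coord d q x) =
      toCoord d q x u := fun u => by rw [components_coord hx, hself]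
  -- the covariant derivative of `constExt z` along `constExt u`
  have hF : ∀ u : TangentSpace (𝓡 d) x,
      components q (fun y => cov (constExt z) y (constExt u y)) =ᶠ[𝓝 (coord d q x)]
        fun y => fderiv ℝ (components q (constExt z)) y (components q (constExt u) y) +
          christoffel cov q y (components q (constExt u) y) (components q (constExt z) y) := by
    intro u
    filter_upwards [coord_target_mem_nhds hx, hd z] with y hy hyd
    have hz := (coord d q).map_target hy
    have h1 := toCoord_cov cov hz (V := constExt z) (by rwa [(coord d q).right_inv hy])
      (constExt u _)
    rw [(coord d q).right_inv hy] at h1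
    exact h1
  have h2 : HasFDerivAt (fderiv ℝ (components q (constExt z)))
      (fderiv ℝ (fderiv ℝ (components q (constExt z))) (coord d q x)) (coord d q x) :=
    ((ContDiffAt.fderiv_right (m := 1) (hsm z) (by norm_num)).differentiableAt
      (by simp)).hasFDerivAt
  have h1 := fun u : TangentSpace (𝓡 d) x => ((hsm u).differentiableAt (by simp)).hasFDerivAt
  have hFd : ∀ u : TangentSpace (𝓡 d) x,
      HasFDerivAt (components q (fun y => cov (constExt z) y (constExt u y))) _ (coord d q x) :=
    fun u => ((h2.clm_apply (h1 u)).add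
      ((hΓ.clm_apply (h1 u)).clm_apply (h1 z))).congr_of_eventuallyEq (hF u)
  have h3 := fun u s : TangentSpace (𝓡 d) x =>
    toCoord_cov cov hx (hFd u).differentiableAt s
  have h4 := toCoord_cov cov hx (h1 z).differentiableAt
    (VectorField.mlieBracket (𝓡 d) (constExt v) (constExt w) x)
  have hsymm : fderiv ℝ (fderiv ℝ (components q (constExt z))) (coord d q x) (toCoord d q x v)
      (toCoord d q x w) = fderiv ℝ (fderiv ℝ (components q (constExt z))) (coord d q x)
      (toCoord d q x w) (toCoord d q x v) :=
    ((hsm z).isSymmSndFDerivAt (by simp)).eq _ _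
  have h5 : ∀ u : TangentSpace (𝓡 d) x,
      toCoord d q x (cov (constExt z) x (constExt u x)) = _ := fun u =>
    toCoord_cov cov hx (h1 z).differentiableAt _
  rw [curvature, map_sub, map_sub, h3, h3, h4, (hFd w).fderiv, (hFd v).fderiv,
    toCoord_mlieBracket hx (h1 v).differentiableAt (h1 w).differentiableAt, h5, h5]
  simp only [hself, hc0, _root_.add_apply, ContinuousLinearMap.comp_apply,
    ContinuousLinearMap.flip_apply, map_add, map_sub, christoffelCurvature,
    _root_.sub_apply, hsymm, mul_apply_eq_comp]
  abel

end Tensors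

/-! ### Curves and frames in coordinates -/

section Curves

open Filter Topology

variable {d : ℕ} {M : Type*} [TopologicalSpace M] [ChartedSpace (EuclideanSpace ℝ (Fin d)) M]
  [IsManifold (𝓡 d) ∞ M] (cov : AffineConnection d M)

/-- `toCoord` as an endomorphism of the model space, to which all tangent spaces are equal. -/
noncomputable def frameCoord (d : ℕ) {M : Type*} [TopologicalSpace M]
    [ChartedSpace (EuclideanSpace ℝ (Fin d)) M] [IsManifold (𝓡 d) ∞ M] (q x : M) :
    ModelSpace d →L[ℝ] ModelSpace d :=
  tangentCoordChange (𝓡 d) x q x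

/-- `ofCoord` as an endomorphism of the model space, to which all tangent spaces are equal. -/
noncomputable def frameOfCoord (d : ℕ) {M : Type*} [TopologicalSpace M]
    [ChartedSpace (EuclideanSpace ℝ (Fin d)) M] [IsManifold (𝓡 d) ∞ M] (q x : M) :
    ModelSpace d →L[ℝ] ModelSpace d :=
  tangentCoordChange (𝓡 d) q x x

theorem frameCoord_mul_frameOfCoord {q x : M} (hx : x ∈ (coord d q).source) :
    frameCoord d q x * frameOfCoord d q x = 1 :=
  ContinuousLinearMap.ext fun v => toCoord_ofCoord hx v

theorem frameOfCoord_mul_frameCoord {q x : M} (hx : x ∈ (coord d q).source) :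
    frameOfCoord d q x * frameCoord d q x = 1 :=
  ContinuousLinearMap.ext fun v => ofCoord_toCoord hx v

theorem frameCoord_eq_fderiv_transition {q r x : M} (hq : x ∈ (coord d q).source)
    (hr : x ∈ (coord d r).source) :
    frameCoord d r x = fderiv ℝ (transition d q r) (coord d q x) * frameCoord d q x :=
  ContinuousLinearMap.ext fun v => toCoord_eq_fderiv_transition hq hr v

theorem frameCoord_self (x : M) : frameCoord d x x = 1 :=
  ContinuousLinearMap.ext fun v => toCoord_self x v

theorem hasMFDerivWithinAt_curve_self {γ : ℝ → M} {s : Set ℝ} {t : ℝ}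
    (v : TangentSpace (𝓡 d) (γ t)) :
    HasMFDerivWithinAt 𝓘(ℝ, ℝ) (𝓡 d) γ s t ((1 : ℝ →L[ℝ] ℝ).smulRight v) ↔
      ContinuousWithinAt γ s t ∧
        HasDerivWithinAt (fun τ => coord d (γ t) (γ τ)) (toCoord d (γ t) (γ t) v) s t := by
  rw [toCoord_self]
  refine and_congr_right fun _ => ?_
  simp only [ModelWithCorners.range_eq_univ, inter_univ]
  rfl

theorem hasDerivWithinAt_coord_change {γ : ℝ → M} {s : Set ℝ} {t : ℝ} {q r : M}
    (hq : γ t ∈ (coord d q).source) (hr : γ t ∈ (coord d r).source)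
    (hc : ContinuousWithinAt γ s t) {a : ModelSpace d}
    (h : HasDerivWithinAt (fun τ => coord d q (γ τ)) a s t) :
    HasDerivWithinAt (fun τ => coord d r (γ τ))
      (fderiv ℝ (transition d q r) (coord d q (γ t)) a) s t := by
  have h1 := HasFDerivAt.comp_hasDerivWithinAt (f := fun τ => coord d q (γ τ)) t
    (hasFDerivAt_transition hq hr) h
  refine h1.congr_of_eventuallyEq ?_ (transition_coord hq).symm
  filter_upwards [hc (coord_source_mem_nhds hq)] with τ hτ
  exact (transition_coord hτ).symm

theorem hasMFDerivWithinAt_curve_iff {γ : ℝ → M} {s : Set ℝ} {t : ℝ} {q : M}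
    (hq : γ t ∈ (coord d q).source) (v : TangentSpace (𝓡 d) (γ t)) :
    HasMFDerivWithinAt 𝓘(ℝ, ℝ) (𝓡 d) γ s t ((1 : ℝ →L[ℝ] ℝ).smulRight v) ↔
      ContinuousWithinAt γ s t ∧
        HasDerivWithinAt (fun τ => coord d q (γ τ)) (toCoord d q (γ t) v) s t := by
  rw [hasMFDerivWithinAt_curve_self]
  have hs := mem_extChartAt_source (I := 𝓡 d) (γ t)
  refine and_congr_right fun hc => ⟨fun h => ?_, fun h => ?_⟩
  · rw [toCoord_eq_fderiv_transition hs hq]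
    exact hasDerivWithinAt_coord_change hs hq hc h
  · rw [toCoord_eq_fderiv_transition hq hs]
    exact hasDerivWithinAt_coord_change hq hs hc h

theorem hasMFDerivAt_curve_iff {γ : ℝ → M} {t : ℝ} {q : M}
    (hq : γ t ∈ (coord d q).source) (v : TangentSpace (𝓡 d) (γ t)) :
    HasMFDerivAt 𝓘(ℝ, ℝ) (𝓡 d) γ t ((1 : ℝ →L[ℝ] ℝ).smulRight v) ↔
      ContinuousAt γ t ∧
        HasDerivAt (fun τ => coord d q (γ τ)) (toCoord d q (γ t) v) t := by
  refine hasMFDerivWithinAt_univ.symm.trans ((hasMFDerivWithinAt_curve_iff hq v).trans ?_)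
  rw [continuousWithinAt_univ, hasDerivWithinAt_univ]

/-- The covariant derivative of a field of vectors along a curve, in terms of the chart at `q`. -/
def HasCovDerivInChart (q : M) (γ : ℝ → M) (V : ℝ → ModelSpace d) (t : ℝ)
    (x' D : ModelSpace d) : Prop :=
  ContinuousAt γ t ∧ HasDerivAt (fun τ => coord d q (γ τ)) x' t ∧
    HasDerivAt (fun τ => frameCoord d q (γ τ) (V τ))
      (frameCoord d q (γ t) D -
        christoffel cov q (coord d q (γ t)) x' (frameCoord d q (γ t) (V t))) t

/-- The second derivative of the transition map, produced by differentiating the transformed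
components, is absorbed by the transformation rule for the Christoffel symbols. -/
theorem HasCovDerivInChart.change {q r : M} {γ : ℝ → M} {V : ℝ → ModelSpace d} {t : ℝ}
    {x' D : ModelSpace d} (h : HasCovDerivInChart cov q γ V t x' D)
    (hq : γ t ∈ (coord d q).source) (hr : γ t ∈ (coord d r).source) :
    HasCovDerivInChart cov r γ V t (fderiv ℝ (transition d q r) (coord d q (γ t)) x') D := by
  obtain ⟨hc, hx, hV⟩ := h
  have hx' : HasDerivAt (fun τ => coord d r (γ τ))
      (fderiv ℝ (transition d q r) (coord d q (γ t)) x') t := by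
    rw [← hasDerivWithinAt_univ] at hx ⊢
    exact hasDerivWithinAt_coord_change hq hr hc.continuousWithinAt hx
  refine ⟨hc, hx', ?_⟩
  have h1 := (HasFDerivAt.comp_hasDerivAt (f := fun τ => coord d q (γ τ)) t
    (hasFDerivAt_fderiv_transition hq hr) hx).clm_apply hV
  have h2 : (fun τ => frameCoord d r (γ τ) (V τ)) =ᶠ[𝓝 t]
      fun τ => fderiv ℝ (transition d q r) (coord d q (γ τ)) (frameCoord d q (γ τ) (V τ)) := by
    filter_upwards [hc (coord_source_mem_nhds hq), hc (coord_source_mem_nhds hr)] with τ h3 h4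
    rw [frameCoord_eq_fderiv_transition h3 h4, mul_apply_eq_comp]
  refine (h1.congr_of_eventuallyEq h2).congr_deriv ?_
  simp only [Function.comp]
  rw [map_sub, fderiv_transition_christoffel cov hq hr, frameCoord_eq_fderiv_transition hq hr,
    mul_apply_eq_comp, mul_apply_eq_comp]
  abel

/-- The extension has constant components in the chart at `x`, so only the Christoffel term remains.
-/
theorem cov_constExt {x : M} (v w : TangentSpace (𝓡 d) x) :
    cov (constExt v) x w = christoffel cov x (coord d x x) w v := by
  have hx := mem_extChartAt_source (I := 𝓡 d) x
  have h1 : cov (constExt v) x = cov (constField d x v) x :=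
    cov.isCovariantDerivativeOnUniv.congr_of_eventuallyEq (vectorFieldDifferentiableAt_constExt v)
      (vectorFieldDifferentiableAt_constField hx v) univ_mem (constExt_eventuallyEq v)
  have hd : HasFDerivAt (components x (constField d x v))
      (0 : ModelSpace d →L[ℝ] ModelSpace d) (coord d x x) :=
    (hasFDerivAt_const (v : ModelSpace d) _).congr_of_eventuallyEq (by
      filter_upwards [coord_target_mem_nhds hx] with y hy
      exact components_constField hy v)
  have h2 := toCoord_cov cov hx hd.differentiableAt w
  rw [hd.fderiv, toCoord_self, toCoord_self, toCoord_self] at h2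
  rw [h1, h2]
  have h3 : constField d x v x = v := ofCoord_self x v
  rw [h3]
  exact zero_add _

/-- The definition uses the chart at `γ t`, which changes with `t`. A fixed chart is needed in order
to treat parallel transport as a differential equation. -/
theorem hasCovDerivAlongAt_iff {q : M} {γ : ℝ → M} {t : ℝ}
    {V : (t : ℝ) → TangentSpace (𝓡 d) (γ t)} {D : TangentSpace (𝓡 d) (γ t)}
    (hq : γ t ∈ (coord d q).source) :
    HasCovDerivAlongAt cov γ V t D ↔ ∃ x', HasCovDerivInChart cov q γ V t x' D := by
  have hs := mem_extChartAt_source (I := 𝓡 d) (γ t)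
  have key : HasCovDerivAlongAt cov γ V t D ↔ ∃ x', HasCovDerivInChart cov (γ t) γ V t x' D := by
    have hsymm : ∀ a : ModelSpace d,
        (trivializationAt (ModelSpace d) (TangentSpace (𝓡 d) : M → Type _) (γ t)).symm (γ t) a = a :=
      fun a => (trivializationAt_symm_eq_ofCoord hs a).trans (ofCoord_self _ a)
    have aux : ∀ a g k : ModelSpace d, a = frameCoord d (γ t) (γ t)
        (a + christoffel cov (γ t) (coord d (γ t) (γ t)) g k) -
        christoffel cov (γ t) (coord d (γ t) (γ t)) g (frameCoord d (γ t) (γ t) k) := by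
      intro a g k
      simp [frameCoord_self]
    have aux' : ∀ a g k : ModelSpace d, a = frameCoord d (γ t) (γ t) a -
        christoffel cov (γ t) (coord d (γ t) (γ t)) g (frameCoord d (γ t) (γ t) k) +
        christoffel cov (γ t) (coord d (γ t) (γ t)) g k := by
      intro a g k
      simp [frameCoord_self]
    constructor
    · rintro ⟨γ', a, h1, h2, h3⟩
      rw [hasMFDerivAt_curve_iff hs, toCoord_self] at h1
      refine ⟨γ', h1.1, h1.2, h2.congr_deriv ?_⟩
      rw [h3, hsymm, cov_constExt]
      exact aux a γ' (V t)
    · rintro ⟨x', h1, h2, h3⟩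
      refine ⟨x', _, (hasMFDerivAt_curve_iff hs _).2 ⟨h1, ?_⟩, h3, ?_⟩
      · exact h2.congr_deriv (toCoord_self (γ t) x').symm
      · rw [hsymm]
        refine Eq.trans ?_ (congrArg _ (cov_constExt cov (V t) x').symm)
        exact aux' D x' (V t)
  rw [key]
  exact ⟨fun ⟨x', h⟩ => ⟨_, h.change cov hs hq⟩, fun ⟨x', h⟩ => ⟨_, h.change cov hq hs⟩⟩

theorem hasDerivAt_clm_iff {F : Type*} [NormedAddCommGroup F] [NormedSpace ℝ F]
    {A : ℝ → ModelSpace d →L[ℝ] F} {A' : ModelSpace d →L[ℝ] F} {t : ℝ} :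
    HasDerivAt A A' t ↔ ∀ v, HasDerivAt (fun s => A s v) (A' v) t := by
  refine ⟨fun h v => by simpa using h.clm_apply (hasDerivAt_const t v), fun h => ?_⟩
  have hB : ∀ B : ModelSpace d →L[ℝ] F, B = ∑ i, ContinuousLinearMap.smulRightL ℝ (ModelSpace d) F
      (EuclideanSpace.proj i) (B (EuclideanSpace.single i (1 : ℝ))) := by
    intro B
    ext v
    rw [_root_.sum_apply]
    conv_lhs => rw [euclideanSpace_eq_sum_single v, map_sum]
    refine Finset.sum_congr rfl fun i _ => ?_
    rw [map_smul]
    rfl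
  have h1 : HasDerivAt (fun s => ∑ i, ContinuousLinearMap.smulRightL ℝ (ModelSpace d) F
      (EuclideanSpace.proj i) (A s (EuclideanSpace.single i (1 : ℝ)))) (∑ i,
      ContinuousLinearMap.smulRightL ℝ (ModelSpace d) F
      (EuclideanSpace.proj i) (A' (EuclideanSpace.single i (1 : ℝ)))) t :=
    HasDerivAt.fun_sum fun i _ => HasFDerivAt.comp_hasDerivAt t
      (ContinuousLinearMap.hasFDerivAt _) (h _)
  rw [← hB A'] at h1
  refine h1.congr_of_eventuallyEq (Eventually.of_forall fun s => hB (A s))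

/-- The coordinates of a frame along a curve. -/
noncomputable def solCoord (d : ℕ) {M : Type*} [TopologicalSpace M]
    [ChartedSpace (EuclideanSpace ℝ (Fin d)) M] [IsManifold (𝓡 d) ∞ M] (q : M) (γ : ℝ → M)
    (P : ℝ → ModelSpace d →L[ℝ] ModelSpace d) (t : ℝ) :
    ModelSpace d × (ModelSpace d →L[ℝ] ModelSpace d) :=
  (coord d q (γ t), frameCoord d q (γ t) * P t)

/-- Velocity and parallelism together form one first order equation for the point and its frame,
that of a horizontal curve in the frame bundle. -/
theorem hasDerivAt_solCoord_iff {q : M} {γ : ℝ → M} {t : ℝ}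
    {P : (t : ℝ) → ModelSpace d →L[ℝ] TangentSpace (𝓡 d) (γ t)} {v : TangentSpace (𝓡 d) (γ t)}
    (hq : γ t ∈ (coord d q).source) :
    (HasMFDerivAt 𝓘(ℝ, ℝ) (𝓡 d) γ t ((1 : ℝ →L[ℝ] ℝ).smulRight v) ∧
      ∀ k, HasCovDerivAlongAt cov γ (fun s => P s k) t 0) ↔
    ContinuousAt γ t ∧ HasDerivAt (solCoord d q γ P) (frameCoord d q (γ t) v,
      - (christoffel cov q (coord d q (γ t)) (frameCoord d q (γ t) v) * (solCoord d q γ P t).2)) t := by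
  rw [hasMFDerivAt_curve_iff hq, and_assoc]
  refine and_congr_right fun hc => ?_
  have h0 : HasDerivAt (solCoord d q γ P) (frameCoord d q (γ t) v,
      - (christoffel cov q (coord d q (γ t)) (frameCoord d q (γ t) v) * (solCoord d q γ P t).2)) t ↔
      HasDerivAt (fun τ => coord d q (γ τ)) (frameCoord d q (γ t) v) t ∧
      HasDerivAt (fun τ => (solCoord d q γ P τ).2) (- (christoffel cov q (coord d q (γ t))
        (frameCoord d q (γ t) v) * (solCoord d q γ P t).2)) t :=
    ⟨fun h => ⟨h.fst, h.snd⟩, fun h => h.1.prodMk h.2⟩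
  rw [h0]
  refine and_congr_right fun hx => ?_
  rw [hasDerivAt_clm_iff]
  refine forall_congr' fun k => ?_
  rw [hasCovDerivAlongAt_iff cov hq]
  have h1 : frameCoord d q (γ t) 0 - christoffel cov q (coord d q (γ t)) (frameCoord d q (γ t) v)
      (frameCoord d q (γ t) (P t k)) = (- (christoffel cov q (coord d q (γ t))
        (frameCoord d q (γ t) v) * (solCoord d q γ P t).2)) k := by
    rw [map_zero, zero_sub]; rfl
  constructor
  · rintro ⟨x', -, h2, h3⟩
    rw [h2.unique hx] at h3
    rw [← h1]
    exact h3
  · intro h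
    refine ⟨_, hc, hx, ?_⟩
    rw [← h1] at h
    exact h

end Curves

/-! ### The development equation in a chart -/

section FrameField

open Filter Topology

variable {E : Type*} [NormedAddCommGroup E] [NormedSpace ℝ E]
  {𝔢 : Type*} [NormedAddCommGroup 𝔢] [NormedSpace ℝ 𝔢]

/-- The values of the coefficients `(Γ, p, n, u)` of the development equation. -/
abbrev FrameCoeff (E 𝔢 : Type*) [NormedAddCommGroup E] [NormedSpace ℝ E]
    [NormedAddCommGroup 𝔢] [NormedSpace ℝ 𝔢] : Type _ :=
  (E →L[ℝ] E →L[ℝ] E) × (E →L[ℝ] E) × (𝔢 →L[ℝ] E) × E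

/-- The velocity `p n e + c u`. -/
noncomputable def velocityMap (a : FrameCoeff E 𝔢) : (ℝ × 𝔢) →L[ℝ] E :=
  (a.2.1.comp a.2.2.1).comp (ContinuousLinearMap.snd ℝ ℝ 𝔢) +
    (ContinuousLinearMap.fst ℝ ℝ 𝔢).smulRight a.2.2.2

/-- The equation `x' = p n w + u`, `p' = - Γ(x)(x') p` as a control system. -/
noncomputable def frameMap (a : FrameCoeff E 𝔢) : (ℝ × 𝔢) →L[ℝ] E × (E →L[ℝ] E) :=
  (ContinuousLinearMap.inl ℝ E (E →L[ℝ] E)).comp (velocityMap a) -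
    (ContinuousLinearMap.inr ℝ E (E →L[ℝ] E)).comp
      (((ContinuousLinearMap.compL ℝ E E E).flip a.2.1).comp (a.1.comp (velocityMap a)))

theorem frameMap_apply (a : FrameCoeff E 𝔢) (c : ℝ) (e : 𝔢) :
    frameMap a (c, e) = (a.2.1 (a.2.2.1 e) + c • a.2.2.2,
      - (a.1 (a.2.1 (a.2.2.1 e) + c • a.2.2.2) * a.2.1)) := by
  have h : velocityMap a (c, e) = a.2.1 (a.2.2.1 e) + c • a.2.2.2 := rfl
  rw [← h]
  ext1
  · exact sub_zero _
  · exact zero_sub _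

theorem contDiff_velocityMap {m : ℕ∞ω} :
    ContDiff ℝ m (velocityMap : FrameCoeff E 𝔢 → _) := by
  unfold velocityMap
  refine ContDiff.add ?_ ?_
  · exact (contDiff_snd.fst.clm_comp contDiff_snd.snd.fst).clm_comp contDiff_const
  · exact (ContinuousLinearMap.smulRightL ℝ (ℝ × 𝔢) E (ContinuousLinearMap.fst ℝ ℝ 𝔢)).contDiff.comp
      contDiff_snd.snd.snd

theorem contDiff_frameMap {m : ℕ∞ω} :
    ContDiff ℝ m (frameMap : FrameCoeff E 𝔢 → _) := by
  unfold frameMap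
  have hv := contDiff_velocityMap (E := E) (𝔢 := 𝔢) (m := m)
  have h2 := (((ContinuousLinearMap.compL ℝ E E E).flip.contDiff (n := m)).comp
    (f := fun a : FrameCoeff E 𝔢 => a.2.1)
    contDiff_snd.fst).clm_comp (contDiff_fst.clm_comp hv)
  exact (contDiff_const.clm_comp hv).sub (contDiff_const.clm_comp h2)

/-- The coefficients of the development equation in a chart, extended to the whole space. -/
structure FrameSystem (E 𝔢 : Type*) [NormedAddCommGroup E] [NormedSpace ℝ E]
    [NormedAddCommGroup 𝔢] [NormedSpace ℝ 𝔢] (T : ℝ) where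
  /-- the connection -/
  Γ : E → E →L[ℝ] E →L[ℝ] E
  /-- the drift -/
  U : ℝ → E → E
  /-- the noise -/
  N : ℝ → 𝔢 →L[ℝ] E
  contDiff_Γ : ContDiff ℝ 1 Γ
  differentiable_U : ∀ t ∈ Icc 0 T, ∀ x, DifferentiableAt ℝ (U t) x
  continuousOn_U : ContinuousOn (fun a : ℝ × E => U a.1 a.2) (Icc 0 T ×ˢ univ)
  continuousOn_fderiv_U : ContinuousOn (fun a : ℝ × E => fderiv ℝ (U a.1) a.2) (Icc 0 T ×ˢ univ)
  continuousOn_N : ContinuousOn N (Icc 0 T)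

namespace FrameSystem

variable {T : ℝ} (F : FrameSystem E 𝔢 T)

/-- The coefficients at a point. -/
noncomputable def coeff (t : ℝ) (y : E × (E →L[ℝ] E)) : FrameCoeff E 𝔢 :=
  (F.Γ y.1, y.2, F.N t, F.U t y.1)

/-- The control system. -/
noncomputable def field (t : ℝ) (y : E × (E →L[ℝ] E)) : (ℝ × 𝔢) →L[ℝ] E × (E →L[ℝ] E) :=
  frameMap (F.coeff t y)

/-- The derivative of the coefficients. -/
noncomputable def coeffDeriv (t : ℝ) (y : E × (E →L[ℝ] E)) :
    E × (E →L[ℝ] E) →L[ℝ] FrameCoeff E 𝔢 :=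
  (ContinuousLinearMap.inl ℝ _ _).comp
      ((fderiv ℝ F.Γ y.1).comp (ContinuousLinearMap.fst ℝ E (E →L[ℝ] E))) +
    (ContinuousLinearMap.inr ℝ (E →L[ℝ] E →L[ℝ] E) ((E →L[ℝ] E) × (𝔢 →L[ℝ] E) × E)).comp
      ((ContinuousLinearMap.inl ℝ (E →L[ℝ] E) ((𝔢 →L[ℝ] E) × E)).comp
        (ContinuousLinearMap.snd ℝ E (E →L[ℝ] E)) +
      (ContinuousLinearMap.inr ℝ (E →L[ℝ] E) ((𝔢 →L[ℝ] E) × E)).comp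
        ((ContinuousLinearMap.inr ℝ (𝔢 →L[ℝ] E) E).comp
          ((fderiv ℝ (F.U t) y.1).comp (ContinuousLinearMap.fst ℝ E (E →L[ℝ] E)))))

/-- The derivative of `field`. -/
noncomputable def fieldDeriv (t : ℝ) (y : E × (E →L[ℝ] E)) :
    E × (E →L[ℝ] E) →L[ℝ] (ℝ × 𝔢) →L[ℝ] E × (E →L[ℝ] E) :=
  (fderiv ℝ (frameMap : FrameCoeff E 𝔢 → _) (F.coeff t y)).comp (F.coeffDeriv t y)

theorem continuousOn_coeff :
    ContinuousOn (fun a : ℝ × (E × (E →L[ℝ] E)) => F.coeff a.1 a.2) (Icc 0 T ×ˢ univ) := by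
  have h1 : ContinuousOn (fun a : ℝ × (E × (E →L[ℝ] E)) => (a.1, a.2.1)) (Icc 0 T ×ˢ univ) := by
    fun_prop
  have hm : MapsTo (fun a : ℝ × (E × (E →L[ℝ] E)) => (a.1, a.2.1)) (Icc 0 T ×ˢ univ)
    (Icc 0 T ×ˢ univ) := fun a ha => ⟨ha.1, mem_univ _⟩
  refine ContinuousOn.prodMk ?_ (ContinuousOn.prodMk (by fun_prop) (ContinuousOn.prodMk ?_ ?_))
  · exact (F.contDiff_Γ.continuous.comp (by fun_prop : Continuous
      (fun a : ℝ × (E × (E →L[ℝ] E)) => a.2.1))).continuousOn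
  · exact F.continuousOn_N.comp (f := fun a : ℝ × (E × (E →L[ℝ] E)) => a.1)
      (by fun_prop) fun a ha => ha.1
  · exact F.continuousOn_U.comp h1 hm

theorem continuousOn_field :
    ContinuousOn (fun a : ℝ × (E × (E →L[ℝ] E)) => F.field a.1 a.2) (Icc 0 T ×ˢ univ) :=
  (contDiff_frameMap (E := E) (𝔢 := 𝔢) (m := 0)).continuous.comp_continuousOn F.continuousOn_coeff

theorem continuousOn_fieldDeriv :
    ContinuousOn (fun a : ℝ × (E × (E →L[ℝ] E)) => F.fieldDeriv a.1 a.2) (Icc 0 T ×ˢ univ) := by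
  have h1 : ContinuousOn (fun a : ℝ × (E × (E →L[ℝ] E)) => (a.1, a.2.1)) (Icc 0 T ×ˢ univ) := by
    fun_prop
  have hm : MapsTo (fun a : ℝ × (E × (E →L[ℝ] E)) => (a.1, a.2.1)) (Icc 0 T ×ˢ univ)
    (Icc 0 T ×ˢ univ) := fun a ha => ⟨ha.1, mem_univ _⟩
  have h2 := ((contDiff_frameMap (E := E) (𝔢 := 𝔢) (m := 1)).continuous_fderiv
    (by simp)).comp_continuousOn F.continuousOn_coeff
  refine ContinuousOn.clm_comp h2 ?_
  have h3 : ContinuousOn (fun a : ℝ × (E × (E →L[ℝ] E)) => fderiv ℝ F.Γ a.2.1)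
      (Icc 0 T ×ˢ univ) :=
    ((F.contDiff_Γ.continuous_fderiv (by simp)).comp (by fun_prop : Continuous
      (fun a : ℝ × (E × (E →L[ℝ] E)) => a.2.1))).continuousOn
  have h4 : ContinuousOn (fun a : ℝ × (E × (E →L[ℝ] E)) => fderiv ℝ (F.U a.1) a.2.1)
      (Icc 0 T ×ˢ univ) := F.continuousOn_fderiv_U.comp h1 hm
  unfold coeffDeriv
  exact (continuousOn_const.clm_comp (h3.clm_comp continuousOn_const)).add
    (continuousOn_const.clm_comp (continuousOn_const.add (continuousOn_const.clm_comp
      (continuousOn_const.clm_comp (h4.clm_comp continuousOn_const)))))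

theorem hasFDerivAt_field {t : ℝ} (ht : t ∈ Icc 0 T) (y : E × (E →L[ℝ] E)) :
    HasFDerivAt (F.field t) (F.fieldDeriv t y) y := by
  have hΓ : HasFDerivAt (fun y : E × (E →L[ℝ] E) => F.Γ y.1)
      ((fderiv ℝ F.Γ y.1).comp (ContinuousLinearMap.fst ℝ E (E →L[ℝ] E))) y :=
    HasFDerivAt.comp (f := Prod.fst) y
      (F.contDiff_Γ.differentiable (by simp) y.1).hasFDerivAt hasFDerivAt_fst
  have hU : HasFDerivAt (fun y : E × (E →L[ℝ] E) => F.U t y.1)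
      ((fderiv ℝ (F.U t) y.1).comp (ContinuousLinearMap.fst ℝ E (E →L[ℝ] E))) y :=
    HasFDerivAt.comp (f := Prod.fst) y
      (F.differentiable_U t ht y.1).hasFDerivAt hasFDerivAt_fst
  have h1 : HasFDerivAt (F.coeff t) (F.coeffDeriv t y) y := by
    have h2 : HasFDerivAt (F.coeff t) _ y :=
      hΓ.prodMk ((hasFDerivAt_snd (𝕜 := ℝ) (p := y)).prodMk
        ((hasFDerivAt_const (F.N t) y).prodMk hU))
    refine h2.congr_fderiv (ContinuousLinearMap.ext fun h => ?_)
    simp [coeffDeriv]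
  exact HasFDerivAt.comp (g := (frameMap : FrameCoeff E 𝔢 → _)) y
    ((contDiff_frameMap (E := E) (𝔢 := 𝔢) (m := 1)).differentiable (by simp) _).hasFDerivAt h1

/-- The first component of the linearization. -/
noncomputable def velocityDeriv (t : ℝ) (y : E × (E →L[ℝ] E)) (h : E × (E →L[ℝ] E)) (c : ℝ)
    (e : 𝔢) : E := h.2 (F.N t e) + c • fderiv ℝ (F.U t) y.1 h.1

/-- For a fixed control, differentiating the explicit formula `frameMap_apply` by the product rule
gives a second derivative of the same map; uniqueness of derivatives identifies the two. -/
theorem fieldDeriv_apply {t : ℝ} (ht : t ∈ Icc 0 T) (y h : E × (E →L[ℝ] E)) (c : ℝ) (e : 𝔢) :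
    F.fieldDeriv t y h (c, e) = (F.velocityDeriv t y h c e,
      - (fderiv ℝ F.Γ y.1 h.1 (F.field t y (c, e)).1 * y.2 +
        F.Γ y.1 (F.velocityDeriv t y h c e) * y.2 + F.Γ y.1 (F.field t y (c, e)).1 * h.2)) := by
  have h1 : HasFDerivAt (fun y => F.field t y (c, e)) _ y :=
    (F.hasFDerivAt_field ht y).clm_apply (hasFDerivAt_const (c, e) y)
  have hΓ : HasFDerivAt (fun y : E × (E →L[ℝ] E) => F.Γ y.1) _ y :=
    HasFDerivAt.comp (f := Prod.fst) y
      (F.contDiff_Γ.differentiable (by simp) y.1).hasFDerivAt hasFDerivAt_fst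
  have hU : HasFDerivAt (fun y : E × (E →L[ℝ] E) => F.U t y.1) _ y :=
    HasFDerivAt.comp (f := Prod.fst) y
      (F.differentiable_U t ht y.1).hasFDerivAt hasFDerivAt_fst
  have hp : HasFDerivAt (fun y : E × (E →L[ℝ] E) => y.2)
      (ContinuousLinearMap.snd ℝ E (E →L[ℝ] E)) y := hasFDerivAt_snd
  have hv : HasFDerivAt (fun y : E × (E →L[ℝ] E) => y.2 (F.N t e) + c • F.U t y.1) _ y :=
    (hp.clm_apply (hasFDerivAt_const (F.N t e) y)).add (hU.const_smul c)
  have h2 := hv.prodMk (((hΓ.clm_apply hv).mul' hp).neg)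
  have h3 : (fun y => F.field t y (c, e)) = fun y => (y.2 (F.N t e) + c • F.U t y.1,
      - (F.Γ y.1 (y.2 (F.N t e) + c • F.U t y.1) * y.2)) :=
    funext fun y => frameMap_apply (F.coeff t y) c e
  rw [h3] at h1
  have h4 := congrArg (fun A : E × (E →L[ℝ] E) →L[ℝ] E × (E →L[ℝ] E) => A h) (h1.unique h2)
  have h5 : (F.field t y (c, e)).1 = y.2 (F.N t e) + c • F.U t y.1 := by
    rw [field, frameMap_apply]; rfl
  rw [h5]
  refine Eq.trans ?_ (h4.trans ?_)
  · simp
  · ext1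
    · simp [velocityDeriv]
    · simp [velocityDeriv, add_mul]
      abel

end FrameSystem

end FrameField

/-! ### Variations in the moving frame and Cartan's structure equations. -/

namespace FrameSystem

open Filter Topology

variable {E : Type*} [NormedAddCommGroup E] [NormedSpace ℝ E] [CompleteSpace E]
  {𝔢 : Type*} [NormedAddCommGroup 𝔢] [NormedSpace ℝ 𝔢] {T : ℝ} (F : FrameSystem E 𝔢 T)

/-- The components of a variation of a solution with respect to the moving frame: the displacement
and the rotation. -/
noncomputable def invariantVariation (Γ : E → E →L[ℝ] E →L[ℝ] E)
    (a : (E × (E →L[ℝ] E)) × (E × (E →L[ℝ] E))) : E × (E →L[ℝ] E) :=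
  (Ring.inverse a.1.2 a.2.1, Ring.inverse a.1.2 * (a.2.2 + Γ a.1.1 a.2.1 * a.1.2))

theorem hasFDerivAt_invariantVariation {a : (E × (E →L[ℝ] E)) × (E × (E →L[ℝ] E))}
    (u : (E →L[ℝ] E)ˣ) (hu : a.1.2 = u) :
    ∃ D, HasFDerivAt (𝕜 := ℝ) (invariantVariation F.Γ) D a ∧ ∀ h : (E × (E →L[ℝ] E)) × (E × (E →L[ℝ] E)),
      D h = ((↑u⁻¹ : E →L[ℝ] E) (h.2.1 - h.1.2 ((↑u⁻¹ : E →L[ℝ] E) a.2.1)),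
        (↑u⁻¹ : E →L[ℝ] E) * (h.2.2 + fderiv ℝ F.Γ a.1.1 h.1.1 a.2.1 * u +
          F.Γ a.1.1 h.2.1 * u + F.Γ a.1.1 a.2.1 * h.1.2
          - h.1.2 * ((↑u⁻¹ : E →L[ℝ] E) * (a.2.2 + F.Γ a.1.1 a.2.1 * u)))) := by
  have hx : HasFDerivAt (fun a : (E × (E →L[ℝ] E)) × (E × (E →L[ℝ] E)) => a.1.1)
      ((ContinuousLinearMap.fst ℝ E (E →L[ℝ] E)).comp (ContinuousLinearMap.fst ℝ (E × (E →L[ℝ] E)) (E × (E →L[ℝ] E)))) a :=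
    ((ContinuousLinearMap.fst ℝ E (E →L[ℝ] E)).comp
      (ContinuousLinearMap.fst ℝ (E × (E →L[ℝ] E)) (E × (E →L[ℝ] E)))).hasFDerivAt
  have hp : HasFDerivAt (fun a : (E × (E →L[ℝ] E)) × (E × (E →L[ℝ] E)) => a.1.2)
      ((ContinuousLinearMap.snd ℝ E (E →L[ℝ] E)).comp (ContinuousLinearMap.fst ℝ (E × (E →L[ℝ] E)) (E × (E →L[ℝ] E)))) a :=
    ((ContinuousLinearMap.snd ℝ E (E →L[ℝ] E)).comp
      (ContinuousLinearMap.fst ℝ (E × (E →L[ℝ] E)) (E × (E →L[ℝ] E)))).hasFDerivAt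
  have hξ : HasFDerivAt (fun a : (E × (E →L[ℝ] E)) × (E × (E →L[ℝ] E)) => a.2.1)
      ((ContinuousLinearMap.fst ℝ E (E →L[ℝ] E)).comp (ContinuousLinearMap.snd ℝ (E × (E →L[ℝ] E)) (E × (E →L[ℝ] E)))) a :=
    ((ContinuousLinearMap.fst ℝ E (E →L[ℝ] E)).comp
      (ContinuousLinearMap.snd ℝ (E × (E →L[ℝ] E)) (E × (E →L[ℝ] E)))).hasFDerivAt
  have hπ : HasFDerivAt (fun a : (E × (E →L[ℝ] E)) × (E × (E →L[ℝ] E)) => a.2.2)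
      ((ContinuousLinearMap.snd ℝ E (E →L[ℝ] E)).comp (ContinuousLinearMap.snd ℝ (E × (E →L[ℝ] E)) (E × (E →L[ℝ] E)))) a :=
    ((ContinuousLinearMap.snd ℝ E (E →L[ℝ] E)).comp
      (ContinuousLinearMap.snd ℝ (E × (E →L[ℝ] E)) (E × (E →L[ℝ] E)))).hasFDerivAt
  have hi : HasFDerivAt (fun a : (E × (E →L[ℝ] E)) × (E × (E →L[ℝ] E)) => Ring.inverse a.1.2) _ a :=
    HasFDerivAt.comp (g := Ring.inverse)
      (f := fun a : (E × (E →L[ℝ] E)) × (E × (E →L[ℝ] E)) => a.1.2) a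
      (by rw [hu]; exact hasFDerivAt_ringInverse (𝕜 := ℝ) u) hp
  have hΓ : HasFDerivAt (fun a : (E × (E →L[ℝ] E)) × (E × (E →L[ℝ] E)) => F.Γ a.1.1) _ a :=
    HasFDerivAt.comp (f := fun a : (E × (E →L[ℝ] E)) × (E × (E →L[ℝ] E)) => a.1.1) a
      (F.contDiff_Γ.differentiable (by simp) a.1.1).hasFDerivAt hx
  have hinv : Ring.inverse a.1.2 = ↑u⁻¹ := by rw [hu, Ring.inverse_unit]
  refine ⟨_, (hi.clm_apply hξ).prodMk (hi.mul' (hπ.add ((hΓ.clm_apply hξ).mul' hp))), fun h => ?_⟩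
  ext1
  · have e : Ring.inverse a.1.2 h.2.1 + (-((↑u⁻¹ : E →L[ℝ] E) * h.1.2 * (↑u⁻¹ : E →L[ℝ] E))) a.2.1 =
        (↑u⁻¹ : E →L[ℝ] E) (h.2.1 - h.1.2 ((↑u⁻¹ : E →L[ℝ] E) a.2.1)) := by
      rw [hinv, _root_.neg_apply, mul_apply_eq_comp, mul_apply_eq_comp, map_sub, sub_eq_add_neg]
    exact e
  · have e : Ring.inverse a.1.2 * (h.2.2 + (F.Γ a.1.1 a.2.1 * h.1.2 + (F.Γ a.1.1 h.2.1 +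
        fderiv ℝ F.Γ a.1.1 h.1.1 a.2.1) * a.1.2)) + (-(↑u⁻¹ * h.1.2 * ↑u⁻¹)) *
        (a.2.2 + F.Γ a.1.1 a.2.1 * a.1.2) = (↑u⁻¹ : E →L[ℝ] E) * (h.2.2 +
        fderiv ℝ F.Γ a.1.1 h.1.1 a.2.1 * u +
          F.Γ a.1.1 h.2.1 * u + F.Γ a.1.1 a.2.1 * h.1.2
          - h.1.2 * ((↑u⁻¹ : E →L[ℝ] E) * (a.2.2 + F.Γ a.1.1 a.2.1 * u))) := by
      rw [hinv, hu]
      simp only [mul_add, mul_sub, mul_assoc, add_mul, neg_mul]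
      abel
    exact e

theorem contDiffAt_invariantVariation {a : (E × (E →L[ℝ] E)) × (E × (E →L[ℝ] E))}
    (u : (E →L[ℝ] E)ˣ) (hu : a.1.2 = u) : ContDiffAt ℝ 1 (invariantVariation F.Γ) a := by
  have hi : ContDiffAt ℝ 1
      (fun a : (E × (E →L[ℝ] E)) × (E × (E →L[ℝ] E)) => Ring.inverse a.1.2) a :=
    ContDiffAt.comp (g := Ring.inverse)
      (f := fun a : (E × (E →L[ℝ] E)) × (E × (E →L[ℝ] E)) => a.1.2) a
      (by rw [hu]; exact contDiffAt_ringInverse ℝ u) (by fun_prop)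
  have hΓ : ContDiffAt ℝ 1 (fun a : (E × (E →L[ℝ] E)) × (E × (E →L[ℝ] E)) => F.Γ a.1.1) a :=
    F.contDiff_Γ.contDiffAt.comp a (by fun_prop)
  exact (hi.clm_apply (by fun_prop)).prodMk (hi.mul (ContDiffAt.add (by fun_prop)
    ((hΓ.clm_apply (by fun_prop)).mul (by fun_prop))))

/-- The covariant derivative of the drift. -/
noncomputable def covDrift (t : ℝ) (x v : E) : E := fderiv ℝ (F.U t) x v + F.Γ x v (F.U t x)

/-- The linearization of the development equation in terms of the moving frame. -/
theorem isPrimitive_invariantVariation {a b : ℝ} (ha : 0 ≤ a) (hab : a ≤ b) (hb : b ≤ T)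
    {w η : ℝ → 𝔢} {y h : ℝ → E × (E →L[ℝ] E)}
    (hy : IsPrimitive y (fun t => F.field t (y t) (1, w t)) a b)
    (hh : IsPrimitive h (fun t => F.fieldDeriv t (y t) (h t) (1, w t) + F.field t (y t) (0, η t)) a b)
    (hu : ∀ t ∈ Icc a b, IsUnit (y t).2) :
    IsPrimitive (fun t => invariantVariation F.Γ (y t, h t)) (fun t =>
      (Ring.inverse (y t).2 (F.Γ (y t).1 (F.field t (y t) (1, w t)).1 (h t).1 -
          F.Γ (y t).1 (h t).1 (F.field t (y t) (1, w t)).1 + F.covDrift t (y t).1 (h t).1) +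
        (invariantVariation F.Γ (y t, h t)).2 (F.N t (w t)) + F.N t (η t),
       Ring.inverse (y t).2 * (christoffelCurvature F.Γ (y t).1 (F.field t (y t) (1, w t)).1 (h t).1
         * (y t).2))) a b := by
  refine ((hy.prodMk hab hh).comp hab (Φ := invariantVariation F.Γ) fun t ht => ?_).congr hab
    (fun t _ => rfl) (Eventually.of_forall fun t ht => ?_)
  · obtain ⟨u, hu⟩ := hu t ht
    exact F.contDiffAt_invariantVariation u hu.symm
  obtain ⟨u, hu⟩ := hu t ht
  obtain ⟨D, hD, hD'⟩ := F.hasFDerivAt_invariantVariation (a := (y t, h t)) u hu.symm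
  have ht' : t ∈ Icc 0 T := ⟨ha.trans ht.1, ht.2.trans hb⟩
  have hfield : ∀ c e, F.field t (y t) (c, e) = ((u : E →L[ℝ] E) (F.N t e) + c • F.U t (y t).1,
      - (F.Γ (y t).1 ((u : E →L[ℝ] E) (F.N t e) + c • F.U t (y t).1) * u)) := by
    intro c e
    rw [field, frameMap_apply, hu]; rfl
  have hui : ∀ v, (u : E →L[ℝ] E) ((↑u⁻¹ : E →L[ℝ] E) v) = v := fun v => by
    rw [← mul_apply_eq_comp, u.mul_inv]; rfl
  have hiu : ∀ v, (↑u⁻¹ : E →L[ℝ] E) ((u : E →L[ℝ] E) v) = v := fun v => by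
    rw [← mul_apply_eq_comp, u.inv_mul]; rfl
  rw [hD.fderiv, hD', F.fieldDeriv_apply ht', hfield, hfield]
  set x' := (u : E →L[ℝ] E) (F.N t (w t)) + (1 : ℝ) • F.U t (y t).1 with hx'
  have hinv : Ring.inverse (y t).2 = ↑u⁻¹ := by rw [← hu, Ring.inverse_unit]
  have hz : (u : E →L[ℝ] E) (F.N t (w t)) = x' - F.U t (y t).1 := by rw [hx']; simp
  -- The two structure equations. In the first component the derivative of the inverse frame turns
  -- the Christoffel terms into torsion; in the second, the derivatives of `Γ` and the products of
  -- its values form the curvature.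
  ext1
  · simp only [invariantVariation, hinv, covDrift, velocityDeriv, Prod.fst_add, ← hu,
      mul_apply_eq_comp, _root_.add_apply, hz, map_add, map_sub, one_smul, zero_smul, hiu,
      add_zero, _root_.neg_apply, hui]
    simp
    abel
  · simp only [invariantVariation, hinv, covDrift, velocityDeriv, Prod.fst_add, Prod.snd_add, ← hu,
      mul_apply_eq_comp, _root_.add_apply, map_add, map_sub, one_smul, zero_smul, hiu,
      add_zero, _root_.neg_apply, hui, christoffelCurvature]
    have h1 : (u : E →L[ℝ] E) * (↑u⁻¹ : E →L[ℝ] E) = 1 := u.mul_inv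
    have h2 : ∀ B : E →L[ℝ] E, (u : E →L[ℝ] E) * ((↑u⁻¹ : E →L[ℝ] E) * B) = B := fun B => by
      rw [← mul_assoc, h1, one_mul]
    rw [Ring.inverse_unit]
    congr 1
    simp only [neg_mul, mul_assoc, h2, mul_add, add_mul, sub_mul, mul_neg]
    abel

end FrameSystem

/-! ### Horizontal curves -/

section Horizontal

open Filter Topology

variable {d : ℕ} {M : Type*} [TopologicalSpace M] [ChartedSpace (EuclideanSpace ℝ (Fin d)) M]
  [IsManifold (𝓡 d) ∞ M] (cov : AffineConnection d M)

/-- The change of coordinates of points with frames. -/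
noncomputable def frameTransition (d : ℕ) {M : Type*} [TopologicalSpace M]
    [ChartedSpace (EuclideanSpace ℝ (Fin d)) M] (q r : M)
    (y : ModelSpace d × (ModelSpace d →L[ℝ] ModelSpace d)) :
    ModelSpace d × (ModelSpace d →L[ℝ] ModelSpace d) :=
  (transition d q r y.1, fderiv ℝ (transition d q r) y.1 * y.2)

theorem frameTransition_solCoord {q r : M} {γ : ℝ → M} {P : ℝ → ModelSpace d →L[ℝ] ModelSpace d}
    {t : ℝ} (hq : γ t ∈ (coord d q).source) (hr : γ t ∈ (coord d r).source) :
    frameTransition d q r (solCoord d q γ P t) = solCoord d r γ P t := by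
  simp only [frameTransition, solCoord, transition_coord hq,
    frameCoord_eq_fderiv_transition hq hr, mul_assoc]

theorem hasFDerivAt_frameTransition {q r x : M} (hq : x ∈ (coord d q).source)
    (hr : x ∈ (coord d r).source) (p : ModelSpace d →L[ℝ] ModelSpace d) :
    ∃ D, HasFDerivAt (𝕜 := ℝ) (frameTransition d q r) D (coord d q x, p) ∧
      ∀ h : ModelSpace d × (ModelSpace d →L[ℝ] ModelSpace d),
        D h = (fderiv ℝ (transition d q r) (coord d q x) h.1,
          fderiv ℝ (transition d q r) (coord d q x) * h.2 +
            fderiv ℝ (fderiv ℝ (transition d q r)) (coord d q x) h.1 * p) := by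
  have h1 : HasFDerivAt (fun y : ModelSpace d × (ModelSpace d →L[ℝ] ModelSpace d) =>
      transition d q r y.1) _ (coord d q x, p) :=
    HasFDerivAt.comp (f := Prod.fst) (coord d q x, p) (hasFDerivAt_transition hq hr)
      hasFDerivAt_fst
  have h2 : HasFDerivAt (fun y : ModelSpace d × (ModelSpace d →L[ℝ] ModelSpace d) =>
      fderiv ℝ (transition d q r) y.1) _ (coord d q x, p) :=
    HasFDerivAt.comp (f := Prod.fst) (coord d q x, p) (hasFDerivAt_fderiv_transition hq hr)
      hasFDerivAt_fst
  exact ⟨_, h1.prodMk (h2.mul' (hasFDerivAt_snd (𝕜 := ℝ) (p := (coord d q x, p)))), fun h => rfl⟩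

theorem contDiffAt_frameTransition {q r x : M} (hq : x ∈ (coord d q).source)
    (hr : x ∈ (coord d r).source) (p : ModelSpace d →L[ℝ] ModelSpace d) :
    ContDiffAt ℝ 1 (frameTransition d q r) (coord d q x, p) := by
  have h1 : ContDiffAt ℝ 1 (fderiv ℝ (transition d q r)) (coord d q x) :=
    ContDiffAt.fderiv_right (m := 1) (contDiffAt_transition hq hr) (by norm_cast)
  have h0 : ContDiffAt ℝ 1 (transition d q r) (coord d q x) :=
    (contDiffAt_transition hq hr).of_le (by norm_cast)
  exact (ContDiffAt.comp (f := Prod.fst) (coord d q x, p) h0 contDiffAt_fst).prodMk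
    ((ContDiffAt.comp (f := Prod.fst) (coord d q x, p) h1 contDiffAt_fst).mul contDiffAt_snd)

/-- The rate of change of the coordinates of a parallel frame along a curve with velocity `ζ`. -/
noncomputable def horizontalRate (q : M) (γ : ℝ → M) (P : ℝ → ModelSpace d →L[ℝ] ModelSpace d)
    (ζ : ℝ → ModelSpace d) (t : ℝ) : ModelSpace d × (ModelSpace d →L[ℝ] ModelSpace d) :=
  (frameCoord d q (γ t) (ζ t), - (christoffel cov q (coord d q (γ t))
    (frameCoord d q (γ t) (ζ t)) * (solCoord d q γ P t).2))

/-- `P` is a parallel frame along the absolutely continuous curve `γ` with velocity `ζ`. -/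
def IsHorizontal (γ : ℝ → M) (P : ℝ → ModelSpace d →L[ℝ] ModelSpace d)
    (ζ : ℝ → ModelSpace d) (a b : ℝ) : Prop :=
  ContinuousOn γ (Icc a b) ∧ ∀ q c e, c ∈ Icc a b → e ∈ Icc a b → c ≤ e →
    (∀ t ∈ Icc c e, γ t ∈ (coord d q).source) →
    IsPrimitive (solCoord d q γ P) (horizontalRate cov q γ P ζ) c e

variable {cov} {γ : ℝ → M} {P : ℝ → ModelSpace d →L[ℝ] ModelSpace d} {ζ : ℝ → ModelSpace d}
  {a b c : ℝ}

/-- The transformation rule of the Christoffel symbols, applied at each time through the chain rule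
for primitives, makes the horizontality equation independent of the chart. -/
theorem IsPrimitive.change_coord (hab : a ≤ b) {q r : M}
    (hq : ∀ t ∈ Icc a b, γ t ∈ (coord d q).source) (hr : ∀ t ∈ Icc a b, γ t ∈ (coord d r).source)
    (h : IsPrimitive (solCoord d q γ P) (horizontalRate cov q γ P ζ) a b) :
    IsPrimitive (solCoord d r γ P) (horizontalRate cov r γ P ζ) a b := by
  refine (h.comp hab (Φ := frameTransition d q r) fun t ht =>
    contDiffAt_frameTransition (hq t ht) (hr t ht) _).congr hab
    (fun t ht => (frameTransition_solCoord (hq t ht) (hr t ht)).symm)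
    (Eventually.of_forall fun t ht => ?_)
  obtain ⟨D, hD, hD'⟩ := hasFDerivAt_frameTransition (hq t ht) (hr t ht) (solCoord d q γ P t).2
  have e1 : fderiv ℝ (frameTransition d q r) (solCoord d q γ P t) = D := hD.fderiv
  rw [e1, hD']
  have h1 : frameCoord d r (γ t) = fderiv ℝ (transition d q r) (coord d q (γ t)) *
    frameCoord d q (γ t) := frameCoord_eq_fderiv_transition (hq t ht) (hr t ht)
  ext1
  · simp only [horizontalRate, h1]; rfl
  · refine ContinuousLinearMap.ext fun k => ?_
    have h2 := fderiv_transition_christoffel cov (hq t ht) (hr t ht)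
      (frameCoord d q (γ t) (ζ t)) ((solCoord d q γ P t).2 k)
    simp only [horizontalRate, h1, _root_.neg_apply, mul_apply_eq_comp, _root_.add_apply, map_neg]
    rw [h2]
    simp only [solCoord, h1, mul_apply_eq_comp]
    abel

theorem exists_eps_forall_mem (hc : ContinuousOn γ (Icc a b)) {t₀ : ℝ}
    (ht₀ : t₀ ∈ Icc a b) {O : Set M} (hO : IsOpen O) (hq : γ t₀ ∈ O) :
    ∃ ε > 0, ∀ s ∈ Icc a b, |s - t₀| < ε → γ s ∈ O := by
  have h1 := hc t₀ ht₀ (hO.mem_nhds hq)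
  rw [mem_map, Metric.mem_nhdsWithin_iff] at h1
  obtain ⟨ε, hε, h⟩ := h1
  exact ⟨ε, hε, fun s hs hst => h ⟨by rwa [Metric.mem_ball, Real.dist_eq], hs⟩⟩

theorem IsHorizontal.trans (h : IsHorizontal cov γ P ζ a b) (h' : IsHorizontal cov γ P ζ b c)
    (hab : a ≤ b) (hbc : b ≤ c) : IsHorizontal cov γ P ζ a c := by
  refine ⟨?_, fun q s t hs ht hst hq => ?_⟩
  · rw [← Icc_union_Icc_eq_Icc hab hbc]
    exact h.1.union_of_isClosed h'.1 isClosed_Icc isClosed_Icc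
  · rcases le_total t b with htb | htb
    · exact h.2 q s t ⟨hs.1, hst.trans htb⟩ ⟨ht.1, htb⟩ hst hq
    rcases le_total b s with hbs | hbs
    · exact h'.2 q s t ⟨hbs, hs.2⟩ ⟨htb, ht.2⟩ hst hq
    · exact (h.2 q s b ⟨hs.1, hbs⟩ ⟨hab, le_refl _⟩ hbs
        fun r hr => hq r ⟨hr.1, hr.2.trans htb⟩).trans
        (h'.2 q b t ⟨le_refl _, hbc⟩ ⟨htb, ht.2⟩ htb fun r hr => hq r ⟨hbs.trans hr.1, hr.2⟩) hbs htb

theorem isHorizontal_refl (γ : ℝ → M) (P : ℝ → ModelSpace d →L[ℝ] ModelSpace d)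
    (ζ : ℝ → ModelSpace d) (a : ℝ) : IsHorizontal cov γ P ζ a a := by
  refine ⟨by simp, fun q s t hs ht _ _ => ?_⟩
  have hs' : s = a := le_antisymm hs.2 hs.1
  have ht' : t = a := le_antisymm ht.2 ht.1
  subst hs'; subst ht'
  exact ⟨IntervalIntegrable.refl, fun r hr => by
    have : r = t := le_antisymm hr.2 hr.1
    subst this; simp⟩

theorem IsHorizontal.congr (h : IsHorizontal cov γ P ζ a b) {γ' : ℝ → M}
    {P' : ℝ → ModelSpace d →L[ℝ] ModelSpace d} {ζ' : ℝ → ModelSpace d}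
    (hγ : ∀ t ∈ Icc a b, γ' t = γ t) (hP : ∀ t ∈ Icc a b, P' t = P t)
    (hζ : ∀ᵐ t, t ∈ Icc a b → ζ' t = ζ t) : IsHorizontal cov γ' P' ζ' a b := by
  refine ⟨h.1.congr hγ, fun q s t hs ht hst hq => ?_⟩
  have hsub : Icc s t ⊆ Icc a b := Icc_subset_Icc hs.1 ht.2
  refine (h.2 q s t hs ht hst fun r hr => hγ r (hsub hr) ▸ hq r hr).congr hst
    (fun r hr => by simp only [solCoord, hγ r (hsub hr), hP r (hsub hr)]) ?_
  filter_upwards [hζ] with r hr hr'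
  simp only [horizontalRate, solCoord, hγ r (hsub hr'), hP r (hsub hr'), hr (hsub hr')]

theorem IsHorizontal.of_coord (hc : ContinuousOn γ (Icc a b)) {q : M}
    (hq : ∀ t ∈ Icc a b, γ t ∈ (coord d q).source)
    (h : IsPrimitive (solCoord d q γ P) (horizontalRate cov q γ P ζ) a b) :
    IsHorizontal cov γ P ζ a b :=
  ⟨hc, fun _ _ _ hs ht hst hr => IsPrimitive.change_coord hst
    (fun τ hτ => hq τ ⟨hs.1.trans hτ.1, hτ.2.trans ht.2⟩) hr (h.mono hs ht)⟩

/-- It suffices to check horizontality locally, in any chart. -/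
theorem IsHorizontal.of_local (hab : a ≤ b) (hc : ContinuousOn γ (Icc a b))
    (h : ∀ t₀ ∈ Icc a b, ∃ ε > 0, ∀ s ∈ Icc a b, ∀ t ∈ Icc a b, s ≤ t → |s - t₀| < ε →
      |t - t₀| < ε → (∀ τ ∈ Icc s t, γ τ ∈ (coord d (γ t₀)).source) →
      IsPrimitive (solCoord d (γ t₀) γ P) (horizontalRate cov (γ t₀) γ P ζ) s t) :
    IsHorizontal cov γ P ζ a b := by
  refine interval_induction (S := fun t => IsHorizontal cov γ P ζ a t)
    (isHorizontal_refl γ P ζ a) ?_ b ⟨hab, le_refl _⟩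
  intro t₀ ht₀
  obtain ⟨ε, hε, h1⟩ := h t₀ ht₀
  obtain ⟨ε', hε', h2⟩ := exists_eps_forall_mem hc ht₀ (isOpen_coord_source (γ t₀))
    (mem_extChartAt_source (I := 𝓡 d) (γ t₀))
  refine ⟨min ε ε', lt_min hε hε', fun s hs t ht hst hs₀ ht₀ hS => ?_⟩
  have h3 : ∀ τ ∈ Icc s t, γ τ ∈ (coord d (γ t₀)).source := fun τ hτ =>
    h2 τ ⟨hs.1.trans hτ.1, hτ.2.trans ht.2⟩ (by
      rw [abs_lt] at *
      exact ⟨by linarith [hτ.1, (lt_min_iff.1 (neg_lt.1 hs₀.1)).2],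
        by linarith [hτ.2, (lt_min_iff.1 ht₀.2).2]⟩)
  refine hS.trans (.of_coord (hc.mono (Icc_subset_Icc hs.1 ht.2)) h3 ?_) hs.1 hst
  exact h1 s hs t ht hst (hs₀.trans_le (min_le_left _ _)) (ht₀.trans_le (min_le_left _ _)) h3

end Horizontal

/-! ### Horizontal curves and parallel transport -/

section ParallelTransport

open Filter Topology

theorem AbsolutelyContinuousOnInterval.sum {F ι : Type*} [SeminormedAddCommGroup F] {a b : ℝ}
    (s : Finset ι) {f : ι → ℝ → F} (h : ∀ i ∈ s, AbsolutelyContinuousOnInterval (f i) a b) :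
    AbsolutelyContinuousOnInterval (fun t => ∑ i ∈ s, f i t) a b := by
  classical
  induction s using Finset.induction_on with
  | empty =>
    have h0 : LipschitzOnWith 0 (fun _ : ℝ => (0 : F)) (uIcc a b) := (LipschitzWith.const (0 : F)).lipschitzOnWith
    simpa using h0.absolutelyContinuousOnInterval
  | insert i s hi ih =>
    simp only [Finset.sum_insert hi]
    exact (h i (Finset.mem_insert_self i s)).add
      (ih fun j hj => h j (Finset.mem_insert_of_mem hj))

theorem AbsolutelyContinuousOnInterval.clm_comp {V W : Type*} [NormedAddCommGroup V]
    [NormedSpace ℝ V] [NormedAddCommGroup W] [NormedSpace ℝ W] {f : ℝ → V} {a b : ℝ}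
    (h : AbsolutelyContinuousOnInterval f a b) (L : V →L[ℝ] W) :
    AbsolutelyContinuousOnInterval (fun t => L (f t)) a b :=
  h.of_dist_le (K := ‖L‖) fun s _ t _ => by
    rw [dist_eq_norm, dist_eq_norm, ← map_sub]; exact L.le_opNorm _

theorem AbsolutelyContinuousOnInterval.prodMk {V W : Type*} [NormedAddCommGroup V]
    [NormedSpace ℝ V] [NormedAddCommGroup W] [NormedSpace ℝ W] {f : ℝ → V} {g : ℝ → W} {a b : ℝ}
    (h : AbsolutelyContinuousOnInterval f a b) (h' : AbsolutelyContinuousOnInterval g a b) :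
    AbsolutelyContinuousOnInterval (fun t => (f t, g t)) a b := by
  have := (h.clm_comp (ContinuousLinearMap.inl ℝ V W)).add
    (h'.clm_comp (ContinuousLinearMap.inr ℝ V W))
  have e : (fun t => (f t, g t)) = (fun t => ContinuousLinearMap.inl ℝ V W (f t)) +
      fun t => ContinuousLinearMap.inr ℝ V W (g t) := by ext <;> simp
  rwa [e]

variable {d : ℕ} {M : Type*} [TopologicalSpace M] [ChartedSpace (EuclideanSpace ℝ (Fin d)) M]
  [IsManifold (𝓡 d) ∞ M] {cov : AffineConnection d M}

theorem clm_eq_sum_smulRight {F : Type*} [NormedAddCommGroup F] [NormedSpace ℝ F]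
    (B : ModelSpace d →L[ℝ] F) : B = ∑ i, ContinuousLinearMap.smulRightL ℝ (ModelSpace d) F
      (EuclideanSpace.proj i) (B (EuclideanSpace.single i (1 : ℝ))) := by
  ext v
  rw [_root_.sum_apply]
  conv_lhs => rw [euclideanSpace_eq_sum_single v, map_sum]
  refine Finset.sum_congr rfl fun i _ => ?_
  rw [map_smul]
  rfl

theorem AbsolutelyContinuousOnInterval.clm_of_single {F : Type*} [NormedAddCommGroup F]
    [NormedSpace ℝ F] {A : ℝ → ModelSpace d →L[ℝ] F} {a b : ℝ}
    (h : ∀ i, AbsolutelyContinuousOnInterval (fun t => A t (EuclideanSpace.single i (1 : ℝ))) a b) :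
    AbsolutelyContinuousOnInterval A a b := by
  have h0 : ∀ i, AbsolutelyContinuousOnInterval (fun t => ContinuousLinearMap.smulRightL ℝ
      (ModelSpace d) F (EuclideanSpace.proj i) (A t (EuclideanSpace.single i (1 : ℝ)))) a b :=
    fun i => AbsolutelyContinuousOnInterval.clm_comp (V := F) (W := ModelSpace d →L[ℝ] F) (h i)
      (ContinuousLinearMap.smulRightL ℝ (ModelSpace d) F (EuclideanSpace.proj i))
  have h1 := AbsolutelyContinuousOnInterval.sum Finset.univ fun i _ => h0 i
  exact h1.of_dist_le (K := 1) fun s _ t _ => by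
    rw [← clm_eq_sum_smulRight, ← clm_eq_sum_smulRight, one_mul]

theorem hasDerivAt_clm_of_single {F : Type*} [NormedAddCommGroup F] [NormedSpace ℝ F]
    {A : ℝ → ModelSpace d →L[ℝ] F} {A' : ModelSpace d →L[ℝ] F} {t : ℝ}
    (h : ∀ i, HasDerivAt (fun s => A s (EuclideanSpace.single i (1 : ℝ)))
      (A' (EuclideanSpace.single i (1 : ℝ))) t) : HasDerivAt A A' t := by
  have h1 : HasDerivAt (fun s => ∑ i, ContinuousLinearMap.smulRightL ℝ (ModelSpace d) F
      (EuclideanSpace.proj i) (A s (EuclideanSpace.single i (1 : ℝ)))) (∑ i,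
      ContinuousLinearMap.smulRightL ℝ (ModelSpace d) F
      (EuclideanSpace.proj i) (A' (EuclideanSpace.single i (1 : ℝ)))) t :=
    HasDerivAt.fun_sum fun i _ => HasFDerivAt.comp_hasDerivAt t
      (ContinuousLinearMap.hasFDerivAt _) (h i)
  rw [← clm_eq_sum_smulRight A'] at h1
  exact h1.congr_of_eventuallyEq (Eventually.of_forall fun s => clm_eq_sum_smulRight (A s))

theorem extChartAt_tangent (x : M) (v : TangentSpace (𝓡 d) x) (c : TangentBundle (𝓡 d) M) :
    (extChartAt (𝓡 d).tangent (⟨x, v⟩ : TangentBundle (𝓡 d) M) c) =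
      (coord d x c.1, toCoord d x c.1 c.2) := by
  have h := FiberBundle.extChartAt (IB := 𝓡 d) (F := ModelSpace d)
    (E := (TangentSpace (𝓡 d) : M → Type _)) (⟨x, v⟩ : TangentBundle (𝓡 d) M)
  have h2 := congrArg (fun e => e.toFun c) h
  exact h2

section

variable {γ : ℝ → M} {P : ℝ → ModelSpace d →L[ℝ] ModelSpace d} {ζ : ℝ → ModelSpace d} {a b T : ℝ}

theorem IsHorizontal.ae_hasDeriv (hab : a ≤ b) (h : IsHorizontal cov γ P ζ a b) :
    ∀ᵐ t, t ∈ Icc a b →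
      HasMFDerivAt 𝓘(ℝ, ℝ) (𝓡 d) γ t
        ((1 : ℝ →L[ℝ] ℝ).smulRight (ζ t : TangentSpace (𝓡 d) (γ t))) ∧
      ∀ k, HasCovDerivAlongAt cov γ (fun s => P s k) t 0 := by
  have hne : ∀ c : ℝ, ∀ᵐ x : ℝ, x ≠ c := fun c => by simp [ae_iff, measure_singleton]
  have key : ∀ t ∈ Icc a b, ∀ᵐ s, s ∈ Icc a t →
      HasMFDerivAt 𝓘(ℝ, ℝ) (𝓡 d) γ s
        ((1 : ℝ →L[ℝ] ℝ).smulRight (ζ s : TangentSpace (𝓡 d) (γ s))) ∧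
      ∀ k, HasCovDerivAlongAt cov γ (fun s => P s k) s 0 := by
    refine interval_induction ?_ ?_
    · filter_upwards [hne a] with s hs hs'
      exact absurd (le_antisymm hs'.2 hs'.1) hs
    intro t₀ ht₀
    obtain ⟨ε, hε, h1⟩ := exists_eps_forall_mem h.1 ht₀ (isOpen_coord_source (γ t₀))
      (mem_extChartAt_source (I := 𝓡 d) (γ t₀))
    refine ⟨ε, hε, fun s hs t ht hst hs₀ ht₀ hS => ?_⟩
    have h3 : ∀ τ ∈ Icc s t, γ τ ∈ (coord d (γ t₀)).source := fun τ hτ =>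
      h1 τ ⟨hs.1.trans hτ.1, hτ.2.trans ht.2⟩ (by
        rw [abs_lt] at *
        exact ⟨by linarith [hτ.1], by linarith [hτ.2]⟩)
    have h4 := (h.2 _ s t hs ht hst h3).ae_hasDerivAt hst
    filter_upwards [hS, h4, hne a, hne b] with r hr1 hr2 hra hrb hr
    rcases le_total r s with hrs | hrs
    · exact hr1 ⟨hr.1, hrs⟩
    have hr' : r ∈ Icc s t := ⟨hrs, hr.2⟩
    refine (hasDerivAt_solCoord_iff cov (h3 r hr')).2 ⟨?_, hr2 hr'⟩
    exact h.1.continuousAt (Icc_mem_nhds (lt_of_le_of_ne hr.1 (Ne.symm hra))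
      (lt_of_le_of_ne (hr.2.trans ht.2) hrb))
  exact key b ⟨hab, le_refl _⟩

/-- Continuity of a frame along a curve, in coordinates. -/
theorem continuousOn_totalSpace_iff {V : ℝ → ModelSpace d} {s : Set ℝ}
    (hγ : ContinuousOn γ s) :
    ContinuousOn (fun t => (⟨γ t, V t⟩ : TangentBundle (𝓡 d) M)) s ↔
      ∀ t ∈ s, ContinuousWithinAt (fun τ => frameCoord d (γ t) (γ τ) (V τ)) s t := by
  refine forall₂_congr fun t ht => ?_
  refine (FiberBundle.continuousWithinAt_totalSpace (F := ModelSpace d)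
    (E := (TangentSpace (𝓡 d) : M → Type _)) _).trans ?_
  exact ⟨fun h => h.2, fun h => ⟨hγ t ht, h⟩⟩

theorem exists_nhd_subset_Icc {t ε : ℝ} (ht : t ∈ Icc 0 T) (hε : 0 < ε) :
    max 0 (t - ε) ≤ t ∧ t ≤ min T (t + ε) ∧ max 0 (t - ε) ∈ Icc 0 T ∧ min T (t + ε) ∈ Icc 0 T ∧
      ∀ s ∈ Icc (max 0 (t - ε)) (min T (t + ε)), s ∈ Icc 0 T ∧ |s - t| ≤ ε := by
  have h1 : max 0 (t - ε) ≤ t := max_le ht.1 (by linarith)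
  have h2 : t ≤ min T (t + ε) := le_min ht.2 (by linarith)
  refine ⟨h1, h2, ⟨le_max_left _ _, h1.trans ht.2⟩, ⟨ht.1.trans h2, min_le_left _ _⟩,
    fun s hs => ⟨⟨(le_max_left _ _).trans hs.1, hs.2.trans (min_le_left _ _)⟩, ?_⟩⟩
  have h3 := (le_max_right _ _).trans hs.1
  have h4 := hs.2.trans (min_le_right _ _)
  rw [abs_le]
  exact ⟨by linarith, by linarith⟩

theorem IsHorizontal.exists_isPrimitive (h : IsHorizontal cov γ P ζ 0 T) {t : ℝ}
    (ht : t ∈ Icc 0 T) : ∃ ε > 0, IsPrimitive (solCoord d (γ t) γ P)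
      (horizontalRate cov (γ t) γ P ζ) (max 0 (t - ε)) (min T (t + ε)) := by
  obtain ⟨ε, hε, h1⟩ := exists_eps_forall_mem h.1 ht (isOpen_coord_source (γ t))
      (mem_extChartAt_source (I := 𝓡 d) (γ t))
  obtain ⟨h2, h3, h4, h5, h6⟩ := exists_nhd_subset_Icc ht (half_pos hε)
  exact ⟨ε / 2, half_pos hε, h.2 _ _ _ h4 h5 (h2.trans h3) fun s hs =>
    h1 s (h6 s hs).1 ((h6 s hs).2.trans_lt (half_lt_self hε))⟩

theorem IsHorizontal.isACCurve (h : IsHorizontal cov γ P ζ 0 T) : IsACCurve (𝓡 d) T γ := by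
  refine ⟨h.1, fun t ht => ?_⟩
  obtain ⟨ε, hε, h1⟩ := h.exists_isPrimitive ht
  obtain ⟨h2, h3, -⟩ := exists_nhd_subset_Icc ht hε
  exact ⟨ε, hε, AbsolutelyContinuousOnInterval.clm_comp (h1.absolutelyContinuous (h2.trans h3))
    (ContinuousLinearMap.fst ℝ _ _)⟩

theorem IsHorizontal.isACCurve_tangent (h : IsHorizontal cov γ P ζ 0 T) (v : ModelSpace d) :
    IsACCurve (𝓡 d).tangent T (fun t => (⟨γ t, P t v⟩ : TangentBundle (𝓡 d) M)) := by
  have hev : ∀ t, (fun s => frameCoord d (γ t) (γ s) (P s v)) = fun s =>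
      ((ContinuousLinearMap.apply ℝ (ModelSpace d) v).comp (ContinuousLinearMap.snd ℝ (ModelSpace d)
        (ModelSpace d →L[ℝ] ModelSpace d))) (solCoord d (γ t) γ P s) := fun t => rfl
  refine ⟨(continuousOn_totalSpace_iff h.1).2 fun t ht => ?_, fun t ht => ?_⟩
  · obtain ⟨ε, hε, h1⟩ := h.exists_isPrimitive ht
    obtain ⟨h2, h3, -⟩ := exists_nhd_subset_Icc ht hε
    rw [hev]
    refine (ContinuousLinearMap.continuous _).continuousAt.comp_continuousWithinAt ?_
    refine ((h1.continuousOn (h2.trans h3)) t ⟨h2, h3⟩).mono_of_mem_nhdsWithin ?_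
    rw [Metric.mem_nhdsWithin_iff]
    refine ⟨ε, hε, fun s hs => ?_⟩
    have h5 := hs.1
    rw [Metric.mem_ball, Real.dist_eq, abs_lt] at h5
    exact ⟨max_le hs.2.1 (by linarith), le_min hs.2.2 (by linarith)⟩
  · obtain ⟨ε, hε, h1⟩ := h.exists_isPrimitive ht
    obtain ⟨h2, h3, -⟩ := exists_nhd_subset_Icc ht hε
    refine ⟨ε, hε, ?_⟩
    have h4 := h1.absolutelyContinuous (h2.trans h3)
    simp only [extChartAt_tangent]
    refine AbsolutelyContinuousOnInterval.prodMk
      (AbsolutelyContinuousOnInterval.clm_comp h4 (ContinuousLinearMap.fst ℝ _ _)) ?_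
    have := AbsolutelyContinuousOnInterval.clm_comp h4
      ((ContinuousLinearMap.apply ℝ (ModelSpace d) v).comp (ContinuousLinearMap.snd ℝ (ModelSpace d)
        (ModelSpace d →L[ℝ] ModelSpace d)))
    exact this

theorem IsHorizontal.isParallelTransport (hT : 0 ≤ T) (h : IsHorizontal cov γ P ζ 0 T) {o : M}
    (h0 : γ 0 = o) (hP : P 0 = 1) : IsParallelTransport cov T o γ P := by
  intro v
  refine ⟨?_, h.isACCurve_tangent v, ?_⟩
  · rw [hP]; subst h0; rfl
  · rw [ae_restrict_iff' measurableSet_Icc]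
    filter_upwards [h.ae_hasDeriv hT] with t ht htm
    exact (ht htm).2 v

theorem IsParallelTransport.initial {o : M} (h : IsParallelTransport cov T o γ P) :
    γ 0 = o ∧ P 0 = 1 := by
  refine ⟨congrArg TotalSpace.proj (h 0).1, ContinuousLinearMap.ext fun v => ?_⟩
  have h1 := (TotalSpace.mk.inj (h v).1).2
  exact eq_of_heq h1

/-- A parallel transport along an absolutely continuous curve is horizontal. -/
theorem IsParallelTransport.isHorizontal (hT : 0 ≤ T) {o : M} (hγ : IsACCurve (𝓡 d) T γ)
    (h : IsParallelTransport cov T o γ P)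
    (hd : ∀ᵐ t, t ∈ Icc 0 T → HasMFDerivAt 𝓘(ℝ, ℝ) (𝓡 d) γ t
        ((1 : ℝ →L[ℝ] ℝ).smulRight (ζ t : TangentSpace (𝓡 d) (γ t))))
    (hint : ∀ q, ∀ s ∈ Icc 0 T, ∀ t ∈ Icc 0 T, s ≤ t → (∀ τ ∈ Icc s t, γ τ ∈ (coord d q).source) →
      ContinuousOn (solCoord d q γ P) (Icc s t) →
      IntervalIntegrable (horizontalRate cov q γ P ζ) volume s t) :
    IsHorizontal cov γ P ζ 0 T := by
  have hcov : ∀ᵐ t, t ∈ Icc 0 T → ∀ i : Fin d,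
      HasCovDerivAlongAt cov γ (fun s => P s (EuclideanSpace.single i (1 : ℝ))) t 0 := by
    have : ∀ i : Fin d, ∀ᵐ t, t ∈ Icc 0 T →
        HasCovDerivAlongAt cov γ (fun s => P s (EuclideanSpace.single i (1 : ℝ))) t 0 := fun i => by
      have h1 := (h (EuclideanSpace.single i (1 : ℝ))).2.2
      rwa [ae_restrict_iff' measurableSet_Icc] at h1
    filter_upwards [ae_all_iff.2 this] with t ht htm i using ht i htm
  refine IsHorizontal.of_local hT hγ.1 fun t₀ ht₀ => ?_
  obtain ⟨ε₀, hε₀, hx⟩ := hγ.2 t₀ ht₀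
  choose ε hε hV using fun i : Fin d => (h (EuclideanSpace.single i (1 : ℝ))).2.1.2 t₀ ht₀
  -- Absolute continuity is given separately for the base curve and for the transport of each basis
  -- vector, each with its own radius; there are finitely many, so one radius serves all.
  obtain ⟨δ, hδ, hδε⟩ : ∃ δ > 0, δ ≤ ε₀ ∧ ∀ i, δ ≤ ε i := by
    have h1 : ∀ᶠ δ in 𝓝[>] (0 : ℝ), δ ≤ ε₀ ∧ ∀ i, δ ≤ ε i :=
      ((eventually_le_nhds hε₀).filter_mono nhdsWithin_le_nhds).and (eventually_all.2 fun i =>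
        (eventually_le_nhds (hε i)).filter_mono nhdsWithin_le_nhds)
    obtain ⟨δ, h2, h3⟩ := (h1.and self_mem_nhdsWithin).exists
    exact ⟨δ, h3, h2⟩
  refine ⟨δ, hδ, fun s hs t ht hst hs₀ ht₀' hsrc => ?_⟩
  rw [abs_lt] at hs₀ ht₀'
  have hsub : ∀ ε', δ ≤ ε' → uIcc s t ⊆ uIcc (max 0 (t₀ - ε')) (min T (t₀ + ε')) := by
    intro ε' hε'
    obtain ⟨h2, h3, -⟩ := exists_nhd_subset_Icc ht₀ (hδ.trans_le hε')
    rw [uIcc_of_le hst, uIcc_of_le (h2.trans h3)]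
    exact Icc_subset_Icc (max_le hs.1 (by linarith)) (le_min ht.2 (by linarith))
  have hac : AbsolutelyContinuousOnInterval (solCoord d (γ t₀) γ P) s t := by
    refine AbsolutelyContinuousOnInterval.prodMk (hx.mono (hsub _ hδε.1)) ?_
    have h1 : ∀ i : Fin d, AbsolutelyContinuousOnInterval (fun τ => (frameCoord d (γ t₀) (γ τ) * P τ)
        (EuclideanSpace.single i (1 : ℝ))) s t := fun i => by
      have h2 := (hV i).mono (hsub _ (hδε.2 i))
      simp only [extChartAt_tangent] at h2
      exact AbsolutelyContinuousOnInterval.clm_comp h2 (ContinuousLinearMap.snd ℝ (ModelSpace d)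
        (ModelSpace d))
    exact AbsolutelyContinuousOnInterval.clm_of_single h1
  have hcont : ContinuousOn (solCoord d (γ t₀) γ P) (Icc s t) := by
    simpa [uIcc_of_le hst] using hac.continuousOn
  refine IsPrimitive.of_absolutelyContinuous hst hac (hint _ s hs t ht hst hsrc hcont) ?_
  filter_upwards [hd, hcov] with τ h1 h2 hτ
  have hτ' : τ ∈ Icc 0 T := ⟨hs.1.trans hτ.1, hτ.2.trans ht.2⟩
  have h3 := (hasMFDerivAt_curve_iff (hsrc τ hτ) _).1 (h1 hτ')
  refine h3.2.prodMk (hasDerivAt_clm_of_single fun i => ?_)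
  obtain ⟨x', -, h5, h6⟩ := (hasCovDerivAlongAt_iff cov (hsrc τ hτ)).1 (h2 hτ' i)
  rw [h5.unique h3.2] at h6
  refine h6.congr_deriv ?_
  exact (congrArg (· - _) (map_zero (frameCoord d (γ t₀) (γ τ)))).trans (zero_sub _)

end

end ParallelTransport

/-! ### The positive square root -/

section PosSqrt

variable {𝔢 : Type*} [NormedAddCommGroup 𝔢] [InnerProductSpace ℝ 𝔢] [FiniteDimensional ℝ 𝔢]

theorem ContinuousLinearMap.IsPositive.inner_map_left {A : 𝔢 →L[ℝ] 𝔢} (hA : A.IsPositive)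
    (x y : 𝔢) : inner ℝ (A x) y = inner ℝ x (A y) := hA.isSymmetric x y

theorem exists_isPositive_sq {A : 𝔢 →L[ℝ] 𝔢} (hA : A.IsPositive) :
    ∃ S : 𝔢 →L[ℝ] 𝔢, S.IsPositive ∧ S ∘L S = A := by
  have hs : (A : 𝔢 →ₗ[ℝ] 𝔢).IsSymmetric := hA.isSymmetric
  let e := hs.eigenvectorBasis rfl
  let l := hs.eigenvalues rfl
  have hl : ∀ i, 0 ≤ l i := fun i => by
    have h1 := hA.inner_nonneg_right (e i)
    have h2 : A (e i) = l i • e i := hs.apply_eigenvectorBasis rfl i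
    rw [h2, inner_smul_right, real_inner_self_eq_norm_sq, e.orthonormal.1 i] at h1
    simpa using h1
  let S : 𝔢 →L[ℝ] 𝔢 := ∑ i, (Real.sqrt (l i)) • (innerSL ℝ (e i)).smulRight (e i)
  have hS : ∀ x, S x = ∑ i, (Real.sqrt (l i) * inner ℝ (e i) x) • e i := fun x => by
    simp [S, _root_.sum_apply, smul_smul]
  have hSe : ∀ i, S (e i) = Real.sqrt (l i) • e i := fun i => by
    rw [hS, Finset.sum_eq_single i]
    · simp [e.orthonormal.1 i]
    · intro j _ hj
      rw [e.orthonormal.2 hj, mul_zero, zero_smul]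
    · simp
  refine ⟨S, ?_, ?_⟩
  · rw [ContinuousLinearMap.isPositive_iff]
    refine ⟨fun x y => ?_, fun x => ?_⟩
    · rw [ContinuousLinearMap.coe_coe, hS, hS, sum_inner, inner_sum]
      refine Finset.sum_congr rfl fun i _ => ?_
      rw [inner_smul_left, inner_smul_right, real_inner_comm x (e i)]
      simp only [conj_trivial]
      ring
    · rw [hS, sum_inner]
      refine Finset.sum_nonneg fun i _ => ?_
      rw [inner_smul_left, conj_trivial, mul_assoc, real_inner_comm]
      exact mul_nonneg (Real.sqrt_nonneg _) (mul_self_nonneg _)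
  · refine ContinuousLinearMap.coe_injective (e.toBasis.ext fun i => ?_)
    have h2 : A (e i) = l i • e i := hs.apply_eigenvectorBasis rfl i
    simp only [OrthonormalBasis.coe_toBasis, ContinuousLinearMap.coe_coe]
    rw [h2, ContinuousLinearMap.comp_apply, hSe, map_smul, hSe, smul_smul,
      Real.mul_self_sqrt (hl i)]

theorem posSqrt_spec {A : 𝔢 →L[ℝ] 𝔢} (hA : A.IsPositive) :
    (posSqrt A).IsPositive ∧ posSqrt A ∘L posSqrt A = A := by
  rw [posSqrt, dif_pos (exists_isPositive_sq hA)]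
  exact (exists_isPositive_sq hA).choose_spec

/-- Let `e` be a unit eigenvector of `S - R` with eigenvalue `l`. Then `⟪e, (S² - R²) e⟫ = l (⟪e, S
e⟫ + ⟪e, R e⟫)`. Positivity bounds `|l| = |⟪e, S e⟫ - ⟪e, R e⟫|` by the sum in the bracket, so `l² ≤
‖S² - R²‖`. Continuity of `Σ_t^{1/2}` in `t` is a consequence. -/
theorem norm_sub_sq_le_of_isPositive {S R : 𝔢 →L[ℝ] 𝔢} (hS : S.IsPositive) (hR : R.IsPositive) :
    ‖S - R‖ ≤ Real.sqrt ‖S ∘L S - R ∘L R‖ := by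
  set D := S - R with hD
  have hs : (D : 𝔢 →ₗ[ℝ] 𝔢).IsSymmetric := hS.isSymmetric.sub hR.isSymmetric
  let e := hs.eigenvectorBasis rfl
  let l := hs.eigenvalues rfl
  have he : ∀ i, D (e i) = l i • e i := hs.apply_eigenvectorBasis rfl
  have hl : ∀ i, l i ^ 2 ≤ ‖S ∘L S - R ∘L R‖ := fun i => by
    have h1 : inner ℝ (e i) ((S ∘L S - R ∘L R) (e i)) =
        l i * (inner ℝ (e i) (S (e i)) + inner ℝ (e i) (R (e i))) := by
      have h2 : (S ∘L S - R ∘L R) (e i) = S (D (e i)) + D (R (e i)) := by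
        simp [hD]
      rw [h2, inner_add_right, ← ContinuousLinearMap.coe_coe D, ← hs (e i), ContinuousLinearMap.coe_coe,
        he, map_smul, inner_smul_right, inner_smul_left]
      simp; ring
    have h3 : inner ℝ (e i) (S (e i)) - inner ℝ (e i) (R (e i)) = l i := by
      rw [← inner_sub_right]
      have : S (e i) - R (e i) = D (e i) := rfl
      rw [this, he, inner_smul_right, real_inner_self_eq_norm_sq, e.orthonormal.1 i]
      simp
    have h4 := hS.inner_nonneg_right (e i)
    have h5 := hR.inner_nonneg_right (e i)
    have h6 : |inner ℝ (e i) ((S ∘L S - R ∘L R) (e i))| ≤ ‖S ∘L S - R ∘L R‖ := by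
      refine (abs_real_inner_le_norm _ _).trans ?_
      rw [e.orthonormal.1 i, one_mul]
      refine ((S ∘L S - R ∘L R).le_opNorm _).trans ?_
      rw [e.orthonormal.1 i, mul_one]
    rw [h1, abs_mul, abs_of_nonneg (add_nonneg h4 h5)] at h6
    refine le_trans ?_ h6
    rw [← sq_abs, sq]
    refine mul_le_mul_of_nonneg_left ?_ (abs_nonneg _)
    rw [abs_le]
    exact ⟨by linarith, by linarith⟩
  refine D.opNorm_le_bound (Real.sqrt_nonneg _) fun x => ?_
  refine abs_le_of_sq_le_sq' ?_ (by positivity) |>.2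
  rw [mul_pow, Real.sq_sqrt (norm_nonneg _), ← e.sum_sq_norm_inner_right x,
    ← e.sum_sq_norm_inner_right (D x), Finset.mul_sum]
  refine Finset.sum_le_sum fun i _ => ?_
  have h7 : inner ℝ (e i) (D x) = l i * inner ℝ (e i) x := by
    rw [← ContinuousLinearMap.coe_coe D, ← hs (e i), ContinuousLinearMap.coe_coe, he,
      inner_smul_left]
    simp
  rw [h7, norm_mul, mul_pow, Real.norm_eq_abs, sq_abs]
  exact mul_le_mul_of_nonneg_right (hl i) (by positivity)

theorem ContinuousOn.posSqrt {X : Type*} [TopologicalSpace X] {A : X → 𝔢 →L[ℝ] 𝔢} {s : Set X}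
    (hA : ContinuousOn A s) (hp : ∀ t ∈ s, (A t).IsPositive) :
    ContinuousOn (fun t => posSqrt (A t)) s := by
  intro t ht
  rw [ContinuousWithinAt, tendsto_iff_norm_sub_tendsto_zero]
  have h1 : Filter.Tendsto (fun r => Real.sqrt ‖A r - A t‖) (nhdsWithin t s) (nhds 0) := by
    have := (tendsto_iff_norm_sub_tendsto_zero.1 (hA t ht)).sqrt
    rwa [Real.sqrt_zero] at this
  refine squeeze_zero' (Filter.Eventually.of_forall fun _ => norm_nonneg _) ?_ h1
  filter_upwards [self_mem_nhdsWithin] with r hr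
  have h2 := norm_sub_sq_le_of_isPositive (posSqrt_spec (hp r hr)).1 (posSqrt_spec (hp t ht)).1
  rwa [(posSqrt_spec (hp r hr)).2, (posSqrt_spec (hp t ht)).2] at h2

end PosSqrt

/-! ### Uniqueness for control systems -/

/-- Both solutions stay in one closed ball, compact in finite dimension, on which the field is
Lipschitz in the state uniformly in time. The difference then satisfies a linear inequality with an
integrable coefficient. -/
theorem IsPrimitive.eq_of_control {V : Type*} [NormedAddCommGroup V] [NormedSpace ℝ V]
    [FiniteDimensional ℝ V] {𝔢 : Type*} [NormedAddCommGroup 𝔢] [NormedSpace ℝ 𝔢] {a b : ℝ}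
    (hab : a ≤ b) {f : ℝ → V → 𝔢 →L[ℝ] V} {f' : ℝ → V → V →L[ℝ] 𝔢 →L[ℝ] V}
    (hf' : ContinuousOn (fun p : ℝ × V => f' p.1 p.2) (Icc a b ×ˢ univ))
    (hf : ∀ t ∈ Icc a b, ∀ y, HasFDerivAt (f t) (f' t y) y) {w : ℝ → 𝔢}
    (hw : IntervalIntegrable w volume a b) {y z : ℝ → V}
    (hy : IsPrimitive y (fun t => f t (y t) (w t)) a b)
    (hz : IsPrimitive z (fun t => f t (z t) (w t)) a b) {t₀ : ℝ} (ht₀ : t₀ ∈ Icc a b)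
    (h0 : y t₀ = z t₀) : ∀ t ∈ Icc a b, y t = z t := by
  have : CompleteSpace V := FiniteDimensional.complete ℝ V
  have : ProperSpace V := FiniteDimensional.proper ℝ V
  obtain ⟨R, hR⟩ := isCompact_Icc.exists_bound_of_continuousOn (hy.continuousOn hab)
  obtain ⟨R', hR'⟩ := isCompact_Icc.exists_bound_of_continuousOn (hz.continuousOn hab)
  obtain ⟨C, hC⟩ := (isCompact_Icc.prod (isCompact_closedBall (0 : V)
    (max R R'))).exists_bound_of_continuousOn (hf'.mono (prod_mono_right (subset_univ _)))
  have hC0 : 0 ≤ C := (norm_nonneg _).trans (hC (a, y a) ⟨⟨le_refl _, hab⟩, by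
    rw [mem_closedBall_zero_iff]; exact (hR a ⟨le_refl _, hab⟩).trans (le_max_left _ _)⟩)
  have hd : IsPrimitive (fun t => y t - z t) (fun t => f t (y t) (w t) - f t (z t) (w t)) a b :=
    ⟨hy.integrable.sub hz.integrable, fun t ht => by
      rw [intervalIntegral.integral_sub, hy.eq t ht, hz.eq t ht]
      · abel
      · exact hy.intervalIntegrable_mono ⟨le_refl _, hab⟩ ht
      · exact hz.intervalIntegrable_mono ⟨le_refl _, hab⟩ ht⟩
  have h1 := hd.eq_zero_of_linear (m := fun t => C * ‖w t‖) (hw.norm.const_mul C)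
    (fun s => by positivity) (Filter.Eventually.of_forall fun t ht => ?_) ht₀ (sub_eq_zero.2 h0)
  · exact fun t ht => sub_eq_zero.1 (h1 t ht)
  · have h2 : ‖f t (y t) - f t (z t)‖ ≤ C * ‖y t - z t‖ :=
      (convex_closedBall (0 : V) (max R R')).norm_image_sub_le_of_norm_hasFDerivWithin_le
        (fun x _ => (hf t ht x).hasFDerivWithinAt) (fun x hx => hC (t, x) ⟨ht, hx⟩)
        (by rw [mem_closedBall_zero_iff]; exact (hR' t ht).trans (le_max_right _ _))
        (by rw [mem_closedBall_zero_iff]; exact (hR t ht).trans (le_max_left _ _))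
    rw [← _root_.sub_apply]
    refine ((f t (y t) - f t (z t)).le_opNorm _).trans ?_
    calc ‖f t (y t) - f t (z t)‖ * ‖w t‖ ≤ C * ‖y t - z t‖ * ‖w t‖ := by gcongr
      _ = C * ‖w t‖ * ‖y t - z t‖ := by ring

/-! ### Cutting off the coefficients -/

section Cutoff

open Filter Topology

variable {E F : Type*} [NormedAddCommGroup E] [NormedSpace ℝ E] [FiniteDimensional ℝ E]
  [NormedAddCommGroup F] [NormedSpace ℝ F]

theorem exists_bump {O : Set E} (hO : IsOpen O) {x₀ : E} (hx₀ : x₀ ∈ O) :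
    ∃ ρ : E → ℝ, ContDiff ℝ ∞ ρ ∧ tsupport ρ ⊆ O ∧ ∀ᶠ x in 𝓝 x₀, ρ x = 1 := by
  obtain ⟨ε, hε, hb⟩ := Metric.isOpen_iff.1 hO x₀ hx₀
  let f : ContDiffBump x₀ := ⟨ε / 4, ε / 2, by positivity, by linarith⟩
  refine ⟨f, f.contDiff, ?_, f.eventuallyEq_one⟩
  rw [f.tsupport_eq]
  exact (Metric.closedBall_subset_ball (half_lt_self hε)).trans hb

theorem contDiff_smul_of_tsupport {n : ℕ∞ω} {O : Set E} (hO : IsOpen O) {ρ : E → ℝ}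
    (hρ : ContDiff ℝ n ρ) (hs : tsupport ρ ⊆ O) {g : E → F} (hg : ContDiffOn ℝ n g O) :
    ContDiff ℝ n fun x => ρ x • g x := by
  rw [contDiff_iff_contDiffAt]
  intro x
  by_cases hx : x ∈ O
  · exact hρ.contDiffAt.smul (hg.contDiffAt (hO.mem_nhds hx))
  · have h1 : (fun x => ρ x • g x) =ᶠ[𝓝 x] fun _ => 0 := by
      filter_upwards [(notMem_tsupport_iff_eventuallyEq.1 fun h => hx (hs h))] with y hy
      rw [hy, Pi.zero_apply, zero_smul]
    exact contDiffAt_const.congr_of_eventuallyEq h1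

theorem continuousOn_smul_of_tsupport {I : Set ℝ} {O : Set E} (hO : IsOpen O) {ρ : E → ℝ}
    (hρ : Continuous ρ) (hs : tsupport ρ ⊆ O) {g : ℝ × E → F} (hg : ContinuousOn g (I ×ˢ O)) :
    ContinuousOn (fun p : ℝ × E => ρ p.2 • g p) (I ×ˢ univ) := by
  rintro ⟨t, x⟩ ⟨ht, -⟩
  by_cases hx : x ∈ O
  · have h1 : ContinuousWithinAt g (I ×ˢ univ) (t, x) := by
      refine (hg (t, x) ⟨ht, hx⟩).mono_of_mem_nhdsWithin ?_
      rw [nhdsWithin_prod_eq]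
      exact prod_mem_prod self_mem_nhdsWithin (mem_nhdsWithin_of_mem_nhds (hO.mem_nhds hx))
    exact (hρ.comp continuous_snd).continuousWithinAt.smul h1
  · have h1 : (fun p : ℝ × E => ρ p.2 • g p) =ᶠ[𝓝 (t, x)] fun _ => 0 := by
      have h2 := (notMem_tsupport_iff_eventuallyEq.1 fun h => hx (hs h))
      filter_upwards [continuous_snd.continuousAt.eventually h2] with p hp
      simp only [Function.comp, Pi.zero_apply] at hp ⊢
      rw [hp, zero_smul]
    exact (continuousAt_const.congr_of_eventuallyEq (h1)).continuousWithinAt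

theorem hasFDerivAt_of_contDiffOn_prod {I : Set ℝ} {O : Set E} (hO : IsOpen O) {g : ℝ × E → F}
    (hg : ContDiffOn ℝ 1 g (I ×ˢ O)) {t : ℝ} (ht : t ∈ I) {x : E} (hx : x ∈ O) :
    HasFDerivAt (fun y => g (t, y))
      ((fderivWithin ℝ g (I ×ˢ O) (t, x)).comp (ContinuousLinearMap.inr ℝ ℝ E)) x := by
  have h1 := (hg.differentiableOn (by simp) (t, x) ⟨ht, hx⟩).hasFDerivWithinAt
  have h2 : HasFDerivWithinAt (fun y => g (t, y)) _ O x :=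
    HasFDerivWithinAt.comp x h1 (hasFDerivAt_prodMk_right t x).hasFDerivWithinAt
      (fun y hy => ⟨ht, hy⟩)
  exact h2.hasFDerivAt (hO.mem_nhds hx)

variable {𝔢 : Type*} [NormedAddCommGroup 𝔢] [NormedSpace ℝ 𝔢]

/-- The connection and the drift are multiplied by a bump function supported in the chart, so that
the flow theorem for globally defined systems applies. They agree with the original ones as germs at
the points of `V`, so their derivatives agree there too. -/
theorem exists_frameSystem {T : ℝ} (hT : 0 < T) {O : Set E} (hO : IsOpen O)
    {Γ : E → E →L[ℝ] E →L[ℝ] E} (hΓ : ContDiffOn ℝ 1 Γ O) {U : ℝ → E → E}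
    (hU : ContDiffOn ℝ 1 (fun p : ℝ × E => U p.1 p.2) (Icc 0 T ×ˢ O)) {N : ℝ → 𝔢 →L[ℝ] E}
    (hN : ContinuousOn N (Icc 0 T)) {x₀ : E} (hx₀ : x₀ ∈ O) :
    ∃ F : FrameSystem E 𝔢 T, F.N = N ∧ ∃ V, IsOpen V ∧ x₀ ∈ V ∧ V ⊆ O ∧
      ∀ x ∈ V, F.Γ =ᶠ[𝓝 x] Γ ∧ ∀ t, F.U t =ᶠ[𝓝 x] U t := by
  obtain ⟨ρ, hρ, hs, h1⟩ := exists_bump hO hx₀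
  have hud : UniqueDiffOn ℝ (Icc 0 T ×ˢ O) := (uniqueDiffOn_Icc hT).prod hO.uniqueDiffOn
  have hd : ∀ t ∈ Icc 0 T, ∀ x ∈ O, HasFDerivAt (fun y => ρ y • U t y)
      (ρ x • (fderivWithin ℝ (fun p : ℝ × E => U p.1 p.2) (Icc 0 T ×ˢ O) (t, x)).comp
        (ContinuousLinearMap.inr ℝ ℝ E) + (fderiv ℝ ρ x).smulRight (U t x)) x :=
    fun t ht x hx => (hρ.differentiable (by simp) x).hasFDerivAt.smul
      (hasFDerivAt_of_contDiffOn_prod hO hU ht hx)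
  have hz : ∀ t, ∀ x ∉ O, (fun y => ρ y • U t y) =ᶠ[𝓝 x] fun _ => 0 := fun t x hx => by
    filter_upwards [(notMem_tsupport_iff_eventuallyEq.1 fun h => hx (hs h))] with y hy
    rw [hy, Pi.zero_apply, zero_smul]
  have hdz : ∀ x ∉ O, ρ x = 0 ∧ fderiv ℝ ρ x = 0 := fun x hx => by
    have h2 := (notMem_tsupport_iff_eventuallyEq.1 fun h => hx (hs h))
    exact ⟨h2.eq_of_nhds, by rw [h2.fderiv_eq]; simp⟩
  obtain ⟨V, hV, hVo, hxV⟩ := eventually_nhds_iff.1 (h1.and (hO.mem_nhds hx₀))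
  refine ⟨⟨fun x => ρ x • Γ x, fun t x => ρ x • U t x, N,
    contDiff_smul_of_tsupport hO (hρ.of_le (by norm_cast)) hs hΓ, fun t ht x => ?_, ?_, ?_, hN⟩, rfl, V,
    hVo, hxV, fun x hx => (hV x hx).2, fun x hx => ⟨?_, fun t => ?_⟩⟩
  · by_cases hx : x ∈ O
    · exact (hd t ht x hx).differentiableAt
    · exact (differentiableAt_const (0 : E)).congr_of_eventuallyEq (hz t x hx)
  · exact continuousOn_smul_of_tsupport hO hρ.continuous hs hU.continuousOn
  · have h2 : ContinuousOn (fun p : ℝ × E => ρ p.2 •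
        (fderivWithin ℝ (fun p : ℝ × E => U p.1 p.2) (Icc 0 T ×ˢ O) p).comp
        (ContinuousLinearMap.inr ℝ ℝ E)) (Icc 0 T ×ˢ univ) :=
      continuousOn_smul_of_tsupport hO hρ.continuous hs
        ((hU.continuousOn_fderivWithin hud (by simp)).clm_comp continuousOn_const)
    have h3 : ContinuousOn (fun p : ℝ × E => (fderiv ℝ ρ p.2).smulRight (U p.1 p.2))
        (Icc 0 T ×ˢ univ) := by
      rintro ⟨t, x⟩ ⟨ht, -⟩
      by_cases hx : x ∈ O
      · have h4 : ContinuousWithinAt (fun p : ℝ × E => U p.1 p.2) (Icc 0 T ×ˢ univ) (t, x) := by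
          refine (hU.continuousOn (t, x) ⟨ht, hx⟩).mono_of_mem_nhdsWithin ?_
          rw [nhdsWithin_prod_eq]
          exact prod_mem_prod self_mem_nhdsWithin (mem_nhdsWithin_of_mem_nhds (hO.mem_nhds hx))
        have h5 : ContinuousWithinAt (fun p : ℝ × E => fderiv ℝ ρ p.2) (Icc 0 T ×ˢ univ) (t, x) :=
          ((hρ.continuous_fderiv (by simp)).comp continuous_snd).continuousWithinAt
        exact ((ContinuousLinearMap.smulRightL ℝ E E).continuous.continuousAt.comp_continuousWithinAt
          h5).clm_apply h4
      · have h4 : (fun p : ℝ × E => (fderiv ℝ ρ p.2).smulRight (U p.1 p.2)) =ᶠ[𝓝 (t, x)]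
            fun _ => 0 := by
          have h5 := (notMem_tsupport_iff_eventuallyEq.1 fun h => hx (hs h)).eventuallyEq_nhds
          filter_upwards [continuous_snd.continuousAt.eventually h5] with p hp
          rw [hp.fderiv_eq]
          ext v
          simp
        exact (continuousAt_const.congr_of_eventuallyEq h4).continuousWithinAt
    refine (h2.add h3).congr fun p hp => ?_
    by_cases hx : p.2 ∈ O
    · exact (hd p.1 hp.1 p.2 hx).fderiv
    · have h4 : fderiv ℝ (fun y => ρ y • U p.1 y) p.2 = 0 := by
        rw [(hz p.1 p.2 hx).fderiv_eq]; simp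
      simp only [h4, Pi.add_apply, (hdz p.2 hx).1, (hdz p.2 hx).2]
      ext v
      simp
  · filter_upwards [hVo.mem_nhds hx] with y hy
    simp [(hV y hy).1]
  · filter_upwards [hVo.mem_nhds hx] with y hy
    simp [(hV y hy).1]

end Cutoff

/-! ### The drift in coordinates. -/

section Drift

variable {d : ℕ} {M : Type*} [TopologicalSpace M] [ChartedSpace (EuclideanSpace ℝ (Fin d)) M]
  [IsManifold (𝓡 d) ∞ M]

theorem contDiffOn_components {u : ℝ → (x : M) → TangentSpace (𝓡 d) x} {I : Set ℝ}
    (hu : ContMDiffOn (𝓘(ℝ, ℝ).prod (𝓡 d)) (𝓡 d).tangent ∞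
      (fun p : ℝ × M => (⟨p.2, u p.1 p.2⟩ : TangentBundle (𝓡 d) M)) (I ×ˢ univ)) (q : M) :
    ContDiffOn ℝ ∞ (fun p : ℝ × ModelSpace d => components q (u p.1) p.2)
      (I ×ˢ (coord d q).target) := by
  have h1 : ContMDiffOn (𝓘(ℝ, ℝ).prod 𝓘(ℝ, ModelSpace d)) (𝓘(ℝ, ℝ).prod (𝓡 d)) ∞
      (fun p : ℝ × ModelSpace d => (p.1, (coord d q).symm p.2)) (I ×ˢ (coord d q).target) :=
    contMDiffOn_fst.prodMk ((contMDiffOn_extChartAt_symm (n := ∞) q).comp contMDiffOn_snd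
      fun p hp => hp.2)
  have h2 := hu.comp h1 fun p hp => ⟨hp.1, mem_univ _⟩
  let e := trivializationAt (ModelSpace d) (TangentSpace (𝓡 d) : M → Type _) q
  have h3 : ContMDiffOn (𝓡 d).tangent ((𝓡 d).prod 𝓘(ℝ, ModelSpace d)) ∞ e e.source :=
    e.contMDiffOn
  have h4 := h3.comp h2 fun p hp => by
    rw [mem_preimage, e.mem_source]
    have := (coord d q).map_target hp.2
    rwa [extChartAt_source] at this
  have h5 : ContMDiffOn (𝓘(ℝ, ℝ).prod 𝓘(ℝ, ModelSpace d)) 𝓘(ℝ, ModelSpace d) ∞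
      (fun p : ℝ × ModelSpace d => components q (u p.1) p.2) (I ×ˢ (coord d q).target) :=
    contMDiff_snd.comp_contMDiffOn h4
  rw [← modelWithCornersSelf_prod, chartedSpaceSelf_prod] at h5
  exact contMDiffOn_iff_contDiffOn.1 h5

end Drift

/-! ### Solutions of the development equation -/

section Horizontal

open Filter Topology

variable {d : ℕ} {M : Type*} [TopologicalSpace M] [ChartedSpace (EuclideanSpace ℝ (Fin d)) M]
  [IsManifold (𝓡 d) ∞ M] {cov : AffineConnection d M}
  {γ : ℝ → M} {P : ℝ → ModelSpace d →L[ℝ] ModelSpace d} {ζ : ℝ → ModelSpace d} {a b : ℝ}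

theorem isUnit_frameCoord {q x : M} (hx : x ∈ (coord d q).source) : IsUnit (frameCoord d q x) :=
  ⟨⟨frameCoord d q x, frameOfCoord d q x, frameCoord_mul_frameOfCoord hx,
    frameOfCoord_mul_frameCoord hx⟩, rfl⟩

theorem continuousOn_christoffel_comp [T2Space M]
    (hcov : CovariantDerivative.ContMDiffCovariantDerivative cov ∞) {q : M} {s : Set ℝ}
    (hc : ContinuousOn (solCoord d q γ P) s) (hq : ∀ t ∈ s, γ t ∈ (coord d q).source) :
    ContinuousOn (fun t => christoffel cov q (coord d q (γ t))) s :=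
  (contDiffOn_christoffel cov hcov q).continuousOn.comp hc.fst
    fun t ht => (coord d q).map_source (hq t ht)

/-- For a fixed vector, the coordinates of its transport solve a linear equation. By uniqueness
backward in time, a vector killed at a later time was already killed earlier; injectivity is enough
in finite dimension. -/
theorem IsHorizontal.isUnit [T2Space M]
    (hcov : CovariantDerivative.ContMDiffCovariantDerivative cov ∞)
    (h : IsHorizontal cov γ P ζ a b) (hP : IsUnit (P a)) : ∀ t ∈ Icc a b, IsUnit (P t) := by
  refine interval_induction hP fun t₀ ht₀ => ?_
  obtain ⟨ε, hε, h1⟩ := exists_eps_forall_mem h.1 ht₀ (isOpen_coord_source (γ t₀))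
      (mem_extChartAt_source (I := 𝓡 d) (γ t₀))
  refine ⟨ε, hε, fun s hs t ht hst hs₀ ht₀ hS => ?_⟩
  have h3 : ∀ τ ∈ Icc s t, γ τ ∈ (coord d (γ t₀)).source := fun τ hτ =>
    h1 τ ⟨hs.1.trans hτ.1, hτ.2.trans ht.2⟩ (by
      rw [abs_lt] at *
      exact ⟨by linarith [hτ.1], by linarith [hτ.2]⟩)
  have h4 := h.2 _ s t hs ht hst h3
  have hmul : ∀ A B : ModelSpace d →L[ℝ] ModelSpace d, IsUnit A → (IsUnit (A * B) ↔ IsUnit B) :=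
    fun A B hA => hA.mul_left_iff
  have hss := (hmul _ (P s) (isUnit_frameCoord (h3 s ⟨le_refl _, hst⟩))).2 hS
  refine (hmul _ (P t) (isUnit_frameCoord (h3 t ⟨hst, le_refl _⟩))).1 ?_
  have hinj : Function.Injective (frameCoord d (γ t₀) (γ t) * P t) := by
    rw [injective_iff_map_eq_zero]
    intro v hv
    have h5 := h4.clm_comp hst ((ContinuousLinearMap.apply ℝ (ModelSpace d) v).comp
      (ContinuousLinearMap.snd ℝ (ModelSpace d) (ModelSpace d →L[ℝ] ModelSpace d)))
    have hi : IntervalIntegrable (fun τ => (horizontalRate cov (γ t₀) γ P ζ τ).1) volume s t :=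
      (h4.clm_comp hst (ContinuousLinearMap.fst ℝ (ModelSpace d)
        (ModelSpace d →L[ℝ] ModelSpace d))).integrable
    have h6 := h5.eq_zero_of_linear (ContinuousOn.intervalIntegrable_clm_apply hst
      (continuousOn_christoffel_comp hcov (h4.continuousOn hst) h3) hi).norm
      (fun _ => norm_nonneg _) (Eventually.of_forall fun τ _ => ?_) ⟨hst, le_refl t⟩ hv s
      ⟨le_refl s, hst⟩
    · obtain ⟨u, hu⟩ := hss
      have h7 : (u : ModelSpace d →L[ℝ] ModelSpace d) v = 0 := by rw [hu]; exact h6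
      have h8 := congrArg (↑u⁻¹ : ModelSpace d →L[ℝ] ModelSpace d) h7
      rwa [← mul_apply_eq_comp, u.inv_mul, map_zero] at h8
    · have : ((ContinuousLinearMap.apply ℝ (ModelSpace d) v).comp
        (ContinuousLinearMap.snd ℝ (ModelSpace d) (ModelSpace d →L[ℝ] ModelSpace d)))
        (horizontalRate cov (γ t₀) γ P ζ τ) = -(christoffel cov (γ t₀) (coord d (γ t₀) (γ τ))
          (horizontalRate cov (γ t₀) γ P ζ τ).1 ((solCoord d (γ t₀) γ P τ).2 v)) := rfl
      rw [this, norm_neg]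
      exact ContinuousLinearMap.le_opNorm _ _
  rw [ContinuousLinearMap.isUnit_iff_bijective]
  exact ⟨hinj, (LinearMap.injective_iff_surjective
    (f := (frameCoord d (γ t₀) (γ t) * P t).toLinearMap)).1 hinj⟩

end Horizontal

namespace DevelopedProcess

open Filter Topology

variable {d : ℕ} {M : Type*} [TopologicalSpace M] [ChartedSpace (EuclideanSpace ℝ (Fin d)) M]
  [IsManifold (𝓡 d) ∞ M]
  {𝔢 : Type*} [NormedAddCommGroup 𝔢] [InnerProductSpace ℝ 𝔢] [FiniteDimensional ℝ 𝔢]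
  (X : DevelopedProcess d M 𝔢)

/-- The data of the process are smooth, on an interval of positive length. -/
structure IsSmooth : Prop where
  T_pos : 0 < X.T
  cov : CovariantDerivative.ContMDiffCovariantDerivative X.cov ∞
  S : ContDiffOn ℝ ∞ X.S (Icc 0 X.T)
  isPositive_S : ∀ t ∈ Icc 0 X.T, (X.S t).IsPositive
  u : ContMDiffOn (𝓘(ℝ, ℝ).prod (𝓡 d)) (𝓡 d).tangent ∞
      (fun p : ℝ × M => (⟨p.2, X.u p.1 p.2⟩ : TangentBundle (𝓡 d) M)) (Icc 0 X.T ×ˢ univ)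

/-- The coefficient `Σ_t^{1/2}` of the noise, with values in the model space. -/
noncomputable def noise (t : ℝ) : 𝔢 →L[ℝ] ModelSpace d :=
  ContinuousLinearMap.comp (M₃ := ModelSpace d) X.ι (posSqrt (X.S t))

/-- The drift, with values in the model space. -/
def drift (t : ℝ) (x : M) : ModelSpace d := X.u t x

/-- The velocity of a solution. -/
noncomputable def drive (γ : ℝ → M) (P : ℝ → ModelSpace d →L[ℝ] ModelSpace d) (w : ℝ → 𝔢) (t : ℝ) :
    ModelSpace d := P t (X.noise t (w t)) + X.drift t (γ t)

/-- `γ` solves the development equation on `[a, b]`, and `P` is a parallel frame along `γ`. -/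
abbrev IsSolution (w : ℝ → 𝔢) (γ : ℝ → M) (P : ℝ → ModelSpace d →L[ℝ] ModelSpace d) (a b : ℝ) :
    Prop := IsHorizontal X.cov γ P (X.drive γ P w) a b

variable {X}

theorem IsSmooth.continuousOn_noise (hX : X.IsSmooth) : ContinuousOn X.noise (Icc 0 X.T) :=
  continuousOn_const.clm_comp (hX.S.continuousOn.posSqrt hX.isPositive_S)

/-- A control system which is the development equation near a given point. -/
theorem IsSmooth.exists_frameSystem [T2Space M] (hX : X.IsSmooth) {q x : M}
    (hx : x ∈ (coord d q).source) :
    ∃ F : FrameSystem (ModelSpace d) 𝔢 X.T, F.N = X.noise ∧ ∃ V, IsOpen V ∧ coord d q x ∈ V ∧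
      V ⊆ (coord d q).target ∧ ∀ y ∈ V, F.Γ =ᶠ[𝓝 y] christoffel X.cov q ∧
        ∀ t, F.U t =ᶠ[𝓝 y] components q (X.u t) :=
  _root_.exists_frameSystem hX.T_pos (isOpen_coord_target q)
    ((contDiffOn_christoffel X.cov hX.cov q).of_le (by norm_cast))
    (U := fun t => components q (X.u t))
    ((contDiffOn_components hX.u q).of_le (by norm_cast)) hX.continuousOn_noise
    ((coord d q).map_source hx)

theorem frameMap_eq_horizontalRate {γ : ℝ → M} {P : ℝ → ModelSpace d →L[ℝ] ModelSpace d}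
    {w : ℝ → 𝔢} {q : M} {t : ℝ} (hq : γ t ∈ (coord d q).source) :
    frameMap (christoffel X.cov q (coord d q (γ t)), (solCoord d q γ P t).2, X.noise t,
      components q (X.u t) (coord d q (γ t))) (1, w t) =
      horizontalRate X.cov q γ P (X.drive γ P w) t := by
  have h1 : (solCoord d q γ P t).2 (X.noise t (w t)) + (1 : ℝ) •
      components q (X.u t) (coord d q (γ t)) = frameCoord d q (γ t) (X.drive γ P w t) := by
    rw [components_coord hq, one_smul]
    exact (map_add (frameCoord d q (γ t)) _ _).symm
  rw [frameMap_apply, horizontalRate]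
  simp only [h1]

theorem field_eq_horizontalRate {γ : ℝ → M} {P : ℝ → ModelSpace d →L[ℝ] ModelSpace d}
    {w : ℝ → 𝔢} {q : M} {t : ℝ} (hq : γ t ∈ (coord d q).source)
    {F : FrameSystem (ModelSpace d) 𝔢 X.T} (hN : F.N = X.noise)
    (hF : F.Γ =ᶠ[𝓝 (coord d q (γ t))] christoffel X.cov q ∧
        ∀ t', F.U t' =ᶠ[𝓝 (coord d q (γ t))] components q (X.u t')) :
    F.field t (solCoord d q γ P t) (1, w t) = horizontalRate X.cov q γ P (X.drive γ P w) t := by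
  rw [← frameMap_eq_horizontalRate hq, FrameSystem.field, FrameSystem.coeff, hN]
  have h1 : F.Γ (solCoord d q γ P t).1 = christoffel X.cov q (coord d q (γ t)) := hF.1.eq_of_nhds
  have h2 : F.U t (solCoord d q γ P t).1 = components q (X.u t) (coord d q (γ t)) :=
    (hF.2 t).eq_of_nhds
  rw [h1, h2]

theorem isOpen_coord_preimage {q : M} {V : Set (ModelSpace d)} (hV : IsOpen V) :
    IsOpen ((coord d q).source ∩ coord d q ⁻¹' V) :=
  (continuousOn_extChartAt q).isOpen_inter_preimage (isOpen_coord_source q) hV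

theorem intervalIntegrable_horizontalRate [T2Space M] (hX : X.IsSmooth) {γ : ℝ → M}
    {P : ℝ → ModelSpace d →L[ℝ] ModelSpace d} (w : CameronMartin 𝔢 X.T) {q : M} {s t : ℝ}
    (hs : s ∈ Icc 0 X.T) (ht : t ∈ Icc 0 X.T) (hst : s ≤ t)
    (hq : ∀ τ ∈ Icc s t, γ τ ∈ (coord d q).source)
    (hc : ContinuousOn (solCoord d q γ P) (Icc s t)) :
    IntervalIntegrable (horizontalRate X.cov q γ P (X.drive γ P w)) volume s t := by
  have hsub : Icc s t ⊆ Icc 0 X.T := Icc_subset_Icc hs.1 ht.2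
  let A : ℝ → (ℝ × 𝔢) →L[ℝ] ModelSpace d × (ModelSpace d →L[ℝ] ModelSpace d) := fun τ =>
    frameMap (christoffel X.cov q (coord d q (γ τ)),
      (solCoord d q γ P τ).2, X.noise τ, components q (X.u τ) (coord d q (γ τ)))
  have hcoeff : ContinuousOn A (Icc s t) := by
    have hU : ContinuousOn (fun τ => components q (X.u τ) (coord d q (γ τ))) (Icc s t) :=
      ContinuousOn.comp (g := fun p : ℝ × ModelSpace d => components q (X.u p.1) p.2)
        (f := fun τ => (τ, coord d q (γ τ))) (contDiffOn_components hX.u q).continuousOn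
        (continuousOn_id.prodMk hc.fst)
        fun τ hτ => ⟨hsub hτ, (coord d q).map_source (hq τ hτ)⟩
    have h0 : ContinuousOn (fun τ => ((christoffel X.cov q (coord d q (γ τ)),
      (solCoord d q γ P τ).2, X.noise τ, components q (X.u τ) (coord d q (γ τ))) :
        FrameCoeff (ModelSpace d) 𝔢)) (Icc s t) :=
      (continuousOn_christoffel_comp hX.cov hc hq).prodMk (hc.snd.prodMk
        ((hX.continuousOn_noise.mono hsub).prodMk hU))
    have hm : Continuous (frameMap : FrameCoeff (ModelSpace d) 𝔢 → _) :=
      (contDiff_frameMap (E := ModelSpace d) (𝔢 := 𝔢) (m := 0)).continuous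
    exact hm.comp_continuousOn h0
  have hw : IntervalIntegrable (fun τ => ((1 : ℝ), w τ)) volume s t :=
    intervalIntegrable_const_prod_Lp hs.1 hst ht.2 1 w
  have h1 : IntervalIntegrable (fun τ => A τ (1, w τ)) volume s t :=
    ContinuousOn.intervalIntegrable_clm_apply (V := ℝ × 𝔢)
      (W := ModelSpace d × (ModelSpace d →L[ℝ] ModelSpace d)) hst hcoeff hw
  refine h1.congr fun τ hτ => ?_
  rw [uIoc_of_le hst] at hτ
  exact frameMap_eq_horizontalRate (hq τ (Ioc_subset_Icc_self hτ))

/-- Passage from the pointwise almost everywhere formulation to integral equations in charts, on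
which all later arguments operate. -/
theorem isDevelopment_iff [T2Space M] (hX : X.IsSmooth) {w : CameronMartin 𝔢 X.T} {γ : ℝ → M} :
    X.IsDevelopment w γ ↔ ∃ P : ℝ → ModelSpace d →L[ℝ] ModelSpace d,
      X.IsSolution w γ P 0 X.T ∧ γ 0 = X.o ∧ P 0 = 1 := by
  constructor
  · rintro ⟨P, h1, h2, h3⟩
    have hi := IsParallelTransport.initial (P := P) h2
    refine ⟨P, IsParallelTransport.isHorizontal hX.T_pos.le h1 h2 ?_ fun q s hs t ht hst hq hc =>
      intervalIntegrable_horizontalRate hX w hs ht hst hq hc, hi.1, hi.2⟩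
    rw [ae_restrict_iff' measurableSet_Icc] at h3
    exact h3
  · rintro ⟨P, h1, h2, h3⟩
    refine ⟨P, h1.isACCurve, h1.isParallelTransport hX.T_pos.le h2 h3, ?_⟩
    rw [ae_restrict_iff' measurableSet_Icc]
    filter_upwards [h1.ae_hasDeriv hX.T_pos.le] with t ht htm
    exact (ht htm).1

/-- Uniqueness in one chart propagates along the interval. The Hausdorff property provides the
closedness of the set of times where the solutions agree. -/
theorem IsSolution.eq_of_eq [T2Space M] (hX : X.IsSmooth) {w : CameronMartin 𝔢 X.T}
    {γ γ' : ℝ → M} {P P' : ℝ → ModelSpace d →L[ℝ] ModelSpace d} {a b : ℝ} (ha : 0 ≤ a)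
    (hb : b ≤ X.T) (h : X.IsSolution w γ P a b) (h' : X.IsSolution w γ' P' a b)
    (hγ : γ a = γ' a) (hP : P a = P' a) : ∀ t ∈ Icc a b, γ t = γ' t ∧ P t = P' t := by
  refine interval_induction ⟨hγ, hP⟩ fun t₀ ht₀ => ?_
  -- If the curves differ at `t₀`, they lie in disjoint open sets nearby, so agreement at a nearby
  -- earlier time is impossible and the induction step is vacuous.
  by_cases hne : γ t₀ = γ' t₀
  swap
  · obtain ⟨O, O', hO, hO', h1, h2, h3⟩ := t2_separation hne
    obtain ⟨ε, hε, h4⟩ := exists_eps_forall_mem h.1 ht₀ hO h1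
    obtain ⟨ε', hε', h5⟩ := exists_eps_forall_mem h'.1 ht₀ hO' h2
    refine ⟨min ε ε', lt_min hε hε', fun s hs t ht hst hs₀ ht₀ hS => ?_⟩
    exact absurd hS.1 (h3.ne_of_mem (h4 s hs (hs₀.trans_le (min_le_left _ _)))
      (h5 s hs (hs₀.trans_le (min_le_right _ _))))
  have hsrc := mem_extChartAt_source (I := 𝓡 d) (γ t₀)
  obtain ⟨F, hN, V, hV, hxV, hVt, hF⟩ := hX.exists_frameSystem hsrc
  obtain ⟨ε, hε, h4⟩ := exists_eps_forall_mem h.1 ht₀ (isOpen_coord_preimage (q := γ t₀) hV)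
    ⟨hsrc, hxV⟩
  obtain ⟨ε', hε', h5⟩ := exists_eps_forall_mem h'.1 ht₀ (isOpen_coord_preimage (q := γ t₀) hV)
    (hne ▸ ⟨hsrc, hxV⟩)
  refine ⟨min ε ε', lt_min hε hε', fun s hs t ht hst hs₀ ht₀ hS => ?_⟩
  have hin : ∀ τ ∈ Icc s t, τ ∈ Icc a b ∧ |τ - t₀| < min ε ε' := fun τ hτ =>
    ⟨⟨hs.1.trans hτ.1, hτ.2.trans ht.2⟩, by
      rw [abs_lt] at *
      exact ⟨by linarith [hτ.1], by linarith [hτ.2]⟩⟩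
  have h6 : ∀ τ ∈ Icc s t, γ τ ∈ (coord d (γ t₀)).source ∩ coord d (γ t₀) ⁻¹' V := fun τ hτ =>
    h4 τ (hin τ hτ).1 ((hin τ hτ).2.trans_le (min_le_left _ _))
  have h7 : ∀ τ ∈ Icc s t, γ' τ ∈ (coord d (γ t₀)).source ∩ coord d (γ t₀) ⁻¹' V := fun τ hτ =>
    h5 τ (hin τ hτ).1 ((hin τ hτ).2.trans_le (min_le_right _ _))
  have h8 := (h.2 _ s t hs ht hst fun τ hτ => (h6 τ hτ).1).congr hst (fun _ _ => rfl)
    (Eventually.of_forall fun τ hτ => field_eq_horizontalRate (h6 τ hτ).1 hN (hF _ (h6 τ hτ).2))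
  have h9 := (h'.2 _ s t hs ht hst fun τ hτ => (h7 τ hτ).1).congr hst (fun _ _ => rfl)
    (Eventually.of_forall fun τ hτ => field_eq_horizontalRate (h7 τ hτ).1 hN (hF _ (h7 τ hτ).2))
  have hsub : Icc s t ⊆ Icc 0 X.T := fun τ hτ =>
    ⟨ha.trans (hin τ hτ).1.1, (hin τ hτ).1.2.trans hb⟩
  have h10 := IsPrimitive.eq_of_control hst
    (F.continuousOn_fieldDeriv.mono (prod_mono_left hsub))
    (fun τ hτ y => F.hasFDerivAt_field (hsub hτ) y)
    (intervalIntegrable_const_prod_Lp (ha.trans hs.1) hst (ht.2.trans hb) 1 w) h8 h9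
    (t₀ := s) ⟨le_refl _, hst⟩ (by simp only [solCoord, hS.1, hS.2]) t ⟨hst, le_refl _⟩
  have ht1 := h6 t ⟨hst, le_refl _⟩
  have ht2 := h7 t ⟨hst, le_refl _⟩
  have h11 : γ t = γ' t := (coord d (γ t₀)).injOn ht1.1 ht2.1 (congrArg Prod.fst h10)
  refine ⟨h11, ?_⟩
  have h12 := congrArg Prod.snd h10
  simp only [solCoord, ← h11] at h12
  exact (isUnit_frameCoord ht1.1).mul_left_cancel h12

end DevelopedProcess

/-! ### The generator of the linearized equation -/

section Generator

open Filter Topology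

variable {E : Type*} [NormedAddCommGroup E] [NormedSpace ℝ E] [FiniteDimensional ℝ E]
  {𝔢 : Type*} [NormedAddCommGroup 𝔢] [NormedSpace ℝ 𝔢] [FiniteDimensional ℝ 𝔢]

/-- The velocity with respect to the frame. -/
noncomputable def frameVelocity (U : E → E) (N : 𝔢 →L[ℝ] E) (y : E × (E →L[ℝ] E)) (e : ℝ × 𝔢) : E :=
  N e.2 + e.1 • Ring.inverse y.2 (U y.1)

/-- The linear map of the linearized equation, on the components of the variation. -/
noncomputable def frameGeneratorFun (Γ : E → E →L[ℝ] E →L[ℝ] E) (U : E → E) (N : 𝔢 →L[ℝ] E)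
    (y : E × (E →L[ℝ] E)) (e : ℝ × 𝔢) (h : E × (E →L[ℝ] E)) : E × (E →L[ℝ] E) :=
  (Ring.inverse y.2 (Γ y.1 (y.2 (frameVelocity U N y e)) (y.2 h.1)
      - Γ y.1 (y.2 h.1) (y.2 (frameVelocity U N y e))
      + e.1 • (fderiv ℝ U y.1 (y.2 h.1) + Γ y.1 (y.2 h.1) (U y.1))) + h.2 (N e.2),
    Ring.inverse y.2 * (christoffelCurvature Γ y.1 (y.2 (frameVelocity U N y e)) (y.2 h.1) * y.2))

theorem christoffelCurvature_add_left (Γ : E → E →L[ℝ] E →L[ℝ] E) (y v v' w : E) :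
    christoffelCurvature Γ y (v + v') w =
      christoffelCurvature Γ y v w + christoffelCurvature Γ y v' w := by
  simp only [christoffelCurvature, map_add, _root_.add_apply, add_mul, mul_add]
  abel

theorem christoffelCurvature_smul_left (Γ : E → E →L[ℝ] E →L[ℝ] E) (y : E) (c : ℝ) (v w : E) :
    christoffelCurvature Γ y (c • v) w = c • christoffelCurvature Γ y v w := by
  simp only [christoffelCurvature, map_smul, _root_.smul_apply, smul_mul_assoc, mul_smul_comm,
    smul_add, smul_sub]

theorem christoffelCurvature_swap (Γ : E → E →L[ℝ] E →L[ℝ] E) (y v w : E) :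
    christoffelCurvature Γ y v w = - christoffelCurvature Γ y w v := by
  simp only [christoffelCurvature]
  abel

theorem christoffelCurvature_add_right (Γ : E → E →L[ℝ] E →L[ℝ] E) (y v w w' : E) :
    christoffelCurvature Γ y v (w + w') =
      christoffelCurvature Γ y v w + christoffelCurvature Γ y v w' := by
  rw [christoffelCurvature_swap, christoffelCurvature_add_left, neg_add,
    ← christoffelCurvature_swap, ← christoffelCurvature_swap]

theorem christoffelCurvature_smul_right (Γ : E → E →L[ℝ] E →L[ℝ] E) (y : E) (c : ℝ) (v w : E) :
    christoffelCurvature Γ y v (c • w) = c • christoffelCurvature Γ y v w := by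
  rw [christoffelCurvature_swap, christoffelCurvature_smul_left, ← smul_neg,
    ← christoffelCurvature_swap]

/-- `frameGeneratorFun` as a continuous bilinear map. -/
noncomputable def frameGenerator (Γ : E → E →L[ℝ] E →L[ℝ] E) (U : E → E) (N : 𝔢 →L[ℝ] E)
    (y : E × (E →L[ℝ] E)) : (ℝ × 𝔢) →L[ℝ] E × (E →L[ℝ] E) →L[ℝ] E × (E →L[ℝ] E) :=
  LinearMap.toContinuousLinearMap
    ((LinearMap.toContinuousLinearMap : (E × (E →L[ℝ] E) →ₗ[ℝ] E × (E →L[ℝ] E)) ≃ₗ[ℝ] _).toLinearMap ∘ₗ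
      LinearMap.mk₂ ℝ (frameGeneratorFun Γ U N y)
        (fun e e' h => by
          ext1
          · simp only [frameGeneratorFun, frameVelocity, Prod.fst_add, Prod.snd_add, map_add,
              _root_.add_apply, add_smul, smul_add, map_sub]
            abel
          · simp only [frameGeneratorFun, frameVelocity, Prod.fst_add, Prod.snd_add, map_add,
              add_smul, christoffelCurvature_add_left, add_mul, mul_add]
            abel)
        (fun c e h => by
          ext1
          · simp only [frameGeneratorFun, frameVelocity, Prod.smul_fst, Prod.smul_snd, map_smul,
              _root_.smul_apply, map_add, map_sub, smul_eq_mul, mul_smul, smul_add, smul_sub,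
              _root_.add_apply]
          · simp only [frameGeneratorFun, frameVelocity, Prod.smul_fst, Prod.smul_snd, map_smul,
              map_add, smul_eq_mul, mul_smul, christoffelCurvature_add_left,
              christoffelCurvature_smul_left, smul_mul_assoc, mul_smul_comm, smul_add, add_mul,
              mul_add])
        (fun e h h' => by
          ext1
          · simp only [frameGeneratorFun, Prod.fst_add, Prod.snd_add, map_add,
              _root_.add_apply, smul_add, map_sub]
            abel
          · simp only [frameGeneratorFun, Prod.fst_add, Prod.snd_add, map_add,
              christoffelCurvature_add_right, add_mul, mul_add])
        (fun c e h => by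
          ext1
          · simp only [frameGeneratorFun, Prod.smul_fst, Prod.smul_snd, map_smul,
              _root_.smul_apply, map_add, map_sub, smul_add, smul_sub, smul_comm e.1 c]
          · simp only [frameGeneratorFun, Prod.smul_fst, Prod.smul_snd, map_smul,
              christoffelCurvature_smul_right, smul_mul_assoc, mul_smul_comm]))

theorem frameGenerator_apply (Γ : E → E →L[ℝ] E →L[ℝ] E) (U : E → E) (N : 𝔢 →L[ℝ] E)
    (y : E × (E →L[ℝ] E)) (e : ℝ × 𝔢) (h : E × (E →L[ℝ] E)) :
    frameGenerator Γ U N y e h = frameGeneratorFun Γ U N y e h := rfl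

variable [CompleteSpace E]

theorem ringInverse_apply_self {p : E →L[ℝ] E} (hp : IsUnit p) (v : E) :
    Ring.inverse p (p v) = v := by
  rw [← mul_apply_eq_comp, Ring.inverse_mul_cancel p hp]; rfl

theorem apply_ringInverse_self {p : E →L[ℝ] E} (hp : IsUnit p) (v : E) :
    p (Ring.inverse p v) = v := by
  rw [← mul_apply_eq_comp, Ring.mul_inverse_cancel p hp]; rfl

theorem apply_frameVelocity (U : E → E) (N : 𝔢 →L[ℝ] E) {y : E × (E →L[ℝ] E)} (hy : IsUnit y.2)
    (e : ℝ × 𝔢) : y.2 (frameVelocity U N y e) = y.2 (N e.2) + e.1 • U y.1 := by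
  rw [frameVelocity, map_add, map_smul, apply_ringInverse_self hy]

namespace FrameSystem

variable {T : ℝ} (F : FrameSystem E 𝔢 T)

/-- The linearization of the development equation, with the generator. -/
theorem isPrimitive_frameGenerator {a b : ℝ} (ha : 0 ≤ a) (hab : a ≤ b) (hb : b ≤ T)
    {w η : ℝ → 𝔢} {y h : ℝ → E × (E →L[ℝ] E)}
    (hy : IsPrimitive y (fun t => F.field t (y t) (1, w t)) a b)
    (hh : IsPrimitive h (fun t => F.fieldDeriv t (y t) (h t) (1, w t) + F.field t (y t) (0, η t)) a b)
    (hu : ∀ t ∈ Icc a b, IsUnit (y t).2) :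
    IsPrimitive (fun t => invariantVariation F.Γ (y t, h t)) (fun t =>
      frameGenerator F.Γ (F.U t) (F.N t) (y t) (1, w t) (invariantVariation F.Γ (y t, h t)) +
        (F.N t (η t), 0)) a b := by
  refine (F.isPrimitive_invariantVariation ha hab hb hy hh hu).congr hab (fun _ _ => rfl)
    (Eventually.of_forall fun t ht => ?_)
  have h1 : (y t).2 (invariantVariation F.Γ (y t, h t)).1 = (h t).1 :=
    apply_ringInverse_self (hu t ht) _
  have h2 : (y t).2 (frameVelocity (F.U t) (F.N t) (y t) (1, w t)) =
      (F.field t (y t) (1, w t)).1 := by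
    rw [apply_frameVelocity _ _ (hu t ht), field, frameMap_apply]; rfl
  rw [frameGenerator_apply, frameGeneratorFun]
  simp only [h1, h2, one_smul]
  ext1
  · rfl
  · exact add_zero _

theorem continuousOn_frameGenerator {s : Set ℝ} (hs : s ⊆ Icc 0 T) {y : ℝ → E × (E →L[ℝ] E)}
    (hy : ContinuousOn y s) (hu : ∀ t ∈ s, IsUnit (y t).2) :
    ContinuousOn (fun t => frameGenerator F.Γ (F.U t) (F.N t) (y t)) s := by
  have hr : ContinuousOn (fun t => Ring.inverse (y t).2) s := fun t ht => by
    obtain ⟨u, hu⟩ := hu t ht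
    have h1 : ContinuousAt Ring.inverse (y t).2 := hu ▸ NormedRing.inverse_continuousAt u
    exact ContinuousAt.comp_continuousWithinAt (f := fun t => (y t).2) h1 (hy.snd t ht)
  have hx := hy.fst
  have hp := hy.snd
  have hm : MapsTo (fun t => (t, (y t).1)) s (Icc 0 T ×ˢ univ) := fun t ht => ⟨hs ht, mem_univ _⟩
  have hG : ContinuousOn (fun t => F.Γ (y t).1) s := F.contDiff_Γ.continuous.comp_continuousOn hx
  have hG' : ContinuousOn (fun t => fderiv ℝ F.Γ (y t).1) s :=
    (F.contDiff_Γ.continuous_fderiv (by simp)).comp_continuousOn hx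
  have hU : ContinuousOn (fun t => F.U t (y t).1) s :=
    F.continuousOn_U.comp (f := fun t => (t, (y t).1)) (continuousOn_id.prodMk hx) hm
  have hU' : ContinuousOn (fun t => fderiv ℝ (F.U t) (y t).1) s :=
    F.continuousOn_fderiv_U.comp (f := fun t => (t, (y t).1)) (continuousOn_id.prodMk hx) hm
  have hN : ContinuousOn F.N s := F.continuousOn_N.mono hs
  refine continuousOn_clm_apply.2 fun e => continuousOn_clm_apply.2 fun h => ?_
  simp only [frameGenerator_apply, frameGeneratorFun]
  have hv : ContinuousOn (fun t => (y t).2 (frameVelocity (F.U t) (F.N t) (y t) e)) s :=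
    hp.clm_apply ((hN.clm_apply continuousOn_const).add
      (continuousOn_const.smul (hr.clm_apply hU)))
  have hh : ContinuousOn (fun t => (y t).2 h.1) s := hp.clm_apply continuousOn_const
  refine ContinuousOn.prodMk ?_ ?_
  · refine (hr.clm_apply ((((hG.clm_apply hv).clm_apply hh).sub ((hG.clm_apply hh).clm_apply
      hv)).add (continuousOn_const.smul ((hU'.clm_apply hh).add
      ((hG.clm_apply hh).clm_apply hU))))).add ?_
    exact continuousOn_const.clm_apply (hN.clm_apply continuousOn_const)
  · exact hr.mul ((((((hG'.clm_apply hv).clm_apply hh).sub ((hG'.clm_apply hh).clm_apply hv)).add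
      ((hG.clm_apply hv).mul (hG.clm_apply hh))).sub ((hG.clm_apply hh).mul
      (hG.clm_apply hv))).mul hp)

end FrameSystem

end Generator

/-! ### The linearized equation in terms of torsion, curvature and drift. -/

namespace DevelopedProcess

open Filter Topology

variable {d : ℕ} {M : Type*} [TopologicalSpace M] [ChartedSpace (EuclideanSpace ℝ (Fin d)) M]
  [IsManifold (𝓡 d) ∞ M] [T2Space M]
  {𝔢 : Type*} [NormedAddCommGroup 𝔢] [InnerProductSpace ℝ 𝔢] [FiniteDimensional ℝ 𝔢]
  (X : DevelopedProcess d M 𝔢)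

/-- The generator of the linearized development equation in the chart at `q`. -/
noncomputable def generatorIn (q : M) (γ : ℝ → M) (P : ℝ → ModelSpace d →L[ℝ] ModelSpace d)
    (t : ℝ) : (ℝ × 𝔢) →L[ℝ] ModelSpace d × (ModelSpace d →L[ℝ] ModelSpace d) →L[ℝ]
      ModelSpace d × (ModelSpace d →L[ℝ] ModelSpace d) :=
  frameGenerator (christoffel X.cov q) (components q (X.u t)) (X.noise t) (solCoord d q γ P t)

/-- The generator of the linearized development equation. -/
noncomputable def generator (γ : ℝ → M) (P : ℝ → ModelSpace d →L[ℝ] ModelSpace d) (t : ℝ) :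
    (ℝ × 𝔢) →L[ℝ] ModelSpace d × (ModelSpace d →L[ℝ] ModelSpace d) →L[ℝ]
      ModelSpace d × (ModelSpace d →L[ℝ] ModelSpace d) :=
  X.generatorIn (γ t) γ P t

/-- The torsion at `x`, on the model space. -/
noncomputable def torsionAt (x : M) (v w : ModelSpace d) : ModelSpace d := X.cov.torsion x v w

/-- The curvature at `x`, on the model space. -/
noncomputable def curvatureAt (x : M) (v w z : ModelSpace d) : ModelSpace d :=
  curvature X.cov (x := x) v w z

/-- The covariant derivative of the drift, on the model space. -/
noncomputable def covDriftAt (t : ℝ) (x : M) (v : ModelSpace d) : ModelSpace d :=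
  X.cov (X.u t) x v

/-- The velocity at time `t` driven by `e`. -/
noncomputable def velocityAt (γ : ℝ → M) (P : ℝ → ModelSpace d →L[ℝ] ModelSpace d) (t : ℝ)
    (e : ℝ × 𝔢) : ModelSpace d := P t (X.noise t e.2) + e.1 • X.drift t (γ t)

variable {X}

theorem IsSmooth.differentiableAt_components (hX : X.IsSmooth) {q x : M}
    (hx : x ∈ (coord d q).source) {t : ℝ} (ht : t ∈ Icc 0 X.T) :
    DifferentiableAt ℝ (components q (X.u t)) (coord d q x) :=
  (hasFDerivAt_of_contDiffOn_prod (isOpen_coord_target q)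
    (g := fun p : ℝ × ModelSpace d => components q (X.u p.1) p.2)
    ((contDiffOn_components hX.u q).of_le (by norm_cast)) ht
    ((coord d q).map_source hx)).differentiableAt

/-- The intrinsic meaning of the generator. -/
theorem generatorIn_spec (hX : X.IsSmooth) {γ : ℝ → M}
    {P : ℝ → ModelSpace d →L[ℝ] ModelSpace d} {t : ℝ} (ht : t ∈ Icc 0 X.T) (hP : IsUnit (P t))
    {q : M} (hq : γ t ∈ (coord d q).source) (e : ℝ × 𝔢)
    (h : ModelSpace d × (ModelSpace d →L[ℝ] ModelSpace d)) :
    P t (X.generatorIn q γ P t e h).1 =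
      X.torsionAt (γ t) (X.velocityAt γ P t e) (P t h.1) + e.1 • X.covDriftAt t (γ t) (P t h.1) +
        P t (h.2 (X.noise t e.2)) ∧
    ∀ k, P t ((X.generatorIn q γ P t e h).2 k) =
      X.curvatureAt (γ t) (X.velocityAt γ P t e) (P t h.1) (P t k) := by
  set L := frameCoord d q (γ t) with hL
  have hLu : IsUnit L := isUnit_frameCoord hq
  have hy : IsUnit (solCoord d q γ P t).2 := hLu.mul hP
  have hinj : Function.Injective L := fun v w hvw => by
    rw [← ringInverse_apply_self hLu v, hvw, ringInverse_apply_self hLu]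
  have h0 : ∀ v, L (P t v) = (solCoord d q γ P t).2 v := fun v => rfl
  have hv : (solCoord d q γ P t).2 (frameVelocity (components q (X.u t)) (X.noise t)
      (solCoord d q γ P t) e) = L (X.velocityAt γ P t e) := by
    rw [apply_frameVelocity _ _ hy, velocityAt, map_add, map_smul, h0]
    congr 2
    exact components_coord hq _
  have hT : ∀ v w, L (X.torsionAt (γ t) v w) = christoffel X.cov q (coord d q (γ t)) (L v) (L w) -
      christoffel X.cov q (coord d q (γ t)) (L w) (L v) := fun v w => toCoord_torsion X.cov hq v w
  have hC : ∀ v w z, L (X.curvatureAt (γ t) v w z) = christoffelCurvature (christoffel X.cov q)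
      (coord d q (γ t)) (L v) (L w) (L z) := fun v w z => toCoord_curvature X.cov hX.cov hq v w z
  have hD : ∀ v, L (X.covDriftAt t (γ t) v) = fderiv ℝ (components q (X.u t)) (coord d q (γ t)) (L v) +
      christoffel X.cov q (coord d q (γ t)) (L v) (components q (X.u t) (coord d q (γ t))) := by
    intro v
    rw [components_coord hq]
    exact toCoord_cov X.cov hq (hX.differentiableAt_components hq ht) v
  have hx : (solCoord d q γ P t).1 = coord d q (γ t) := rfl
  constructor
  · apply hinj
    rw [h0, generatorIn, frameGenerator_apply, frameGeneratorFun, map_add (solCoord d q γ P t).2,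
      apply_ringInverse_self hy, hv, map_add L, map_add L, hT, map_smul L, hD, h0, h0, hx]
  · intro k
    apply hinj
    rw [h0, generatorIn, frameGenerator_apply, frameGeneratorFun, mul_apply_eq_comp,
      apply_ringInverse_self hy, hv, hC, h0, h0, mul_apply_eq_comp, hx]

/-- After application of the invertible `P t`, both sides are given by the same tensors at `γ t`, in
which no chart appears. -/
theorem generatorIn_eq_generator (hX : X.IsSmooth) {γ : ℝ → M}
    {P : ℝ → ModelSpace d →L[ℝ] ModelSpace d} {t : ℝ} (ht : t ∈ Icc 0 X.T) (hP : IsUnit (P t))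
    {q : M} (hq : γ t ∈ (coord d q).source) : X.generatorIn q γ P t = X.generator γ P t := by
  have hinj : Function.Injective (P t) := fun v w hvw => by
    rw [← ringInverse_apply_self hP v, hvw, ringInverse_apply_self hP]
  refine ContinuousLinearMap.ext fun e => ContinuousLinearMap.ext fun h => ?_
  have h1 := generatorIn_spec hX ht hP hq e h
  have h2 := generatorIn_spec hX ht hP (mem_extChartAt_source (I := 𝓡 d) (γ t)) e h
  ext1
  · exact hinj (h1.1.trans h2.1.symm)
  · exact ContinuousLinearMap.ext fun k => hinj ((h1.2 k).trans (h2.2 k).symm)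

/-- Equality of germs is needed, since derivatives of the connection and of the drift enter the
generator. -/
theorem frameGenerator_congr {F : FrameSystem (ModelSpace d) 𝔢 X.T} (hN : F.N = X.noise) {q : M}
    {y : ModelSpace d × (ModelSpace d →L[ℝ] ModelSpace d)} {t : ℝ}
    (hF : F.Γ =ᶠ[𝓝 y.1] christoffel X.cov q ∧ ∀ t', F.U t' =ᶠ[𝓝 y.1] components q (X.u t')) :
    frameGenerator F.Γ (F.U t) (F.N t) y =
      frameGenerator (christoffel X.cov q) (components q (X.u t)) (X.noise t) y := by
  refine ContinuousLinearMap.ext fun e => ContinuousLinearMap.ext fun h => ?_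
  simp only [frameGenerator_apply, frameGeneratorFun, frameVelocity, christoffelCurvature, hN,
    hF.1.eq_of_nhds, (hF.2 t).eq_of_nhds, hF.1.fderiv_eq, (hF.2 t).fderiv_eq]

end DevelopedProcess

/-! ### The differential of the end point map -/

namespace DevelopedProcess

open Filter Topology

variable {d : ℕ} {M : Type*} [TopologicalSpace M] [ChartedSpace (EuclideanSpace ℝ (Fin d)) M]
  [IsManifold (𝓡 d) ∞ M] [T2Space M]
  {𝔢 : Type*} [NormedAddCommGroup 𝔢] [InnerProductSpace ℝ 𝔢] [FiniteDimensional ℝ 𝔢]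
  {X : DevelopedProcess d M 𝔢}

theorem isUnit_fderiv_transition {q r x : M} (hq : x ∈ (coord d q).source)
    (hr : x ∈ (coord d r).source) : IsUnit (fderiv ℝ (transition d q r) (coord d q x)) := by
  have h1 := isUnit_frameCoord hr
  rw [frameCoord_eq_fderiv_transition hq hr] at h1
  exact ((isUnit_frameCoord hq).mul_right_iff).1 h1

/-- The components of a variation do not depend on the chart. -/
theorem invariantVariation_frameTransition (cov : AffineConnection d M) {q r x : M}
    (hq : x ∈ (coord d q).source) (hr : x ∈ (coord d r).source)
    {p : ModelSpace d →L[ℝ] ModelSpace d} (hp : IsUnit p)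
    (h : ModelSpace d × (ModelSpace d →L[ℝ] ModelSpace d)) :
    FrameSystem.invariantVariation (christoffel cov r) (frameTransition d q r (coord d q x, p),
      fderiv ℝ (frameTransition d q r) (coord d q x, p) h) =
    FrameSystem.invariantVariation (christoffel cov q) ((coord d q x, p), h) := by
  obtain ⟨D, hD, hD'⟩ := hasFDerivAt_frameTransition hq hr p
  rw [hD.fderiv, hD']
  have hu := isUnit_fderiv_transition hq hr
  simp only [FrameSystem.invariantVariation, frameTransition, transition_coord hq]
  set L := fderiv ℝ (transition d q r) (coord d q x) with hL
  have hinv : Ring.inverse (L * p) = Ring.inverse p * Ring.inverse L := by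
    obtain ⟨a, ha⟩ := hu
    obtain ⟨b, hb⟩ := hp
    rw [← ha, ← hb, ← Units.val_mul, Ring.inverse_unit, Ring.inverse_unit, Ring.inverse_unit,
      mul_inv_rev, Units.val_mul]
  rw [hinv]
  ext1
  · simp only [mul_apply_eq_comp, ringInverse_apply_self hu]
  · have h1 : L * h.2 + fderiv ℝ (fderiv ℝ (transition d q r)) (coord d q x) h.1 * p +
        christoffel cov r (coord d r x) (L h.1) * (L * p) =
        L * (h.2 + christoffel cov q (coord d q x) h.1 * p) := by
      refine ContinuousLinearMap.ext fun k => ?_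
      have h2 := fderiv_transition_christoffel cov hq hr h.1 (p k)
      simp only [_root_.add_apply, mul_apply_eq_comp, map_add]
      rw [h2]
      abel
    simp only [h1, mul_assoc, Ring.inverse_mul_cancel_left _ _ hu]

theorem IsSmooth.exists_local_frameSystem (hX : X.IsSmooth) {γ : ℝ → M} {a b : ℝ}
    (hc : ContinuousOn γ (Icc a b)) {t₀ : ℝ} (ht₀ : t₀ ∈ Icc a b) :
    ∃ F : FrameSystem (ModelSpace d) 𝔢 X.T, F.N = X.noise ∧ ∃ V, IsOpen V ∧
      V ⊆ (coord d (γ t₀)).target ∧ (∀ y ∈ V, F.Γ =ᶠ[𝓝 y] christoffel X.cov (γ t₀) ∧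
        ∀ t, F.U t =ᶠ[𝓝 y] components (γ t₀) (X.u t)) ∧
      ∃ ε > 0, ∀ s ∈ Icc a b, ∀ t ∈ Icc a b, |s - t₀| < ε → |t - t₀| < ε → ∀ τ ∈ Icc s t,
        τ ∈ Icc a b ∧ γ τ ∈ (coord d (γ t₀)).source ∧ coord d (γ t₀) (γ τ) ∈ V := by
  have hsrc := mem_extChartAt_source (I := 𝓡 d) (γ t₀)
  obtain ⟨F, hN, V, hV, hxV, hVt, hF⟩ := hX.exists_frameSystem hsrc
  obtain ⟨ε, hε, h4⟩ := exists_eps_forall_mem hc ht₀ (isOpen_coord_preimage (q := γ t₀) hV)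
    ⟨hsrc, hxV⟩
  refine ⟨F, hN, V, hV, hVt, hF, ε, hε, fun s hs t ht hs₀ ht₀ τ hτ => ?_⟩
  have h : τ ∈ Icc a b := ⟨hs.1.trans hτ.1, hτ.2.trans ht.2⟩
  refine ⟨h, h4 τ h ?_⟩
  rw [abs_lt] at *
  exact ⟨by linarith [hτ.1], by linarith [hτ.2]⟩

variable {w₀ : CameronMartin 𝔢 X.T} {γ : ℝ → M} {P : ℝ → ModelSpace d →L[ℝ] ModelSpace d}

/-- The definition uses the chart at `γ t`, which varies with `t`. Near `t₀` the generator can be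
computed in the fixed chart at `γ t₀`, where continuity is visible. -/
theorem IsSolution.continuousOn_generator (hX : X.IsSmooth) (h : X.IsSolution w₀ γ P 0 X.T)
    (hP : ∀ t ∈ Icc 0 X.T, IsUnit (P t)) : ContinuousOn (X.generator γ P) (Icc 0 X.T) := by
  intro t₀ ht₀
  obtain ⟨F, hN, V, hV, hVt, hF, ε, hε, hloc⟩ := hX.exists_local_frameSystem h.1 ht₀
  obtain ⟨h2, h3, h4, h5, h6⟩ := exists_nhd_subset_Icc ht₀ (half_pos hε)
  set s := max 0 (t₀ - ε / 2)
  set t := min X.T (t₀ + ε / 2)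
  have hin : ∀ τ ∈ Icc s t, τ ∈ Icc 0 X.T ∧ γ τ ∈ (coord d (γ t₀)).source ∧
      coord d (γ t₀) (γ τ) ∈ V := hloc s h4 t h5
    ((h6 s ⟨le_refl _, h2.trans h3⟩).2.trans_lt (half_lt_self hε))
    ((h6 t ⟨h2.trans h3, le_refl _⟩).2.trans_lt (half_lt_self hε))
  have hprim := h.2 (γ t₀) s t h4 h5 (h2.trans h3) fun τ hτ => (hin τ hτ).2.1
  have hcont : ContinuousOn (X.generator γ P) (Icc s t) := by
    refine (F.continuousOn_frameGenerator (fun τ hτ => (hin τ hτ).1)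
      (hprim.continuousOn (h2.trans h3)) fun τ hτ =>
        (isUnit_frameCoord (hin τ hτ).2.1).mul (hP τ (hin τ hτ).1)).congr fun τ hτ => ?_
    exact (generatorIn_eq_generator hX (hin τ hτ).1 (hP τ (hin τ hτ).1) (hin τ hτ).2.1).symm.trans
      (frameGenerator_congr hN (y := solCoord d (γ t₀) γ P τ) (hF _ (hin τ hτ).2.2)).symm
  refine (hcont t₀ ⟨h2, h3⟩).mono_of_mem_nhdsWithin ?_
  rw [Metric.mem_nhdsWithin_iff]
  refine ⟨ε / 2, half_pos hε, fun s hs => ?_⟩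
  have h7 := hs.1
  rw [Metric.mem_ball, Real.dist_eq, abs_lt] at h7
  exact ⟨max_le hs.2.1 (by linarith), le_min hs.2.2 (by linarith)⟩

/-- `Θ` solves the adjoint of the linearized equation. -/
def IsAdjoint (X : DevelopedProcess d M 𝔢) (w : ℝ → 𝔢) (γ : ℝ → M)
    (P : ℝ → ModelSpace d →L[ℝ] ModelSpace d)
    (Θ : ℝ → ModelSpace d × (ModelSpace d →L[ℝ] ModelSpace d) →L[ℝ] ℝ) : Prop :=
  IsPrimitive Θ (fun t => -(Θ t).comp (X.generator γ P t (1, w t))) 0 X.T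

theorem IsSolution.exists_isAdjoint (hX : X.IsSmooth) (h : X.IsSolution w₀ γ P 0 X.T)
    (hP : ∀ t ∈ Icc 0 X.T, IsUnit (P t))
    (Λ : ModelSpace d × (ModelSpace d →L[ℝ] ModelSpace d) →L[ℝ] ℝ) :
    ∃ Θ, X.IsAdjoint w₀ γ P Θ ∧ Θ X.T = Λ := by
  let W := ModelSpace d × (ModelSpace d →L[ℝ] ModelSpace d)
  let K : (W →L[ℝ] W) →L[ℝ] (W →L[ℝ] ℝ) →L[ℝ] (W →L[ℝ] ℝ) :=
    -(ContinuousLinearMap.compL ℝ W W ℝ).flip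
  have h1 : IntervalIntegrable (fun t => X.generator γ P t (1, w₀ t)) volume 0 X.T :=
    ContinuousOn.intervalIntegrable_clm_apply (V := ℝ × 𝔢) (W := W →L[ℝ] W) hX.T_pos.le
      (h.continuousOn_generator hX hP)
      (intervalIntegrable_const_prod_Lp le_rfl hX.T_pos.le le_rfl 1 w₀)
  have h2 : IntervalIntegrable (fun t => K (X.generator γ P t (1, w₀ t))) volume 0 X.T :=
    ContinuousOn.intervalIntegrable_clm_apply (V := W →L[ℝ] W)
      (W := (W →L[ℝ] ℝ) →L[ℝ] (W →L[ℝ] ℝ)) hX.T_pos.le continuousOn_const h1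
  obtain ⟨Θ, h3, h4⟩ := exists_isPrimitive_linear_backward (V := W →L[ℝ] ℝ) hX.T_pos.le h2 Λ
  exact ⟨Θ, h4, h3⟩

/-- Near `w₀`, the solutions exist up to time `t` and depend differentiably on the control. The
derivative is determined by the adjoint equation. -/
def HasFlowAt (X : DevelopedProcess d M 𝔢) (w₀ : CameronMartin 𝔢 X.T) (γ : ℝ → M)
    (P : ℝ → ModelSpace d →L[ℝ] ModelSpace d) (t : ℝ) : Prop :=
  ∃ q, γ t ∈ (coord d q).source ∧
    ∃ (Y : CameronMartin 𝔢 X.T → ModelSpace d × (ModelSpace d →L[ℝ] ModelSpace d))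
      (D : CameronMartin 𝔢 X.T →L[ℝ] ModelSpace d × (ModelSpace d →L[ℝ] ModelSpace d)),
    HasStrictFDerivAt Y D w₀ ∧ Y w₀ = solCoord d q γ P t ∧
    (∀ᶠ w : CameronMartin 𝔢 X.T in 𝓝 w₀, ∃ γ' P', X.IsSolution w γ' P' 0 t ∧ γ' 0 = X.o ∧ P' 0 = 1 ∧
      γ' t ∈ (coord d q).source ∧ solCoord d q γ' P' t = Y w) ∧
    ∀ Θ, X.IsAdjoint w₀ γ P Θ → ∀ η : CameronMartin 𝔢 X.T,
      Θ t (FrameSystem.invariantVariation (christoffel X.cov q) (Y w₀, D η)) =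
        ∫ s in (0 : ℝ)..t, Θ s (X.noise s (η s), 0)

theorem hasFlowAt_zero (h0 : γ 0 = X.o) (hP0 : P 0 = 1) : X.HasFlowAt w₀ γ P 0 := by
  have hsrc := mem_extChartAt_source (I := 𝓡 d) (γ 0)
  refine ⟨γ 0, hsrc, fun _ => solCoord d (γ 0) γ P 0, 0, hasStrictFDerivAt_const _ _, rfl,
    Eventually.of_forall fun w => ⟨γ, P, isHorizontal_refl _ _ _ _, h0, hP0, hsrc, rfl⟩,
    fun Θ _ η => ?_⟩
  rw [intervalIntegral.integral_same]
  have : FrameSystem.invariantVariation (christoffel X.cov (γ 0)) (solCoord d (γ 0) γ P 0,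
      (0 : CameronMartin 𝔢 X.T →L[ℝ] ModelSpace d × (ModelSpace d →L[ℝ] ModelSpace d)) η) = 0 := by
    simp [FrameSystem.invariantVariation]
  rw [this, map_zero]

theorem intervalIntegrable_adjoint_noise (hX : X.IsSmooth)
    {Θ : ℝ → ModelSpace d × (ModelSpace d →L[ℝ] ModelSpace d) →L[ℝ] ℝ}
    (hΘ : ContinuousOn Θ (Icc 0 X.T)) (η : CameronMartin 𝔢 X.T) :
    IntervalIntegrable (fun s => Θ s (X.noise s (η s), 0)) volume 0 X.T := by
  let W := ModelSpace d × (ModelSpace d →L[ℝ] ModelSpace d)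
  let A : ℝ → (ℝ × 𝔢) →L[ℝ] ℝ := fun s => (Θ s).comp
    ((ContinuousLinearMap.inl ℝ (ModelSpace d) (ModelSpace d →L[ℝ] ModelSpace d)).comp
      ((X.noise s).comp (ContinuousLinearMap.snd ℝ ℝ 𝔢)))
  have hA : ContinuousOn A (Icc 0 X.T) :=
    hΘ.clm_comp (continuousOn_const.clm_comp (hX.continuousOn_noise.clm_comp continuousOn_const))
  exact ContinuousOn.intervalIntegrable_clm_apply (V := ℝ × 𝔢) (W := ℝ) hX.T_pos.le hA
    (intervalIntegrable_const_prod_Lp le_rfl hX.T_pos.le le_rfl 1 η)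

end DevelopedProcess

/-! ### Propagation of the differentiable flow along the curve. -/

namespace DevelopedProcess

open Filter Topology

variable {d : ℕ} {M : Type*} [TopologicalSpace M] [ChartedSpace (EuclideanSpace ℝ (Fin d)) M]
  [IsManifold (𝓡 d) ∞ M] [T2Space M]
  {𝔢 : Type*} [NormedAddCommGroup 𝔢] [InnerProductSpace ℝ 𝔢] [FiniteDimensional ℝ 𝔢]
  {X : DevelopedProcess d M 𝔢}

/-- Continuation of a solution by a solution in coordinates. -/
theorem IsSolution.continuation {w : ℝ → 𝔢} {γ : ℝ → M} {P : ℝ → ModelSpace d →L[ℝ] ModelSpace d}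
    {a s t : ℝ} (has : a ≤ s) (hst : s ≤ t) (h : X.IsSolution w γ P a s) {q : M}
    (hq : γ s ∈ (coord d q).source)
    {F : FrameSystem (ModelSpace d) 𝔢 X.T} (hN : F.N = X.noise) {V : Set (ModelSpace d)}
    (hVt : V ⊆ (coord d q).target)
    (hF : ∀ y ∈ V, F.Γ =ᶠ[𝓝 y] christoffel X.cov q ∧ ∀ t, F.U t =ᶠ[𝓝 y] components q (X.u t))
    {y : ℝ → ModelSpace d × (ModelSpace d →L[ℝ] ModelSpace d)}
    (hy : IsPrimitive y (fun τ => F.field τ (y τ) (1, w τ)) s t)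
    (hyV : ∀ τ ∈ Icc s t, (y τ).1 ∈ V) (hys : y s = solCoord d q γ P s) :
    ∃ γ' P', X.IsSolution w γ' P' a t ∧ (∀ τ ∈ Icc a s, γ' τ = γ τ ∧ P' τ = P τ) ∧
      γ' t ∈ (coord d q).source ∧ solCoord d q γ' P' t = y t := by
  let γ₂ : ℝ → M := fun τ => (coord d q).symm (y τ).1
  let P₂ : ℝ → ModelSpace d →L[ℝ] ModelSpace d := fun τ => frameOfCoord d q (γ₂ τ) * (y τ).2
  have hsrc : ∀ τ ∈ Icc s t, γ₂ τ ∈ (coord d q).source := fun τ hτ =>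
    (coord d q).map_target (hVt (hyV τ hτ))
  have hsol : ∀ τ ∈ Icc s t, solCoord d q γ₂ P₂ τ = y τ := fun τ hτ => by
    have h1 : coord d q (γ₂ τ) = (y τ).1 := (coord d q).right_inv (hVt (hyV τ hτ))
    ext1
    · exact h1
    · change frameCoord d q (γ₂ τ) * (frameOfCoord d q (γ₂ τ) * (y τ).2) = (y τ).2
      rw [← mul_assoc, frameCoord_mul_frameOfCoord (hsrc τ hτ), one_mul]
  have hγ₂s : γ₂ s = γ s := by
    simp only [γ₂, hys, solCoord]
    exact (coord d q).left_inv hq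
  have hP₂s : P₂ s = P s := by
    simp only [P₂, hγ₂s]
    rw [hys]
    simp only [solCoord]
    rw [← mul_assoc, frameOfCoord_mul_frameCoord hq, one_mul]
  have hcont : ContinuousOn γ₂ (Icc s t) :=
    (continuousOn_extChartAt_symm q).comp (hy.continuousOn hst).fst fun τ hτ => hVt (hyV τ hτ)
  have hsol₂ : X.IsSolution w γ₂ P₂ s t := by
    refine IsHorizontal.of_coord hcont hsrc (hy.congr hst hsol (Eventually.of_forall fun τ hτ => ?_))
    have h1 := field_eq_horizontalRate (w := w) (P := P₂) (hsrc τ hτ) hN (hF _ (by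
      rw [show coord d q (γ₂ τ) = (y τ).1 from congrArg Prod.fst (hsol τ hτ)]; exact hyV τ hτ))
    rw [hsol τ hτ] at h1
    exact h1.symm
  let γ' : ℝ → M := fun τ => if τ ≤ s then γ τ else γ₂ τ
  let P' : ℝ → ModelSpace d →L[ℝ] ModelSpace d := fun τ => if τ ≤ s then P τ else P₂ τ
  have h1 : ∀ τ ∈ Icc a s, γ' τ = γ τ ∧ P' τ = P τ := fun τ hτ =>
    ⟨if_pos hτ.2, if_pos hτ.2⟩
  have h2 : ∀ τ ∈ Icc s t, γ' τ = γ₂ τ ∧ P' τ = P₂ τ := fun τ hτ => by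
    rcases eq_or_lt_of_le hτ.1 with rfl | hlt
    · exact ⟨(if_pos le_rfl).trans hγ₂s.symm, (if_pos le_rfl).trans hP₂s.symm⟩
    · exact ⟨if_neg (not_le.2 hlt), if_neg (not_le.2 hlt)⟩
  have hdrive : ∀ (γ₁ : ℝ → M) (P₁ : ℝ → ModelSpace d →L[ℝ] ModelSpace d) (τ : ℝ),
      γ' τ = γ₁ τ ∧ P' τ = P₁ τ → X.drive γ' P' w τ = X.drive γ₁ P₁ w τ := fun γ₁ P₁ τ hτ => by
    simp only [drive, hτ.1, hτ.2]
  have ht : t ∈ Icc s t := ⟨hst, le_rfl⟩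
  refine ⟨γ', P', ?_, h1, (h2 t ht).1 ▸ hsrc t ht, ?_⟩
  · exact (IsHorizontal.congr h (fun τ hτ => (h1 τ hτ).1) (fun τ hτ => (h1 τ hτ).2)
      (Eventually.of_forall fun τ hτ => hdrive γ P τ (h1 τ hτ))).trans
      (IsHorizontal.congr hsol₂ (fun τ hτ => (h2 τ hτ).1) (fun τ hτ => (h2 τ hτ).2)
      (Eventually.of_forall fun τ hτ => hdrive γ₂ P₂ τ (h2 τ hτ))) has hst
  · rw [← hsol t ht]
    simp only [solCoord, (h2 t ht).1, (h2 t ht).2]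

variable {w₀ : CameronMartin 𝔢 X.T} {γ : ℝ → M} {P : ℝ → ModelSpace d →L[ℝ] ModelSpace d}

/-- The state at time `s`, a differentiable function of the control, is moved to the chart at `γ t₀`
and used as initial value of the flow in that chart. The strict chain rule gives differentiability
at time `t`, and the adjoint identity is extended by the integral over `[s, t]`. -/
theorem IsSolution.hasFlowAt_step (hX : X.IsSmooth) (h : X.IsSolution w₀ γ P 0 X.T)
    (hP : ∀ t ∈ Icc 0 X.T, IsUnit (P t)) {t₀ : ℝ} (ht₀ : t₀ ∈ Icc 0 X.T) :
    ∃ ε > 0, ∀ s ∈ Icc 0 X.T, ∀ t ∈ Icc 0 X.T, s ≤ t → |s - t₀| < ε → |t - t₀| < ε →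
      X.HasFlowAt w₀ γ P s → X.HasFlowAt w₀ γ P t := by
  obtain ⟨F, hN, V, hV, hVt, hF, ε, hε, hloc⟩ := hX.exists_local_frameSystem h.1 ht₀
  refine ⟨ε, hε, fun s hs t ht hst hs₀ ht₀' hS => ?_⟩
  have hin := hloc s hs t ht hs₀ ht₀'
  set q := γ t₀ with hqdef
  obtain ⟨q₁, hq₁, Y₁, D₁, hD₁, hY₁, hreal, hadj⟩ := hS
  have hsI : s ∈ Icc s t := ⟨le_rfl, hst⟩
  have htI : t ∈ Icc s t := ⟨hst, le_rfl⟩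
  have hqs := (hin s hsI).2.1
  -- the reference solution in the chart at `q`
  have hy : IsPrimitive (solCoord d q γ P) (fun τ => F.field τ (solCoord d q γ P τ) (1, w₀ τ)) s t :=
    (h.2 q s t hs ht hst fun τ hτ => (hin τ hτ).2.1).congr hst (fun _ _ => rfl)
      (Eventually.of_forall fun τ hτ => field_eq_horizontalRate (hin τ hτ).2.1 hN
        (hF _ (hin τ hτ).2.2))
  have hsub : Icc s t ⊆ Icc 0 X.T := fun τ hτ => (hin τ hτ).1
  obtain ⟨Z, hZ₀, hZ, hclose, L, hL, hLv⟩ := exists_strictly_differentiable_flow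
    (V := ModelSpace d × (ModelSpace d →L[ℝ] ModelSpace d)) hs.1 hst ht.2
    (F.continuousOn_field.mono (prod_mono_left hsub))
    (F.continuousOn_fieldDeriv.mono (prod_mono_left hsub))
    (fun τ hτ y => F.hasFDerivAt_field (hsub hτ) y) w₀ hy
  -- change of chart
  have hct : ContDiffAt ℝ 1 (frameTransition d q₁ q) (Y₁ w₀) := by
    rw [hY₁]; exact contDiffAt_frameTransition hq₁ hqs _
  have hD₂ := (hct.hasStrictFDerivAt (by simp)).comp w₀ hD₁
  set D₂ := (fderiv ℝ (frameTransition d q₁ q) (Y₁ w₀)).comp D₁ with hD₂def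
  have hY₂ : frameTransition d q₁ q (Y₁ w₀) = solCoord d q γ P s := by
    rw [hY₁]; exact frameTransition_solCoord hq₁ hqs
  have hG : HasStrictFDerivAt (fun w => (frameTransition d q₁ q (Y₁ w), w))
      (D₂.prod (ContinuousLinearMap.id ℝ _)) w₀ := hD₂.prodMk (hasStrictFDerivAt_id w₀)
  have hG₀ : (frameTransition d q₁ q (Y₁ w₀), w₀) = (solCoord d q γ P s, w₀) := by rw [hY₂]
  have hGt : Tendsto (fun w => (frameTransition d q₁ q (Y₁ w), w)) (𝓝 w₀)
      (𝓝 (solCoord d q γ P s, w₀)) := by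
    have := hG.continuousAt
    rwa [ContinuousAt, hG₀] at this
  have hYd : HasStrictFDerivAt (fun w => Z (frameTransition d q₁ q (Y₁ w), w) t)
      (L.comp (D₂.prod (ContinuousLinearMap.id ℝ _))) w₀ :=
    HasStrictFDerivAt.comp (g := fun p => Z p t) w₀ (by rw [hG₀]; exact hL) hG
  have hYv : Z (frameTransition d q₁ q (Y₁ w₀), w₀) t = solCoord d q γ P t := by
    rw [hG₀]; exact hZ₀ t htI
  refine ⟨q, (hin t htI).2.1, _, _, hYd, hYv, ?_, fun Θ hΘ η => ?_⟩
  -- The cut-off system agrees with the true one only on `V`. A tube around the compact reference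
  -- curve lies in `V`, and perturbed solutions stay in the tube.
  · obtain ⟨δ, hδ, hδV⟩ := (isCompact_Icc.image_of_continuousOn
      (hy.continuousOn hst).fst).exists_thickening_subset_open hV (by
        rintro _ ⟨τ, hτ, rfl⟩; exact (hin τ hτ).2.2)
    have h1 : ∀ᶠ w in 𝓝 w₀, (Y₁ w).1 ∈ transitionSource d q₁ q := by
      have h2 : Tendsto (fun w => (Y₁ w).1) (𝓝 w₀) (𝓝 (coord d q₁ (γ s))) := by
        have := (continuous_fst.tendsto _).comp hD₁.continuousAt
        rwa [hY₁] at this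
      exact h2 (transitionSource_mem_nhds hq₁ hqs)
    filter_upwards [hreal, h1, hGt.eventually hZ, hGt.eventually (hclose δ hδ)] with w hw hw1 hw2 hw3
    obtain ⟨γ', P', hsol, h0, hP0, hsrc', hY⟩ := hw
    have hqs' : γ' s ∈ (coord d q).source := by
      have h3 : coord d q₁ (γ' s) ∈ transitionSource d q₁ q := by
        rw [← hY] at hw1; exact hw1
      have h4 := h3.2
      rwa [mem_preimage, (coord d q₁).left_inv hsrc'] at h4
    obtain ⟨γ'', P'', h5, h6, h7, h8⟩ := hsol.continuation hs.1 hst hqs' hN hVt hF hw2.2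
      (fun τ hτ => hδV (Metric.mem_thickening_iff.2 ⟨_, mem_image_of_mem _ hτ, by
        rw [dist_eq_norm]
        exact (norm_fst_le (Z (frameTransition d q₁ q (Y₁ w), w) τ - solCoord d q γ P τ)).trans_lt
          (hw3 τ hτ)⟩))
      (by rw [hw2.1, ← hY, frameTransition_solCoord hsrc' hqs'])
    have hz : (0 : ℝ) ∈ Icc 0 s := ⟨le_rfl, hs.1⟩
    exact ⟨γ'', P'', h5, (h6 0 hz).1.trans h0, (h6 0 hz).2.trans hP0, h7, h8⟩
  · obtain ⟨v, hvs, hvt, hv⟩ := hLv (D₂ η, η)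
    have hPu : ∀ τ ∈ Icc s t, IsUnit (solCoord d q γ P τ).2 := fun τ hτ =>
      (isUnit_frameCoord (hin τ hτ).2.1).mul (hP τ (hsub hτ))
    have hlin := F.isPrimitive_frameGenerator hs.1 hst ht.2 hy hv hPu
    have hΓ : ∀ τ ∈ Icc s t, ∀ k, FrameSystem.invariantVariation F.Γ (solCoord d q γ P τ, k) =
        FrameSystem.invariantVariation (christoffel X.cov q) (solCoord d q γ P τ, k) := by
      intro τ hτ k
      have : F.Γ (solCoord d q γ P τ).1 = christoffel X.cov q (solCoord d q γ P τ).1 :=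
        (hF _ (hin τ hτ).2.2).1.eq_of_nhds
      simp only [FrameSystem.invariantVariation, this]
    have hΘs := IsPrimitive.mono hΘ hs ht
    let W := ModelSpace d × (ModelSpace d →L[ℝ] ModelSpace d)
    -- Product rule for the adjoint paired with the variation: the generator terms cancel, and only
    -- the contribution of `η` remains.
    have hpair := hΘs.bilin hst hlin (ContinuousLinearMap.id ℝ (W →L[ℝ] ℝ))
    have hval := hpair.eq t htI
    have hrate : (∫ τ in s..t, ((ContinuousLinearMap.id ℝ (W →L[ℝ] ℝ))
        (-(Θ τ).comp (X.generator γ P τ (1, w₀ τ))))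
          (FrameSystem.invariantVariation F.Γ (solCoord d q γ P τ, v τ)) +
        ((ContinuousLinearMap.id ℝ (W →L[ℝ] ℝ)) (Θ τ))
          (frameGenerator F.Γ (F.U τ) (F.N τ) (solCoord d q γ P τ) (1, w₀ τ)
            (FrameSystem.invariantVariation F.Γ (solCoord d q γ P τ, v τ)) + (F.N τ (η τ), 0))) =
        ∫ τ in s..t, Θ τ (X.noise τ (η τ), 0) := by
      refine intervalIntegral.integral_congr fun τ hτ => ?_
      rw [uIcc_of_le hst] at hτ
      have h1 : frameGenerator F.Γ (F.U τ) (F.N τ) (solCoord d q γ P τ) = X.generator γ P τ :=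
        (frameGenerator_congr hN (y := solCoord d q γ P τ) (hF _ (hin τ hτ).2.2)).trans
          (generatorIn_eq_generator hX (hsub hτ) (hP τ (hsub hτ)) (hin τ hτ).2.1)
      simp only [h1]
      simp only [ContinuousLinearMap.id_apply, _root_.neg_apply, ContinuousLinearMap.comp_apply,
        map_add, hN]
      abel
    rw [hrate] at hval
    -- The pairing at time `s` is known in the earlier chart; displacement and rotation do not
    -- change under the transition.
    have hstart : FrameSystem.invariantVariation F.Γ (solCoord d q γ P s, v s) =
        FrameSystem.invariantVariation (christoffel X.cov q₁) (Y₁ w₀, D₁ η) := by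
      rw [hΓ s hsI, hvs]
      have h1 := invariantVariation_frameTransition X.cov hq₁ hqs
        (p := (solCoord d q₁ γ P s).2) ((isUnit_frameCoord hq₁).mul (hP s hs)) (D₁ η)
      have h2 : ((coord d q₁ (γ s), (solCoord d q₁ γ P s).2) :
        ModelSpace d × (ModelSpace d →L[ℝ] ModelSpace d)) = Y₁ w₀ := hY₁.symm
      rw [h2, hY₂] at h1
      exact h1
    have hend : FrameSystem.invariantVariation (christoffel X.cov q)
        (Z (frameTransition d q₁ q (Y₁ w₀), w₀) t,
          (L.comp (D₂.prod (ContinuousLinearMap.id ℝ _))) η) =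
        FrameSystem.invariantVariation F.Γ (solCoord d q γ P t, v t) := by
      rw [hΓ t htI, hYv, hvt]; rfl
    rw [hend]
    have hval' : Θ t (FrameSystem.invariantVariation F.Γ (solCoord d q γ P t, v t)) =
        Θ s (FrameSystem.invariantVariation F.Γ (solCoord d q γ P s, v s)) +
          ∫ τ in s..t, Θ τ (X.noise τ (η τ), 0) := hval
    have hint := intervalIntegrable_adjoint_noise hX (IsPrimitive.continuousOn hΘ hX.T_pos.le) η
    rw [hval', hstart, hadj Θ hΘ η]
    exact intervalIntegral.integral_add_adjacent_intervals
      (hint.mono_set (by rw [uIcc_of_le hs.1, uIcc_of_le hX.T_pos.le]; exact Icc_subset_Icc le_rfl hs.2))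
      (hint.mono_set (by rw [uIcc_of_le hst, uIcc_of_le hX.T_pos.le]; exact hsub))

theorem IsSolution.hasFlowAt (hX : X.IsSmooth) (h : X.IsSolution w₀ γ P 0 X.T)
    (h0 : γ 0 = X.o) (hP0 : P 0 = 1) : ∀ t ∈ Icc 0 X.T, X.HasFlowAt w₀ γ P t :=
  interval_induction (hasFlowAt_zero h0 hP0) fun _ ht₀ => h.hasFlowAt_step hX
    (IsHorizontal.isUnit hX.cov h (hP0 ▸ isUnit_one)) ht₀

end DevelopedProcess

/-! ### The Lagrange multiplier rule and the minimizing control. -/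

theorem inner_rieszVector {𝔢 : Type*} [NormedAddCommGroup 𝔢] [InnerProductSpace ℝ 𝔢]
    [FiniteDimensional ℝ 𝔢] (α : 𝔢 →L[ℝ] ℝ) (v : 𝔢) : inner ℝ (rieszVector α) v = α v := by
  have := FiniteDimensional.complete ℝ 𝔢
  exact InnerProductSpace.toDual_symm_apply

theorem continuousOn_rieszVector {𝔢 : Type*} [NormedAddCommGroup 𝔢] [InnerProductSpace ℝ 𝔢]
    [FiniteDimensional ℝ 𝔢] {α : ℝ → 𝔢 →L[ℝ] ℝ} {s : Set ℝ} (h : ContinuousOn α s) :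
    ContinuousOn (fun t => rieszVector (α t)) s := by
  have := FiniteDimensional.complete ℝ 𝔢
  exact (InnerProductSpace.toDual ℝ 𝔢).symm.continuous.comp_continuousOn h

namespace DevelopedProcess

open Filter Topology

variable {d : ℕ} {M : Type*} [TopologicalSpace M] [ChartedSpace (EuclideanSpace ℝ (Fin d)) M]
  [IsManifold (𝓡 d) ∞ M] [T2Space M]
  {𝔢 : Type*} [NormedAddCommGroup 𝔢] [InnerProductSpace ℝ 𝔢] [FiniteDimensional ℝ 𝔢]
  {X : DevelopedProcess d M 𝔢}

theorem IsSolution.isDevelopment (hX : X.IsSmooth) {w : CameronMartin 𝔢 X.T} {γ : ℝ → M}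
    {P : ℝ → ModelSpace d →L[ℝ] ModelSpace d} (h : X.IsSolution w γ P 0 X.T) (h0 : γ 0 = X.o)
    (hP : P 0 = 1) : X.IsDevelopment w γ :=
  (isDevelopment_iff hX).2 ⟨P, h, h0, hP⟩

/-- Uniqueness of solutions makes the choice in the definition of `endpoint` immaterial. -/
theorem IsDevelopment.endpoint_eq (hX : X.IsSmooth) {w : CameronMartin 𝔢 X.T} {γ : ℝ → M}
    (h : X.IsDevelopment w γ) : X.endpoint w = γ X.T := by
  have hex : ∃ γ, X.IsDevelopment w γ := ⟨γ, h⟩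
  rw [endpoint, dif_pos hex]
  obtain ⟨P, h1, h2, h3⟩ := (isDevelopment_iff hX).1 h
  obtain ⟨P', h1', h2', h3'⟩ := (isDevelopment_iff hX).1 hex.choose_spec
  exact ((h1'.eq_of_eq hX le_rfl le_rfl h1 (h2'.trans h2.symm) (h3'.trans h3.symm)) X.T
    ⟨hX.T_pos.le, le_rfl⟩).1

theorem OM_eq (w : CameronMartin 𝔢 X.T) : X.OM w = (1 / 2) * ‖w‖ ^ 2 := by
  rw [OM, ← real_inner_self_eq_norm_sq, L2.inner_def]
  simp only [real_inner_self_eq_norm_sq]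

/-- The Lagrange multiplier rule for a regular most probable path. -/
theorem exists_adjoint_of_isMostProbablePath (hX : X.IsSmooth) {γ : ℝ → M}
    (hγ : X.IsMostProbablePath γ) (hreg : ¬ X.IsSingular γ) :
    ∃ (w₀ : CameronMartin 𝔢 X.T) (P : ℝ → ModelSpace d →L[ℝ] ModelSpace d)
      (Θ : ℝ → ModelSpace d × (ModelSpace d →L[ℝ] ModelSpace d) →L[ℝ] ℝ),
      X.IsSolution w₀ γ P 0 X.T ∧ γ 0 = X.o ∧ P 0 = 1 ∧ X.IsAdjoint w₀ γ P Θ ∧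
      (∀ A, Θ X.T (0, A) = 0) ∧
      ∀ η : CameronMartin 𝔢 X.T,
        inner ℝ w₀ η = ∫ s in (0 : ℝ)..X.T, Θ s (X.noise s (η s), 0) := by
  have := FiniteDimensional.complete ℝ 𝔢
  obtain ⟨w₀, hdev, hmin⟩ := hγ
  have hsurj : X.IsRegular w₀ := by
    by_contra h
    exact hreg ⟨w₀, hdev, h⟩
  obtain ⟨P, hsol, h0, hP0⟩ := (isDevelopment_iff hX).1 hdev
  have hTI : X.T ∈ Icc 0 X.T := ⟨hX.T_pos.le, le_rfl⟩
  obtain ⟨q, hq, Y, D, hY, hYw, hnear, hadj⟩ := hsol.hasFlowAt hX h0 hP0 X.T hTI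
  have hunit := IsHorizontal.isUnit hX.cov hsol (hP0 ▸ isUnit_one)
  -- the endpoint map in coordinates
  have hend : ∀ᶠ w : CameronMartin 𝔢 X.T in 𝓝 w₀, ∃ γ', X.IsDevelopment w γ' ∧
      γ' X.T ∈ (coord d q).source ∧ coord d q (γ' X.T) = (Y w).1 := by
    filter_upwards [hnear] with w hw
    obtain ⟨γ', P', h1, h2, h3, h4, h5⟩ := hw
    exact ⟨γ', h1.isDevelopment hX h2 h3, h4, congrArg Prod.fst h5⟩
  have hG : HasStrictFDerivAt (fun w => (Y w).1) ((ContinuousLinearMap.fst ℝ _ _).comp D) w₀ :=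
    hY.fst
  have hYw1 : (Y w₀).1 = coord d q (γ X.T) := congrArg Prod.fst hYw
  have hsymm : ∀ᶠ w : CameronMartin 𝔢 X.T in 𝓝 w₀,
      X.endpoint w = (coord d q).symm ((Y w).1) ∧ coord d q (X.endpoint w) = (Y w).1 := by
    filter_upwards [hend] with w hw
    obtain ⟨γ', h1, h2, h3⟩ := hw
    rw [h1.endpoint_eq hX, h3, ← h3, (coord d q).left_inv h2]
    exact ⟨rfl, rfl⟩
  have hend0 : X.endpoint w₀ = γ X.T := hdev.endpoint_eq hX
  have hmd : MDifferentiableAt 𝓘(ℝ, CameronMartin 𝔢 X.T) (𝓡 d) X.endpoint w₀ := by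
    have h1 : MDifferentiableAt 𝓘(ℝ, CameronMartin 𝔢 X.T) 𝓘(ℝ, ModelSpace d)
        (fun w => (Y w).1) w₀ := hG.hasFDerivAt.differentiableAt.mdifferentiableAt
    have h2 : MDifferentiableAt 𝓘(ℝ, ModelSpace d) (𝓡 d) (coord d q).symm ((Y w₀).1) := by
      have hm : (Y w₀).1 ∈ (coord d q).target := hYw1 ▸ (coord d q).map_source hq
      have h3 := (contMDiffOn_extChartAt_symm (I := 𝓡 d) (n := ∞) q).contMDiffAt
        ((isOpen_coord_target q).mem_nhds hm)
      exact h3.mdifferentiableAt (by simp)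
    exact (h2.comp w₀ h1).congr_of_eventuallyEq (hsymm.mono fun w hw => hw.1)
  -- Regularity is stated for the manifold-valued end point map. Composing its differential with the
  -- coordinate isomorphism gives the first component of `D`, by uniqueness of derivatives.
  have hD1 : Function.Surjective ((ContinuousLinearMap.fst ℝ (ModelSpace d)
      (ModelSpace d →L[ℝ] ModelSpace d)).comp D) := by
    have hq' : X.endpoint w₀ ∈ (coord d q).source := hend0 ▸ hq
    have h1 := (hasMFDerivAt_coord hq').comp w₀ hmd.hasMFDerivAt
    have h2 : HasMFDerivAt 𝓘(ℝ, CameronMartin 𝔢 X.T) 𝓘(ℝ, ModelSpace d) (fun w => (Y w).1) w₀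
        ((toCoord d q (X.endpoint w₀)).comp (mfderiv _ _ X.endpoint w₀)) :=
      h1.congr_of_eventuallyEq (hsymm.mono fun w hw => hw.2.symm)
    let A : CameronMartin 𝔢 X.T →L[ℝ] ModelSpace d :=
      (toCoord d q (X.endpoint w₀)).comp (mfderiv 𝓘(ℝ, CameronMartin 𝔢 X.T) (𝓡 d) X.endpoint w₀)
    have h2' : HasFDerivAt (fun w => (Y w).1) A w₀ := hasMFDerivAt_iff_hasFDerivAt.1 h2
    have h3 := h2'.unique hG.hasFDerivAt
    intro k
    obtain ⟨η, hη⟩ := hsurj (ofCoord d q (X.endpoint w₀) k)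
    change CameronMartin 𝔢 X.T at η
    refine ⟨η, ?_⟩
    have h4 := DFunLike.congr_fun h3 η
    refine h4.symm.trans (Eq.trans ?_ (toCoord_ofCoord hq' k))
    exact congrArg (toCoord d q (X.endpoint w₀)) hη
  -- the minimum
  have hextr : IsLocalExtrOn (fun w : CameronMartin 𝔢 X.T => ‖w‖ ^ 2)
      {w | (Y w).1 = (Y w₀).1} w₀ := by
    left
    have h1 : ∀ᶠ w : CameronMartin 𝔢 X.T in 𝓝[{w | (Y w).1 = (Y w₀).1}] w₀,
        ‖w₀‖ ^ 2 ≤ ‖w‖ ^ 2 := by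
      filter_upwards [nhdsWithin_le_nhds hend, self_mem_nhdsWithin] with w hw hw'
      obtain ⟨γ', h2, h3, h4⟩ := hw
      have h5 : γ' X.T = γ X.T :=
        (coord d q).injOn h3 hq (h4.trans (Eq.trans hw' hYw1))
      have h6 := hmin w ⟨γ', h2, h5⟩
      rw [OM_eq, OM_eq] at h6
      linarith
    exact h1
  obtain ⟨Λ, Λ₀, hne, hΛ⟩ := hextr.exists_linear_map_of_hasStrictFDerivAt hG
    (hasStrictFDerivAt_norm_sq w₀)
  -- With `Λ₀ = 0` the functional `Λ` would vanish on the range of a surjective map, so the pair of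
  -- multipliers would be zero.
  have hΛ₀ : Λ₀ ≠ 0 := by
    rintro rfl
    refine hne (Prod.ext (LinearMap.ext fun k => ?_) rfl)
    obtain ⟨η, rfl⟩ := hD1 k
    simpa using hΛ η
  -- The derivative of `‖w‖²` at `w₀` is `2⟪w₀, ·⟫`, whence the factor 2 in the normalization.
  let Λ' : ModelSpace d →L[ℝ] ℝ := -(2 * Λ₀)⁻¹ • LinearMap.toContinuousLinearMap Λ
  have hΛ' : ∀ η, inner ℝ w₀ η = Λ' (D η).1 := by
    intro η
    have h1 := hΛ η
    have h2 : Λ' (D η).1 = -(2 * Λ₀)⁻¹ * Λ (D η).1 := rfl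
    have h3 : Λ (((ContinuousLinearMap.fst ℝ (ModelSpace d)
      (ModelSpace d →L[ℝ] ModelSpace d)).comp D) η) = Λ (D η).1 := rfl
    have h4 : (2 • innerSL ℝ w₀) η = 2 * inner ℝ w₀ η := by simp
    rw [h3] at h1
    rw [h2]
    have h5 : Λ (D η).1 = - (Λ₀ * (2 * inner ℝ w₀ η)) := by
      rw [← h4]; exact eq_neg_of_add_eq_zero_left h1
    rw [h5]
    field_simp
  have hpu : IsUnit (Y w₀).2 := by
    have : (Y w₀).2 = frameCoord d q (γ X.T) * P X.T := congrArg Prod.snd hYw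
    rw [this]
    exact (isUnit_frameCoord hq).mul (hunit X.T hTI)
  -- The final value is the multiplier expressed in the moving frame. The constraint fixes the end
  -- point but not the final frame, so there is no component on rotations; this becomes `χ_T = 0`.
  obtain ⟨Θ, hΘ, hΘT⟩ := hsol.exists_isAdjoint hX hunit
    ((Λ'.comp (Y w₀).2).comp (ContinuousLinearMap.fst ℝ (ModelSpace d) _))
  refine ⟨w₀, P, Θ, hsol, h0, hP0, hΘ, fun A => ?_, fun η => ?_⟩
  · rw [hΘT]; simp
  · rw [hΛ' η, ← hadj Θ hΘ η, hΘT]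
    exact congrArg Λ' (apply_ringInverse_self hpu (D η).1).symm

/-- The minimizing control, expressed by the adjoint. -/
theorem ae_eq_of_inner_eq (hX : X.IsSmooth) {w₀ : CameronMartin 𝔢 X.T}
    {Θ : ℝ → ModelSpace d × (ModelSpace d →L[ℝ] ModelSpace d) →L[ℝ] ℝ}
    (hΘ : ContinuousOn Θ (Icc 0 X.T))
    (h : ∀ η : CameronMartin 𝔢 X.T,
        inner ℝ w₀ η = ∫ s in (0 : ℝ)..X.T, Θ s (X.noise s (η s), 0)) :
    ∀ᵐ t ∂(volume.restrict (Icc 0 X.T)), w₀ t = rieszVector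
      (((Θ t).comp (ContinuousLinearMap.inl ℝ (ModelSpace d) _)).comp (X.noise t)) := by
  have := FiniteDimensional.complete ℝ 𝔢
  set n : ℝ → 𝔢 := fun t => rieszVector
      (((Θ t).comp (ContinuousLinearMap.inl ℝ (ModelSpace d) _)).comp (X.noise t)) with hn
  have hnc : ContinuousOn n (Icc 0 X.T) :=
    continuousOn_rieszVector (α := fun t => ((Θ t).comp
      (ContinuousLinearMap.inl ℝ (ModelSpace d) _)).comp (X.noise t))
      ((hΘ.clm_comp continuousOn_const).clm_comp hX.continuousOn_noise)
  have hmem : MemLp n 2 (volume.restrict (Icc 0 X.T)) := by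
    obtain ⟨C, hC⟩ := isCompact_Icc.exists_bound_of_continuousOn hnc
    exact MemLp.of_bound (hnc.aestronglyMeasurable measurableSet_Icc) C
      ((ae_restrict_iff' measurableSet_Icc).2 (ae_of_all _ hC))
  have heq : w₀ = hmem.toLp n := by
    refine ext_inner_right ℝ fun η => ?_
    rw [h η, L2.inner_def, intervalIntegral.integral_of_le hX.T_pos.le,
      ← integral_Icc_eq_integral_Ioc]
    refine integral_congr_ae ?_
    filter_upwards [hmem.coeFn_toLp] with t ht
    rw [ht]
    exact (inner_rieszVector (𝔢 := 𝔢) (((Θ t).comp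
      (ContinuousLinearMap.inl ℝ (ModelSpace d) _)).comp (X.noise t)) (η t)).symm
  have := hmem.coeFn_toLp
  rw [← heq] at this
  exact this

end DevelopedProcess

/-! ### Regularity of the path and the intrinsic adjoint equation. -/

theorem Icc_max_min_mem_nhdsWithin {t ε T : ℝ} (hε : 0 < ε) :
    Icc (max 0 (t - ε)) (min T (t + ε)) ∈ nhdsWithin t (Icc 0 T) := by
  rw [Metric.mem_nhdsWithin_iff]
  refine ⟨ε, hε, fun s hs => ?_⟩
  have h7 := hs.1
  rw [Metric.mem_ball, Real.dist_eq, abs_lt] at h7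
  exact ⟨max_le hs.2.1 (by linarith), le_min hs.2.2 (by linarith)⟩

theorem rieszVector_comp_isPositive {𝔢 : Type*} [NormedAddCommGroup 𝔢] [InnerProductSpace ℝ 𝔢]
    [FiniteDimensional ℝ 𝔢] (α : 𝔢 →L[ℝ] ℝ) {A : 𝔢 →L[ℝ] 𝔢} (hA : A.IsPositive) :
    rieszVector (α.comp A) = A (rieszVector α) := by
  refine ext_inner_right ℝ fun v => ?_
  rw [inner_rieszVector, hA.inner_map_left, inner_rieszVector]; rfl

theorem FrameSystem.continuousOn_field_curve {E 𝔢 : Type*} [NormedAddCommGroup E]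
    [NormedSpace ℝ E] [NormedAddCommGroup 𝔢] [NormedSpace ℝ 𝔢] {T : ℝ} (F : FrameSystem E 𝔢 T)
    {s : Set ℝ} (hs : s ⊆ Icc 0 T) {y : ℝ → E × (E →L[ℝ] E)} (hy : ContinuousOn y s) {w : ℝ → 𝔢}
    (hw : ContinuousOn w s) : ContinuousOn (fun τ => F.field τ (y τ) (1, w τ)) s := by
  have h : ContinuousOn (fun τ => F.field τ (y τ)) s :=
    F.continuousOn_field.comp (f := fun τ => (τ, y τ)) (continuousOn_id.prodMk hy)
      fun τ hτ => ⟨hs hτ, mem_univ _⟩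
  exact h.clm_apply (continuousOn_const.prodMk hw)

namespace DevelopedProcess

open Filter Topology

variable {d : ℕ} {M : Type*} [TopologicalSpace M] [ChartedSpace (EuclideanSpace ℝ (Fin d)) M]
  [IsManifold (𝓡 d) ∞ M] [T2Space M]
  {𝔢 : Type*} [NormedAddCommGroup 𝔢] [InnerProductSpace ℝ 𝔢] [FiniteDimensional ℝ 𝔢]
  {X : DevelopedProcess d M 𝔢}

/-- With a continuous control the right-hand side in coordinates is continuous, so the fundamental
theorem of calculus gives the derivative at every time, one-sided at the ends. -/
theorem IsSolution.hasMFDerivWithinAt (hX : X.IsSmooth) {w : ℝ → 𝔢} {γ : ℝ → M}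
    {P : ℝ → ModelSpace d →L[ℝ] ModelSpace d} (h : X.IsSolution w γ P 0 X.T)
    (hw : ContinuousOn w (Icc 0 X.T)) {t : ℝ} (ht : t ∈ Icc 0 X.T) :
    HasMFDerivWithinAt 𝓘(ℝ, ℝ) (𝓡 d) γ (Icc 0 X.T) t
      ((1 : ℝ →L[ℝ] ℝ).smulRight (X.drive γ P w t : TangentSpace (𝓡 d) (γ t))) := by
  obtain ⟨F, hN, V, hV, hVt, hF, ε, hε, hloc⟩ := hX.exists_local_frameSystem h.1 ht
  obtain ⟨h2, h3, h4, h5, h6⟩ := exists_nhd_subset_Icc ht (half_pos hε)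
  have hnhd := Icc_max_min_mem_nhdsWithin (t := t) (T := X.T) (half_pos hε)
  set a := max 0 (t - ε / 2)
  set b := min X.T (t + ε / 2)
  have hin : ∀ τ ∈ Icc a b, τ ∈ Icc 0 X.T ∧ γ τ ∈ (coord d (γ t)).source ∧
      coord d (γ t) (γ τ) ∈ V := hloc a h4 b h5
    ((h6 a ⟨le_refl _, h2.trans h3⟩).2.trans_lt (half_lt_self hε))
    ((h6 b ⟨h2.trans h3, le_refl _⟩).2.trans_lt (half_lt_self hε))
  have hprim : IsPrimitive (solCoord d (γ t) γ P)
      (horizontalRate X.cov (γ t) γ P (X.drive γ P w)) a b :=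
    h.2 (γ t) a b h4 h5 (h2.trans h3) fun τ hτ => (hin τ hτ).2.1
  have hrate : ∀ τ ∈ Icc a b, F.field τ (solCoord d (γ t) γ P τ) (1, w τ) =
      horizontalRate X.cov (γ t) γ P (X.drive γ P w) τ := fun τ hτ =>
    field_eq_horizontalRate (X := X) (γ := γ) (P := P) (w := w) (hin τ hτ).2.1 hN
      (hF _ (hin τ hτ).2.2)
  have hprim' : IsPrimitive (solCoord d (γ t) γ P)
      (fun τ => F.field τ (solCoord d (γ t) γ P τ) (1, w τ)) a b :=
    hprim.congr (h2.trans h3) (fun _ _ => rfl) (ae_of_all _ hrate)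
  have hcont : ContinuousOn (fun τ => F.field τ (solCoord d (γ t) γ P τ) (1, w τ)) (Icc a b) := by
    exact F.continuousOn_field_curve (fun τ hτ => (hin τ hτ).1)
      (hprim.continuousOn (h2.trans h3)) (hw.mono fun τ hτ => (hin τ hτ).1)
  have hd := (hprim'.hasDerivWithinAt hcont ⟨h2, h3⟩).mono_of_mem_nhdsWithin hnhd
  have hd1 : HasDerivWithinAt (fun τ => coord d (γ t) (γ τ))
      (F.field t (solCoord d (γ t) γ P t) (1, w t)).1 (Icc 0 X.T) t := hd.fst
  rw [hrate t ⟨h2, h3⟩] at hd1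
  exact (hasMFDerivWithinAt_curve_iff (mem_extChartAt_source (I := 𝓡 d) (γ t)) _).2
    ⟨h.1 t ht, hd1⟩

/-- The differential equation of the adjoint, in terms of torsion and curvature. -/
theorem adjoint_generator (hX : X.IsSmooth) {γ : ℝ → M} {P : ℝ → ModelSpace d →L[ℝ] ModelSpace d}
    {t : ℝ} (ht : t ∈ Icc 0 X.T) (hP : IsUnit (P t)) (w : ℝ → 𝔢)
    (Θ : ModelSpace d × (ModelSpace d →L[ℝ] ModelSpace d) →L[ℝ] ℝ) :
    (∀ v, Θ (X.generator γ P t (1, w t) (v, 0)) =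
      Θ (Ring.inverse (P t) (X.torsionAt (γ t) (X.drive γ P w t) (P t v) +
        X.covDriftAt t (γ t) (P t v)), 0) +
      Θ (0, (X.generator γ P t (1, w t) (v, 0)).2)) ∧
    (∀ v k, P t ((X.generator γ P t (1, w t) (v, 0)).2 k) =
      X.curvatureAt (γ t) (X.drive γ P w t) (P t v) (P t k)) ∧
    ∀ A, Θ (X.generator γ P t (1, w t) (0, A)) = Θ (A (X.noise t (w t)), 0) := by
  have hq := mem_extChartAt_source (I := 𝓡 d) (γ t)
  have hdrive : X.velocityAt γ P t (1, w t) = X.drive γ P w t := by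
    simp [velocityAt, drive]
  have hgen := generatorIn_eq_generator hX ht hP hq
  refine ⟨fun v => ?_, fun v k => ?_, fun A => ?_⟩
  · have h1 := (generatorIn_spec hX ht hP hq (1, w t) (v, 0)).1
    rw [hgen, hdrive] at h1
    have h2 : (X.generator γ P t (1, w t) (v, 0)).1 =
        Ring.inverse (P t) (X.torsionAt (γ t) (X.drive γ P w t) (P t v) +
        X.covDriftAt t (γ t) (P t v)) := by
      rw [← ringInverse_apply_self hP (X.generator γ P t (1, w t) (v, 0)).1, h1]
      simp
    rw [← h2, ← map_add]
    simp
  · have h1 := (generatorIn_spec hX ht hP hq (1, w t) (v, 0)).2 k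
    rw [hgen, hdrive] at h1
    exact h1
  · obtain ⟨h1, h2⟩ := generatorIn_spec hX ht hP hq (1, w t) (0, A)
    rw [hgen, hdrive] at h1 h2
    have hz : ∀ x : M, ∀ v : ModelSpace d, X.torsionAt x v 0 = 0 := fun x v =>
      map_zero (X.cov.torsion x v)
    have hz' : X.covDriftAt t (γ t) 0 = 0 := map_zero (X.cov (X.u t) (γ t))
    have h3 : (X.generator γ P t (1, w t) (0, A)).1 = A (X.noise t (w t)) := by
      rw [← ringInverse_apply_self hP (X.generator γ P t (1, w t) (0, A)).1, h1]
      simp only [map_zero, hz, hz', smul_zero, zero_add]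
      exact ringInverse_apply_self hP _
    have h4 : (X.generator γ P t (1, w t) (0, A)).2 = 0 := by
      refine ContinuousLinearMap.ext fun k => ?_
      rw [← ringInverse_apply_self hP ((X.generator γ P t (1, w t) (0, A)).2 k)]
      refine Eq.trans (congrArg _ (Eq.trans (h2 k) ?_)) (map_zero (Ring.inverse (P t)))
      have h5 := (generatorIn_spec hX ht hP hq (1, w t) (0, 0)).2 k
      rw [hgen, hdrive] at h5
      refine h5.symm.trans ?_
      have h6 : X.generator γ P t (1, w t) (0, 0) = 0 := map_zero _
      rw [h6]
      exact map_zero (P t)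
    rw [← h3, ← h4]

/-- A regular most probable path has a continuous control, given by a solution of the adjoint
equation. -/
theorem exists_continuous_control (hX : X.IsSmooth) {γ : ℝ → M}
    (hγ : X.IsMostProbablePath γ) (hreg : ¬ X.IsSingular γ) :
    ∃ (w : ℝ → 𝔢) (P : ℝ → ModelSpace d →L[ℝ] ModelSpace d)
      (Θ : ℝ → ModelSpace d × (ModelSpace d →L[ℝ] ModelSpace d) →L[ℝ] ℝ),
      ContinuousOn w (Icc 0 X.T) ∧ X.IsSolution w γ P 0 X.T ∧ γ 0 = X.o ∧ P 0 = 1 ∧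
      (∀ t, w t = rieszVector
        (((Θ t).comp (ContinuousLinearMap.inl ℝ (ModelSpace d) _)).comp (X.noise t))) ∧
      (∀ A, Θ X.T (0, A) = 0) ∧
      ∀ t ∈ Icc 0 X.T, HasDerivWithinAt Θ (-(Θ t).comp (X.generator γ P t (1, w t)))
        (Icc 0 X.T) t := by
  obtain ⟨w₀, P, Θ, hsol, h0, hP0, hΘ, hΘT, hinner⟩ :=
    exists_adjoint_of_isMostProbablePath hX hγ hreg
  have hΘc : ContinuousOn Θ (Icc 0 X.T) := IsPrimitive.continuousOn hΘ hX.T_pos.le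
  have hae := ae_eq_of_inner_eq hX hΘc hinner
  rw [ae_restrict_iff' measurableSet_Icc] at hae
  -- The continuous representative of the minimizing control. The solution and its adjoint depend on
  -- the control through integrals only, so they are unchanged.
  let w : ℝ → 𝔢 := fun t => rieszVector
    (((Θ t).comp (ContinuousLinearMap.inl ℝ (ModelSpace d) _)).comp (X.noise t))
  have hw : ContinuousOn w (Icc 0 X.T) :=
    continuousOn_rieszVector (α := fun t => ((Θ t).comp
      (ContinuousLinearMap.inl ℝ (ModelSpace d) _)).comp (X.noise t))
      ((hΘc.clm_comp continuousOn_const).clm_comp hX.continuousOn_noise)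
  have hunit := IsHorizontal.isUnit hX.cov hsol (hP0 ▸ isUnit_one)
  have hgen := hsol.continuousOn_generator hX hunit
  refine ⟨w, P, Θ, hw, ?_, h0, hP0, fun t => rfl, hΘT, fun t ht => ?_⟩
  · refine IsHorizontal.congr hsol (fun _ _ => rfl) (fun _ _ => rfl) ?_
    filter_upwards [hae] with t h ht
    simp only [drive, h ht, w]
  · have h1 : IsPrimitive Θ (fun t => -(Θ t).comp (X.generator γ P t (1, w t))) 0 X.T := by
      refine IsPrimitive.congr hΘ hX.T_pos.le (fun _ _ => rfl) ?_
      filter_upwards [hae] with t h ht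
      simp only [h ht, w]
    have h2 : ContinuousOn (fun t => X.generator γ P t (1, w t)) (Icc 0 X.T) :=
      hgen.clm_apply (continuousOn_const.prodMk hw)
    exact h1.hasDerivWithinAt (hΘc.clm_comp h2).neg ht

end DevelopedProcess

/-! ### Smooth parallel transport and the holonomy group -/

section Holonomy

open Filter Topology

variable {d : ℕ} {M : Type*} [TopologicalSpace M] [ChartedSpace (EuclideanSpace ℝ (Fin d)) M]
  [IsManifold (𝓡 d) ∞ M] {cov : AffineConnection d M}

/-- The frame `P` along the curve `γ` is parallel at time `t`. -/
def IsParallelAt (cov : AffineConnection d M) (γ : ℝ → M)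
    (P : ℝ → ModelSpace d →L[ℝ] ModelSpace d) (t : ℝ) : Prop :=
  ∃ q x', γ t ∈ (coord d q).source ∧ ContinuousAt γ t ∧ HasDerivAt (solCoord d q γ P)
    (x', -(christoffel cov q (coord d q (γ t)) x' * (solCoord d q γ P t).2)) t

namespace IsParallelAt

variable {γ : ℝ → M} {P : ℝ → ModelSpace d →L[ℝ] ModelSpace d} {t : ℝ}

/-- The velocity in one chart defines a tangent vector, which then serves in all charts around the
point. -/
theorem exists_velocity (h : IsParallelAt cov γ P t) :
    ∃ v : ModelSpace d, ∀ q, γ t ∈ (coord d q).source →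
      HasDerivAt (solCoord d q γ P) (frameCoord d q (γ t) v,
        -(christoffel cov q (coord d q (γ t)) (frameCoord d q (γ t) v) *
          (solCoord d q γ P t).2)) t := by
  obtain ⟨q, x', hq, hc, hd⟩ := h
  have h1 : frameCoord d q (γ t) (ofCoord d q (γ t) x') = x' := toCoord_ofCoord hq x'
  refine ⟨ofCoord d q (γ t) x', fun r hr => ?_⟩
  have h2 := (hasDerivAt_solCoord_iff (cov := cov) (P := P)
    (v := ofCoord d q (γ t) x') hq).2 ⟨hc, by rw [h1]; exact hd⟩
  exact ((hasDerivAt_solCoord_iff (cov := cov) (P := P)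
    (v := ofCoord d q (γ t) x') hr).1 h2).2

theorem comp {g : ℝ → ℝ} {g' : ℝ} (h : IsParallelAt cov γ P (g t)) (hg : HasDerivAt g g' t) :
    IsParallelAt cov (fun s => γ (g s)) (fun s => P (g s)) t := by
  obtain ⟨q, x', hq, hc, hd⟩ := h
  refine ⟨q, g' • x', hq, ContinuousAt.comp (f := g) hc hg.continuousAt, ?_⟩
  have h1 := HasDerivAt.scomp t hd hg
  refine h1.congr_deriv ?_
  rw [Prod.smul_mk, map_smul, smul_neg, ← smul_mul_assoc]
  rfl

theorem mul_right (h : IsParallelAt cov γ P t) (B : ModelSpace d →L[ℝ] ModelSpace d) :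
    IsParallelAt cov γ (fun s => P s * B) t := by
  obtain ⟨q, x', hq, hc, hd⟩ := h
  refine ⟨q, x', hq, hc, ?_⟩
  have h0 : HasDerivAt (fun s => (solCoord d q γ P s).2)
      (-(christoffel cov q (coord d q (γ t)) x' * (solCoord d q γ P t).2)) t := hd.snd
  have h1 : HasDerivAt (fun s => (coord d q (γ s), frameCoord d q (γ s) * P s * B)) _ t :=
    HasDerivAt.prodMk hd.fst (h0.mul_const B)
  simp only [mul_assoc] at h1
  refine (h1.congr_deriv ?_)
  simp only [neg_mul, solCoord, mul_assoc]

theorem congr (h : IsParallelAt cov γ P t) {γ' : ℝ → M}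
    {P' : ℝ → ModelSpace d →L[ℝ] ModelSpace d} (hγ : γ' =ᶠ[𝓝 t] γ) (hP : P' =ᶠ[𝓝 t] P) :
    IsParallelAt cov γ' P' t := by
  obtain ⟨q, x', hq, hc, hd⟩ := h
  have h1 : solCoord d q γ' P' =ᶠ[𝓝 t] solCoord d q γ P := by
    filter_upwards [hγ, hP] with s h1 h2
    simp only [solCoord, h1, h2]
  refine ⟨q, x', hγ.eq_of_nhds ▸ hq, hc.congr hγ.symm, ?_⟩
  rw [hγ.eq_of_nhds, h1.eq_of_nhds]
  exact hd.congr_of_eventuallyEq h1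

theorem const (x : M) (A : ModelSpace d →L[ℝ] ModelSpace d) (t : ℝ) :
    IsParallelAt cov (fun _ => x) (fun _ => A) t := by
  refine ⟨x, 0, mem_extChartAt_source x, continuousAt_const, ?_⟩
  have h : HasDerivAt (solCoord d x (fun _ : ℝ => x) (fun _ => A))
      (0 : ModelSpace d × (ModelSpace d →L[ℝ] ModelSpace d)) t := hasDerivAt_const t _
  refine h.congr_deriv ?_
  rw [map_zero, zero_mul, neg_zero]
  rfl

end IsParallelAt

/-- A smooth curve with a parallel frame. -/
structure IsSmoothParallel (cov : AffineConnection d M) (c : ℝ → M)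
    (P : ℝ → ModelSpace d →L[ℝ] ModelSpace d) : Prop where
  smooth : ContMDiff 𝓘(ℝ, ℝ) (𝓡 d) ∞ c
  parallel : ∀ t, IsParallelAt cov c P t

/-- Along a smooth curve the rate of change in coordinates is continuous, so the pointwise equation
integrates to the integral form. -/
theorem IsSmoothParallel.exists_isHorizontal [T2Space M]
    (hcov : CovariantDerivative.ContMDiffCovariantDerivative cov ∞) {c : ℝ → M}
    {P : ℝ → ModelSpace d →L[ℝ] ModelSpace d} (h : IsSmoothParallel cov c P) :
    ∃ ζ, ∀ a b, IsHorizontal cov c P ζ a b := by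
  choose ζ hζ using fun t => (h.parallel t).exists_velocity
  refine ⟨ζ, fun a b => ⟨h.smooth.continuous.continuousOn, fun q s t _ _ hst hq => ?_⟩⟩
  have hO : IsOpen (c ⁻¹' (coord d q).source) :=
    (isOpen_coord_source q).preimage h.smooth.continuous
  have h1 : ContDiffOn ℝ ∞ (fun τ => coord d q (c τ)) (c ⁻¹' (coord d q).source) := by
    rw [← contMDiffOn_iff_contDiffOn]
    have h2 := contMDiffOn_extChartAt (I := 𝓡 d) (n := ∞) (x := q)
    rw [← extChartAt_source (𝓡 d)] at h2
    exact h2.comp h.smooth.contMDiffOn fun τ hτ => hτ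
  have h2 : ContinuousOn (fun τ => frameCoord d q (c τ) (ζ τ)) (Icc s t) := by
    refine ((h1.continuousOn_deriv_of_isOpen hO (by norm_cast)).mono hq).congr fun τ hτ => ?_
    exact (HasDerivAt.deriv (hζ τ q (hq τ hτ)).fst).symm
  have h3 : ContinuousOn (solCoord d q c P) (Icc s t) := fun τ hτ =>
    (hζ τ q (hq τ hτ)).continuousAt.continuousWithinAt
  have h4 : ContinuousOn (fun τ => christoffel cov q (coord d q (c τ))) (Icc s t) :=
    continuousOn_christoffel_comp hcov h3 hq
  have h5 : ContinuousOn (horizontalRate cov q c P ζ) (Icc s t) :=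
    h2.prodMk ((h4.clm_apply h2).mul h3.snd).neg
  have h6 : IntervalIntegrable (horizontalRate cov q c P ζ) volume s t :=
    h5.intervalIntegrable_of_Icc hst
  refine ⟨h6, fun τ hτ => ?_⟩
  rw [intervalIntegral.integral_eq_sub_of_hasDerivAt (f := solCoord d q c P)]
  · abel
  · intro r hr
    rw [uIcc_of_le hτ.1] at hr
    exact hζ r q (hq r ⟨hr.1, hr.2.trans hτ.2⟩)
  · exact h6.mono_set (by rw [uIcc_of_le hτ.1, uIcc_of_le hst]; exact Icc_subset_Icc le_rfl hτ.2)

/-- `A : T_x M → T_y M` is the parallel transport along a smooth curve that stops at its ends. -/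
def IsTransport (cov : AffineConnection d M) (x y : M)
    (A : ModelSpace d →L[ℝ] ModelSpace d) : Prop :=
  ∃ c P a b, IsSmoothParallel cov c P ∧ (∀ t ≤ a, c t = x ∧ P t = 1) ∧
    ∀ t, b ≤ t → c t = y ∧ P t = A

namespace IsTransport

variable {x y z : M} {A B : ModelSpace d →L[ℝ] ModelSpace d}

theorem refl (x : M) : IsTransport cov x x 1 :=
  ⟨fun _ => x, fun _ => 1, 0, 0, ⟨contMDiff_const, fun t => .const x 1 t⟩, fun _ _ => ⟨rfl, rfl⟩,
    fun _ _ => ⟨rfl, rfl⟩⟩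

theorem exists_lt (h : IsTransport cov x y A) : ∃ c P a b, a < b ∧ IsSmoothParallel cov c P ∧
    (∀ t ≤ a, c t = x ∧ P t = 1) ∧ ∀ t, b ≤ t → c t = y ∧ P t = A := by
  obtain ⟨c, P, a, b, h1, h2, h3⟩ := h
  exact ⟨c, P, a, max b (a + 1), by simp, h1, h2, fun t ht => h3 t ((le_max_left _ _).trans ht)⟩

theorem isUnit [T2Space M] (hcov : CovariantDerivative.ContMDiffCovariantDerivative cov ∞)
    (h : IsTransport cov x y A) : IsUnit A := by
  obtain ⟨c, P, a, b, hab, h1, h2, h3⟩ := h.exists_lt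
  obtain ⟨ζ, hζ⟩ := h1.exists_isHorizontal hcov
  have h4 := (hζ a b).isUnit hcov ((h2 a le_rfl).2 ▸ isUnit_one) b ⟨hab.le, le_rfl⟩
  rwa [(h3 b le_rfl).2] at h4

/-- The curve is run backward, and the frame is multiplied on the right by a constant so that it
starts at the identity; such a factor preserves parallelism. -/
theorem symm [T2Space M] (hcov : CovariantDerivative.ContMDiffCovariantDerivative cov ∞)
    (h : IsTransport cov x y A) : IsTransport cov y x (Ring.inverse A) := by
  have hA := h.isUnit hcov
  obtain ⟨c, P, a, b, h1, h2, h3⟩ := h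
  refine ⟨fun t => c (-t), fun t => P (-t) * Ring.inverse A, -b, -a, ⟨?_, fun t => ?_⟩,
    fun t ht => ?_, fun t ht => ?_⟩
  · exact h1.smooth.comp contDiff_neg.contMDiff
  · exact ((h1.parallel (-t)).comp (hasDerivAt_neg t)).mul_right _
  · obtain ⟨h4, h5⟩ := h3 (-t) (by linarith)
    exact ⟨h4, by simp only [h5]; exact Ring.mul_inverse_cancel A hA⟩
  · obtain ⟨h4, h5⟩ := h2 (-t) (by linarith)
    exact ⟨h4, by simp only [h5, one_mul]⟩

/-- Both curves are constant near the junction, so the concatenation is smooth. This is the reason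
for requiring curves that stop at their ends. -/
theorem trans (h : IsTransport cov x y A) (h' : IsTransport cov y z B) :
    IsTransport cov x z (B * A) := by
  obtain ⟨c, P, a, b, hab, h1, h2, h3⟩ := h.exists_lt
  obtain ⟨c', P', a', b', hab', h1', h2', h3'⟩ := h'.exists_lt
  -- The shift sends `b + 1` to `a'`, so both pieces are at rest on `[b, b + 1]`. Each time then has
  -- a neighbourhood on which a single formula holds.
  let g : ℝ → ℝ := fun t => t + (a' - b - 1)
  have hg : ∀ t, HasDerivAt g 1 t := fun t => (hasDerivAt_id t).add_const _
  let C : ℝ → M := fun t => if t ≤ b then c t else c' (g t)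
  let Q : ℝ → ModelSpace d →L[ℝ] ModelSpace d := fun t => if t ≤ b then P t else P' (g t) * A
  have hleft : ∀ t < b + 1, C t = c t ∧ Q t = P t := by
    intro t ht
    by_cases htb : t ≤ b
    · exact ⟨if_pos htb, if_pos htb⟩
    · push Not at htb
      obtain ⟨h4, h5⟩ := h3 t htb.le
      obtain ⟨h6, h7⟩ := h2' (g t) (by simp only [g]; linarith)
      simp only [C, Q, if_neg htb.not_ge, h4, h5, h6, h7, one_mul, and_self]
  have hright : ∀ t, b < t → C t = c' (g t) ∧ Q t = P' (g t) * A := fun t ht =>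
    ⟨if_neg ht.not_ge, if_neg ht.not_ge⟩
  have hloc : ∀ t, (C =ᶠ[𝓝 t] c ∧ Q =ᶠ[𝓝 t] P) ∨
      (C =ᶠ[𝓝 t] (fun t => c' (g t)) ∧ Q =ᶠ[𝓝 t] fun t => P' (g t) * A) := by
    intro t
    rcases lt_or_ge t (b + 1) with ht | ht
    · left
      have := Iio_mem_nhds ht
      exact ⟨by filter_upwards [this] with s hs using (hleft s hs).1,
        by filter_upwards [this] with s hs using (hleft s hs).2⟩
    · right
      have := Ioi_mem_nhds (show b < t by linarith)
      exact ⟨by filter_upwards [this] with s hs using (hright s hs).1,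
        by filter_upwards [this] with s hs using (hright s hs).2⟩
  have hgs : ContMDiff 𝓘(ℝ, ℝ) 𝓘(ℝ, ℝ) ∞ g := (contDiff_id.add contDiff_const).contMDiff
  refine ⟨C, Q, a, b' - (a' - b - 1), ⟨fun t => ?_, fun t => ?_⟩, fun t ht => ?_, fun t ht => ?_⟩
  · rcases hloc t with h4 | h4
    · exact (h1.smooth t).congr_of_eventuallyEq h4.1
    · exact ((h1'.smooth.comp hgs) t).congr_of_eventuallyEq h4.1
  · rcases hloc t with h4 | h4
    · exact (h1.parallel t).congr h4.1 h4.2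
    · exact (((h1'.parallel (g t)).comp (hg t)).mul_right A).congr h4.1 h4.2
  · rw [(hleft t (by linarith)).1, (hleft t (by linarith)).2]
    exact h2 t ht
  · have h4 := h3' (g t) (by simp only [g]; linarith)
    rw [(hright t (by linarith)).1, (hright t (by linarith)).2, h4.1, h4.2]
    exact ⟨rfl, rfl⟩

theorem mem_holonomy [T2Space M] (hcov : CovariantDerivative.ContMDiffCovariantDerivative cov ∞)
    {o : M} (h : IsTransport cov o o A) :
    (A : TangentSpace (𝓡 d) o →L[ℝ] TangentSpace (𝓡 d) o) ∈ holonomy cov o := by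
  obtain ⟨c, P, a, b, hab, h1, h2, h3⟩ := h.exists_lt
  let g : ℝ → ℝ := fun t => a + t * (b - a)
  have hg : ∀ t, HasDerivAt g (b - a) t := fun t =>
    (((hasDerivAt_id t).mul_const (b - a)).const_add a).congr_deriv (one_mul _)
  have hgs : ContMDiff 𝓘(ℝ, ℝ) 𝓘(ℝ, ℝ) ∞ g :=
    (contDiff_const.add (contDiff_id.mul contDiff_const)).contMDiff
  have h4 : IsSmoothParallel cov (fun t => c (g t)) (fun t => P (g t)) :=
    ⟨h1.smooth.comp hgs, fun t => (h1.parallel (g t)).comp (hg t)⟩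
  obtain ⟨ζ, hζ⟩ := h4.exists_isHorizontal hcov
  have h5 := h2 (g 0) (by simp [g])
  have h6 := h3 (g 1) (by simp [g])
  refine ⟨fun t => c (g t), fun t => P (g t), h4.smooth.contMDiffOn,
    (hζ 0 1).isParallelTransport zero_le_one h5.1 h5.2, fun v => ?_⟩
  have h7 : (⟨c (g 1), P (g 1) v⟩ : TangentBundle (𝓡 d) M) = ⟨c (g 1), A v⟩ := by rw [h6.2]
  refine h7.trans ?_
  have h8 : ∀ x : M, x = o → (⟨x, A v⟩ : TangentBundle (𝓡 d) M) = ⟨o, A v⟩ := by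
    rintro x rfl; rfl
  exact h8 _ h6.1

/-- Parallel transport along a line segment of a coordinate domain. -/
theorem of_line [T2Space M] {q : M} {y h : ModelSpace d}
    (hy : ∀ s ∈ Icc (0 : ℝ) 1, y + s • h ∈ (coord d q).target)
    {p : ℝ → ModelSpace d →L[ℝ] ModelSpace d} (hp0 : p 0 = 1)
    (hp : ∀ s ∈ Icc (0 : ℝ) 1, HasDerivWithinAt p
      (-(christoffel cov q (y + s • h) h * p s)) (Icc 0 1) s) :
    IsTransport cov ((coord d q).symm y) ((coord d q).symm (y + h))
      (frameOfCoord d q ((coord d q).symm (y + h)) * p 1 *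
        frameCoord d q ((coord d q).symm y)) := by
  -- This smooth parameter is 0 before time 0 and 1 after time 1, so the segment is run through with
  -- rests at both ends.
  let θ : ℝ → ℝ := Real.smoothTransition
  have hθ : ∀ t, θ t ∈ Icc (0 : ℝ) 1 := fun t =>
    ⟨Real.smoothTransition.nonneg t, Real.smoothTransition.le_one t⟩
  have hθs : ContDiff ℝ ∞ θ := Real.smoothTransition.contDiff
  let c : ℝ → M := fun t => (coord d q).symm (y + θ t • h)
  let B := frameCoord d q ((coord d q).symm y)
  let P : ℝ → ModelSpace d →L[ℝ] ModelSpace d := fun t => frameOfCoord d q (c t) * p (θ t) * B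
  have hsrc : ∀ t, c t ∈ (coord d q).source := fun t => (coord d q).map_target (hy _ (hθ t))
  have hcoord : ∀ t, coord d q (c t) = y + θ t • h := fun t =>
    (coord d q).right_inv (hy _ (hθ t))
  have hsol : ∀ t, solCoord d q c P t = (y + θ t • h, p (θ t) * B) := by
    intro t
    have h1 : frameCoord d q (c t) * P t = p (θ t) * B := by
      simp only [P]
      rw [mul_assoc, ← mul_assoc (frameCoord d q (c t)), frameCoord_mul_frameOfCoord (hsrc t),
        one_mul]
    simp only [solCoord, hcoord, h1]
  have hlin : ContDiff ℝ ∞ fun t => y + θ t • h :=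
    contDiff_const.add (hθs.smul contDiff_const)
  have hc : ContMDiff 𝓘(ℝ, ℝ) (𝓡 d) ∞ c :=
    (contMDiffOn_extChartAt_symm (I := 𝓡 d) (n := ∞) q).comp_contMDiff hlin.contMDiff
      fun t => hy _ (hθ t)
  have h0 : ∀ t ≤ 0, c t = (coord d q).symm y ∧ P t = 1 := by
    intro t ht
    have h1 : θ t = 0 := Real.smoothTransition.zero_of_nonpos ht
    have h2 : c t = (coord d q).symm y := by simp only [c, h1, zero_smul, add_zero]
    refine ⟨h2, ?_⟩
    simp only [P, h2, h1, hp0, mul_one, B]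
    exact frameOfCoord_mul_frameCoord (h2 ▸ hsrc t)
  refine ⟨c, P, 0, 1, ⟨hc, fun t => ⟨q, deriv θ t • h, hsrc t, hc.continuous.continuousAt, ?_⟩⟩,
    h0, fun t ht => ?_⟩
  · have hd : HasDerivAt θ (deriv θ t) t := (hθs.differentiable (by simp) t).hasDerivAt
    have h1 : HasDerivAt (fun t => p (θ t))
        (deriv θ t • -(christoffel cov q (y + θ t • h) h * p (θ t))) t := by
      rw [← hasDerivWithinAt_univ]
      exact HasDerivWithinAt.scomp t (hp _ (hθ t)) hd.hasDerivWithinAt fun s _ => hθ s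
    have h2 : HasDerivAt (fun t => (y + θ t • h, p (θ t) * B))
        (deriv θ t • h, deriv θ t • -(christoffel cov q (y + θ t • h) h * p (θ t)) * B) t :=
      ((hd.smul_const h).const_add y).prodMk (h1.mul_const B)
    rw [← funext hsol] at h2
    refine h2.congr_deriv ?_
    rw [hcoord, hsol, map_smul, smul_neg, neg_mul, smul_mul_assoc, smul_mul_assoc, mul_assoc]
  · have h1 : θ t = 1 := Real.smoothTransition.one_of_one_le ht
    have h2 : c t = (coord d q).symm (y + h) := by simp only [c, h1, one_smul]
    exact ⟨h2, by simp only [P, h2, h1, B]⟩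

end IsTransport

end Holonomy

/-! ### Linear equations depending on a parameter. -/

section LinearFlow

open Filter Topology

/-- Integration from the initial time, as an operator on continuous functions. -/
theorem exists_integralOperator {V : Type*} [NormedAddCommGroup V] [NormedSpace ℝ V]
    [CompleteSpace V] {a b : ℝ} (hab : a ≤ b) : ∃ J : C(Icc a b, V) →L[ℝ] C(Icc a b, V),
      ∀ f (t : Icc a b), J f t = ∫ s in a..(t : ℝ), f (projIcc a b hab s) := by
  have hint : ∀ (f : C(Icc a b, V)) (c e : ℝ),
      IntervalIntegrable (fun s => f (projIcc a b hab s)) volume c e := fun f c e =>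
    (by fun_prop : Continuous fun s => f (projIcc a b hab s)).intervalIntegrable c e
  have hcont : ∀ f : C(Icc a b, V),
      Continuous fun t : Icc a b => ∫ s in a..(t : ℝ), f (projIcc a b hab s) := fun f =>
    (intervalIntegral.continuous_primitive (fun c e => hint f c e) a).comp continuous_subtype_val
  let L : C(Icc a b, V) →ₗ[ℝ] C(Icc a b, V) :=
    { toFun := fun f => ⟨_, hcont f⟩
      map_add' := fun f g => by
        ext t
        exact intervalIntegral.integral_add (hint f _ _) (hint g _ _)
      map_smul' := fun c f => by
        ext t
        exact intervalIntegral.integral_smul _ _ }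
  refine ⟨L.mkContinuous (b - a) fun f => ?_, fun f t => rfl⟩
  refine (ContinuousMap.norm_le _ (mul_nonneg (sub_nonneg.2 hab) (norm_nonneg _))).2 fun t => ?_
  have h1 : ‖∫ s in a..(t : ℝ), f (projIcc a b hab s)‖ ≤ ‖f‖ * |(t : ℝ) - a| :=
    intervalIntegral.norm_integral_le_of_norm_le_const fun s _ => f.norm_coe_le_norm _
  refine h1.trans ?_
  rw [abs_of_nonneg (sub_nonneg.2 t.2.1), mul_comm]
  gcongr
  exact t.2.2

/-- Smooth dependence on parameters for linear differential equations. -/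
theorem exists_linearFlow_contDiff {E 𝒜 : Type} [NormedAddCommGroup E] [NormedSpace ℝ E]
    [FiniteDimensional ℝ E] [NormedRing 𝒜] [NormedAlgebra ℝ 𝒜] [CompleteSpace 𝒜] {n : ℕ}
    {g : ℝ × E → 𝒜} (hg : ContDiff ℝ n g) :
    ∃ p : E → ℝ → 𝒜, (∀ y, p y 0 = 1) ∧
      (∀ y, ∀ s ∈ Icc (0 : ℝ) 1, HasDerivWithinAt (p y) (g (s, y) * p y s) (Icc 0 1) s) ∧
      ContDiff ℝ n fun y => p y 1 := by
  let I : Set ℝ := Icc 0 1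
  let pr : ℝ → I := projIcc 0 1 zero_le_one
  let G : C(ℝ × E, 𝒜) := ⟨g, hg.continuous⟩
  obtain ⟨J, hJ⟩ := exists_integralOperator (V := 𝒜) (zero_le_one' ℝ)
  let t₀ : C(I, ℝ × E) := ⟨fun t => ((t : ℝ), 0), by fun_prop⟩
  let l₀ : E →ₗ[ℝ] C(I, ℝ × E) :=
    { toFun := fun y => ContinuousMap.const I (0, y)
      map_add' := fun y z => by ext t <;> simp
      map_smul' := fun c y => by ext t <;> simp }
  let ψ : E → C(I, ℝ × E) := fun y => t₀ + LinearMap.toContinuousLinearMap l₀ y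
  have hψ : ContDiff ℝ n ψ := contDiff_const.add (ContinuousLinearMap.contDiff _)
  have hψv : ∀ y (t : I), ψ y t = ((t : ℝ), y) := fun y t => by simp [ψ, t₀, l₀]
  let A : E → C(I, 𝒜) := fun y => G.comp (ψ y)
  have hA : ContDiff ℝ n A := (ContinuousMap.contDiff_comp n G hg).comp hψ
  have hAv : ∀ y (t : I), A y t = g (t, y) := fun y t => congrArg g (hψv y t)
  let B : C(I, 𝒜) →L[ℝ] C(I, 𝒜) →L[ℝ] C(I, 𝒜) :=
    ContinuousMap.bilinLift I (ContinuousLinearMap.mul ℝ 𝒜)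
  -- The solution is `(1 - K y)⁻¹ 1`. Here `K` depends smoothly on `y`, and inversion is smooth on
  -- the units of the algebra of operators.
  let K : E → C(I, 𝒜) →L[ℝ] C(I, 𝒜) := fun y => J.comp (B (A y))
  have hK : ContDiff ℝ n K :=
    ((ContinuousLinearMap.compL ℝ C(I, 𝒜) C(I, 𝒜) C(I, 𝒜) J).contDiff).comp (B.contDiff.comp hA)
  have hKv : ∀ y f (t : I), K y f t = ∫ s in (0 : ℝ)..(t : ℝ), A y (pr s) * f (pr s) := fun y f t =>
    hJ _ t
  have hu : ∀ y, IsUnit (1 - K y) := fun y => by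
    refine isUnit_one_sub_of_volterra zero_le_one (K y) (m := fun _ => ‖A y‖)
      intervalIntegrable_const (fun _ => norm_nonneg _) fun f t => ?_
    rw [hKv]
    refine intervalIntegral.norm_integral_le_of_norm_le t.2.1 (ae_of_all _ fun s _ => ?_) ?_
    · exact (norm_mul_le _ _).trans
        (mul_le_mul_of_nonneg_right ((A y).norm_coe_le_norm _) (norm_nonneg _))
    · have : Continuous fun s => ‖A y‖ * ‖f (projIcc 0 1 zero_le_one s)‖ := by fun_prop
      exact this.intervalIntegrable _ _
  let P : E → C(I, 𝒜) := fun y => Ring.inverse (1 - K y) 1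
  have hP : ContDiff ℝ n P := by
    have h1 : ContDiff ℝ n fun y => Ring.inverse (1 - K y) := by
      rw [contDiff_iff_contDiffAt]
      intro y
      obtain ⟨u, hu⟩ := hu y
      have h2 : ContDiffAt ℝ n (Ring.inverse : (C(I, 𝒜) →L[ℝ] C(I, 𝒜)) → _) (1 - K y) := by
        rw [← hu]
        exact contDiffAt_ringInverse ℝ u
      exact h2.comp y (contDiff_const.sub hK).contDiffAt
    exact h1.clm_apply contDiff_const
  have hPv : ∀ y (t : I), P y t = 1 + ∫ s in (0 : ℝ)..(t : ℝ), A y (pr s) * P y (pr s) := by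
    intro y t
    have h1 : (1 - K y) (P y) = 1 :=
      congrArg (fun T : C(I, 𝒜) →L[ℝ] C(I, 𝒜) => T 1) (Ring.mul_inverse_cancel _ (hu y))
    have h2 : P y t - K y (P y) t = 1 := congrArg (fun f : C(I, 𝒜) => f t) h1
    rw [hKv] at h2
    exact sub_eq_iff_eq_add.1 h2
  have hpr : ∀ s ∈ Icc (0 : ℝ) 1, (pr s : ℝ) = s := fun s hs => by
    simp only [pr, projIcc_of_mem zero_le_one hs]
  refine ⟨fun y s => P y (pr s), fun y => ?_, fun y s hs => ?_, ?_⟩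
  · simp only [hPv y (pr 0), hpr 0 (left_mem_Icc.2 zero_le_one), intervalIntegral.integral_same,
      add_zero]
  · have hc : Continuous fun s => A y (pr s) * P y (pr s) := by fun_prop
    have h1 : IsPrimitive (fun s => P y (pr s)) (fun s => A y (pr s) * P y (pr s)) 0 1 :=
      ⟨hc.intervalIntegrable _ _, fun t ht => by
        simp only [hPv y (pr t), hPv y (pr 0), hpr t ht, hpr 0 (left_mem_Icc.2 zero_le_one),
          intervalIntegral.integral_same, add_zero]⟩
    have h2 := h1.hasDerivWithinAt hc.continuousOn hs
    rw [hAv, hpr s hs] at h2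
    exact h2
  · exact (ContinuousMap.evalCLM ℝ (pr 1)).contDiff.comp hP

end LinearFlow

/-! ### Parallel frame fields in coordinate neighbourhoods. -/

section ParallelFrames

open Filter Topology

theorem HasDerivWithinAt.ringInverse_of_eq_one {𝒜 : Type*} [NormedRing 𝒜] [NormedAlgebra ℝ 𝒜]
    [CompleteSpace 𝒜] {p : ℝ → 𝒜} {p' : 𝒜} {s : Set ℝ} {t : ℝ} (h : HasDerivWithinAt p p' s t)
    (h1 : p t = 1) : HasDerivWithinAt (fun r => Ring.inverse (p r)) (-p') s t := by
  have h3 := hasFDerivAt_ringInverse (𝕜 := ℝ) (1 : 𝒜ˣ)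
  rw [Units.val_one, ← h1] at h3
  refine (h3.comp_hasDerivWithinAt t h).congr_deriv ?_
  simp

/-- The derivative of a family of isometries at the identity is skew. -/
theorem inner_eq_zero_of_isometry {𝔢 : Type*} [NormedAddCommGroup 𝔢] [InnerProductSpace ℝ 𝔢]
    {V : ℝ → 𝔢 →L[ℝ] 𝔢} {B : 𝔢 →L[ℝ] 𝔢} {s : Set ℝ} {t : ℝ} (hs : UniqueDiffWithinAt ℝ s t)
    (h : HasDerivWithinAt V B s t) (hV : ∀ r z, ‖V r z‖ = ‖z‖) (h1 : ∀ z, V t z = z) (z : 𝔢) :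
    inner ℝ (B z) z = 0 := by
  have h2 : HasDerivWithinAt (fun r => V r z) (B z) s t :=
    (h.clm_apply (hasDerivWithinAt_const _ _ z)).congr_deriv (by simp)
  have h3 := h2.inner ℝ h2
  have h4 : HasDerivWithinAt (fun r => inner ℝ (V r z) (V r z)) 0 s t := by
    simp only [real_inner_self_eq_norm_sq, hV]
    exact hasDerivWithinAt_const _ _ _
  have h5 := hs.eq_deriv _ h3 h4
  rw [h1, real_inner_comm] at h5
  linarith

/-- Composition with a constant linear map. -/
theorem HasDerivWithinAt.const_clm_comp {E F G : Type*} [NormedAddCommGroup E] [NormedSpace ℝ E]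
    [NormedAddCommGroup F] [NormedSpace ℝ F] [NormedAddCommGroup G] [NormedSpace ℝ G]
    {W : ℝ → E →L[ℝ] F} {W' : E →L[ℝ] F} {s : Set ℝ} {t : ℝ} (h : HasDerivWithinAt W W' s t)
    (L : F →L[ℝ] G) : HasDerivWithinAt (fun r => L.comp (W r)) (L.comp W') s t :=
  (ContinuousLinearMap.compL ℝ E F G L).hasFDerivAt.comp_hasDerivWithinAt t h

variable {d : ℕ} {M : Type*} [TopologicalSpace M] [ChartedSpace (EuclideanSpace ℝ (Fin d)) M]
  [IsManifold (𝓡 d) ∞ M]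
  {𝔢 : Type*} [NormedAddCommGroup 𝔢] [InnerProductSpace ℝ 𝔢] [FiniteDimensional ℝ 𝔢]

/-- The isometries from `𝔢` onto the fibre at `x` of the sub-Riemannian structure obtained by
parallel transport. -/
def IsParallelFrame (cov : AffineConnection d M) (o : M) (ι : 𝔢 →L[ℝ] ModelSpace d) (x : M)
    (f : 𝔢 →L[ℝ] ModelSpace d) : Prop :=
  ∃ Q, ∃ V : 𝔢 ≃ₗᵢ[ℝ] 𝔢, IsTransport cov o x Q ∧ ∀ z, f z = Q (ι (V z))

/-- The holonomy acts on the model fibre by isometries. -/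
def HolonomyPreserves (cov : AffineConnection d M) (o : M) (ι : 𝔢 →L[ℝ] ModelSpace d) : Prop :=
  ∀ A : ModelSpace d →L[ℝ] ModelSpace d, IsTransport cov o o A →
    ∃ U : 𝔢 ≃ₗᵢ[ℝ] 𝔢, ∀ v, A (ι v) = ι (U v)

variable {cov : AffineConnection d M} {o : M} {ι : 𝔢 →L[ℝ] ModelSpace d}

namespace IsParallelFrame

variable {x y : M} {f f' : 𝔢 →L[ℝ] ModelSpace d}

theorem refl (cov : AffineConnection d M) (o : M) (ι : 𝔢 →L[ℝ] ModelSpace d) :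
    IsParallelFrame cov o ι o ι :=
  ⟨1, LinearIsometryEquiv.refl ℝ 𝔢, .refl o, fun _ => rfl⟩

theorem transport (h : IsParallelFrame cov o ι x f) {A : ModelSpace d →L[ℝ] ModelSpace d}
    (hA : IsTransport cov x y A) : IsParallelFrame cov o ι y (A.comp f) := by
  obtain ⟨Q, V, hQ, hf⟩ := h
  exact ⟨A * Q, V, hQ.trans hA, fun z => congrArg A (hf z)⟩

theorem comp_isometry (h : IsParallelFrame cov o ι x f) {W : 𝔢 ≃ₗᵢ[ℝ] 𝔢}
    (hf' : ∀ z, f' z = f (W z)) : IsParallelFrame cov o ι x f' := by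
  obtain ⟨Q, V, hQ, hf⟩ := h
  exact ⟨Q, W.trans V, hQ, fun z => (hf' z).trans (hf _)⟩

theorem injective [T2Space M] (hcov : CovariantDerivative.ContMDiffCovariantDerivative cov ∞)
    (hι : Function.Injective ι) (h : IsParallelFrame cov o ι x f) : Function.Injective f := by
  obtain ⟨Q, V, hQ, hf⟩ := h
  intro z w hzw
  rw [hf, hf] at hzw
  have h1 : Ring.inverse Q (Q (ι (V z))) = Ring.inverse Q (Q (ι (V w))) := by rw [hzw]
  rw [ringInverse_apply_self (hQ.isUnit hcov), ringInverse_apply_self (hQ.isUnit hcov)] at h1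
  exact V.injective (hι h1)

/-- Going out along one curve and back along the other is a loop at `o`, and its transport acts on
`𝔢` by an isometry. -/
theorem exists_isometry [T2Space M]
    (hcov : CovariantDerivative.ContMDiffCovariantDerivative cov ∞)
    (hB : HolonomyPreserves cov o ι) (h : IsParallelFrame cov o ι x f)
    (h' : IsParallelFrame cov o ι x f') : ∃ V : 𝔢 ≃ₗᵢ[ℝ] 𝔢, ∀ z, f' z = f (V z) := by
  obtain ⟨Q, V, hQ, hf⟩ := h
  obtain ⟨Q', V', hQ', hf'⟩ := h'
  obtain ⟨U, hU⟩ := hB _ (hQ'.trans (hQ.symm hcov))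
  refine ⟨V'.trans (U.trans V.symm), fun z => ?_⟩
  have h1 : Ring.inverse Q (Q' (ι (V' z))) = ι (U (V' z)) := hU (V' z)
  rw [hf', hf, LinearIsometryEquiv.trans_apply, LinearIsometryEquiv.trans_apply,
    LinearIsometryEquiv.apply_symm_apply, ← h1, apply_ringInverse_self (hQ.isUnit hcov)]

end IsParallelFrame

/-- A field of parallel frames on a coordinate domain. -/
structure IsFrameField (cov : AffineConnection d M) (o : M) (ι : 𝔢 →L[ℝ] ModelSpace d) (q : M)
    (U : Set (ModelSpace d)) (F : ModelSpace d → 𝔢 →L[ℝ] ModelSpace d) : Prop where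
  subset : U ⊆ (coord d q).target
  contDiff : ContDiff ℝ 2 F
  frame : ∀ y ∈ U, IsParallelFrame cov o ι ((coord d q).symm y)
    ((frameOfCoord d q ((coord d q).symm y)).comp (F y))

/-- A convex coordinate neighbourhood on which the connection is given by a smooth function. -/
structure IsRegularDomain (cov : AffineConnection d M) (q : M) (U : Set (ModelSpace d)) :
    Prop where
  isOpen : IsOpen U
  convex : Convex ℝ U
  subset : U ⊆ (coord d q).target
  exists_eq : ∃ Γ : ModelSpace d → ModelSpace d →L[ℝ] ModelSpace d →L[ℝ] ModelSpace d,
    ContDiff ℝ ∞ Γ ∧ ∀ y ∈ U, Γ y = christoffel cov q y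

theorem exists_isRegularDomain [T2Space M]
    (hcov : CovariantDerivative.ContMDiffCovariantDerivative cov ∞) {q : M} {y : ModelSpace d}
    (hy : y ∈ (coord d q).target) : ∃ U, y ∈ U ∧ IsRegularDomain cov q U := by
  obtain ⟨ρ, hρ, hs, h1⟩ := exists_bump (isOpen_coord_target q) hy
  obtain ⟨ε, hε, h2⟩ := Metric.eventually_nhds_iff_ball.1
    (h1.and ((isOpen_coord_target q).mem_nhds hy))
  refine ⟨Metric.ball y ε, Metric.mem_ball_self hε, Metric.isOpen_ball, convex_ball _ _,
    fun z hz => (h2 z hz).2, fun z => ρ z • christoffel cov q z,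
    contDiff_smul_of_tsupport (isOpen_coord_target q) hρ hs (contDiffOn_christoffel cov hcov q),
    fun z hz => ?_⟩
  simp only [(h2 z hz).1, one_smul]

namespace IsRegularDomain

variable {q : M} {U : Set (ModelSpace d)}

theorem add_smul_mem (hU : IsRegularDomain cov q U) {y h : ModelSpace d} (hy : y ∈ U)
    (hh : y + h ∈ U) {s : ℝ} (hs : s ∈ Icc (0 : ℝ) 1) : y + s • h ∈ U := by
  have := hU.convex.add_smul_sub_mem hy hh hs
  rwa [add_sub_cancel_left] at this

/-- The frame at `y₀` is transported radially, along the segments from `y₀`. The transport equation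
on the unit interval depends smoothly on the end point of the segment, hence so does its solution.
-/
theorem exists_isFrameField [T2Space M] (hU : IsRegularDomain cov q U) {y₀ : ModelSpace d}
    (hy₀ : y₀ ∈ U) {f : 𝔢 →L[ℝ] ModelSpace d}
    (hf : IsParallelFrame cov o ι ((coord d q).symm y₀) f) :
    ∃ F, IsFrameField cov o ι q U F ∧
      F y₀ = (frameCoord d q ((coord d q).symm y₀)).comp f := by
  obtain ⟨Γ, hΓ, hΓU⟩ := hU.exists_eq
  let g : ℝ × ModelSpace d → ModelSpace d →L[ℝ] ModelSpace d := fun a =>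
    -(Γ (y₀ + a.1 • (a.2 - y₀)) (a.2 - y₀))
  have hg : ContDiff ℝ (2 : ℕ) g := by
    have h1 : ContDiff ℝ (2 : ℕ) fun a : ℝ × ModelSpace d => a.2 - y₀ :=
      contDiff_snd.sub contDiff_const
    have h2 : ContDiff ℝ (2 : ℕ) fun a : ℝ × ModelSpace d => Γ (y₀ + a.1 • (a.2 - y₀)) :=
      (hΓ.of_le (by norm_cast)).comp (contDiff_const.add (contDiff_fst.smul h1))
    exact (h2.clm_apply h1).neg
  obtain ⟨p, hp0, hp, hps⟩ := exists_linearFlow_contDiff hg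
  have htr : ∀ y ∈ U, IsTransport cov ((coord d q).symm y₀) ((coord d q).symm y)
      (frameOfCoord d q ((coord d q).symm y) * p y 1 *
        frameCoord d q ((coord d q).symm y₀)) := by
    intro y hy
    have hmem : ∀ s ∈ Icc (0 : ℝ) 1, y₀ + s • (y - y₀) ∈ U := fun s hs =>
      hU.convex.add_smul_sub_mem hy₀ hy hs
    have h1 := IsTransport.of_line (cov := cov) (q := q) (y := y₀) (h := y - y₀)
      (fun s hs => hU.subset (hmem s hs)) (hp0 y) fun s hs => by
        refine (hp y s hs).congr_deriv ?_
        rw [← hΓU _ (hmem s hs), ← neg_mul]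
    rwa [add_sub_cancel] at h1
  refine ⟨fun y => (p y 1).comp ((frameCoord d q ((coord d q).symm y₀)).comp f),
    ⟨hU.subset, hps.clm_comp contDiff_const, fun y hy => hf.transport (htr y hy)⟩, ?_⟩
  -- The segment from `y₀` to itself is constant, so the transport equation has zero right-hand
  -- side.
  have h1 : p y₀ 1 = 1 := by
    have hsrc := (coord d q).map_target (hU.subset hy₀)
    have hz : ∀ s ∈ Icc (0 : ℝ) 1, HasDerivWithinAt (p y₀) 0 (Icc 0 1) s := fun s hs => by
      refine (hp y₀ s hs).congr_deriv ?_
      simp [g]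
    have h2 := (convex_Icc (0 : ℝ) 1).is_const_of_fderivWithin_eq_zero
      (fun s hs => (hz s hs).differentiableWithinAt) (fun s hs => by
        refine ContinuousLinearMap.ext_ring ?_
        have h3 := (hz s hs).derivWithin (uniqueDiffOn_Icc zero_lt_one s hs)
        exact h3) (right_mem_Icc.2 zero_le_one) (left_mem_Icc.2 zero_le_one)
    exact h2.trans (hp0 y₀)
  simp only [h1]
  rfl

end IsRegularDomain

/-- A continuous left inverse of an injective linear map. -/
theorem exists_leftInverse_clm {f : 𝔢 →L[ℝ] ModelSpace d} (hf : Function.Injective f) :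
    ∃ L : ModelSpace d →L[ℝ] 𝔢, L.comp f = ContinuousLinearMap.id ℝ 𝔢 := by
  obtain ⟨g, hg⟩ := LinearMap.exists_leftInverse_of_injective (f : 𝔢 →ₗ[ℝ] ModelSpace d)
    (LinearMap.ker_eq_bot.2 hf)
  exact ⟨LinearMap.toContinuousLinearMap g, ContinuousLinearMap.ext fun z =>
    LinearMap.congr_fun hg z⟩

namespace IsFrameField

variable {q : M} {U : Set (ModelSpace d)} {F : ModelSpace d → 𝔢 →L[ℝ] ModelSpace d}

theorem injective [T2Space M] (hcov : CovariantDerivative.ContMDiffCovariantDerivative cov ∞)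
    (hι : Function.Injective ι) (hF : IsFrameField cov o ι q U F) {y : ModelSpace d}
    (hy : y ∈ U) : Function.Injective (F y) := fun _ _ hzw =>
  (hF.frame y hy).injective hcov hι
    (congrArg (frameOfCoord d q ((coord d q).symm y)) hzw)

/-- The transport of `F y` along the segment up to parameter `s` and the frame `F (y + s • h)` are
parallel frames at the same point, so they differ by an isometry. -/
theorem exists_isometry_of_line [T2Space M]
    (hcov : CovariantDerivative.ContMDiffCovariantDerivative cov ∞)
    (hB : HolonomyPreserves cov o ι) (hU : IsRegularDomain cov q U)
    (hF : IsFrameField cov o ι q U F) {y h : ModelSpace d} (hy : y ∈ U) (hh : y + h ∈ U)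
    {p : ℝ → ModelSpace d →L[ℝ] ModelSpace d} (hp0 : p 0 = 1)
    (hp : ∀ s ∈ Icc (0 : ℝ) 1, HasDerivWithinAt p
      (-(christoffel cov q (y + s • h) h * p s)) (Icc 0 1) s) {s : ℝ} (hs : s ∈ Icc (0 : ℝ) 1) :
    ∃ V : 𝔢 ≃ₗᵢ[ℝ] 𝔢, ∀ z, F (y + s • h) z = p s (F y (V z)) := by
  have hsU : y + s • h ∈ U := hU.add_smul_mem hy hh hs
  have hmaps : ∀ r ∈ Icc (0 : ℝ) 1, s * r ∈ Icc (0 : ℝ) 1 := fun r hr =>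
    ⟨mul_nonneg hs.1 hr.1, mul_le_one₀ hs.2 hr.1 hr.2⟩
  have htr := IsTransport.of_line (cov := cov) (q := q) (y := y) (h := s • h)
    (p := fun r => p (s * r)) (fun r hr => hU.subset (hU.add_smul_mem hy hsU hr))
    (by simpa using hp0) fun r hr => by
      have h1 : HasDerivWithinAt (fun r : ℝ => s * r) s (Icc 0 1) r := by
        simpa using ((hasDerivAt_id r).const_mul s).hasDerivWithinAt
      have h2 := HasDerivWithinAt.scomp r (hp _ (hmaps r hr)) h1 hmaps
      refine h2.congr_deriv ?_
      rw [smul_neg, map_smul, smul_mul_assoc, smul_smul, mul_comm r s]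
  obtain ⟨V, hV⟩ := ((hF.frame y hy).transport htr).exists_isometry hcov hB (hF.frame _ hsU)
  have hsrc := (coord d q).map_target (hU.subset hsU)
  have hsrc' := (coord d q).map_target (hU.subset hy)
  refine ⟨V, fun z => ?_⟩
  have h1 := congrArg (frameCoord d q ((coord d q).symm (y + s • h))) (hV z)
  have h2 : ∀ k, frameCoord d q ((coord d q).symm (y + s • h))
      (frameOfCoord d q ((coord d q).symm (y + s • h)) k) = k := fun k =>
    DFunLike.congr_fun (frameCoord_mul_frameOfCoord hsrc) k
  have h3 : ∀ k, frameCoord d q ((coord d q).symm y)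
      (frameOfCoord d q ((coord d q).symm y) k) = k := fun k =>
    DFunLike.congr_fun (frameCoord_mul_frameOfCoord hsrc') k
  simp only [ContinuousLinearMap.comp_apply, mul_apply_eq_comp, h2, h3, mul_one] at h1
  exact h1

/-- The connection form of a field of parallel frames is skew. -/
theorem exists_skew_of_line [T2Space M]
    (hcov : CovariantDerivative.ContMDiffCovariantDerivative cov ∞)
    (hι : Function.Injective ι) (hB : HolonomyPreserves cov o ι) (hU : IsRegularDomain cov q U)
    (hF : IsFrameField cov o ι q U F) {y h : ModelSpace d} (hy : y ∈ U) (hh : y + h ∈ U) :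
    ∃ B : 𝔢 →L[ℝ] 𝔢, fderiv ℝ F y h + (christoffel cov q y h).comp (F y) = (F y).comp B ∧
      ∀ z, inner ℝ (B z) z = 0 := by
  obtain ⟨Γ, hΓ, hΓU⟩ := hU.exists_eq
  have hg : ContDiff ℝ (0 : ℕ) fun a : ℝ × ℝ => -(Γ (y + a.1 • h) h) := by
    have h2 : ContDiff ℝ (0 : ℕ) fun a : ℝ × ℝ => Γ (y + a.1 • h) :=
      (hΓ.of_le (by norm_cast)).comp
        (contDiff_const.add (contDiff_fst.smul contDiff_const))
    exact (h2.clm_apply contDiff_const).neg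
  obtain ⟨p', hp0', hp', -⟩ := exists_linearFlow_contDiff hg
  set p := p' 0
  have hp0 : p 0 = 1 := hp0' 0
  have hp : ∀ s ∈ Icc (0 : ℝ) 1, HasDerivWithinAt p
      (-(christoffel cov q (y + s • h) h * p s)) (Icc 0 1) s := fun s hs => by
    refine (hp' 0 s hs).congr_deriv ?_
    rw [← hΓU _ (hU.add_smul_mem hy hh hs), ← neg_mul]
  choose! V hV using fun s (hs : s ∈ Icc (0 : ℝ) 1) =>
    hF.exists_isometry_of_line hcov hB hU hy hh hp0 hp hs
  have h01 : (0 : ℝ) ∈ Icc (0 : ℝ) 1 := left_mem_Icc.2 zero_le_one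
  have hpu : ∀ᶠ s in 𝓝[Icc (0 : ℝ) 1] 0, IsUnit (p s) := by
    have h1 : ContinuousWithinAt p (Icc 0 1) 0 := (hp 0 h01).continuousWithinAt
    exact h1 (hp0 ▸ Units.isOpen.mem_nhds (isUnit_one :
      IsUnit (1 : ModelSpace d →L[ℝ] ModelSpace d)))
  obtain ⟨L, hL⟩ := exists_leftInverse_clm (hF.injective hcov hι hy)
  -- The frame field along the segment, transported back to `y`. Its derivative at 0 is the
  -- covariant derivative of `F` in direction `h`, while near 0 it equals `F y` composed with the
  -- isometries `V s`.
  let W : ℝ → 𝔢 →L[ℝ] ModelSpace d := fun s => (Ring.inverse (p s)).comp (F (y + s • h))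
  have hWd : HasDerivWithinAt W (fderiv ℝ F y h + (christoffel cov q y h).comp (F y))
      (Icc 0 1) 0 := by
    have h1 : HasDerivWithinAt p (-(christoffel cov q y h)) (Icc 0 1) 0 := by
      refine (hp 0 h01).congr_deriv ?_
      rw [hp0, mul_one, zero_smul, add_zero]
    have h2 : HasDerivWithinAt (fun s => Ring.inverse (p s)) (christoffel cov q y h)
        (Icc 0 1) 0 := by
      have h3 := h1.ringInverse_of_eq_one hp0
      rwa [neg_neg] at h3
    have h4 : HasDerivWithinAt (fun s : ℝ => F (y + s • h)) (fderiv ℝ F y h) (Icc 0 1) 0 := by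
      have h5 : HasDerivAt (fun s : ℝ => y + s • h) h 0 := by
        simpa using ((hasDerivAt_id (0 : ℝ)).smul_const h).const_add y
      have h6 : HasFDerivAt F (fderiv ℝ F y) (y + (0 : ℝ) • h) := by
        rw [zero_smul, add_zero]
        exact (hF.contDiff.differentiable (by norm_num) y).hasFDerivAt
      have h7 : HasDerivAt (fun s : ℝ => F (y + s • h)) (fderiv ℝ F y h) 0 :=
        h6.comp_hasDerivAt 0 h5
      exact h7.hasDerivWithinAt
    refine (h2.clm_comp h4).congr_deriv ?_
    rw [hp0, Ring.inverse_one, zero_smul, add_zero, add_comm]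
    rfl
  have hWV : ∀ᶠ s in 𝓝[Icc (0 : ℝ) 1] 0, W s = (F y).comp
      ((V s).toContinuousLinearEquiv : 𝔢 →L[ℝ] 𝔢) := by
    filter_upwards [hpu, self_mem_nhdsWithin] with s hs hsI
    refine ContinuousLinearMap.ext fun z => ?_
    have h1 : W s z = Ring.inverse (p s) (F (y + s • h) z) := rfl
    rw [h1, hV s hsI z, ringInverse_apply_self hs]
    rfl
  set G := fderiv ℝ F y h + (christoffel cov q y h).comp (F y) with hG
  -- The isometries were only chosen pointwise. The left inverse `L` recovers them from `W`, so they
  -- are differentiable at 0.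
  have hVd : HasDerivWithinAt (fun s => ((V s).toContinuousLinearEquiv : 𝔢 →L[ℝ] 𝔢))
      (L.comp G) (Icc 0 1) 0 := by
    have h1 : HasDerivWithinAt (fun s => L.comp (W s)) (L.comp G) (Icc 0 1) 0 :=
      hWd.const_clm_comp L
    have h2 : ∀ᶠ s in 𝓝[Icc (0 : ℝ) 1] 0,
        ((V s).toContinuousLinearEquiv : 𝔢 →L[ℝ] 𝔢) = L.comp (W s) := by
      filter_upwards [hWV] with s hs
      rw [hs, ← ContinuousLinearMap.comp_assoc, hL, ContinuousLinearMap.id_comp]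
    exact h1.congr_of_eventuallyEq h2 (h2.self_of_nhdsWithin h01)
  have huniq : UniqueDiffWithinAt ℝ (Icc (0 : ℝ) 1) 0 := uniqueDiffOn_Icc zero_lt_one 0 h01
  have hV0 : ∀ z, V 0 z = z := by
    intro z
    have h1 := hV 0 h01 z
    rw [hp0, zero_smul, add_zero] at h1
    exact (hF.injective hcov hι hy h1).symm
  refine ⟨L.comp G, ?_, fun z => ?_⟩
  · have h1 : HasDerivWithinAt (fun s => (F y).comp
        ((V s).toContinuousLinearEquiv : 𝔢 →L[ℝ] 𝔢)) ((F y).comp (L.comp G)) (Icc 0 1) 0 :=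
      hVd.const_clm_comp (F y)
    exact huniq.eq_deriv _ (hWd.congr_of_eventuallyEq (hWV.mono fun s hs => hs.symm)
      (hWV.self_of_nhdsWithin h01).symm) h1
  · refine inner_eq_zero_of_isometry huniq hVd (fun s w => ?_) (fun w => hV0 w) z
    exact (V s).norm_map w

/-- Both sides are linear in the direction, so `h` may be scaled until the segment lies in the open
set `U`. -/
theorem exists_connectionForm [T2Space M]
    (hcov : CovariantDerivative.ContMDiffCovariantDerivative cov ∞)
    (hι : Function.Injective ι) (hB : HolonomyPreserves cov o ι) (hU : IsRegularDomain cov q U)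
    (hF : IsFrameField cov o ι q U F) {y : ModelSpace d} (hy : y ∈ U) (h : ModelSpace d) :
    ∃ B : 𝔢 →L[ℝ] 𝔢, fderiv ℝ F y h + (christoffel cov q y h).comp (F y) = (F y).comp B ∧
      ∀ z, inner ℝ (B z) z = 0 := by
  have h1 : ∀ᶠ s in 𝓝[>] (0 : ℝ), y + s • h ∈ U := by
    have h2 : Tendsto (fun s : ℝ => y + s • h) (𝓝 0) (𝓝 (y + (0 : ℝ) • h)) :=
      (by fun_prop : Continuous fun s : ℝ => y + s • h).tendsto 0
    rw [zero_smul, add_zero] at h2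
    exact nhdsWithin_le_nhds (h2 (hU.isOpen.mem_nhds hy))
  obtain ⟨s, hs, hs0⟩ := (h1.and self_mem_nhdsWithin).exists
  have hs0 : (0 : ℝ) < s := hs0
  obtain ⟨B, hB1, hB2⟩ := hF.exists_skew_of_line hcov hι hB hU hy hs
  refine ⟨s⁻¹ • B, ?_, fun z => ?_⟩
  · rw [ContinuousLinearMap.comp_smul, ← hB1, map_smul, map_smul,
      ContinuousLinearMap.smul_comp, ← smul_add, inv_smul_smul₀ hs0.ne']
  · rw [_root_.smul_apply, inner_smul_left, hB2, mul_zero]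

end IsFrameField

end ParallelFrames

/-! ### Connection forms and the structure equation. -/

section ConnectionForm

open Filter Topology

variable {E : Type*} [NormedAddCommGroup E] [NormedSpace ℝ E] [CompleteSpace E]
  {𝔢 : Type*} [NormedAddCommGroup 𝔢] [InnerProductSpace ℝ 𝔢] [FiniteDimensional ℝ 𝔢]

theorem HasDerivAt.eval {W Z : Type*} [NormedAddCommGroup W] [NormedSpace ℝ W]
    [NormedAddCommGroup Z] [NormedSpace ℝ Z] {Φ : ℝ → W →L[ℝ] Z} {Φ' : W →L[ℝ] Z} {t : ℝ}
    (h : HasDerivAt Φ Φ' t) (w : W) : HasDerivAt (fun s => Φ s w) (Φ' w) t :=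
  (h.clm_apply (hasDerivAt_const t w)).congr_deriv (by simp)

/-- The derivative along a line. -/
theorem DifferentiableAt.hasDerivAt_line {W Z : Type*} [NormedAddCommGroup W] [NormedSpace ℝ W]
    [NormedAddCommGroup Z] [NormedSpace ℝ Z] {Φ : W → Z} {y : W} (h : DifferentiableAt ℝ Φ y)
    (k : W) : HasDerivAt (fun s : ℝ => Φ (y + s • k)) (fderiv ℝ Φ y k) 0 := by
  have h1 : HasFDerivAt Φ (fderiv ℝ Φ y) (y + (0 : ℝ) • k) := by
    rw [zero_smul, add_zero]; exact h.hasFDerivAt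
  have h2 : HasDerivAt (fun s : ℝ => y + s • k) k 0 := by
    simpa using ((hasDerivAt_id (0 : ℝ)).smul_const k).const_add y
  exact h1.comp_hasDerivAt 0 h2

theorem inner_skew {B : 𝔢 →L[ℝ] 𝔢} (h : ∀ z, inner ℝ (B z) z = 0) (z w : 𝔢) :
    inner ℝ (B z) w = -inner ℝ z (B w) := by
  have h1 := h (z + w)
  rw [map_add, inner_add_left, inner_add_right, inner_add_right, h z, h w,
    real_inner_comm z (B w)] at h1
  linarith

/-- `a` is the connection form of the frame field `F` on `U`, for the connection `Γ`. -/
structure IsConnectionForm (U : Set E) (Γ : E → E →L[ℝ] E →L[ℝ] E) (F : E → 𝔢 →L[ℝ] E)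
    (a : E → E →L[ℝ] 𝔢 →L[ℝ] 𝔢) : Prop where
  isOpen : IsOpen U
  contDiff_Γ : ContDiffOn ℝ 1 Γ U
  contDiff_F : ContDiff ℝ 2 F
  exists_leftInverse : ∀ y ∈ U, ∃ L : E →L[ℝ] 𝔢, L.comp (F y) = ContinuousLinearMap.id ℝ 𝔢
  eq : ∀ y ∈ U, ∀ h, fderiv ℝ F y h + (Γ y h).comp (F y) = (F y).comp (a y h)
  skew : ∀ y ∈ U, ∀ h z, inner ℝ (a y h z) z = 0

/-- The covariant derivative of the frame field. -/
noncomputable def covFrame (Γ : E → E →L[ℝ] E →L[ℝ] E) (F : E → 𝔢 →L[ℝ] E) (y : E) :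
    E →L[ℝ] 𝔢 →L[ℝ] E :=
  fderiv ℝ F y + ((ContinuousLinearMap.compL ℝ 𝔢 E E).flip (F y)).comp (Γ y)

theorem covFrame_apply (Γ : E → E →L[ℝ] E →L[ℝ] E) (F : E → 𝔢 →L[ℝ] E) (y h : E) :
    covFrame Γ F y h = fderiv ℝ F y h + (Γ y h).comp (F y) := rfl

/-- Choosing an endomorphism for each direction separately would not give linearity. A left inverse
of the frame applied to its covariant derivative is linear in the direction, and it must agree with
each of the given endomorphisms. -/
theorem exists_isConnectionForm {U : Set E} (hU : IsOpen U) {Γ : E → E →L[ℝ] E →L[ℝ] E}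
    (hΓ : ContDiffOn ℝ 1 Γ U) {F : E → 𝔢 →L[ℝ] E} (hF : ContDiff ℝ 2 F)
    (hL : ∀ y ∈ U, ∃ L : E →L[ℝ] 𝔢, L.comp (F y) = ContinuousLinearMap.id ℝ 𝔢)
    (h : ∀ y ∈ U, ∀ h, ∃ B : 𝔢 →L[ℝ] 𝔢,
      fderiv ℝ F y h + (Γ y h).comp (F y) = (F y).comp B ∧ ∀ z, inner ℝ (B z) z = 0) :
    ∃ a, IsConnectionForm U Γ F a := by
  choose! L hL' using hL
  have key : ∀ y ∈ U, ∀ k B, covFrame Γ F y k = (F y).comp B →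
      ((ContinuousLinearMap.compL ℝ 𝔢 E 𝔢 (L y)).comp (covFrame Γ F y)) k = B := by
    intro y hy k B hB
    rw [ContinuousLinearMap.comp_apply, hB, ContinuousLinearMap.compL_apply,
      ← ContinuousLinearMap.comp_assoc, hL' y hy, ContinuousLinearMap.id_comp]
  refine ⟨fun y => (ContinuousLinearMap.compL ℝ 𝔢 E 𝔢 (L y)).comp (covFrame Γ F y), hU, hΓ, hF,
    fun y hy => ⟨L y, hL' y hy⟩, fun y hy k => ?_, fun y hy k z => ?_⟩
  · obtain ⟨B, hB, -⟩ := h y hy k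
    rw [key y hy k B hB]; exact hB
  · obtain ⟨B, hB, hs⟩ := h y hy k
    rw [key y hy k B hB]; exact hs z

namespace IsConnectionForm

variable {U : Set E} {Γ : E → E →L[ℝ] E →L[ℝ] E} {F : E → 𝔢 →L[ℝ] E}
  {a : E → E →L[ℝ] 𝔢 →L[ℝ] 𝔢}

/-- If `L` is a left inverse of `F y`, then `(L F(z))⁻¹ L` is a left inverse of `F z` near `y` and
depends on `z` in a `C¹` manner. It recovers `a` from the covariant derivative of `F`, for which `F`
has to be `C²`. -/
theorem contDiffAt (ha : IsConnectionForm U Γ F a) {y : E} (hy : y ∈ U) : ContDiffAt ℝ 1 a y := by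
  have := FiniteDimensional.complete ℝ 𝔢
  have hUy := ha.isOpen.mem_nhds hy
  obtain ⟨L, hL⟩ := ha.exists_leftInverse y hy
  have hF : ContDiff ℝ 1 F := ha.contDiff_F.of_le (by norm_num)
  have hLF : ContDiff ℝ 1 fun z => L.comp (F z) := contDiff_const.clm_comp hF
  have h1 : (L.comp (F y) : 𝔢 →L[ℝ] 𝔢) = ((1 : (𝔢 →L[ℝ] 𝔢)ˣ) : 𝔢 →L[ℝ] 𝔢) := hL
  have hunit : ∀ᶠ z in 𝓝 y, IsUnit (L.comp (F z)) :=
    hLF.continuous.continuousAt (h1 ▸ Units.isOpen.mem_nhds (Units.isUnit _))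
  have hinv : ContDiffAt ℝ 1 (fun z => Ring.inverse (L.comp (F z))) y := by
    have h2 : ContDiffAt ℝ 1 (Ring.inverse : (𝔢 →L[ℝ] 𝔢) → _) (L.comp (F y)) :=
      h1 ▸ contDiffAt_ringInverse ℝ _
    exact h2.comp y hLF.contDiffAt
  have hcov : ContDiffAt ℝ 1 (covFrame Γ F) y := by
    have h2 : ContDiffAt ℝ 1 (fderiv ℝ F) y :=
      (ha.contDiff_F.fderiv_right (m := 1) (by norm_num)).contDiffAt
    have h3 : ContDiffAt ℝ 1 (fun z => (ContinuousLinearMap.compL ℝ 𝔢 E E).flip (F z)) y :=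
      ((ContinuousLinearMap.compL ℝ 𝔢 E E).flip.contDiff.comp hF).contDiffAt
    exact h2.add (h3.clm_comp (ha.contDiff_Γ.contDiffAt hUy))
  have hJ : ContDiffAt ℝ 1 (fun z => (Ring.inverse (L.comp (F z))).comp L) y :=
    hinv.clm_comp contDiffAt_const
  have hJ' : ContDiffAt ℝ 1
      (fun z => ContinuousLinearMap.compL ℝ 𝔢 E 𝔢 ((Ring.inverse (L.comp (F z))).comp L)) y :=
    (ContinuousLinearMap.compL ℝ 𝔢 E 𝔢).contDiff.contDiffAt.comp y hJ
  refine (hJ'.clm_comp hcov).congr_of_eventuallyEq ?_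
  filter_upwards [hunit, hUy] with z hz hzU
  refine ContinuousLinearMap.ext fun k => ?_
  rw [ContinuousLinearMap.comp_apply, covFrame_apply, ha.eq z hzU k,
    ContinuousLinearMap.compL_apply, ContinuousLinearMap.comp_assoc,
    ← ContinuousLinearMap.comp_assoc L, ← ContinuousLinearMap.comp_assoc]
  have h2 : (Ring.inverse (L.comp (F z))).comp (L.comp (F z)) = 1 :=
    Ring.inverse_mul_cancel _ hz
  rw [h2]
  rfl

/-- The structure equation: the curvature acts on the frame by skew endomorphisms. -/
theorem exists_skew_curvature (ha : IsConnectionForm U Γ F a) {y : E} (hy : y ∈ U) (k h : E) :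
    ∃ B : 𝔢 →L[ℝ] 𝔢, (∀ z, christoffelCurvature Γ y k h (F y z) = F y (B z)) ∧
      ∀ z, inner ℝ (B z) z = 0 := by
  have hUy := ha.isOpen.mem_nhds hy
  have hnear : ∀ k : E, ∀ᶠ s : ℝ in 𝓝 0, y + s • k ∈ U := fun k =>
    (by fun_prop : Continuous fun s : ℝ => y + s • k).continuousAt
      (by rw [zero_smul, add_zero]; exact hUy)
  have dF : DifferentiableAt ℝ F y := ha.contDiff_F.differentiable (by norm_num) y
  have dF' : DifferentiableAt ℝ (fderiv ℝ F) y :=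
    (ha.contDiff_F.fderiv_right (m := 1) (by norm_num)).differentiable (by norm_num) y
  have dΓ : DifferentiableAt ℝ Γ y := (ha.contDiff_Γ.contDiffAt hUy).differentiableAt (by norm_num)
  have da : DifferentiableAt ℝ a y := (ha.contDiffAt hy).differentiableAt (by norm_num)
  have hsymm : ∀ k h, fderiv ℝ (fderiv ℝ F) y k h = fderiv ℝ (fderiv ℝ F) y h k :=
    (ha.contDiff_F.contDiffAt (x := y)).isSymmSndFDerivAt (by simp)
  have hev : ∀ y ∈ U, ∀ h z, fderiv ℝ F y h z = F y (a y h z) - Γ y h (F y z) := fun y hy h z =>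
    eq_sub_of_add_eq (DFunLike.congr_fun (ha.eq y hy h) z)
  -- Differentiation of `dF = F a - Γ F` once more, in direction `k`.
  have key : ∀ k h z, fderiv ℝ (fderiv ℝ F) y k h z =
      fderiv ℝ F y k (a y h z) + F y (fderiv ℝ a y k h z) -
        (fderiv ℝ Γ y k h (F y z) + Γ y h (fderiv ℝ F y k z)) := by
    intro k h z
    have c1 : HasDerivAt (fun s : ℝ => fderiv ℝ F (y + s • k) h z)
        (fderiv ℝ (fderiv ℝ F) y k h z) 0 := ((dF'.hasDerivAt_line k).eval h).eval z
    have c2 : HasDerivAt (fun s : ℝ => F (y + s • k) z) (fderiv ℝ F y k z) 0 :=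
      (dF.hasDerivAt_line k).eval z
    have c3 : HasDerivAt (fun s : ℝ => Γ (y + s • k) h (F (y + s • k) z))
        (fderiv ℝ Γ y k h (F y z) + Γ y h (fderiv ℝ F y k z)) 0 := by
      have c := ((dΓ.hasDerivAt_line k).eval h).clm_apply c2
      rwa [zero_smul, add_zero] at c
    have c4 : HasDerivAt (fun s : ℝ => a (y + s • k) h z) (fderiv ℝ a y k h z) 0 :=
      ((da.hasDerivAt_line k).eval h).eval z
    have c5 : HasDerivAt (fun s : ℝ => F (y + s • k) (a (y + s • k) h z))
        (fderiv ℝ F y k (a y h z) + F y (fderiv ℝ a y k h z)) 0 := by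
      have c := (dF.hasDerivAt_line k).clm_apply c4
      rwa [zero_smul, add_zero] at c
    have c6 : (fun s : ℝ => fderiv ℝ F (y + s • k) h z) =ᶠ[𝓝 0] fun s : ℝ =>
        F (y + s • k) (a (y + s • k) h z) - Γ (y + s • k) h (F (y + s • k) z) :=
      (hnear k).mono fun s hs => hev _ hs h z
    exact c1.unique ((c5.sub c3).congr_of_eventuallyEq c6)
  have hskew : ∀ k h z, inner ℝ (fderiv ℝ a y k h z) z = 0 := by
    intro k h z
    have c1 : HasDerivAt (fun s : ℝ => inner ℝ (a (y + s • k) h z) z)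
        (inner ℝ (fderiv ℝ a y k h z) z) 0 := by
      have c := (((da.hasDerivAt_line k).eval h).eval z).inner ℝ (hasDerivAt_const (0 : ℝ) z)
      rwa [inner_zero_right, zero_add] at c
    have c2 : (fun s : ℝ => inner ℝ (a (y + s • k) h z) z) =ᶠ[𝓝 0] fun _ => (0 : ℝ) :=
      (hnear k).mono fun s hs => ha.skew _ hs h z
    exact c1.unique ((hasDerivAt_const (0 : ℝ) (0 : ℝ)).congr_of_eventuallyEq c2)
  -- The curvature form `[a_k, a_h] + ∂_k a_h - ∂_h a_k`. Antisymmetrizing `key` removes the second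
  -- derivatives of `F`. The form is skew because commutators and derivatives of skew endomorphisms
  -- are skew.
  refine ⟨(a y k).comp (a y h) - (a y h).comp (a y k) + fderiv ℝ a y k h - fderiv ℝ a y h k,
    fun z => ?_, fun z => ?_⟩
  · have e1 := key k h z
    have e2 := key h k z
    rw [hsymm h k, e1] at e2
    simp only [hev y hy, map_sub] at e2
    simp only [christoffelCurvature, _root_.add_apply, _root_.sub_apply, mul_apply_eq_comp,
      ContinuousLinearMap.comp_apply, map_add, map_sub]
    have e3 := sub_eq_zero.2 e2
    rw [← sub_eq_zero, ← neg_eq_zero, ← e3]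
    abel
  · simp only [_root_.add_apply, _root_.sub_apply, ContinuousLinearMap.comp_apply, inner_add_left,
      inner_sub_left, hskew]
    have e1 := inner_skew (ha.skew y hy k) (a y h z) z
    have e2 := inner_skew (ha.skew y hy h) (a y k z) z
    have e3 := real_inner_comm (a y h z) (a y k z)
    linarith

/-- Parallel transport along a curve preserves the frame field up to isometries. -/
theorem exists_isometry_of_isPrimitive (ha : IsConnectionForm U Γ F a) {s t : ℝ} (hst : s ≤ t)
    {x ξ : ℝ → E} {p : ℝ → E →L[ℝ] E} (hx : IsPrimitive x ξ s t)
    (hp : IsPrimitive p (fun τ => -(Γ (x τ) (ξ τ) * p τ)) s t) (hxU : ∀ τ ∈ Icc s t, x τ ∈ U)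
    {f : 𝔢 →L[ℝ] E} (hs : F (x s) = (p s).comp f) :
    ∃ V : 𝔢 ≃ₗᵢ[ℝ] 𝔢, ∀ z, p t (f z) = F (x t) (V z) := by
  have := FiniteDimensional.complete ℝ 𝔢
  have hsI : s ∈ Icc s t := left_mem_Icc.2 hst
  have htI : t ∈ Icc s t := right_mem_Icc.2 hst
  have hxc := hx.continuousOn hst
  have hac : ContinuousOn (fun τ => a (x τ)) (Icc s t) := fun τ hτ =>
    (ha.contDiffAt (hxU τ hτ)).continuousAt.comp_continuousWithinAt (hxc τ hτ)
  have hΓc : ContinuousOn (fun τ => Γ (x τ)) (Icc s t) := fun τ hτ =>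
    (ha.contDiff_Γ.continuousOn.continuousAt
      (ha.isOpen.mem_nhds (hxU τ hτ))).comp_continuousWithinAt (hxc τ hτ)
  have hai : IntervalIntegrable (fun τ => a (x τ) (ξ τ)) volume s t :=
    ContinuousOn.intervalIntegrable_clm_apply (V := E) (W := 𝔢 →L[ℝ] 𝔢) hst hac hx.integrable
  have hΓi : IntervalIntegrable (fun τ => Γ (x τ) (ξ τ)) volume s t :=
    ContinuousOn.intervalIntegrable_clm_apply (V := E) (W := E →L[ℝ] E) hst hΓc hx.integrable
  let K : (𝔢 →L[ℝ] 𝔢) →L[ℝ] (𝔢 →L[ℝ] 𝔢) →L[ℝ] (𝔢 →L[ℝ] 𝔢) :=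
    -(ContinuousLinearMap.compL ℝ 𝔢 𝔢 𝔢)
  have hA : IntervalIntegrable (fun τ => K (a (x τ) (ξ τ))) volume s t :=
    ContinuousOn.intervalIntegrable_clm_apply (V := 𝔢 →L[ℝ] 𝔢)
      (W := (𝔢 →L[ℝ] 𝔢) →L[ℝ] (𝔢 →L[ℝ] 𝔢)) hst continuousOn_const hai
  -- Here `m' = -a(x') m` with `m = 1` at time `s`. Skewness of `a` makes `m` isometric, and `F(x)
  -- m` solves the same linear equation, with the same initial value, as `p` composed with `f`.
  obtain ⟨m, hm0, hm⟩ := exists_isPrimitive_linear (V := 𝔢 →L[ℝ] 𝔢) hst hA 1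
  have hKv : ∀ τ z, K (a (x τ) (ξ τ)) (m τ) z = -(a (x τ) (ξ τ) (m τ z)) := fun τ z => rfl
  have hmz : ∀ z, IsPrimitive (fun τ => m τ z) (fun τ => -(a (x τ) (ξ τ) (m τ z))) s t := fun z =>
    hm.clm_comp hst (ContinuousLinearMap.apply ℝ 𝔢 z)
  have hnorm : ∀ z, ‖m t z‖ = ‖z‖ := by
    intro z
    have h1 := (hmz z).bilin hst (hmz z) (innerSL ℝ)
    have h2 := h1.eq t htI
    have h3 : ∀ τ ∈ Icc s t, (innerSL ℝ (-(a (x τ) (ξ τ) (m τ z)))) (m τ z) +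
        (innerSL ℝ (m τ z)) (-(a (x τ) (ξ τ) (m τ z))) = 0 := by
      intro τ hτ
      have h4 := ha.skew _ (hxU τ hτ) (ξ τ) (m τ z)
      rw [innerSL_apply_apply, innerSL_apply_apply, inner_neg_left, inner_neg_right,
        real_inner_comm (a (x τ) (ξ τ) (m τ z)), h4]
      simp
    rw [intervalIntegral.integral_congr (g := fun _ => (0 : ℝ)) (fun τ hτ => h3 τ
      (by rwa [uIcc_of_le hst] at hτ)), intervalIntegral.integral_zero, add_zero, hm0,
      innerSL_apply_apply, innerSL_apply_apply, real_inner_self_eq_norm_sq] at h2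
    have h5 : inner ℝ ((1 : 𝔢 →L[ℝ] 𝔢) z) ((1 : 𝔢 →L[ℝ] 𝔢) z) = ‖z‖ ^ 2 :=
      real_inner_self_eq_norm_sq z
    rw [h5] at h2
    exact (sq_eq_sq₀ (norm_nonneg _) (norm_nonneg _)).1 h2
  have hFx : IsPrimitive (fun τ => F (x τ)) (fun τ => fderiv ℝ F (x τ) (ξ τ)) s t :=
    hx.comp hst fun τ _ => (ha.contDiff_F.of_le (by norm_num)).contDiffAt
  have heq : ∀ z, p t (f z) - F (x t) (m t z) = 0 := by
    intro z
    have h1 := hFx.bilin hst (hmz z) (ContinuousLinearMap.id ℝ (𝔢 →L[ℝ] E))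
    have h2 := hp.clm_comp hst (ContinuousLinearMap.apply ℝ E (f z))
    have h3 := (h2.prodMk hst h1).clm_comp hst
      (ContinuousLinearMap.fst ℝ E E - ContinuousLinearMap.snd ℝ E E)
    refine h3.eq_zero_of_linear hΓi.norm (fun _ => norm_nonneg _)
      (Eventually.of_forall fun τ hτ => ?_) hsI ?_ t htI
    · have h4 : fderiv ℝ F (x τ) (ξ τ) (m τ z) =
          F (x τ) (a (x τ) (ξ τ) (m τ z)) - Γ (x τ) (ξ τ) (F (x τ) (m τ z)) :=
        eq_sub_of_add_eq (DFunLike.congr_fun (ha.eq _ (hxU τ hτ) (ξ τ)) (m τ z))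
      have h5 : -(Γ (x τ) (ξ τ) (p τ (f z))) - (fderiv ℝ F (x τ) (ξ τ) (m τ z) +
          F (x τ) (-(a (x τ) (ξ τ) (m τ z)))) =
          -(Γ (x τ) (ξ τ) (p τ (f z) - F (x τ) (m τ z))) := by
        rw [h4, map_neg, map_sub]; abel
      refine le_trans (le_of_eq (congrArg norm h5)) ?_
      rw [norm_neg]
      exact (Γ (x τ) (ξ τ)).le_opNorm _
    · change p s (f z) - F (x s) (m s z) = 0
      rw [hm0, hs]
      exact sub_self _
  let V : 𝔢 →ₗᵢ[ℝ] 𝔢 := ⟨(m t : 𝔢 →ₗ[ℝ] 𝔢), hnorm⟩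
  exact ⟨V.toLinearIsometryEquiv rfl, fun z => sub_eq_zero.1 (heq z)⟩

end IsConnectionForm

end ConnectionForm

/-! ### Transport of the fibres along absolutely continuous curves. -/

section ParallelFramesAlongCurves

open Filter Topology

variable {d : ℕ} {M : Type*} [TopologicalSpace M] [ChartedSpace (EuclideanSpace ℝ (Fin d)) M]
  [IsManifold (𝓡 d) ∞ M] [T2Space M]
  {𝔢 : Type*} [NormedAddCommGroup 𝔢] [InnerProductSpace ℝ 𝔢] [FiniteDimensional ℝ 𝔢]
  {cov : AffineConnection d M} {o : M} {ι : 𝔢 →L[ℝ] ModelSpace d}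

/-- A parallel frame at a point extends to a frame field with skew connection form. -/
theorem IsParallelFrame.exists_isConnectionForm
    (hcov : CovariantDerivative.ContMDiffCovariantDerivative cov ∞)
    (hι : Function.Injective ι) (hB : HolonomyPreserves cov o ι) {q : M} {U : Set (ModelSpace d)}
    (hU : IsRegularDomain cov q U) {x : M} (hx : x ∈ (coord d q).source) (hxU : coord d q x ∈ U)
    {f : 𝔢 →L[ℝ] ModelSpace d} (hf : IsParallelFrame cov o ι x f) :
    ∃ F a, IsFrameField cov o ι q U F ∧ F (coord d q x) = (frameCoord d q x).comp f ∧
      IsConnectionForm U (christoffel cov q) F a := by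
  have hinv : (coord d q).symm (coord d q x) = x := (coord d q).left_inv hx
  obtain ⟨F, hF, hF0⟩ := hU.exists_isFrameField hxU (f := f) (hinv.symm ▸ hf)
  rw [hinv] at hF0
  obtain ⟨a, ha⟩ := _root_.exists_isConnectionForm hU.isOpen
    (((contDiffOn_christoffel cov hcov q).mono hU.subset).of_le (by norm_cast)) hF.contDiff
    (fun y hy => exists_leftInverse_clm (hF.injective hcov hι hy))
    (fun y hy h => hF.exists_connectionForm hcov hι hB hU hy h)
  exact ⟨F, a, hF, hF0, ha⟩

/-- Parallel transport along an absolutely continuous curve maps the model fibre isometrically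
onto the fibres of the sub-Riemannian structure. -/
theorem IsHorizontal.isParallelFrame
    (hcov : CovariantDerivative.ContMDiffCovariantDerivative cov ∞)
    (hι : Function.Injective ι) (hB : HolonomyPreserves cov o ι) {γ : ℝ → M}
    {P : ℝ → ModelSpace d →L[ℝ] ModelSpace d} {ζ : ℝ → ModelSpace d} {a b : ℝ}
    (h : IsHorizontal cov γ P ζ a b) (h0 : γ a = o) (hP0 : P a = 1) :
    ∀ t ∈ Icc a b, IsParallelFrame cov o ι (γ t) ((P t).comp ι) := by
  refine interval_induction ?_ fun t₀ ht₀ => ?_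
  · rw [h0, hP0]
    exact .refl cov o ι
  have hsrc := mem_extChartAt_source (I := 𝓡 d) (γ t₀)
  obtain ⟨U, hyU, hU⟩ := exists_isRegularDomain hcov ((coord d (γ t₀)).map_source hsrc)
  obtain ⟨ε, hε, h4⟩ := exists_eps_forall_mem h.1 ht₀ (DevelopedProcess.isOpen_coord_preimage (q := γ t₀) hU.isOpen)
    ⟨hsrc, hyU⟩
  refine ⟨ε, hε, fun s hs t ht hst hs₀ ht₀ hS => ?_⟩
  have hin : ∀ τ ∈ Icc s t, γ τ ∈ (coord d (γ t₀)).source ∧ coord d (γ t₀) (γ τ) ∈ U :=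
    fun τ hτ => h4 τ ⟨hs.1.trans hτ.1, hτ.2.trans ht.2⟩ (by
      rw [abs_lt] at *
      exact ⟨by linarith [hτ.1], by linarith [hτ.2]⟩)
  have hsI : s ∈ Icc s t := left_mem_Icc.2 hst
  have htI : t ∈ Icc s t := right_mem_Icc.2 hst
  obtain ⟨F, A, hF, hF0, hA⟩ := hS.exists_isConnectionForm hcov hι hB hU (hin s hsI).1
    (hin s hsI).2
  have hprim : IsPrimitive (solCoord d (γ t₀) γ P) (horizontalRate cov (γ t₀) γ P ζ) s t :=
    h.2 (γ t₀) s t hs ht hst fun τ hτ => (hin τ hτ).1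
  -- The holonomy assumption speaks of smooth loops, whereas `γ` is only absolutely continuous. The
  -- skew connection form, obtained from smooth transports, bridges the gap since it acts on any
  -- integrable velocity.
  obtain ⟨V, hV⟩ := hA.exists_isometry_of_isPrimitive hst
    (x := fun τ => coord d (γ t₀) (γ τ)) (ξ := fun τ => frameCoord d (γ t₀) (γ τ) (ζ τ))
    (p := fun τ => frameCoord d (γ t₀) (γ τ) * P τ)
    (hprim.clm_comp hst (ContinuousLinearMap.fst ℝ (ModelSpace d) _))
    (hprim.clm_comp hst (ContinuousLinearMap.snd ℝ (ModelSpace d) _))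
    (fun τ hτ => (hin τ hτ).2) (f := ι) hF0
  have hfr := hF.frame _ (hin t htI).2
  rw [(coord d (γ t₀)).left_inv (hin t htI).1] at hfr
  refine hfr.comp_isometry (W := V) fun z => ?_
  have h5 := DFunLike.congr_fun (frameOfCoord_mul_frameCoord (hin t htI).1) (P t (ι z))
  exact h5.symm.trans (congrArg (frameOfCoord d (γ t₀) (γ t)) (hV z))

namespace DevelopedProcess

variable {X : DevelopedProcess d M 𝔢}

theorem AssumptionB.holonomyPreserves (hcov : CovariantDerivative.ContMDiffCovariantDerivative X.cov ∞)
    (hB : X.AssumptionB) : HolonomyPreserves (𝔢 := 𝔢) X.cov X.o X.ι := by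
  intro A hA
  obtain ⟨U, hU⟩ := hB _ (hA.mem_holonomy hcov)
  exact ⟨U.toLinearIsometryEquiv rfl, hU⟩

/-- By the theorem of Ambrose and Singer, the curvature acts by skew endomorphisms. -/
theorem exists_skew_curvatureAt (hcov : CovariantDerivative.ContMDiffCovariantDerivative X.cov ∞)
    (hι : Function.Injective ι) (hB : HolonomyPreserves X.cov o ι) {x : M}
    {f : 𝔢 →L[ℝ] ModelSpace d} (hf : IsParallelFrame X.cov o ι x f) (v w : ModelSpace d) :
    ∃ B : 𝔢 →L[ℝ] 𝔢, (∀ z, X.curvatureAt x v w (f z) = f (B z)) ∧ ∀ z, inner ℝ (B z) z = 0 := by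
  have hsrc := mem_extChartAt_source (I := 𝓡 d) x
  obtain ⟨U, hyU, hU⟩ := exists_isRegularDomain hcov ((coord d x).map_source hsrc)
  obtain ⟨F, A, hF, hF0, hA⟩ := hf.exists_isConnectionForm hcov hι hB hU hsrc hyU
  obtain ⟨B, hB, hs⟩ := hA.exists_skew_curvature hyU (frameCoord d x x v) (frameCoord d x x w)
  refine ⟨B, fun z => ?_, hs⟩
  have h1 : frameCoord d x x (X.curvatureAt x v w (f z)) = frameCoord d x x (f (B z)) := by
    refine (toCoord_curvature X.cov hcov hsrc v w (f z)).trans ?_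
    have h2 := hB z
    rw [hF0] at h2
    exact h2
  have h3 := congrArg (frameOfCoord d x x) h1
  have h4 : ∀ k, frameOfCoord d x x (frameCoord d x x k) = k := fun k =>
    DFunLike.congr_fun (frameOfCoord_mul_frameCoord hsrc) k
  rwa [h4, h4] at h3

end DevelopedProcess

end ParallelFramesAlongCurves

/-! ### Bivectors and skew endomorphisms. -/

section Bivectors

variable {𝔢 : Type*} [NormedAddCommGroup 𝔢] [InnerProductSpace ℝ 𝔢] [FiniteDimensional ℝ 𝔢]

theorem inner_wedge (a c v w : 𝔢) :
    inner ℝ (wedge a c) (wedge v w) = inner ℝ a v * inner ℝ c w - inner ℝ a w * inner ℝ c v := by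
  rw [wedge, wedge, exteriorPower.inner_ιMulti_ιMulti, Matrix.det_fin_two]
  simp only [Matrix.of_apply, Matrix.cons_val_zero, Matrix.cons_val_one]
  ring

theorem continuousOn_wedge {s : Set ℝ} {v w : ℝ → 𝔢} (hv : ContinuousOn v s)
    (hw : ContinuousOn w s) : ContinuousOn (fun t => wedge (v t) (w t)) s := by
  let φ := exteriorPower.ιMulti ℝ 2 (M := 𝔢)
  let B : 𝔢 →ₗ[ℝ] 𝔢 →ₗ[ℝ] ⋀[ℝ]^2 𝔢 := LinearMap.mk₂ ℝ wedge
    (fun v v' w => φ.map_vecCons_add ![w] v v') (fun c v w => φ.map_vecCons_smul ![w] c v)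
    (fun v w w' => (φ.curryLeft v).map_vecCons_add ![] w w')
    (fun c v w => (φ.curryLeft v).map_vecCons_smul ![] c w)
  let C : 𝔢 →L[ℝ] 𝔢 →L[ℝ] ⋀[ℝ]^2 𝔢 := LinearMap.toContinuousLinearMap
    ((LinearMap.toContinuousLinearMap (𝕜 := ℝ) (E := 𝔢) (F' := ⋀[ℝ]^2 𝔢)).toLinearMap.comp B)
  exact ((C.continuous.comp_continuousOn hv).clm_apply hw :
    ContinuousOn (fun t => C (v t) (w t)) s)

/-- The bivector of a skew endomorphism. -/
noncomputable def bivectorOf (B : 𝔢 →L[ℝ] 𝔢) : ⋀[ℝ]^2 𝔢 :=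
  let b := stdOrthonormalBasis ℝ 𝔢
  ∑ α, ∑ β, inner ℝ (B (b α)) (b β) • wedge (b α) (b β)

/-- The sum defining the bivector runs over all ordered pairs, and by skewness `(α, β)` and `(β, α)`
contribute equally. This is the factor 2 that cancels the ½ in the equation for `χ`. -/
theorem inner_wedge_bivectorOf {B : 𝔢 →L[ℝ] 𝔢} (hB : ∀ z, inner ℝ (B z) z = 0) (a c : 𝔢) :
    inner ℝ (wedge a c) (bivectorOf B) = 2 * inner ℝ (B a) c := by
  set b := stdOrthonormalBasis ℝ 𝔢 with hb
  have key : ∀ a c : 𝔢, ∑ α, ∑ β, inner ℝ (B (b α)) (b β) * (inner ℝ a (b α) * inner ℝ c (b β)) =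
      inner ℝ (B a) c := by
    intro a c
    have h1 : ∀ α, ∑ β, inner ℝ (B (b α)) (b β) * (inner ℝ a (b α) * inner ℝ c (b β)) =
        -(inner ℝ a (b α) * inner ℝ (b α) (B c)) := by
      intro α
      have h2 := b.sum_inner_mul_inner (B (b α)) c
      rw [inner_skew hB] at h2
      rw [← mul_neg, ← h2, Finset.mul_sum]
      refine Finset.sum_congr rfl fun β _ => ?_
      rw [real_inner_comm c]
      ring
    rw [Finset.sum_congr rfl fun α _ => h1 α, Finset.sum_neg_distrib, b.sum_inner_mul_inner,
      inner_skew hB]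
  have h3 : inner ℝ (wedge a c) (bivectorOf B) = inner ℝ (B a) c - inner ℝ (B c) a := by
    rw [← key a c, ← key c a, bivectorOf, inner_sum, ← Finset.sum_sub_distrib]
    refine Finset.sum_congr rfl fun α _ => ?_
    rw [inner_sum, ← Finset.sum_sub_distrib]
    refine Finset.sum_congr rfl fun β _ => ?_
    rw [inner_smul_right, inner_wedge]
    ring
  rw [h3, inner_skew hB c a, real_inner_comm]
  ring

theorem rangeInner_apply {V : Type*} {f : 𝔢 → V} (hf : Function.Injective f) (x y : 𝔢) :
    rangeInner f (f x) (f y) = inner ℝ x y := by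
  rw [rangeInner, Function.leftInverse_invFun hf x, Function.leftInverse_invFun hf y]

end Bivectors

/-- A primitive that vanishes at the final time. -/
theorem exists_hasDerivWithinAt_of_continuousOn {V : Type*} [NormedAddCommGroup V]
    [NormedSpace ℝ V] [CompleteSpace V] {T : ℝ} (hT : 0 ≤ T) {g : ℝ → V}
    (hg : ContinuousOn g (Icc 0 T)) :
    ∃ f : ℝ → V, f T = 0 ∧ ∀ t ∈ Icc 0 T, HasDerivWithinAt f (g t) (Icc 0 T) t := by
  have h : IsPrimitive (fun t => ∫ s in (0 : ℝ)..t, g s) g 0 T :=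
    ⟨hg.intervalIntegrable_of_Icc hT, fun t _ => by simp⟩
  exact ⟨fun t => (∫ s in (0 : ℝ)..t, g s) - ∫ s in (0 : ℝ)..T, g s, sub_self _, fun t ht =>
    (h.hasDerivWithinAt hg ht).sub_const _⟩

theorem HasDerivWithinAt.eval {W Z : Type*} [NormedAddCommGroup W] [NormedSpace ℝ W]
    [NormedAddCommGroup Z] [NormedSpace ℝ Z] {Φ : ℝ → W →L[ℝ] Z} {Φ' : W →L[ℝ] Z} {s : Set ℝ}
    {t : ℝ} (h : HasDerivWithinAt Φ Φ' s t) (w : W) :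
    HasDerivWithinAt (fun r => Φ r w) (Φ' w) s t :=
  (h.clm_apply (hasDerivWithinAt_const t s w)).congr_deriv (by simp)

/-! ### The curvature term as a pairing of bivectors. -/

namespace DevelopedProcess

variable {d : ℕ} {M : Type*} [TopologicalSpace M] [ChartedSpace (EuclideanSpace ℝ (Fin d)) M]
  [IsManifold (𝓡 d) ∞ M]
  {𝔢 : Type*} [NormedAddCommGroup 𝔢] [InnerProductSpace ℝ 𝔢] [FiniteDimensional ℝ 𝔢]
  {X : DevelopedProcess d M 𝔢}

/-- Once the curvature is known to act on the fibre through an endomorphism `B` of `𝔢`, the inner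
product of the fibre can be computed in `𝔢`, and the double sum is the expansion of the bivector of
`B`. -/
theorem tensorK_eq {x : M} {f : 𝔢 →L[ℝ] ModelSpace d} (hf : Function.Injective f) (χ : ⋀[ℝ]^2 𝔢)
    {v w : ModelSpace d} {B : 𝔢 →L[ℝ] 𝔢} (hB : ∀ z, X.curvatureAt x v w (f z) = f (B z)) :
    X.tensorK (x := x) f χ v w = inner ℝ χ (bivectorOf B) := by
  rw [bivectorOf, inner_sum]
  refine Finset.sum_congr rfl fun α _ => ?_
  rw [inner_sum]
  refine Finset.sum_congr rfl fun β _ => ?_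
  rw [inner_smul_right, mul_comm]
  refine congrArg (· * _) ?_
  refine Eq.trans ?_ (rangeInner_apply hf (B (stdOrthonormalBasis ℝ 𝔢 α))
    (stdOrthonormalBasis ℝ 𝔢 β))
  exact congrArg (fun k : ModelSpace d => rangeInner (𝔢 := 𝔢) (V := ModelSpace d) f k
    (f (stdOrthonormalBasis ℝ 𝔢 β))) (hB _)

end DevelopedProcess

/-! ### The equations for a regular most probable path. -/

theorem mainTheorem1 {d : ℕ} {M : Type*} [TopologicalSpace M] [T2Space M]
    [ChartedSpace (EuclideanSpace ℝ (Fin d)) M] [IsManifold (𝓡 d) ∞ M]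
    {𝔢 : Type*} [NormedAddCommGroup 𝔢] [InnerProductSpace ℝ 𝔢] [FiniteDimensional ℝ 𝔢]
    (X : DevelopedProcess d M 𝔢)
    (hT : 0 < X.T)
    (hcov : CovariantDerivative.ContMDiffCovariantDerivative X.cov ∞)
    (hι : Function.Injective X.ι)
    (hS : ContDiffOn ℝ ∞ X.S (Icc 0 X.T))
    (hSpos : ∀ t ∈ Icc 0 X.T, (X.S t).IsPositive)
    (hu : ContMDiffOn (𝓘(ℝ, ℝ).prod (𝓡 d)) (𝓡 d).tangent ∞
      (fun p : ℝ × M => (⟨p.2, X.u p.1 p.2⟩ : TangentBundle (𝓡 d) M)) (Icc 0 X.T ×ˢ univ))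
    (hA : X.AssumptionA) (hB : X.AssumptionB)
    (γ : ℝ → M) (hγ : X.IsMostProbablePath γ) (hreg : ¬ X.IsSingular γ) :
    ∃ (P : (t : ℝ) → TangentSpace (𝓡 d) X.o →L[ℝ] TangentSpace (𝓡 d) (γ t))
      (γ' : (t : ℝ) → TangentSpace (𝓡 d) (γ t))
      (lam : (t : ℝ) → TangentSpace (𝓡 d) (γ t) →L[ℝ] ℝ)
      (χ : ℝ → ⋀[ℝ]^2 𝔢) (sharp : ℝ → 𝔢),
      X.IsMPPSolution γ P γ' lam χ sharp := by
  have hX : X.IsSmooth := ⟨hT, hcov, hS, hSpos, hu⟩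
  obtain ⟨w, P, Θ, hw, hsol, h0, hP0, hwΘ, hΘT, hΘ⟩ :=
    DevelopedProcess.exists_continuous_control hX hγ hreg
  have hunit := IsHorizontal.isUnit hcov hsol (hP0 ▸ isUnit_one)
  let ι : 𝔢 →L[ℝ] ModelSpace d := X.ι
  have hframe : ∀ t ∈ Icc 0 X.T, IsParallelFrame X.cov X.o ι (γ t) ((P t).comp ι) :=
    hsol.isParallelFrame hcov hι (hB.holonomyPreserves hcov) h0 hP0
  -- the covector and its dual vector
  let ℓ : ℝ → ModelSpace d →L[ℝ] ℝ := fun t =>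
    (Θ t).comp (ContinuousLinearMap.inl ℝ (ModelSpace d) (ModelSpace d →L[ℝ] ModelSpace d))
  let lam : ℝ → ModelSpace d →L[ℝ] ℝ := fun t => (ℓ t).comp (Ring.inverse (P t))
  have hlam : ∀ t ∈ Icc 0 X.T, ∀ v, lam t (P t v) = Θ t (v, 0) := fun t ht v =>
    congrArg (ℓ t) (ringInverse_apply_self (hunit t ht) v)
  let sharp : ℝ → 𝔢 := fun t => rieszVector ((lam t).comp ((P t).comp ι))
  have hsharp : ∀ t ∈ Icc 0 X.T, sharp t = rieszVector ((ℓ t).comp ι) := fun t ht =>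
    congrArg rieszVector (ContinuousLinearMap.ext fun z => hlam t ht (ι z))
  have hΘc : ContinuousOn Θ (Icc 0 X.T) := fun t ht => (hΘ t ht).continuousWithinAt
  have hsc : ContinuousOn sharp (Icc 0 X.T) :=
    (continuousOn_rieszVector (α := fun t => (ℓ t).comp ι)
      ((hΘc.clm_comp continuousOn_const).clm_comp continuousOn_const)).congr hsharp
  -- Since `Σ^{1/2}` is symmetric, the control formula reads `w = Σ^{1/2} ♯λ`; the noise coefficient
  -- applies the root a second time.
  have hnoise : ∀ t ∈ Icc 0 X.T, X.noise t (w t) = ι (X.S t (sharp t)) := by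
    intro t ht
    obtain ⟨hp, hsq⟩ := posSqrt_spec (hSpos t ht)
    have h1 : w t = posSqrt (X.S t) (sharp t) := by
      rw [hwΘ t, hsharp t ht, ← rieszVector_comp_isPositive _ hp]
      rfl
    have h2 : posSqrt (X.S t) (w t) = X.S t (sharp t) := by
      rw [h1]; exact DFunLike.congr_fun hsq (sharp t)
    exact congrArg ι h2
  -- the bivector
  obtain ⟨χ, hχT, hχ⟩ := exists_hasDerivWithinAt_of_continuousOn (V := ⋀[ℝ]^2 𝔢) hT.le
    ((continuousOn_wedge (hS.continuousOn.clm_apply hsc) hsc).const_smul (1 / 2 : ℝ))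
  -- the bivector represents the adjoint on the skew endomorphisms
  have hpair : ∀ (A : ModelSpace d →L[ℝ] ModelSpace d) (B : 𝔢 →L[ℝ] 𝔢),
      (∀ z, A (ι z) = ι (B z)) → (∀ z, inner ℝ (B z) z = 0) → ∀ t ∈ Icc 0 X.T,
      Θ t (0, A) + inner ℝ (χ t) (bivectorOf B) = 0 := by
    intro A B hAB hBs
    have hd : ∀ t ∈ Icc 0 X.T, HasDerivWithinAt
        (fun t => Θ t (0, A) + inner ℝ (χ t) (bivectorOf B)) 0 (Icc 0 X.T) t := by
      intro t ht
      have h1 := (hΘ t ht).eval (0, A)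
      have h2 : HasDerivWithinAt (fun t => inner ℝ (χ t) (bivectorOf B))
          (inner ℝ ((1 / 2 : ℝ) • wedge (X.S t (sharp t)) (sharp t)) (bivectorOf B))
          (Icc 0 X.T) t := by
        have h3 := (hχ t ht).inner ℝ (hasDerivWithinAt_const t (Icc 0 X.T) (bivectorOf B))
        rwa [inner_zero_right, zero_add] at h3
      refine (h1.add h2).congr_deriv ?_
      have h4 : Θ t (X.generator γ P t (1, w t) (0, A)) = Θ t (A (X.noise t (w t)), 0) :=
        (DevelopedProcess.adjoint_generator hX ht (hunit t ht) w (Θ t)).2.2 A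
      have h5 : Θ t (A (X.noise t (w t)), 0) = inner ℝ (B (X.S t (sharp t))) (sharp t) := by
        rw [hnoise t ht, hAB, real_inner_comm, hsharp t ht, inner_rieszVector]
        rfl
      -- The derivative of the second term is `½ · 2 ⟪B Σ ♯λ, ♯λ⟫`, and that of the first is its
      -- negative.
      rw [inner_smul_left, inner_wedge_bivectorOf hBs, ← h5, ← h4]
      simp
    intro t ht
    have hconst := constant_of_derivWithin_zero
      (fun t ht => (hd t ht).differentiableWithinAt)
      (fun t ht => (hd t (Ico_subset_Icc_self ht)).derivWithin
        (uniqueDiffOn_Icc hT t (Ico_subset_Icc_self ht)))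
    have h1 : Θ X.T (0, A) + inner ℝ (χ X.T) (bivectorOf B) = 0 := by
      rw [hΘT, hχT, inner_zero_left, add_zero]
    exact (hconst t ht).trans ((hconst X.T ⟨hT.le, le_rfl⟩).symm.trans h1)
  refine ⟨P, X.drive γ P w, lam, χ, sharp, hsol.isParallelTransport hT.le h0 hP0,
    fun t ht => hsol.hasMFDerivWithinAt hX hw ht, fun t _ => rfl, fun t ht => ?_,
    fun t ht v => ?_, hχ, hχT⟩
  · have h1 : X.drive γ P w t - X.drift t (γ t) = P t (X.noise t (w t)) := add_sub_cancel_right _ _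
    exact h1.trans (congrArg (P t) (hnoise t ht))
  · change ModelSpace d at v
    obtain ⟨hg1, hg2, -⟩ := DevelopedProcess.adjoint_generator hX ht (hunit t ht) w (Θ t)
    set A := (X.generator γ P t (1, w t) (v, 0)).2 with hAdef
    -- The rotation `A` is `P⁻¹ R(γ', P v) P`. On `𝔢` it is the skew `B`, so its pairing with the
    -- adjoint can be exchanged for the pairing of `χ` with `B`.
    obtain ⟨B, hB1, hB2⟩ := DevelopedProcess.exists_skew_curvatureAt hcov hι
      (hB.holonomyPreserves hcov) (hframe t ht) (X.drive γ P w t) (P t v)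
    have hAB : ∀ z, A (ι z) = ι (B z) := by
      intro z
      have h1 : P t (A (ι z)) = P t (ι (B z)) := (hg2 v (ι z)).trans (hB1 z)
      rw [← ringInverse_apply_self (hunit t ht) (A (ι z)), h1,
        ringInverse_apply_self (hunit t ht)]
    have hinj : Function.Injective ((P t).comp ι) := (hframe t ht).injective hcov hι
    have hK : X.tensorK (x := γ t) ((P t).comp ι) (χ t) (X.drive γ P w t) (P t v) =
        -Θ t (0, A) := by
      rw [DevelopedProcess.tensorK_eq hinj (χ t) hB1]
      exact eq_neg_of_add_eq_zero_right (hpair A B hAB hB2 t ht)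
    have h1 : HasDerivWithinAt (fun s => lam s (P s v))
        (-Θ t (X.generator γ P t (1, w t) (v, 0))) (Icc 0 X.T) t :=
      ((hΘ t ht).eval (v, 0)).congr (fun s hs => hlam s hs v) (hlam t ht v)
    refine h1.congr_deriv ?_
    have h2 : Θ t (X.generator γ P t (1, w t) (v, 0)) =
        lam t (X.torsionAt (γ t) (X.drive γ P w t) (P t v)) +
          lam t (X.covDriftAt t (γ t) (P t v)) + Θ t (0, A) := by
      rw [hg1 v]
      exact congrArg (· + Θ t (0, A)) (map_add (lam t) _ _)
    have h3 : -Θ t (X.generator γ P t (1, w t) (v, 0)) =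
        -lam t (X.covDriftAt t (γ t) (P t v)) -
          lam t (X.torsionAt (γ t) (X.drive γ P w t) (P t v)) +
          X.tensorK (x := γ t) ((P t).comp ι) (χ t) (X.drive γ P w t) (P t v) := by
      rw [h2, hK]; ring
    exact h3
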